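/- Work in $\mathbb R^{1+3}$ with coordinates $(t,x)$, $\square=-\partial_t^2+\Delta$, $\partial=(\partial_t,\partial_1,\partial_2,\partial_3)$ and $\langle s\rangle=(1+s^2)^{1/2}$. Let $\Gamma$ range over $\partial_1,\partial_2,\partial_3$ and $S=t\partial_t+x^i\partial_i$; $\Gamma^{\le n}$ denotes all products of at most $n$ of these fields, and a norm of $\Gamma^{\le n}\psi$ or $\partial\Gamma^{\le n}\psi$ is the sum of the norms of all such derivatives; it may be $+\infty$. Let $\phi$ be a smooth complex-valued function on $(a,b)\times\mathbb R^3$ with $\square\phi=f$ there. All estimates below hold for all $t\in(a,b)$ with $t\ge 0$ and all $x\in\mathbb R^3$. The constants $C$ are absolute, except that in (ii) $C$ depends only on $\Lambda$; in particular they do not depend on $\phi,f,a,b,t,x,\delta,k,l$. (i) For every $\delta\in(0,1)$, $$|\partial\phi(t,x)|\le C\delta^{-1}\Big[\langle t\rangle^{-1/2}\big(\langle t-|x|\rangle^{-1+\delta}\mathbf 1_{|x|\le t}+\mathbf 1_{|x|>t}\big)\|\partial\Gamma^{\le 3}\phi(t)\|_{L^2_x}+\langle t\rangle^{1/2}\|\Gamma^{\le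 2}f(t)\|_{L^2_x}\Big].$$ (ii) Let $\Lambda\ge 1$ and $k\in\mathbb Z$. Suppose that all derivatives of $\phi$ grow at most polynomially in $x$, locally uniformly in $t\in(a,b)$, and that $\operatorname{supp}\hat\phi(s,\cdot)\subset\{\xi\in\mathbb R^3:\Lambda^{-1}2^k\le|\xi|\le\Lambda 2^k\}$ for every $s\in(a,b)$, where $\hat{\ }$ is the Fourier transform in $x$ (with kernel $e^{-ix\cdot\xi}$), in the sense of tempered distributions. Then $$|\partial\phi(t,x)|\le C\Big[\langle t\rangle^{-1}2^{2k}\big\|\widehat{\partial\Gamma^{\le 2}\phi}(t,\xi)\big\|_{L^\infty_\xi}+\langle t\rangle^{1/2}2^k\|\Gamma^{\le 1}f(t)\|_{L^2_x}\Big],$$ the $L^\infty_\xi$ norm being $+\infty$ if the Fourier transform is not a bounded function. Moreover, without any frequency localization or growth assumption: if $f=0$, $0\in(a,b)$ and $(\phi,\partial_t\phi)|_{t=0}=(\phi_0,\phi_1)$, then $$|\partial\phi(t,x)|\le C\langle t\rangle^{-1}\big(\|\Gamma^{\le 4}\phi_0\|_{L^1_x}+\|\Gamma^{\le 4}\phi_1\|_{L^1_x}\big),$$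 where on functions of $x$ alone $S$ acts as $x^i\partial_i$. Finally, for $k,l\in\mathbb Z$, $\mu\in\{+1,-1\}$, $t\in\mathbb R\setminus\{0\}$, $x\in\mathbb R^3$, the set $$S_{k,l}(t,x)=\Big\{\xi\in\mathbb R^3:\Big|1+\frac{\mu\,x\cdot\xi}{t|\xi|}\Big|\le 2^l,\ |\xi|\in[2^{k-1},2^k]\Big\}$$ has Lebesgue measure $|S_{k,l}(t,x)|\le C\,2^{3k+l}$. -/

import Mathlib

open MeasureTheory Set
open scoped ENNReal FourierTransform SchwartzMap ContDiff

/-- Physical space `ℝ³` with its Euclidean norm. -/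
abbrev Space3 : Type := EuclideanSpace ℝ (Fin 3)

noncomputable section

namespace WaveDecay

/-- The Japanese bracket `⟨s⟩ = (1 + s²)^{1/2}`. -/
def bracket (s : ℝ) : ℝ := Real.sqrt (1 + s ^ 2)

/-- The slab `(a, b) × ℝ³` of Minkowski space; points are pairs `(t, x)`. -/
def slab (a b : ℝ) : Set (ℝ × Space3) := Ioo a b ×ˢ univ

/-- The time derivative `∂_t ψ`. -/
def dt (ψ : ℝ × Space3 → ℂ) : ℝ × Space3 → ℂ :=
  fun p => fderiv ℝ ψ p (1, 0)

/-- The spatial derivative `∂_i ψ`. -/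
def dx (i : Fin 3) (ψ : ℝ × Space3 → ℂ) : ℝ × Space3 → ℂ :=
  fun p => fderiv ℝ ψ p (0, EuclideanSpace.single i 1)

/-- The components of the spacetime gradient: `∂_0 = ∂_t`, followed by `∂_1, ∂_2, ∂_3`. -/
def grad (μ : Fin 4) (ψ : ℝ × Space3 → ℂ) : ℝ × Space3 → ℂ :=
  Fin.cases (dt ψ) (fun i => dx i ψ) μ

/-- The wave operator `□ = -∂_t² + Δ`. -/
def box (ψ : ℝ × Space3 → ℂ) : ℝ × Space3 → ℂ :=
  fun p => -dt (dt ψ) p + ∑ i, dx i (dx i ψ) p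

/-- The scaling vector field `S = t ∂_t + x^i ∂_i`. -/
def scaling (ψ : ℝ × Space3 → ℂ) : ℝ × Space3 → ℂ :=
  fun p => (p.1 : ℂ) * dt ψ p + ∑ i, ((p.2 i : ℝ) : ℂ) * dx i ψ p

/-- The vector fields `Γ ∈ {S, ∂_1, ∂_2, ∂_3}`: `none` is `S` and `some i` is `∂_i`. -/
def gam (Z : Option (Fin 3)) (ψ : ℝ × Space3 → ℂ) : ℝ × Space3 → ℂ :=
  match Z with
  | none => scaling ψ
  | some i => dx i ψ

/-- Iterated application of vector fields `Γ`, the head of the list being applied last. -/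
def gamWord : List (Option (Fin 3)) → (ℝ × Space3 → ℂ) → ℝ × Space3 → ℂ
  | [], ψ => ψ
  | Z :: w, ψ => gam Z (gamWord w ψ)

/-- `‖Γ^{≤ n} ψ(t)‖_N`: the sum of `N` over all products of at most `n` vector fields `Γ`
applied to `ψ` and restricted to the time slice `t`; `N` is a norm of functions on `ℝ³`. -/
def gamNorm (N : (Space3 → ℂ) → ℝ≥0∞) (n : ℕ) (ψ : ℝ × Space3 → ℂ) (t : ℝ) : ℝ≥0∞ :=
  ∑ j ∈ Finset.range (n + 1), ∑ w : Fin j → Option (Fin 3),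
    N (fun x => gamWord (List.ofFn w) ψ (t, x))

/-- `‖∂ Γ^{≤ n} ψ(t)‖_N`, with `∂` the full spacetime gradient. -/
def gradGamNorm (N : (Space3 → ℂ) → ℝ≥0∞) (n : ℕ) (ψ : ℝ × Space3 → ℂ) (t : ℝ) : ℝ≥0∞ :=
  ∑ j ∈ Finset.range (n + 1), ∑ w : Fin j → Option (Fin 3), ∑ μ : Fin 4,
    N (fun x => grad μ (gamWord (List.ofFn w) ψ) (t, x))

/-- `|∂ψ(t, x)|`, as the sum of the absolute values of the four components. -/
def absGrad (ψ : ℝ × Space3 → ℂ) (t : ℝ) (x : Space3) : ℝ≥0∞ :=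
  ∑ μ : Fin 4, ‖grad μ ψ (t, x)‖ₑ

/-- The `L²` norm on `ℝ³`. -/
def normL2 (g : Space3 → ℂ) : ℝ≥0∞ := eLpNorm g 2 volume

/-- The `L¹` norm on `ℝ³`. -/
def normL1 (g : Space3 → ℂ) : ℝ≥0∞ := eLpNorm g 1 volume

/-- The tempered distribution `T` is integration against the function `g`. -/
def IsIntegrationAgainst (T : 𝓢'(Space3, ℂ)) (g : Space3 → ℂ) : Prop :=
  ∀ η : 𝓢(Space3, ℂ), Integrable (fun x => g x * η x) volume ∧ T η = ∫ x, g x * η x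

/-- `‖ĝ‖_{L^∞_ξ}` for a function `g` that defines a tempered distribution: the `L^∞` norm of the
bounded function which is the distributional Fourier transform of `g`, and `∞` if there is none.
Here `𝓕` has the kernel `e^{-2πi x·ξ}`; passing to the kernel `e^{-i x·ξ}` rescales `ξ` and so
does not change the `L^∞` norm. -/
def fourierSupNorm (g : Space3 → ℂ) : ℝ≥0∞ :=
  ⨅ (T : 𝓢'(Space3, ℂ)) (_ : IsIntegrationAgainst T g) (h : Space3 → ℂ)
    (_ : MemLp h ∞ volume) (_ : IsIntegrationAgainst (𝓕 T : 𝓢'(Space3, ℂ)) h), eLpNorm h ∞ volume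

/-- `supp ĝ ⊆ {ξ : Λ⁻¹ 2^k ≤ |ξ| ≤ Λ 2^k}`, where `ĝ` is taken with the kernel `e^{-i x·ξ}`;
the frequency `ξ` of Mathlib's `𝓕` (kernel `e^{-2πi x·ξ}`) corresponds to `2πξ`. -/
def FrequencyLocalized (Λ : ℝ) (k : ℤ) (g : Space3 → ℂ) : Prop :=
  ∃ T : 𝓢'(Space3, ℂ), IsIntegrationAgainst T g ∧
    Distribution.dsupport (𝓕 T : 𝓢'(Space3, ℂ)) ⊆
      {ξ : Space3 | Λ⁻¹ * (2 : ℝ) ^ k ≤ ‖(2 * Real.pi) • ξ‖ ∧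
        ‖(2 * Real.pi) • ξ‖ ≤ Λ * (2 : ℝ) ^ k}

/-- All spacetime derivatives of `ψ` grow at most polynomially in `x`, locally uniformly in
`t ∈ (a, b)`, so that the time slices are a smooth curve of tempered distributions. -/
def TemperateOnSlab (a b : ℝ) (ψ : ℝ × Space3 → ℂ) : Prop :=
  ∀ n : ℕ, ∀ c d : ℝ, a < c → d < b → ∃ (N : ℕ) (C : ℝ), ∀ s ∈ Icc c d, ∀ x : Space3,
    ‖iteratedFDeriv ℝ n ψ (s, x)‖ ≤ C * (1 + ‖x‖) ^ N

/-- `ψ` is a smooth solution of `□ψ = f` on the slab `(a, b) × ℝ³`. -/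
def IsSmoothSolution (a b : ℝ) (ψ f : ℝ × Space3 → ℂ) : Prop :=
  ContDiffOn ℝ ∞ ψ (slab a b) ∧ ∀ p ∈ slab a b, box ψ p = f p

/-- The weight `⟨t - |x|⟩^{-1+δ} 1_{|x| ≤ t} + 1_{|x| > t}`. -/
def coneWeight (δ t : ℝ) (x : Space3) : ℝ :=
  if ‖x‖ ≤ t then bracket (t - ‖x‖) ^ (-1 + δ) else 1

/-- The set `S_{k,l}(t, x) = {ξ : |1 + μ x·ξ / (t|ξ|)| ≤ 2^l, |ξ| ∈ [2^{k-1}, 2^k]}`. -/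
def phaseSet (μ : ℝ) (k l : ℤ) (t : ℝ) (x : Space3) : Set Space3 :=
  {ξ | |1 + μ * inner ℝ x ξ / (t * ‖ξ‖)| ≤ (2 : ℝ) ^ l ∧
    ‖ξ‖ ∈ Icc ((2 : ℝ) ^ (k - 1)) ((2 : ℝ) ^ k)}

end WaveDecay

end

/-!
All four estimates rest on Archimedes' theorem: for `ν` uniformly distributed on the unit sphere of
`ℝ³`, the number `x·ν` is uniformly distributed on `[-|x|, |x|]` (`lintegral_sph_inner`). In polar
coordinates it gives the measure of the dyadic sets at once (`volume_phaseSet_le`).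

*The first two estimates* are proved at a fixed time. With `P = ∂φ(t)`, the components of
`∂Sφ(t)` are `P₀ + t (div P - f) + x·∇P₀` and `P_j + t ∂_j P₀ + x·∇P_j`, and the spatial part of `P`
is curl free (`IsSmoothSolution.scalRel`). Hence the two half-waves, for `s = ±1`, into which a
component of `P` splits (`halfVec`, `sym`) satisfy a relation
`g₁ + e = (1 + x·∇) g + s t |∇| g`, where `g₁` comes from `∂Sφ` and `e` is of size `t f`
(`HalfWave`, `halfWave_halfVec`). On the ray `ξ = ρ ν` of Fourier space this is an ordinary
differential equation in `ρ`, and it trades a factor `τ = x·ν + s t`, the phase of the half-wave,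
for one scaling field by integration by parts in `ρ` (`HalfWave.integral_by_parts`). Two
integrations by parts where `|τ|` is large, and none where it is small, bound a half-wave by
integrals over frequency space with weights concentrated at `τ = 0` (`HalfWave.enorm_osc_le`).
The Cauchy-Schwarz inequality and Archimedes' theorem turn these into the decay of the first
estimate (`enorm_le_of_scalErr`); for frequencies in an annulus, suprema of the Fourier transforms
and Archimedes' theorem turn them into the second one (`enorm_le_of_annulus`).

These bounds are proved for Schwartz functions, with defects in the relations between `P` and `∂Sφ`
(`scalErr`). A solution is multiplied by a cutoff `χ(ε x)`, whose contributions to the defects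
tend to zero with `ε` (`CutClass.errNorm_le`, `tendsto_cutErr`). The cutoff has compact support in
the first estimate. In the second one its Fourier transform has compact support, so that the
cutoff does not move the frequencies out of a fixed annulus (`FourierOff.fourierVanish_cut`).
Times `t ≤ 1` are covered by `H² ⊆ L^∞` and by the elementary bounds for annuli.

*The third estimate* follows from Kirchhoff's formula (`IsSmoothSolution.kirchhoff`): its integrand
over the spheres of a backward light cone has a derivative in time which, by the wave equation,
is a spherical Laplacian up to a factor; this is a sum of squares of rotation fields and integrates
to zero, by the rotation invariance of the surface measure. The integrals over spheres of large
radius are controlled by those of derivatives over the exterior of the sphere, by integration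
along rays (`sphNorm_le`); each derivative gains a power of the radius.

The numerical constants are not optimal.
-/

open MeasureTheory Set
open scoped ENNReal FourierTransform SchwartzMap ContDiff

noncomputable section

namespace WaveDecay

section

/-! ### Polar coordinates and zonal integrals on the sphere -/

/-- The unit sphere of `ℝ³`. -/
abbrev S2 : Type := Metric.sphere (0 : Space3) 1

/-- Surface measure on the unit sphere of `ℝ³`. -/
abbrev sph : Measure S2 := (volume : Measure Space3).toSphere

lemma finrank_space3 : Module.finrank ℝ Space3 = 3 := by simp

lemma norm_S2 (ν : S2) : ‖(ν : Space3)‖ = 1 := mem_sphere_zero_iff_norm.1 ν.2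

lemma measurePreserving_polar :
    MeasurePreserving (homeomorphUnitSphereProd Space3)
      ((volume : Measure Space3).comap (↑)) (sph.prod (Measure.volumeIoiPow 2)) := by
  have := (volume : Measure Space3).measurePreserving_homeomorphUnitSphereProd
  rwa [finrank_space3] at this

lemma lintegral_polar_prod {F : Space3 → ℝ≥0∞} :
    ∫⁻ y, F y = ∫⁻ q : S2 × Ioi (0 : ℝ), F (q.2.1 • (q.1 : Space3))
      ∂(sph.prod (Measure.volumeIoiPow 2)) := by
  have h := (measurePreserving_polar.symm (homeomorphUnitSphereProd Space3).toMeasurableEquiv).lintegral_comp_emb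
    (homeomorphUnitSphereProd Space3).toMeasurableEquiv.symm.measurableEmbedding
    (fun y : ({0}ᶜ : Set Space3) => F y)
  calc ∫⁻ y, F y = ∫⁻ y in ({0}ᶜ : Set Space3), F y := by
        rw [restrict_compl_singleton]
    _ = ∫⁻ y : ({0}ᶜ : Set Space3), F y ∂((volume : Measure Space3).comap (↑)) :=
        (lintegral_subtype_comap (measurableSet_singleton _).compl F).symm
    _ = _ := by rw [← h]; rfl

lemma lintegral_volumeIoiPow {G : ℝ → ℝ≥0∞} (hG : Measurable G) :
    ∫⁻ ρ : Ioi (0 : ℝ), G ρ ∂(Measure.volumeIoiPow 2)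
      = ∫⁻ ρ in Ioi (0 : ℝ), ENNReal.ofReal (ρ ^ 2) * G ρ := by
  rw [Measure.volumeIoiPow, lintegral_withDensity_eq_lintegral_mul _ (by fun_prop) (by fun_prop)]
  exact lintegral_subtype_comap measurableSet_Ioi (fun ρ => ENNReal.ofReal (ρ ^ 2) * G ρ)

lemma lintegral_polar {F : Space3 → ℝ≥0∞} (hF : Measurable F) :
    ∫⁻ y, F y = ∫⁻ ν : S2, ∫⁻ ρ in Ioi (0 : ℝ),
      ENNReal.ofReal (ρ ^ 2) * F (ρ • (ν : Space3)) ∂volume ∂sph := by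
  rw [lintegral_polar_prod, lintegral_prod _ (by fun_prop)]
  refine lintegral_congr fun ν => ?_
  exact lintegral_volumeIoiPow (G := fun ρ => F (ρ • (ν : Space3))) (by fun_prop)

lemma integral_polar {F : Space3 → ℂ} (hF : Integrable F) :
    ∫ y, F y = ∫ ν : S2, ∫ ρ in Ioi (0 : ℝ), (ρ ^ 2) • F (ρ • (ν : Space3)) ∂volume ∂sph := by
  have h := (measurePreserving_polar.symm (homeomorphUnitSphereProd Space3).toMeasurableEquiv).integral_comp
    (homeomorphUnitSphereProd Space3).toMeasurableEquiv.symm.measurableEmbedding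
    (fun y : ({0}ᶜ : Set Space3) => F y)
  have h2 := (measurePreserving_polar.symm (homeomorphUnitSphereProd Space3).toMeasurableEquiv).integrable_comp_emb
    (homeomorphUnitSphereProd Space3).toMeasurableEquiv.symm.measurableEmbedding
    (g := fun y : ({0}ᶜ : Set Space3) => F y)
  have h3 : Integrable (fun y : ({0}ᶜ : Set Space3) => F y)
      ((volume : Measure Space3).comap (↑)) :=
    (integrableOn_iff_comap_subtypeVal (measurableSet_singleton _).compl).1 hF.integrableOn
  have h4 := h2.2 h3
  calc ∫ y, F y = ∫ y in ({0}ᶜ : Set Space3), F y := by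
        rw [restrict_compl_singleton]
    _ = ∫ y : ({0}ᶜ : Set Space3), F y ∂((volume : Measure Space3).comap (↑)) :=
        (integral_subtype_comap (measurableSet_singleton _).compl F).symm
    _ = ∫ q : S2 × Ioi (0 : ℝ), F (q.2.1 • (q.1 : Space3))
      ∂(sph.prod (Measure.volumeIoiPow 2)) := by rw [← h]; rfl
    _ = ∫ ν : S2, ∫ ρ : Ioi (0 : ℝ), F (ρ.1 • (ν : Space3)) ∂(Measure.volumeIoiPow 2) ∂sph :=
        integral_prod _ h4
    _ = _ := by
        congr 1; ext ν
        simp only [Measure.volumeIoiPow, ENNReal.ofReal]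
        rw [integral_withDensity_eq_integral_smul (by fun_prop),
          integral_subtype_comap measurableSet_Ioi
            fun a => Real.toNNReal (a ^ 2) • F (a • (ν : Space3))]
        refine setIntegral_congr_fun measurableSet_Ioi fun x hx => ?_
        simp only [NNReal.smul_def, Real.coe_toNNReal _ (pow_nonneg (le_of_lt hx) 2)]

/-- Integrals over the sphere as integrals over the unit ball of functions that are homogeneous of
degree zero; this transports properties of Lebesgue measure to surface measure. -/
lemma lintegral_sph_eq_ball {h : Space3 → ℝ≥0∞} (hh : Measurable h) :
    ∫⁻ ν : S2, h ν ∂sph = 3 * ∫⁻ y in Metric.ball (0 : Space3) 1, h (‖y‖⁻¹ • y) := by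
  rw [← lintegral_indicator Metric.isOpen_ball.measurableSet, lintegral_polar]
  · have hin : ∀ ν : S2, ∫⁻ ρ in Ioi (0 : ℝ), ENNReal.ofReal (ρ ^ 2) *
        (Metric.ball (0 : Space3) 1).indicator (fun y => h (‖y‖⁻¹ • y)) (ρ • (ν : Space3))
        = 3⁻¹ * h ν := by
      intro ν
      have e1 : ∀ ρ ∈ Ioi (0 : ℝ), ENNReal.ofReal (ρ ^ 2) *
          (Metric.ball (0 : Space3) 1).indicator (fun y => h (‖y‖⁻¹ • y)) (ρ • (ν : Space3))
          = (Ioo (0 : ℝ) 1).indicator (fun ρ => ENNReal.ofReal (ρ ^ 2)) ρ * h ν := by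
        intro ρ hρ
        have hn : ‖ρ • (ν : Space3)‖ = ρ := by
          rw [norm_smul, norm_S2, mul_one, Real.norm_of_nonneg (le_of_lt hρ)]
        by_cases h1 : ρ < 1
        · rw [indicator_of_mem, indicator_of_mem (show ρ ∈ Ioo (0 : ℝ) 1 from ⟨hρ, h1⟩), hn,
            smul_smul, inv_mul_cancel₀ (ne_of_gt hρ), one_smul]
          simpa [hn] using h1
        · rw [indicator_of_notMem, indicator_of_notMem (fun h => h1 h.2)]
          · simp
          · simpa [hn] using h1
      rw [setLIntegral_congr_fun measurableSet_Ioi e1, lintegral_mul_const _ (by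
        exact (Measurable.indicator (by fun_prop) measurableSet_Ioo)),
        lintegral_indicator measurableSet_Ioo, Measure.restrict_restrict measurableSet_Ioo,
        inter_eq_left.2 (fun x hx => hx.1)]
      congr 1
      rw [Measure.restrict_congr_set Ioo_ae_eq_Ioc, ← ofReal_integral_eq_lintegral_ofReal
        (intervalIntegral.intervalIntegrable_pow (μ := volume) (a := (0 : ℝ)) (b := 1) 2).1,
        ← intervalIntegral.integral_of_le zero_le_one]
      · rw [integral_pow]
        norm_num
        rw [ENNReal.ofReal_div_of_pos (by norm_num)]; simp
      · exact Filter.Eventually.of_forall fun y => by positivity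
    simp_rw [hin]
    rw [lintegral_const_mul _ (by fun_prop), ← mul_assoc,
      ENNReal.mul_inv_cancel (by norm_num) (by norm_num), one_mul]
  · exact Measurable.indicator (by fun_prop) Metric.isOpen_ball.measurableSet

/-- The action of a linear isometry on the unit sphere. -/
def sphMap (L : Space3 ≃ₗᵢ[ℝ] Space3) (ν : S2) : S2 :=
  ⟨L ν, by simp⟩

lemma continuous_sphMap (L : Space3 ≃ₗᵢ[ℝ] Space3) : Continuous (sphMap L) :=
  Continuous.subtype_mk (by fun_prop) _

lemma lintegral_sph_rotate (L : Space3 ≃ₗᵢ[ℝ] Space3) {h : Space3 → ℝ≥0∞} (hh : Measurable h) :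
    ∫⁻ ν : S2, h (L ν) ∂sph = ∫⁻ ν : S2, h ν ∂sph := by
  rw [lintegral_sph_eq_ball hh, lintegral_sph_eq_ball (h := fun y => h (L y)) (by fun_prop)]
  congr 1
  have hp := (L.measurePreserving).setLIntegral_comp_preimage_emb
    L.toHomeomorph.measurableEmbedding (fun y => h (‖y‖⁻¹ • y)) (Metric.ball (0 : Space3) 1)
  rw [← hp]
  have : L ⁻¹' (Metric.ball (0 : Space3) 1) = Metric.ball (0 : Space3) 1 := by
    ext y; simp
  rw [this]
  simp

lemma measurePreserving_sphMap (L : Space3 ≃ₗᵢ[ℝ] Space3) :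
    MeasurePreserving (sphMap L) sph sph := by
  refine ⟨(continuous_sphMap L).measurable, ?_⟩
  refine Measure.ext_of_lintegral _ fun f hf => ?_
  rw [lintegral_map hf (continuous_sphMap L).measurable]
  -- extend `f` to the whole space by zero
  have hemb : MeasurableEmbedding (Subtype.val : S2 → Space3) :=
    MeasurableEmbedding.subtype_coe (Metric.isClosed_sphere.measurableSet)
  obtain ⟨g, hg, hgf⟩ := hemb.exists_measurable_extend hf (fun _ => ⟨0⟩)
  have e : ∀ ν : S2, f ν = g ν := fun ν => (congrFun hgf ν).symm
  simp_rw [e]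
  exact lintegral_sph_rotate L hg

/-- Archimedes' theorem for the first coordinate, in the unit ball. -/
lemma lintegral_ball_zonal {h : ℝ → ℝ≥0∞} (hh : Measurable h) :
    ∫⁻ y in Metric.ball (0 : Space3) 1, h ((‖y‖⁻¹ • y) 0)
      = 3⁻¹ * (ENNReal.ofReal (2 * Real.pi) * ∫⁻ z in Icc (-1 : ℝ) 1, h z) := by
  set G : ℝ → ℝ → ℝ≥0∞ := fun a s => if a ^ 2 + s ^ 2 < 1 then h ((√(a ^ 2 + s ^ 2))⁻¹ * a) else 0
    with hG
  have hGm : Measurable (Function.uncurry G) := by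
    refine Measurable.ite ?_ (by fun_prop) measurable_const
    exact measurableSet_lt (by fun_prop) measurable_const
  -- separate the first coordinate from the other two
  have step1 : ∫⁻ y in Metric.ball (0 : Space3) 1, h ((‖y‖⁻¹ • y) 0)
      = ∫⁻ a : ℝ, ∫⁻ p : ℝ × ℝ, G a (√(p.1 ^ 2 + p.2 ^ 2)) := by
    rw [← lintegral_indicator Metric.isOpen_ball.measurableSet]
    have hn : ∀ y : Space3, ‖y‖ = √(y 0 ^ 2 + (y 1 ^ 2 + y 2 ^ 2)) := by
      intro y
      rw [EuclideanSpace.norm_eq, Fin.sum_univ_three]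
      simp [add_assoc]
    have e1 : ∀ y : Space3, (Metric.ball (0 : Space3) 1).indicator (fun y => h ((‖y‖⁻¹ • y) 0)) y
        = G (y 0) (√(y 1 ^ 2 + y 2 ^ 2)) := by
      intro y
      have hs : √(y 1 ^ 2 + y 2 ^ 2) ^ 2 = y 1 ^ 2 + y 2 ^ 2 := Real.sq_sqrt (by positivity)
      have hb : y ∈ Metric.ball (0 : Space3) 1 ↔ y 0 ^ 2 + (y 1 ^ 2 + y 2 ^ 2) < 1 := by
        rw [mem_ball_zero_iff, hn, Real.sqrt_lt' one_pos, one_pow]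
      simp only [hG, hs]
      by_cases hy : y ∈ Metric.ball (0 : Space3) 1
      · rw [indicator_of_mem hy, if_pos (hb.1 hy), hn]; rfl
      · rw [indicator_of_notMem hy, if_neg (mt hb.2 hy)]
    simp_rw [e1]
    have m1 := (EuclideanSpace.volume_preserving_symm_measurableEquiv_toLp (Fin 3))
    have m2 := (volume_preserving_piFinSuccAbove (fun _ : Fin 3 => ℝ) 0)
    have m3 := (MeasurePreserving.id (volume : Measure ℝ)).prod
      (volume_preserving_finTwoArrow ℝ)
    have m := m3.comp (m2.comp m1)
    have hFm : Measurable (fun q : ℝ × ℝ × ℝ => G q.1 (√(q.2.1 ^ 2 + q.2.2 ^ 2))) :=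
      hGm.comp (by fun_prop : Measurable fun q : ℝ × ℝ × ℝ => (q.1, √(q.2.1 ^ 2 + q.2.2 ^ 2)))
    have := m.lintegral_comp hFm
    rw [lintegral_prod _ hFm.aemeasurable] at this
    rw [← this]
    rfl
  -- polar coordinates in the plane of the last two coordinates
  have step2 : ∀ a : ℝ, ∫⁻ p : ℝ × ℝ, G a (√(p.1 ^ 2 + p.2 ^ 2))
      = ENNReal.ofReal (2 * Real.pi) * ∫⁻ s in Ioi (0 : ℝ), ENNReal.ofReal s * G a s := by
    intro a
    have hGa : Measurable (G a) := hGm.comp (by fun_prop : Measurable fun s : ℝ => (a, s))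
    rw [← lintegral_comp_polarCoord_symm]
    have e : ∀ p ∈ polarCoord.target, ENNReal.ofReal p.1 •
        G a (√((polarCoord.symm p).1 ^ 2 + (polarCoord.symm p).2 ^ 2))
        = ENNReal.ofReal p.1 * G a p.1 := by
      intro p hp
      have hp1 : 0 < p.1 := hp.1
      have : (polarCoord.symm p).1 ^ 2 + (polarCoord.symm p).2 ^ 2 = p.1 ^ 2 := by
        simp only [polarCoord_symm_apply]
        nlinarith [Real.sin_sq_add_cos_sq p.2]
      rw [this, Real.sqrt_sq hp1.le, smul_eq_mul]
    rw [setLIntegral_congr_fun polarCoord.open_target.measurableSet e]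
    have : polarCoord.target = Ioi (0 : ℝ) ×ˢ Ioo (-Real.pi) Real.pi := rfl
    rw [this, Measure.volume_eq_prod, ← Measure.prod_restrict, lintegral_prod _ (by fun_prop)]
    simp only [lintegral_const, Measure.restrict_apply MeasurableSet.univ, univ_inter,
      Real.volume_Ioo]
    rw [lintegral_mul_const _ (by fun_prop), mul_comm]
    congr 2; ring
  -- polar coordinates in the half plane
  have step3 : ∫⁻ a : ℝ, ∫⁻ s in Ioi (0 : ℝ), ENNReal.ofReal s * G a s
      = 3⁻¹ * ∫⁻ z in Icc (-1 : ℝ) 1, h z := by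
    have hF : Measurable fun q : ℝ × ℝ =>
        (Ioi (0 : ℝ)).indicator (fun s => ENNReal.ofReal s * G q.1 s) q.2 := by
      have : (fun q : ℝ × ℝ => (Ioi (0 : ℝ)).indicator (fun s => ENNReal.ofReal s * G q.1 s) q.2)
          = (Prod.snd ⁻¹' (Ioi (0 : ℝ))).indicator
            (fun q : ℝ × ℝ => ENNReal.ofReal q.2 * G q.1 q.2) := by
        ext q; simp only [indicator, mem_preimage]
      rw [this]
      refine Measurable.indicator ?_ (measurable_snd measurableSet_Ioi)
      exact (by fun_prop : Measurable fun q : ℝ × ℝ => ENNReal.ofReal q.2).mul hGm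
    have c1 : ∫⁻ a : ℝ, ∫⁻ s in Ioi (0 : ℝ), ENNReal.ofReal s * G a s
        = ∫⁻ q : ℝ × ℝ, (Ioi (0 : ℝ)).indicator (fun s => ENNReal.ofReal s * G q.1 s) q.2 := by
      rw [Measure.volume_eq_prod, lintegral_prod _ hF.aemeasurable]
      refine lintegral_congr fun a => ?_
      exact (lintegral_indicator measurableSet_Ioi _).symm
    rw [c1, ← lintegral_comp_polarCoord_symm]
    have e : ∀ p ∈ polarCoord.target, ENNReal.ofReal p.1 • (Ioi (0 : ℝ)).indicator
          (fun s => ENNReal.ofReal s * G (polarCoord.symm p).1 s) (polarCoord.symm p).2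
        = (Ioo (0 : ℝ) 1).indicator (fun ρ => ENNReal.ofReal (ρ ^ 2)) p.1 *
          (Ioo (0 : ℝ) Real.pi).indicator
            (fun θ => ENNReal.ofReal (Real.sin θ) * h (Real.cos θ)) p.2 := by
      rintro ⟨ρ, θ⟩ ⟨hρ, hθ⟩
      simp only [mem_Ioi, mem_Ioo] at hρ hθ
      simp only [polarCoord_symm_apply, smul_eq_mul]
      by_cases hpos : 0 < θ
      · have hs : 0 < Real.sin θ := Real.sin_pos_of_pos_of_lt_pi hpos hθ.2
        have hsq : (ρ * Real.cos θ) ^ 2 + (ρ * Real.sin θ) ^ 2 = ρ ^ 2 := by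
          nlinarith [Real.sin_sq_add_cos_sq θ]
        rw [indicator_of_mem (show ρ * Real.sin θ ∈ Ioi (0 : ℝ) from mul_pos hρ hs),
          indicator_of_mem (show θ ∈ Ioo (0 : ℝ) Real.pi from ⟨hpos, hθ.2⟩)]
        simp only [hG, hsq, Real.sqrt_sq hρ.le]
        by_cases h1 : ρ < 1
        · rw [if_pos (by nlinarith), indicator_of_mem (show ρ ∈ Ioo (0 : ℝ) 1 from ⟨hρ, h1⟩),
            ← mul_assoc, ← mul_assoc, ← ENNReal.ofReal_mul hρ.le,
            inv_mul_cancel₀ hρ.ne', one_mul, ← mul_assoc (ENNReal.ofReal (ρ ^ 2)),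
            ← ENNReal.ofReal_mul (by positivity)]
          congr 2; ring
        · rw [if_neg (by nlinarith), indicator_of_notMem (fun h => h1 h.2)]
          simp
      · have hs : Real.sin θ ≤ 0 := Real.sin_nonpos_of_nonpos_of_neg_pi_le (by linarith) hθ.1.le
        rw [indicator_of_notMem (s := Ioi (0 : ℝ)), indicator_of_notMem (s := Ioo (0 : ℝ) Real.pi)]
        · simp
        · exact fun h => hpos h.1
        · simp only [mem_Ioi, not_lt]
          nlinarith
    rw [setLIntegral_congr_fun polarCoord.open_target.measurableSet e]
    have : polarCoord.target = Ioi (0 : ℝ) ×ˢ Ioo (-Real.pi) Real.pi := rfl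
    have hm1 : Measurable ((Ioo (0 : ℝ) 1).indicator (fun ρ => ENNReal.ofReal (ρ ^ 2))) :=
      Measurable.indicator (by fun_prop) measurableSet_Ioo
    have hm2 : Measurable ((Ioo (0 : ℝ) Real.pi).indicator
        (fun θ => ENNReal.ofReal (Real.sin θ) * h (Real.cos θ))) :=
      Measurable.indicator (by fun_prop) measurableSet_Ioo
    rw [this, Measure.volume_eq_prod, ← Measure.prod_restrict,
      lintegral_prod_mul hm1.aemeasurable hm2.aemeasurable]
    congr 1
    · rw [lintegral_indicator measurableSet_Ioo, Measure.restrict_restrict measurableSet_Ioo,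
        inter_eq_left.2 (fun x hx => hx.1), Measure.restrict_congr_set Ioo_ae_eq_Ioc,
        ← ofReal_integral_eq_lintegral_ofReal
        (intervalIntegral.intervalIntegrable_pow (μ := volume) (a := (0 : ℝ)) (b := 1) 2).1,
        ← intervalIntegral.integral_of_le zero_le_one]
      · rw [integral_pow]
        norm_num
        rw [ENNReal.ofReal_div_of_pos (by norm_num)]; simp
      · exact Filter.Eventually.of_forall fun y => by positivity
    · rw [lintegral_indicator measurableSet_Ioo, Measure.restrict_restrict measurableSet_Ioo,
        inter_eq_left.2 (Ioo_subset_Ioo_left (by linarith [Real.pi_pos])),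
        Measure.restrict_congr_set Ioo_ae_eq_Icc]
      have hb := Real.bijOn_cos
      rw [← hb.image_eq, lintegral_image_eq_lintegral_abs_deriv_mul measurableSet_Icc
        (fun θ _ => (Real.hasDerivAt_cos θ).hasDerivWithinAt) hb.injOn]
      refine setLIntegral_congr_fun measurableSet_Icc fun θ hθ => ?_
      simp only [abs_neg]
      rw [abs_of_nonneg (Real.sin_nonneg_of_mem_Icc hθ)]
  rw [step1]
  simp_rw [step2]
  rw [lintegral_const_mul', step3]
  · ring
  · exact ENNReal.ofReal_ne_top

/-- Archimedes' theorem: `x·ν` is uniformly distributed on `[-|x|, |x|]` when `ν` is uniformly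
distributed on the sphere. -/
lemma lintegral_sph_inner (x : Space3) {h : ℝ → ℝ≥0∞} (hh : Measurable h) :
    ∫⁻ ν : S2, h (inner ℝ x (ν : Space3)) ∂sph
      = ENNReal.ofReal (2 * Real.pi) * ∫⁻ z in Icc (-1 : ℝ) 1, h (‖x‖ * z) := by
  -- a reflection takes `x` to the first coordinate axis
  obtain ⟨L, hL⟩ : ∃ L : Space3 ≃ₗᵢ[ℝ] Space3, L (EuclideanSpace.single 0 ‖x‖) = x := by
    refine ⟨Submodule.reflection (ℝ ∙ (EuclideanSpace.single 0 ‖x‖ - x))ᗮ, ?_⟩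
    exact Submodule.reflection_sub (by simp)
  rw [← lintegral_sph_rotate L (h := fun y => h (inner ℝ x y)) (by fun_prop)]
  have e : ∀ ν : S2, inner ℝ x (L ν) = ‖x‖ * (ν : Space3) 0 := by
    intro ν
    nth_rewrite 1 [← hL]
    rw [L.inner_map_map, EuclideanSpace.inner_single_left]
    simp
  simp_rw [e]
  rw [lintegral_sph_eq_ball (h := fun y : Space3 => h (‖x‖ * y 0)) (by fun_prop),
    lintegral_ball_zonal (h := fun z => h (‖x‖ * z)) (by fun_prop), ← mul_assoc,
    ENNReal.mul_inv_cancel (by norm_num) (by norm_num), one_mul]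

lemma sph_univ : sph univ = ENNReal.ofReal (4 * Real.pi) := by
  have := lintegral_sph_inner 0 (h := fun _ => 1) measurable_const
  simp only [lintegral_const, one_mul, Measure.restrict_apply MeasurableSet.univ, univ_inter,
    Real.volume_Icc] at this
  rw [this, ← ENNReal.ofReal_mul (by positivity)]
  congr 1; ring

end

section

/-! ### Integrals over the sphere of weights concentrated near the light cone -/

lemma lintegral_Ici_inv_sq {K d : ℝ} (hK : 0 < K) (hd : 0 ≤ d) :
    ∫⁻ u in Ici d, ENNReal.ofReal ((1 + K * u) ^ 2)⁻¹ = ENNReal.ofReal (K * (1 + K * d))⁻¹ := by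
  have hpos : ∀ u ∈ Ici d, 0 < 1 + K * u := fun u hu => by
    have : 0 ≤ K * u := mul_nonneg hK.le (hd.trans hu)
    linarith
  have hder : ∀ u ∈ Ici d, HasDerivAt (fun u => -(K * (1 + K * u))⁻¹) ((1 + K * u) ^ 2)⁻¹ u := by
    intro u hu
    have h1 : HasDerivAt (fun u : ℝ => K * (1 + K * u)) (K * K) u := by
      simpa using (((hasDerivAt_id u).const_mul K).const_add 1).const_mul K
    have := (h1.inv (mul_pos hK (hpos u hu)).ne').neg
    refine this.congr_deriv ?_
    have := (hpos u hu).ne'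
    field_simp
  have hlim : Filter.Tendsto (fun u => -(K * (1 + K * u))⁻¹) Filter.atTop (nhds 0) := by
    rw [← neg_zero]
    refine (Filter.Tendsto.inv_tendsto_atTop ?_).neg
    exact (Filter.tendsto_atTop_add_const_left _ _ (Filter.tendsto_id.const_mul_atTop hK)).const_mul_atTop hK
  have hint := integrableOn_Ioi_deriv_of_nonneg' hder (fun u hu => by positivity) hlim
  have hval := integral_Ioi_of_hasDerivAt_of_nonneg' hder (fun u hu => by positivity) hlim
  rw [setLIntegral_congr Ioi_ae_eq_Ici.symm, ← ofReal_integral_eq_lintegral_ofReal hint, hval]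
  · simp
  · exact Filter.Eventually.of_forall fun u => by positivity

lemma lintegral_Ici_inv_cube {d : ℝ} (hd : 0 ≤ d) :
    ∫⁻ u in Ici d, ENNReal.ofReal ((1 + u) ^ 3)⁻¹ = ENNReal.ofReal (2 * (1 + d) ^ 2)⁻¹ := by
  have hpos : ∀ u ∈ Ici d, 0 < 1 + u := fun u hu => by
    have : 0 ≤ u := hd.trans hu
    linarith
  have hder : ∀ u ∈ Ici d, HasDerivAt (fun u => -(2 * (1 + u) ^ 2)⁻¹) ((1 + u) ^ 3)⁻¹ u := by
    intro u hu
    have h1 : HasDerivAt (fun u : ℝ => 2 * (1 + u) ^ 2) (2 * (2 * (1 + u))) u := by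
      simpa using (((hasDerivAt_id u).const_add 1).pow 2).const_mul 2
    have := (h1.inv (mul_pos two_pos (pow_pos (hpos u hu) 2)).ne').neg
    refine this.congr_deriv ?_
    have := (hpos u hu).ne'
    field_simp
  have hlim : Filter.Tendsto (fun u : ℝ => -(2 * (1 + u) ^ 2)⁻¹) Filter.atTop (nhds 0) := by
    rw [← neg_zero]
    refine (Filter.Tendsto.inv_tendsto_atTop ?_).neg
    refine Filter.Tendsto.const_mul_atTop two_pos ?_
    exact (Filter.tendsto_pow_atTop two_ne_zero).comp
      (Filter.tendsto_atTop_add_const_left _ _ Filter.tendsto_id)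
  have hnn : ∀ u ∈ Ioi d, 0 ≤ ((1 + u) ^ 3)⁻¹ := fun u hu => by
    have := hpos u (mem_Ici.2 (le_of_lt hu)); positivity
  have hint := integrableOn_Ioi_deriv_of_nonneg' hder hnn hlim
  have hval := integral_Ioi_of_hasDerivAt_of_nonneg' hder hnn hlim
  rw [setLIntegral_congr Ioi_ae_eq_Ici.symm, ← ofReal_integral_eq_lintegral_ofReal hint, hval]
  · simp
  · exact (ae_restrict_mem measurableSet_Ioi).mono fun u hu => hnn u hu

/-- Archimedes' theorem, in the form of a bound for functions of the distance to the cone. -/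
lemma lintegral_sph_abs_le {x : Space3} {t s : ℝ} (hs : s = 1 ∨ s = -1) (hx : 0 < ‖x‖)
    {d : ℝ} (hd : d ≤ t - ‖x‖ ∨ d = 0) {h : ℝ → ℝ≥0∞} (hh : Measurable h) :
    ∫⁻ ν : S2, h |inner ℝ x (ν : Space3) + s * t| ∂sph
      ≤ ENNReal.ofReal (4 * Real.pi / ‖x‖) * ∫⁻ u in Ici d, h u := by
  rw [lintegral_sph_inner x (h := fun z => h |z + s * t|) (by fun_prop)]
  have hcv := lintegral_image_eq_lintegral_abs_deriv_mul (s := Icc (-1 : ℝ) 1) measurableSet_Icc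
    (f := fun z => ‖x‖ * z + s * t) (f' := fun _ => ‖x‖)
    (fun z _ => by simpa using (((hasDerivAt_id z).const_mul ‖x‖).add_const (s * t)).hasDerivWithinAt)
    (fun z _ w _ h => by simpa [hx.ne'] using h) (fun u => h |u|)
  rw [lintegral_const_mul' _ _ ENNReal.ofReal_ne_top, abs_of_pos hx] at hcv
  have hsub : (fun z => ‖x‖ * z + s * t) '' Icc (-1 : ℝ) 1 ⊆ {u | d ≤ |u|} := by
    rintro _ ⟨z, ⟨hz1, hz2⟩, rfl⟩
    rcases hd with hd | rfl
    · change d ≤ |‖x‖ * z + s * t|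
      have h1 : ‖x‖ * z ≤ ‖x‖ := by nlinarith
      have h2 : -‖x‖ ≤ ‖x‖ * z := by nlinarith
      rcases hs with rfl | rfl
      · exact le_abs.2 (Or.inl (by linarith))
      · exact le_abs.2 (Or.inr (by linarith))
    · exact abs_nonneg (‖x‖ * z + s * t)
  have htail : ∫⁻ u in {u : ℝ | d ≤ |u|}, h |u| ≤ 2 * ∫⁻ u in Ici d, h u := by
    have hpos : ∫⁻ u in Ici d ∩ Ici 0, h |u| ≤ ∫⁻ u in Ici d, h u := by
      rw [setLIntegral_congr_fun (g := h) (measurableSet_Ici.inter measurableSet_Ici)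
        (fun u hu => by simp only [abs_of_nonneg (show (0 : ℝ) ≤ u from hu.2)])]
      exact lintegral_mono_set inter_subset_left
    have hneg : ∫⁻ u in (fun u : ℝ => -u) ⁻¹' (Ici d ∩ Ici 0), h |u| ≤ ∫⁻ u in Ici d, h u := by
      have := (Measure.measurePreserving_neg (volume : Measure ℝ)).setLIntegral_comp_preimage_emb
        (MeasurableEquiv.neg ℝ).measurableEmbedding (fun u => h |u|) (Ici d ∩ Ici 0)
      simp only [abs_neg] at this
      calc _ = _ := this
        _ ≤ _ := hpos
    calc ∫⁻ u in {u : ℝ | d ≤ |u|}, h |u|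
        ≤ ∫⁻ u in (Ici d ∩ Ici 0) ∪ (fun u : ℝ => -u) ⁻¹' (Ici d ∩ Ici 0), h |u| := by
          refine lintegral_mono_set fun u hu => ?_
          rcases le_total 0 u with h0 | h0
          · exact Or.inl ⟨by simpa [abs_of_nonneg h0] using hu, h0⟩
          · exact Or.inr ⟨by simpa [abs_of_nonpos h0] using hu, by simpa using h0⟩
      _ ≤ _ := lintegral_union_le _ _ _
      _ ≤ _ := by rw [two_mul]; exact add_le_add hpos hneg
  have hx' : ENNReal.ofReal ‖x‖ ≠ 0 := by simpa using hx
  have h3 : ∫⁻ z in Icc (-1 : ℝ) 1, h |‖x‖ * z + s * t|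
      ≤ (ENNReal.ofReal ‖x‖)⁻¹ * (2 * ∫⁻ u in Ici d, h u) := by
    rw [← ENNReal.div_eq_inv_mul, ENNReal.le_div_iff_mul_le (Or.inl hx') (Or.inl ENNReal.ofReal_ne_top),
      mul_comm, ← hcv]
    exact (lintegral_mono_set hsub).trans htail
  calc _ ≤ ENNReal.ofReal (2 * Real.pi) * ((ENNReal.ofReal ‖x‖)⁻¹ * (2 * ∫⁻ u in Ici d, h u)) := by
        gcongr
    _ = _ := by
        have hw : ENNReal.ofReal ‖x‖⁻¹ * 2 = ENNReal.ofReal (‖x‖⁻¹ * 2) := by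
          rw [ENNReal.ofReal_mul (by positivity)]; simp
        rw [← ENNReal.ofReal_inv_of_pos hx, ← mul_assoc (ENNReal.ofReal ‖x‖⁻¹), hw, ← mul_assoc,
          ← ENNReal.ofReal_mul (by positivity)]
        congr 2; ring

lemma half_le_abs_inner_add {x : Space3} {t s : ℝ} (hs : s = 1 ∨ s = -1)
    (hxt : ‖x‖ < t / 2) (ν : S2) : t / 2 ≤ |inner ℝ x (ν : Space3) + s * t| := by
  have h := abs_le.1 (abs_real_inner_le_norm x (ν : Space3))
  rw [norm_S2, mul_one] at h
  rcases hs with rfl | rfl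
  · exact le_abs.2 (Or.inl (by linarith))
  · exact le_abs.2 (Or.inr (by linarith))

/-- The weight is of size one on a band of the sphere of area at most `C / (K t)`, uniformly in
`x`. -/
lemma lintegral_sph_cone_two {x : Space3} {t s K : ℝ} (hs : s = 1 ∨ s = -1) (hK : 0 < K)
    (ht : 0 < t) :
    ∫⁻ ν : S2, ENNReal.ofReal ((1 + K * |inner ℝ x (ν : Space3) + s * t|) ^ 2)⁻¹ ∂sph
      ≤ ENNReal.ofReal (8 * Real.pi / (K * t)) := by
  by_cases hxt : ‖x‖ < t / 2
  · calc _ ≤ ∫⁻ ν : S2, ENNReal.ofReal (2 * (K * t))⁻¹ ∂sph := by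
          refine lintegral_mono fun ν => ENNReal.ofReal_le_ofReal ?_
          have h1 := half_le_abs_inner_add hs hxt ν
          have h2 : K * (t / 2) ≤ K * |inner ℝ x (ν : Space3) + s * t| := by gcongr
          refine inv_anti₀ (by positivity) ?_
          have h3 : 0 ≤ K * t := by positivity
          nlinarith [sq_nonneg (1 - K * |inner ℝ x (ν : Space3) + s * t|)]
      _ ≤ _ := by
          rw [lintegral_const, sph_univ, ← ENNReal.ofReal_mul (by positivity)]
          refine ENNReal.ofReal_le_ofReal ?_
          rw [mul_inv, div_eq_mul_inv]
          have : 0 ≤ (K * t)⁻¹ := by positivity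
          nlinarith [Real.pi_pos, mul_nonneg Real.pi_pos.le this]
  · have hx : 0 < ‖x‖ := by linarith
    refine (lintegral_sph_abs_le hs hx (d := 0) (Or.inr rfl)
      (h := fun u => ENNReal.ofReal ((1 + K * u) ^ 2)⁻¹) (by fun_prop)).trans ?_
    rw [lintegral_Ici_inv_sq hK le_rfl, ← ENNReal.ofReal_mul (by positivity)]
    refine ENNReal.ofReal_le_ofReal ?_
    have : (‖x‖)⁻¹ ≤ 2 * t⁻¹ := by
      rw [inv_le_comm₀ hx (by positivity), mul_inv, inv_inv]; linarith
    calc 4 * Real.pi / ‖x‖ * (K * (1 + K * 0))⁻¹ = 4 * Real.pi * K⁻¹ * ‖x‖⁻¹ := by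
          rw [mul_zero, add_zero, mul_one]; ring
      _ ≤ 4 * Real.pi * K⁻¹ * (2 * t⁻¹) := by gcongr
      _ = _ := by rw [div_eq_mul_inv, mul_inv]; ring

/-- The cubic power gains the decay `⟨t - |x|⟩⁻²` in the interior of the cone, where the weight
stays away from its singularity. -/
lemma lintegral_sph_cone_three {x : Space3} {t s : ℝ} (hs : s = 1 ∨ s = -1) (ht : 1 ≤ t) :
    ∫⁻ ν : S2, ENNReal.ofReal ((1 + |inner ℝ x (ν : Space3) + s * t|) ^ 3)⁻¹ ∂sph
      ≤ ENNReal.ofReal (32 * Real.pi / t *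
        (if ‖x‖ ≤ t then (1 + (t - ‖x‖))⁻¹ else 1) ^ 2) := by
  have hπ := Real.pi_pos
  by_cases hxt : ‖x‖ < t / 2
  · calc _ ≤ ∫⁻ ν : S2, ENNReal.ofReal (8 * (t * (1 + (t - ‖x‖)) ^ 2)⁻¹) ∂sph := by
          refine lintegral_mono fun ν => ENNReal.ofReal_le_ofReal ?_
          have h1 := half_le_abs_inner_add hs hxt ν
          have h0 : 0 < 1 + (t - ‖x‖) := by linarith
          have h3 : ((1 + |inner ℝ x (ν : Space3) + s * t|) ^ 3)⁻¹ ≤ ((1 + t / 2) ^ 3)⁻¹ := by gcongr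
          refine h3.trans ?_
          rw [← div_eq_mul_inv, le_div_iff₀ (by positivity), inv_mul_le_iff₀ (by positivity)]
          have hn := norm_nonneg x
          have h4 : t * (1 + (t - ‖x‖)) ^ 2 ≤ t * (1 + t) ^ 2 := by
            gcongr; linarith
          nlinarith [sq_nonneg t, mul_pos (by linarith : 0 < t) (by linarith : 0 < t)]
      _ ≤ _ := by
          rw [lintegral_const, sph_univ, ← ENNReal.ofReal_mul (by
            have : 0 < 1 + (t - ‖x‖) := by linarith
            positivity), if_pos (by linarith)]
          refine ENNReal.ofReal_le_ofReal (le_of_eq ?_)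
          rw [mul_inv, div_eq_mul_inv, inv_pow]; ring
  · have hx : 0 < ‖x‖ := by linarith
    have hxi : (‖x‖)⁻¹ ≤ 2 * t⁻¹ := by
      rw [inv_le_comm₀ hx (by positivity), mul_inv, inv_inv]; linarith
    have key : ∀ d, 0 ≤ d → (d ≤ t - ‖x‖ ∨ d = 0) →
        ∫⁻ ν : S2, ENNReal.ofReal ((1 + |inner ℝ x (ν : Space3) + s * t|) ^ 3)⁻¹ ∂sph
        ≤ ENNReal.ofReal (32 * Real.pi / t * ((1 + d)⁻¹) ^ 2) := by
      intro d hd hd'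
      refine (lintegral_sph_abs_le hs hx hd'
        (h := fun u => ENNReal.ofReal ((1 + u) ^ 3)⁻¹) (by fun_prop)).trans ?_
      rw [lintegral_Ici_inv_cube hd, ← ENNReal.ofReal_mul (by positivity)]
      refine ENNReal.ofReal_le_ofReal ?_
      calc 4 * Real.pi / ‖x‖ * (2 * (1 + d) ^ 2)⁻¹ = 2 * Real.pi * ((1 + d)⁻¹) ^ 2 * ‖x‖⁻¹ := by
            rw [mul_inv, div_eq_mul_inv, inv_pow]; ring
        _ ≤ 2 * Real.pi * ((1 + d)⁻¹) ^ 2 * (2 * t⁻¹) := by gcongr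
        _ = 4 * (Real.pi * (((1 + d)⁻¹) ^ 2 * t⁻¹)) := by ring
        _ ≤ 32 * (Real.pi * (((1 + d)⁻¹) ^ 2 * t⁻¹)) := by
            gcongr; norm_num
        _ = _ := by rw [div_eq_mul_inv]; ring
    split_ifs with hle
    · exact key _ (by linarith) (Or.inl le_rfl)
    · simpa using key 0 le_rfl (Or.inr rfl)

/-! ### The measure of the dyadic sets -/

lemma measurable_phaseSet (μ : ℝ) (k l : ℤ) (t : ℝ) (x : Space3) :
    MeasurableSet (phaseSet μ k l t x) := by
  refine MeasurableSet.inter ?_ ?_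
  · have hm : Measurable fun ξ : Space3 => |1 + μ * inner ℝ x ξ / (t * ‖ξ‖)| := by fun_prop
    exact measurableSet_le hm measurable_const
  · exact measurableSet_Icc.preimage measurable_norm

lemma volume_phaseSet_le {μ : ℝ} (hμ : μ = 1 ∨ μ = -1) (k l : ℤ) {t : ℝ} (ht : t ≠ 0)
    (x : Space3) : volume (phaseSet μ k l t x) ≤
      ENNReal.ofReal (8 * Real.pi * (2 : ℝ) ^ (3 * k + l)) := by
  have hπ := Real.pi_pos
  have h2k : (0 : ℝ) < 2 ^ k := by positivity
  have h2k1 : (0 : ℝ) < 2 ^ (k - 1) := by positivity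
  have h2l : (0 : ℝ) < 2 ^ l := by positivity
  set A : Set ℝ := {z | |1 + μ * z / t| ≤ (2 : ℝ) ^ l} with hA
  have hAm : MeasurableSet A := measurableSet_le (by fun_prop) measurable_const
  -- in polar coordinates the set is contained in a product
  have h1 : volume (phaseSet μ k l t x) ≤
      (∫⁻ ν : S2, A.indicator 1 (inner ℝ x (ν : Space3)) ∂sph) * ENNReal.ofReal ((2 : ℝ) ^ (3 * k)) := by
    rw [← lintegral_indicator_one (measurable_phaseSet μ k l t x),
      lintegral_polar (measurable_one.indicator (measurable_phaseSet μ k l t x)),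
      ← lintegral_mul_const _ (show Measurable fun ν : S2 => A.indicator 1 (inner ℝ x (ν : Space3)) from
        (measurable_one.indicator hAm).comp (by fun_prop :
          Measurable fun ν : S2 => inner ℝ x (ν : Space3)))]
    refine lintegral_mono fun ν => ?_
    have e : ∀ ρ ∈ Ioi (0 : ℝ), ENNReal.ofReal (ρ ^ 2) *
        (phaseSet μ k l t x).indicator 1 (ρ • (ν : Space3)) ≤
        (Iic ((2 : ℝ) ^ k)).indicator (fun _ => A.indicator 1 (inner ℝ x (ν : Space3)) *
          ENNReal.ofReal (((2 : ℝ) ^ k) ^ 2)) ρ := by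
      intro ρ hρ
      have hn : ‖ρ • (ν : Space3)‖ = ρ := by
        rw [norm_smul, norm_S2, mul_one, Real.norm_of_nonneg (le_of_lt hρ)]
      by_cases hm : ρ • (ν : Space3) ∈ phaseSet μ k l t x
      · obtain ⟨hm1, hm2⟩ := id hm
        rw [hn] at hm1 hm2
        have hin : inner ℝ x (ν : Space3) ∈ A := by
          rw [inner_smul_right] at hm1
          have hρ' : ρ ≠ 0 := ne_of_gt hρ
          have : μ * (ρ * inner ℝ x (ν : Space3)) / (t * ρ) = μ * inner ℝ x (ν : Space3) / t := by
            field_simp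
          rwa [this] at hm1
        rw [indicator_of_mem hm, indicator_of_mem (show ρ ∈ Iic ((2 : ℝ) ^ k) from hm2.2),
          indicator_of_mem hin]
        simp only [Pi.one_apply, mul_one, one_mul]
        exact ENNReal.ofReal_le_ofReal (pow_le_pow_left₀ (le_of_lt hρ) hm2.2 2)
      · rw [indicator_of_notMem hm]; simp
    refine (setLIntegral_mono' measurableSet_Ioi e).trans ?_
    rw [lintegral_indicator measurableSet_Iic, lintegral_const,
      Measure.restrict_restrict measurableSet_Iic, Measure.restrict_apply MeasurableSet.univ,
      univ_inter, inter_comm, Ioi_inter_Iic, Real.volume_Ioc, mul_assoc,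
      ← ENNReal.ofReal_mul (by positivity)]
    gcongr
    rw [sub_zero, mul_comm 3 k, zpow_mul, ← pow_succ]
    apply le_of_eq
    norm_cast
  have h2 : ∫⁻ ν : S2, A.indicator 1 (inner ℝ x (ν : Space3)) ∂sph
      ≤ ENNReal.ofReal (8 * Real.pi * (2 : ℝ) ^ l) := by
    by_cases hxt : ‖x‖ < |t| / 2
    · -- far from the light cone the phase is not stationary: the set is empty for small `l`
      by_cases hl : (2 : ℝ) ^ l < 1 / 2
      · have : ∀ ν : S2, A.indicator (1 : ℝ → ℝ≥0∞) (inner ℝ x (ν : Space3)) = 0 := by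
          intro ν
          refine indicator_of_notMem (fun hν => ?_) _
          have hν' : |1 + μ * inner ℝ x (ν : Space3) / t| ≤ (2 : ℝ) ^ l := hν
          have h3 := abs_real_inner_le_norm x (ν : Space3)
          rw [norm_S2, mul_one] at h3
          have h4 : |μ * inner ℝ x (ν : Space3) / t| ≤ 1 / 2 := by
            rw [abs_div, abs_mul, show |μ| = 1 by rcases hμ with rfl | rfl <;> simp, one_mul,
              div_le_iff₀ (abs_pos.2 ht)]
            linarith
          have := (abs_le.1 hν').2
          have := (abs_le.1 h4).1
          linarith
        simp [this]
      · calc ∫⁻ ν : S2, A.indicator 1 (inner ℝ x (ν : Space3)) ∂sph ≤ ∫⁻ ν : S2, 1 ∂sph :=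
              lintegral_mono fun ν => indicator_apply_le' (fun _ => le_rfl) (fun _ => zero_le)
          _ ≤ _ := by
              rw [lintegral_one, sph_univ]
              exact ENNReal.ofReal_le_ofReal (by nlinarith)
    · have hx : 0 < ‖x‖ := by have := abs_pos.2 ht; linarith
      rw [lintegral_sph_inner x (measurable_one.indicator hAm)]
      have : ∫⁻ z in Icc (-1 : ℝ) 1, A.indicator (1 : ℝ → ℝ≥0∞) (‖x‖ * z) ≤
          ENNReal.ofReal (4 * (2 : ℝ) ^ l) := by
        have hsub : ∀ z, A.indicator (1 : ℝ → ℝ≥0∞) (‖x‖ * z) ≤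
            (Icc (-(t * μ) / ‖x‖ - 2 * 2 ^ l) (-(t * μ) / ‖x‖ + 2 * 2 ^ l)).indicator 1 z := by
          intro z
          by_cases hz : ‖x‖ * z ∈ A
          · have hz' : |1 + μ * (‖x‖ * z) / t| ≤ (2 : ℝ) ^ l := hz
            have hq : |z - -(t * μ) / ‖x‖| ≤ 2 * 2 ^ l := by
              have e1 : z - -(t * μ) / ‖x‖ = (t * μ / ‖x‖) * (1 + μ * (‖x‖ * z) / t) := by
                have : μ * μ = 1 := by rcases hμ with rfl | rfl <;> norm_num
                field_simp
                linear_combination (-z * ‖x‖) * this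
              have e2 : |t * μ / ‖x‖| ≤ 2 := by
                rw [abs_div, abs_mul, show |μ| = 1 by rcases hμ with rfl | rfl <;> simp, mul_one,
                  abs_of_pos hx, div_le_iff₀ hx]
                linarith
              rw [e1, abs_mul]
              gcongr
            have := abs_le.1 hq
            rw [indicator_of_mem hz, indicator_of_mem]
            · simp
            · constructor <;> linarith
          · rw [indicator_of_notMem hz]; simp
        calc _ ≤ ∫⁻ z, A.indicator (1 : ℝ → ℝ≥0∞) (‖x‖ * z) := setLIntegral_le_lintegral _ _
          _ ≤ _ := lintegral_mono hsub
          _ = _ := by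
              rw [lintegral_indicator_one measurableSet_Icc, Real.volume_Icc]
              congr 1; ring
      calc _ ≤ ENNReal.ofReal (2 * Real.pi) * ENNReal.ofReal (4 * (2 : ℝ) ^ l) := by gcongr
        _ = _ := by
            rw [← ENNReal.ofReal_mul (by positivity)]; congr 1; ring
  calc _ ≤ _ := h1
    _ ≤ ENNReal.ofReal (8 * Real.pi * (2 : ℝ) ^ l) * ENNReal.ofReal ((2 : ℝ) ^ (3 * k)) := by gcongr
    _ = _ := by
        rw [← ENNReal.ofReal_mul (by positivity), zpow_add₀ two_ne_zero]
        congr 1; ring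

end

section

/-! ### Fourier transforms of Schwartz functions along rays -/

/-- The `i`-th standard basis vector of `ℝ³`. -/
abbrev bas (i : Fin 3) : Space3 := EuclideanSpace.single i 1

/-- The partial derivative `∂_i` on Schwartz functions. -/
def sd (i : Fin 3) (f : 𝓢(Space3, ℂ)) : 𝓢(Space3, ℂ) := LineDeriv.lineDerivOp (bas i) f

/-- Multiplication of Schwartz functions by the coordinate `x_i`. -/
def sx (i : Fin 3) (f : 𝓢(Space3, ℂ)) : 𝓢(Space3, ℂ) :=
  SchwartzMap.smulLeftCLM ℂ (fun y : Space3 => inner ℝ y (bas i)) f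

/-- The radial derivative `x·∇` on Schwartz functions. -/
def sD (f : 𝓢(Space3, ℂ)) : 𝓢(Space3, ℂ) := ∑ i, sx i (sd i f)

lemma inner_bas (y : Space3) (i : Fin 3) : inner ℝ y (bas i) = y i := by
  simp [bas, EuclideanSpace.inner_single_right]

lemma hasTemperateGrowth_inner_bas (i : Fin 3) :
    (fun y : Space3 => inner ℝ y (bas i)).HasTemperateGrowth := by fun_prop

lemma sd_apply (i : Fin 3) (f : 𝓢(Space3, ℂ)) (y : Space3) : sd i f y = fderiv ℝ f y (bas i) := rfl

lemma sx_apply (i : Fin 3) (f : 𝓢(Space3, ℂ)) (y : Space3) : sx i f y = (y i : ℂ) * f y := by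
  rw [sx, SchwartzMap.smulLeftCLM_apply_apply (hasTemperateGrowth_inner_bas i), inner_bas]
  simp

lemma sum_schwartz_apply {ι : Type*} (s : Finset ι) (F : ι → 𝓢(Space3, ℂ)) (y : Space3) :
    (∑ i ∈ s, F i) y = ∑ i ∈ s, F i y := by
  classical
  induction s using Finset.induction_on with
  | empty => simp
  | insert a s ha ih => simp [Finset.sum_insert ha, ih]

lemma sD_apply (f : 𝓢(Space3, ℂ)) (y : Space3) :
    sD f y = ∑ i, (y i : ℂ) * fderiv ℝ f y (bas i) := by
  simp [sD, sx_apply, sd_apply]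

lemma fourier_sd (i : Fin 3) (f : 𝓢(Space3, ℂ)) :
    𝓕 (sd i f) = (2 * Real.pi * Complex.I) • sx i (𝓕 f) :=
  SchwartzMap.fourier_lineDerivOp_eq f (bas i)

lemma fourier_sd_apply (i : Fin 3) (f : 𝓢(Space3, ℂ)) (ξ : Space3) :
    𝓕 (sd i f) ξ = 2 * Real.pi * Complex.I * (ξ i : ℂ) * 𝓕 f ξ := by
  rw [fourier_sd, smul_apply, sx_apply, smul_eq_mul]; ring

lemma sd_fourier (i : Fin 3) (f : 𝓢(Space3, ℂ)) :
    sd i (𝓕 f) = -(2 * Real.pi * Complex.I) • 𝓕 (sx i f) := by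
  rw [sd, SchwartzMap.lineDerivOp_fourier_eq]
  exact FourierTransform.fourier_smul _ _

lemma sd_sx_self (i : Fin 3) (f : 𝓢(Space3, ℂ)) : sd i (sx i f) = f + sx i (sd i f) := by
  ext y
  have hc : (sx i f : Space3 → ℂ) = fun y => (y i : ℂ) * f y := funext fun y => sx_apply i f y
  rw [sd_apply, hc, add_apply, sx_apply, sd_apply]
  have h1 : HasFDerivAt (fun y : Space3 => ((y i : ℝ) : ℂ))
      (Complex.ofRealCLM.comp (EuclideanSpace.proj i : Space3 →L[ℝ] ℝ)) y :=
    (Complex.ofRealCLM.comp (EuclideanSpace.proj i : Space3 →L[ℝ] ℝ)).hasFDerivAt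
  have h2 := (h1.fun_mul (f.hasFDerivAt y)).fderiv
  rw [h2]
  simp [bas]
  ring

/-- The Fourier transform turns `3 + x·∇` into `-ξ·∇`. -/
lemma fourier_sD (f : 𝓢(Space3, ℂ)) (ξ : Space3) :
    ∑ i, (ξ i : ℂ) * fderiv ℝ (𝓕 f : 𝓢(Space3, ℂ)) ξ (bas i) = -(3 * 𝓕 f ξ + 𝓕 (sD f) ξ) := by
  have h2pi : (2 * Real.pi * Complex.I : ℂ) ≠ 0 := Complex.two_pi_I_ne_zero
  have key : ∀ i, 𝓕 (sx i (sd i f)) = -(𝓕 f + sx i (sd i (𝓕 f))) := by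
    intro i
    have h1 := sd_fourier i (sd i f)
    rw [fourier_sd] at h1
    have h3 : sd i ((2 * Real.pi * Complex.I) • sx i (𝓕 f))
        = (2 * Real.pi * Complex.I) • sd i (sx i (𝓕 f)) := LineDeriv.lineDerivOp_smul _ _ _
    rw [h3, sd_sx_self, neg_smul, ← smul_neg] at h1
    have := smul_right_injective _ h2pi h1
    rw [← neg_eq_iff_eq_neg] at this
    exact this.symm ▸ rfl
  have h4 : 𝓕 (sD f) = ∑ i, 𝓕 (sx i (sd i f)) := by
    rw [sD]
    exact map_sum (FourierTransform.fourierCLM ℂ 𝓢(Space3, ℂ)) _ _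
  rw [h4, sum_schwartz_apply]
  simp only [key, neg_apply, add_apply, sx_apply, sd_apply,
    Fin.sum_univ_three]
  ring

/-- The coefficients `1, ν_1, ν_2, ν_3` which assemble a spacetime vector into a half-wave in the
direction `ν`. -/
def dirCoef (μ : Fin 4) (v : Space3) : ℂ := Fin.cases (motive := fun _ => ℂ) 1 (fun i => (v i : ℂ)) μ

@[simp] lemma dirCoef_zero (v : Space3) : dirCoef 0 v = 1 := rfl
@[simp] lemma dirCoef_succ (i : Fin 3) (v : Space3) : dirCoef i.succ v = (v i : ℂ) := rfl

lemma norm_dirCoef_le (μ : Fin 4) {v : Space3} (hv : ‖v‖ ≤ 1) : ‖dirCoef μ v‖ ≤ 1 := by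
  refine Fin.cases ?_ (fun i => ?_) μ
  · simp
  · rw [dirCoef_succ, Complex.norm_real]
    exact (PiLp.norm_apply_le v i).trans hv

lemma measurable_dirCoef (μ : Fin 4) : Measurable (dirCoef μ) := by
  refine Fin.cases ?_ (fun i => ?_) μ
  · exact measurable_const
  · exact Complex.measurable_ofReal.comp (by fun_prop : Measurable fun v : Space3 => v i)

/-- The symbol `ĝ_0(ξ) + ∑ (ξ_i/|ξ|) ĝ_i(ξ)` of the half-wave attached to a spacetime vector `g`
of Schwartz functions. -/
def sym (g : Fin 4 → 𝓢(Space3, ℂ)) (ξ : Space3) : ℂ :=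
  ∑ μ, dirCoef μ (‖ξ‖⁻¹ • ξ) * 𝓕 (g μ) ξ

/-- The restriction of the symbol to the line `ℝ ν`. -/
def ray (g : Fin 4 → 𝓢(Space3, ℂ)) (ν : S2) (ρ : ℝ) : ℂ :=
  ∑ μ, dirCoef μ ν * 𝓕 (g μ) (ρ • (ν : Space3))

lemma sym_smul (g : Fin 4 → 𝓢(Space3, ℂ)) (ν : S2) {ρ : ℝ} (hρ : 0 < ρ) :
    sym g (ρ • (ν : Space3)) = ray g ν ρ := by
  have : ‖ρ • (ν : Space3)‖⁻¹ • ρ • (ν : Space3) = ν := by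
    rw [norm_smul, norm_S2, mul_one, Real.norm_of_nonneg hρ.le, smul_smul,
      inv_mul_cancel₀ hρ.ne', one_smul]
  simp only [sym, ray, this]

lemma measurable_sym (g : Fin 4 → 𝓢(Space3, ℂ)) : Measurable (sym g) := by
  refine Finset.measurable_sum _ fun μ _ => ?_
  exact ((measurable_dirCoef μ).comp (by fun_prop)).mul (𝓕 (g μ)).continuous.measurable

lemma norm_normalize_le (ξ : Space3) : ‖‖ξ‖⁻¹ • ξ‖ ≤ 1 := by
  rw [norm_smul, norm_inv, norm_norm]
  exact inv_mul_le_one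

lemma enorm_sym_le (g : Fin 4 → 𝓢(Space3, ℂ)) (ξ : Space3) :
    ‖sym g ξ‖ₑ ≤ ∑ μ, ‖𝓕 (g μ) ξ‖ₑ := by
  refine (enorm_sum_le _ _).trans (Finset.sum_le_sum fun μ _ => ?_)
  rw [enorm_mul]
  calc _ ≤ 1 * ‖𝓕 (g μ) ξ‖ₑ := by
        gcongr
        rw [← ofReal_norm, ENNReal.ofReal_le_one]
        exact norm_dirCoef_le μ (norm_normalize_le ξ)
    _ = _ := one_mul _

lemma integrable_sym (g : Fin 4 → 𝓢(Space3, ℂ)) : Integrable (sym g) := by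
  refine integrable_finsetSum _ fun μ _ => ?_
  refine (𝓕 (g μ)).integrable.bdd_mul (c := 1)
    ((measurable_dirCoef μ).comp (by fun_prop)).aestronglyMeasurable ?_
  exact Filter.Eventually.of_forall fun ξ => norm_dirCoef_le μ (norm_normalize_le ξ)

lemma antilipschitz_line (ν : S2) : AntilipschitzWith 1 (fun ρ : ℝ => ρ • (ν : Space3)) := by
  refine AntilipschitzWith.of_le_mul_dist fun a b => ?_
  rw [dist_eq_norm, dist_eq_norm, ← sub_smul, norm_smul, norm_S2]
  simp

/-- The restriction of the symbol to a line is a Schwartz function. -/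
def rayS (g : Fin 4 → 𝓢(Space3, ℂ)) (ν : S2) : 𝓢(ℝ, ℂ) :=
  ∑ μ, dirCoef μ ν • SchwartzMap.compCLMOfAntilipschitz ℂ
    (g := fun ρ : ℝ => ρ • (ν : Space3)) (by fun_prop) (antilipschitz_line ν) (𝓕 (g μ))

lemma rayS_apply (g : Fin 4 → 𝓢(Space3, ℂ)) (ν : S2) (ρ : ℝ) : rayS g ν ρ = ray g ν ρ := by
  simp [rayS, ray, Fin.sum_univ_four]

lemma continuous_ray (g : Fin 4 → 𝓢(Space3, ℂ)) (ν : S2) : Continuous (ray g ν) := by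
  rw [← funext (rayS_apply g ν)]; exact (rayS g ν).continuous

lemma integrable_pow_mul_ray (g : Fin 4 → 𝓢(Space3, ℂ)) (ν : S2) (n : ℕ) :
    Integrable (fun ρ : ℝ => ((ρ ^ n : ℝ) : ℂ) * ray g ν ρ) := by
  have h := (rayS g ν).integrable_pow_mul volume n
  simp only [rayS_apply] at h
  refine h.mono' ?_ ?_
  · have := continuous_ray g ν
    exact (by fun_prop : Continuous fun ρ : ℝ => ((ρ ^ n : ℝ) : ℂ) * ray g ν ρ).aestronglyMeasurable
  · exact Filter.Eventually.of_forall fun ρ => by simp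

lemma tendsto_pow_mul_ray (g : Fin 4 → 𝓢(Space3, ℂ)) (ν : S2) (n : ℕ) :
    Filter.Tendsto (fun ρ : ℝ => ((ρ ^ n : ℝ) : ℂ) * ray g ν ρ) Filter.atTop (nhds 0) := by
  have ht : (fun ρ : ℝ => ρ ^ n).HasTemperateGrowth := by fun_prop
  have h := (SchwartzMap.smulLeftCLM ℂ (fun ρ : ℝ => ρ ^ n) (rayS g ν)).tendsto_cocompact
  have h2 := h.mono_left (atTop_le_cocompact)
  refine h2.congr fun ρ => ?_
  rw [SchwartzMap.smulLeftCLM_apply_apply ht, rayS_apply]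
  simp

lemma hasDerivAt_fourier_line (f : 𝓢(Space3, ℂ)) (v : Space3) (ρ : ℝ) :
    HasDerivAt (fun ρ : ℝ => 𝓕 f (ρ • v)) (fderiv ℝ (𝓕 f : 𝓢(Space3, ℂ)) (ρ • v) v) ρ := by
  have h1 : HasDerivAt (fun ρ : ℝ => ρ • v) v ρ := by
    simpa using (hasDerivAt_id ρ).smul_const v
  exact ((𝓕 f : 𝓢(Space3, ℂ)).hasFDerivAt (ρ • v)).comp_hasDerivAt ρ h1

/-- The derivative of the symbol along a ray. -/
def rayDeriv (g : Fin 4 → 𝓢(Space3, ℂ)) (ν : S2) (ρ : ℝ) : ℂ :=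
  ∑ μ, dirCoef μ ν * fderiv ℝ (𝓕 (g μ) : 𝓢(Space3, ℂ)) (ρ • (ν : Space3)) ν

lemma hasDerivAt_ray (g : Fin 4 → 𝓢(Space3, ℂ)) (ν : S2) (ρ : ℝ) :
    HasDerivAt (ray g ν) (rayDeriv g ν ρ) ρ := by
  unfold ray rayDeriv
  exact HasDerivAt.fun_sum fun μ _ => (hasDerivAt_fourier_line (g μ) ν ρ).const_mul _

lemma mul_rayDeriv (g : Fin 4 → 𝓢(Space3, ℂ)) (ν : S2) (ρ : ℝ) :
    (ρ : ℂ) * rayDeriv g ν ρ = -2 * ray g ν ρ - ray (fun μ => g μ + sD (g μ)) ν ρ := by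
  have hb : ∀ (f : 𝓢(Space3, ℂ)), (ρ : ℂ) * fderiv ℝ (𝓕 f : 𝓢(Space3, ℂ)) (ρ • (ν : Space3)) ν
      = -(3 * 𝓕 f (ρ • (ν : Space3)) + 𝓕 (sD f) (ρ • (ν : Space3))) := by
    intro f
    rw [← fourier_sD]
    have hv : (ν : Space3) = ∑ i, (ν : Space3) i • bas i := by
      ext j; simp [bas, Pi.single_apply]
    conv_lhs => rw [show fderiv ℝ (𝓕 f : 𝓢(Space3, ℂ)) (ρ • (ν : Space3)) (ν : Space3)
      = fderiv ℝ (𝓕 f : 𝓢(Space3, ℂ)) (ρ • (ν : Space3)) (∑ i, (ν : Space3) i • bas i) by rw [← hv]]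
    rw [map_sum, Finset.mul_sum]
    refine Finset.sum_congr rfl fun i _ => ?_
    rw [map_smul, PiLp.smul_apply]
    simp only [smul_eq_mul, Complex.real_smul, Complex.ofReal_mul]
    ring
  have hadd : ∀ f : 𝓢(Space3, ℂ), ∀ ξ, 𝓕 (f + sD f) ξ = 𝓕 f ξ + 𝓕 (sD f) ξ := by
    intro f ξ
    rw [FourierTransform.fourier_add, add_apply]
  simp only [rayDeriv, ray, hadd, Finset.mul_sum]
  rw [← Finset.sum_sub_distrib]
  refine Finset.sum_congr rfl fun μ _ => ?_
  linear_combination dirCoef μ ν * hb (g μ)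

/-- The relation `g₁ + e = (1 + x·∇) g + s t |∇| g`, read on the Fourier side for the half-wave
symbols: it is what the scaling field gives for a half-wave with inhomogeneity `e`. -/
def HalfWave (s t : ℝ) (g g₁ e : Fin 4 → 𝓢(Space3, ℂ)) : Prop :=
  ∀ ξ : Space3, ξ ≠ 0 → sym g₁ ξ + sym e ξ =
    sym (fun μ => g μ + sD (g μ)) ξ + 2 * Real.pi * Complex.I * (s * t * ‖ξ‖ : ℝ) * sym g ξ

lemma HalfWave.mul_rayDeriv {s t : ℝ} {g g₁ e : Fin 4 → 𝓢(Space3, ℂ)} (h : HalfWave s t g g₁ e)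
    (ν : S2) {ρ : ℝ} (hρ : 0 < ρ) :
    (ρ : ℂ) * rayDeriv g ν ρ = -2 * ray g ν ρ +
      2 * Real.pi * Complex.I * (s * t * ρ : ℝ) * ray g ν ρ - ray g₁ ν ρ - ray e ν ρ := by
  have hne : ρ • (ν : Space3) ≠ 0 := by
    rw [Ne, smul_eq_zero, not_or]
    exact ⟨hρ.ne', fun h0 => by simpa [h0] using norm_S2 ν⟩
  have h1 := h _ hne
  have hn : ‖ρ • (ν : Space3)‖ = ρ := by
    rw [norm_smul, norm_S2, mul_one, Real.norm_of_nonneg hρ.le]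
  simp only [sym_smul _ ν hρ, hn] at h1
  rw [WaveDecay.mul_rayDeriv]
  linear_combination h1

/-- The plane wave `e^{2πi b ρ}`. -/
def wav (b ρ : ℝ) : ℂ := Complex.exp (2 * Real.pi * Complex.I * (b * ρ : ℝ))

lemma norm_wav (b ρ : ℝ) : ‖wav b ρ‖ = 1 := by
  rw [wav, show (2 * Real.pi * Complex.I * (b * ρ : ℝ) : ℂ) = ((2 * Real.pi * (b * ρ) : ℝ) : ℂ) *
    Complex.I by push_cast; ring, Complex.norm_exp_ofReal_mul_I]

lemma hasDerivAt_wav (b ρ : ℝ) : HasDerivAt (wav b) (2 * Real.pi * Complex.I * b * wav b ρ) ρ := by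
  have h1 : HasDerivAt (fun ρ : ℝ => 2 * Real.pi * Complex.I * ((b * ρ : ℝ) : ℂ))
      (2 * Real.pi * Complex.I * b) ρ := by
    have : HasDerivAt (fun ρ : ℝ => b * ρ) b ρ := by
      simpa using (hasDerivAt_id ρ).const_mul b
    exact this.ofReal_comp.const_mul _
  exact h1.cexp.congr_deriv (by rw [wav]; ring)

lemma continuous_wav (b : ℝ) : Continuous (wav b) := by unfold wav; fun_prop

lemma integrable_wav_mul_ray (f : Fin 4 → 𝓢(Space3, ℂ)) (ν : S2) (b : ℝ) {c : ℝ → ℝ} {M : ℝ}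
    (hc : Continuous c) (hcM : ∀ ρ, |c ρ| ≤ M) (n : ℕ) :
    Integrable (fun ρ : ℝ => wav b ρ * ((c ρ * ρ ^ n : ℝ) * ray f ν ρ)) := by
  have := (integrable_pow_mul_ray f ν n).bdd_mul (c := M) (f := fun ρ => wav b ρ * (c ρ : ℂ))
    (((continuous_wav b).mul (Complex.continuous_ofReal.comp hc)).aestronglyMeasurable)
    (Filter.Eventually.of_forall fun ρ => by
      rw [norm_mul, norm_wav, one_mul, Complex.norm_real]; exact hcM ρ)
  refine this.congr (Filter.Eventually.of_forall fun ρ => ?_)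
  push_cast; ring

/-- Integration by parts along a ray: the phase `τ = b + s t` of a half-wave is traded for the
scaling derivative. -/
lemma HalfWave.integral_by_parts {s t : ℝ} {g g₁ e : Fin 4 → 𝓢(Space3, ℂ)}
    (h : HalfWave s t g g₁ e) (ν : S2) (b : ℝ) {κ κ' : ℝ → ℝ} {M : ℝ}
    (hκ : ∀ ρ, HasDerivAt κ (κ' ρ) ρ) (hκ' : Continuous κ')
    (hb : ∀ ρ, |κ ρ| ≤ M) (hb' : ∀ ρ, |κ' ρ| ≤ M) :
    2 * Real.pi * Complex.I * ((b + s * t : ℝ) : ℂ) *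
      ∫ ρ in Ioi (0 : ℝ), wav b ρ * ((κ ρ * ρ ^ 2 : ℝ) * ray g ν ρ)
      = ∫ ρ in Ioi (0 : ℝ), wav b ρ * ((κ ρ * ρ : ℝ) * (ray g₁ ν ρ + ray e ν ρ)
          - (κ' ρ * ρ ^ 2 : ℝ) * ray g ν ρ) := by
  have hκc : Continuous κ := continuous_iff_continuousAt.2 fun ρ => (hκ ρ).continuousAt
  have hint := fun (c : ℝ → ℝ) (hc : Continuous c) (hcM : ∀ ρ, |c ρ| ≤ M) (n : ℕ)
    (f : Fin 4 → 𝓢(Space3, ℂ)) => integrable_wav_mul_ray f ν b hc hcM n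
  set F' : ℝ → ℂ := fun ρ => 2 * Real.pi * Complex.I * ((b + s * t : ℝ) : ℂ) *
      (wav b ρ * ((κ ρ * ρ ^ 2 : ℝ) * ray g ν ρ)) -
      wav b ρ * ((κ ρ * ρ : ℝ) * (ray g₁ ν ρ + ray e ν ρ)
          - (κ' ρ * ρ ^ 2 : ℝ) * ray g ν ρ) with hF'
  have i1 := (hint κ hκc hb 2 g).const_mul (2 * Real.pi * Complex.I * ((b + s * t : ℝ) : ℂ))
  have i2 : Integrable (fun ρ => wav b ρ * ((κ ρ * ρ : ℝ) * (ray g₁ ν ρ + ray e ν ρ)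
          - (κ' ρ * ρ ^ 2 : ℝ) * ray g ν ρ)) := by
    refine (((hint κ hκc hb 1 g₁).add (hint κ hκc hb 1 e)).sub (hint κ' hκ' hb' 2 g)).congr
      (Filter.Eventually.of_forall fun ρ => ?_)
    simp only [Pi.add_apply, Pi.sub_apply]
    push_cast; ring
  have hder : ∀ ρ ∈ Ioi (0 : ℝ),
      HasDerivAt (fun ρ => wav b ρ * ((κ ρ * ρ ^ 2 : ℝ) * ray g ν ρ)) (F' ρ) ρ := by
    intro ρ hρ
    have d1 : HasDerivAt (fun ρ => κ ρ * ρ ^ 2) (κ' ρ * ρ ^ 2 + κ ρ * (2 * ρ)) ρ := by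
      simpa using (hκ ρ).fun_mul ((hasDerivAt_id ρ).fun_pow 2)
    have d2 := (hasDerivAt_wav b ρ).fun_mul (d1.ofReal_comp.fun_mul (hasDerivAt_ray g ν ρ))
    refine d2.congr_deriv ?_
    have h3 := h.mul_rayDeriv ν (show 0 < ρ from hρ)
    simp only [hF']
    push_cast at h3 ⊢
    linear_combination (wav b ρ * κ ρ * ρ) * h3
  have hlim : Filter.Tendsto (fun ρ => wav b ρ * ((κ ρ * ρ ^ 2 : ℝ) * ray g ν ρ))
      Filter.atTop (nhds 0) := by
    have h1 := (tendsto_pow_mul_ray g ν 2).norm.const_mul M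
    rw [norm_zero, mul_zero] at h1
    refine squeeze_zero_norm (fun ρ => ?_) h1
    rw [norm_mul, norm_wav, one_mul, Complex.ofReal_mul, mul_assoc, norm_mul, Complex.norm_real]
    gcongr
    exact hb ρ
  have hcont : ContinuousWithinAt (fun ρ => wav b ρ * ((κ ρ * ρ ^ 2 : ℝ) * ray g ν ρ)) (Ici 0) 0 := by
    have := continuous_wav b
    have := continuous_ray g ν
    exact (by fun_prop : Continuous fun ρ => wav b ρ *
      ((κ ρ * ρ ^ 2 : ℝ) * ray g ν ρ)).continuousWithinAt
  have hfin := integral_Ioi_of_hasDerivAt_of_tendsto hcont hder (i1.sub i2).integrableOn hlim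
  simp only [hF'] at hfin
  rw [integral_sub i1.integrableOn i2.integrableOn, integral_const_mul] at hfin
  simp only [ne_eq, OfNat.ofNat_ne_zero, not_false_eq_true, zero_pow, mul_zero, Complex.ofReal_zero,
    zero_mul, sub_zero] at hfin
  exact sub_eq_zero.1 hfin

end

section

/-! ### Decay of the oscillatory integral along a ray -/

/-- The contribution of the ray in direction `ν` to a half-wave, with phase `b = x·ν`. -/
def rayInt (g : Fin 4 → 𝓢(Space3, ℂ)) (ν : S2) (b : ℝ) : ℂ :=
  ∫ ρ in Ioi (0 : ℝ), wav b ρ * ((ρ ^ 2 : ℝ) * ray g ν ρ)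

lemma enorm_wav_mul (b ρ c : ℝ) (z : ℂ) : ‖wav b ρ * ((c : ℂ) * z)‖ₑ = ENNReal.ofReal |c| * ‖z‖ₑ := by
  rw [enorm_mul, enorm_mul, ← ofReal_norm, norm_wav, ENNReal.ofReal_one, one_mul, ← ofReal_norm,
    Complex.norm_real, Real.norm_eq_abs]

lemma enorm_rayInt_le (g : Fin 4 → 𝓢(Space3, ℂ)) (ν : S2) (b : ℝ) :
    ‖rayInt g ν b‖ₑ ≤ ∫⁻ ρ in Ioi (0 : ℝ), ENNReal.ofReal (ρ ^ 2) * ‖ray g ν ρ‖ₑ := by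
  refine (enorm_integral_le_lintegral_enorm _).trans (le_of_eq ?_)
  refine lintegral_congr fun ρ => ?_
  rw [enorm_wav_mul, abs_of_nonneg (sq_nonneg ρ)]

lemma le_ofReal_inv_mul {a : ℝ} (ha : 0 < a) {A B : ℝ≥0∞} (h : ENNReal.ofReal a * A ≤ B) :
    A ≤ ENNReal.ofReal a⁻¹ * B := by
  calc A = ENNReal.ofReal a⁻¹ * (ENNReal.ofReal a * A) := by
        rw [← mul_assoc, ← ENNReal.ofReal_mul (by positivity), inv_mul_cancel₀ ha.ne',
          ENNReal.ofReal_one, one_mul]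
    _ ≤ _ := by gcongr

lemma enorm_phase_mul (τ : ℝ) (z : ℂ) :
    ENNReal.ofReal |τ| * ‖z‖ₑ ≤ ‖2 * Real.pi * Complex.I * (τ : ℂ) * z‖ₑ := by
  rw [enorm_mul]
  gcongr
  rw [← ofReal_norm]
  refine ENNReal.ofReal_le_ofReal ?_
  simp only [norm_mul, Complex.norm_ofNat, Complex.norm_real, Complex.norm_I, mul_one,
    Real.norm_eq_abs, abs_of_pos Real.pi_pos]
  nlinarith [abs_nonneg τ, Real.pi_gt_three]

/-- Away from the cone `τ = b + s t = 0`, two integrations by parts along the ray; the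
inhomogeneity `e` of the half-wave itself is kept out of the second one. -/
lemma HalfWave.enorm_rayInt_le {s t : ℝ} {g g₁ g₂ e e₁ : Fin 4 → 𝓢(Space3, ℂ)}
    (h : HalfWave s t g g₁ e) (h₁ : HalfWave s t g₁ g₂ e₁) (ν : S2) {b σ : ℝ} (hσ : 0 < σ)
    (hτ : |b + s * t| = σ⁻¹) :
    ‖rayInt g ν b‖ₑ ≤ ENNReal.ofReal σ * (∫⁻ ρ in Ioi (0 : ℝ), ENNReal.ofReal ρ * ‖ray e ν ρ‖ₑ) +
      ENNReal.ofReal (σ ^ 2) * ∫⁻ ρ in Ioi (0 : ℝ), ENNReal.ofReal ((ρ ^ 2 + σ * ρ) / (ρ ^ 2 + σ ^ 2)) *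
        (‖ray g₁ ν ρ‖ₑ + ‖ray g₂ ν ρ‖ₑ + ‖ray e₁ ν ρ‖ₑ) := by
  have hm : ∀ f, Continuous (ray f ν) := fun f => continuous_ray f ν
  set J : ℂ := ∫ ρ in Ioi (0 : ℝ), wav b ρ * ((1 * ρ ^ 1 : ℝ) * ray g₁ ν ρ) with hJ
  have hcon : ∀ f n, Integrable (fun ρ : ℝ => wav b ρ * ((1 * ρ ^ n : ℝ) * ray f ν ρ)) :=
    fun f n => integrable_wav_mul_ray f ν b (c := fun _ => 1) (M := 1) continuous_const (by simp) n
  -- first integration by parts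
  have s1 : ‖rayInt g ν b‖ₑ ≤ ENNReal.ofReal σ *
      (‖J‖ₑ + ∫⁻ ρ in Ioi (0 : ℝ), ENNReal.ofReal ρ * ‖ray e ν ρ‖ₑ) := by
    have ibp := h.integral_by_parts ν b (κ := fun _ => 1) (κ' := fun _ => 0) (M := 1)
      (fun ρ => hasDerivAt_const ρ 1) continuous_const (by simp) (by simp)
    have e1 : ∫ ρ in Ioi (0 : ℝ), wav b ρ * ((1 * ρ ^ 2 : ℝ) * ray g ν ρ) = rayInt g ν b := by
      simp only [one_mul, rayInt]
    have e2 : ∫ ρ in Ioi (0 : ℝ), wav b ρ * ((1 * ρ : ℝ) * (ray g₁ ν ρ + ray e ν ρ)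
          - (0 * ρ ^ 2 : ℝ) * ray g ν ρ)
        = J + ∫ ρ in Ioi (0 : ℝ), wav b ρ * ((1 * ρ ^ 1 : ℝ) * ray e ν ρ) := by
      rw [hJ, ← integral_add (hcon g₁ 1).integrableOn (hcon e 1).integrableOn]
      congr 1; ext ρ; push_cast; ring
    rw [e1, e2] at ibp
    have := le_ofReal_inv_mul (by positivity : (0:ℝ) < σ⁻¹)
      (hτ ▸ (enorm_phase_mul (b + s * t) (rayInt g ν b)).trans (by rw [ibp]))
    rw [inv_inv] at this
    refine this.trans ?_
    gcongr
    refine (enorm_add_le _ _).trans ?_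
    gcongr
    refine (enorm_integral_le_lintegral_enorm _).trans (le_of_eq ?_)
    refine setLIntegral_congr_fun measurableSet_Ioi fun ρ hρ => ?_
    rw [enorm_wav_mul, one_mul, pow_one, abs_of_pos hρ]
  -- second integration by parts, with a weight that vanishes at the origin
  have s2 : ‖J‖ₑ ≤ ENNReal.ofReal σ *
      ∫⁻ ρ in Ioi (0 : ℝ), ENNReal.ofReal ((ρ ^ 2 + σ * ρ) / (ρ ^ 2 + σ ^ 2)) *
        (‖ray g₁ ν ρ‖ₑ + ‖ray g₂ ν ρ‖ₑ + ‖ray e₁ ν ρ‖ₑ) := by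
    have hden : ∀ ρ : ℝ, 0 < ρ ^ 2 + σ ^ 2 := fun ρ => by positivity
    set κ : ℝ → ℝ := fun ρ => ρ / (ρ ^ 2 + σ ^ 2) with hκ
    set κ' : ℝ → ℝ := fun ρ => (σ ^ 2 - ρ ^ 2) / (ρ ^ 2 + σ ^ 2) ^ 2 with hκ'
    set η : ℝ → ℝ := fun ρ => σ ^ 2 / (ρ ^ 2 + σ ^ 2) with hη
    have hder : ∀ ρ, HasDerivAt κ (κ' ρ) ρ := by
      intro ρ
      have h1 : HasDerivAt (fun ρ : ℝ => ρ ^ 2 + σ ^ 2) (2 * ρ) ρ := by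
        simpa using (hasDerivAt_pow 2 ρ).add_const (σ ^ 2)
      refine ((hasDerivAt_id ρ).fun_div h1 (hden ρ).ne').congr_deriv ?_
      simp only [hκ', id]
      congr 1; ring
    have hκ'c : Continuous κ' := by
      refine Continuous.div (by fun_prop) (by fun_prop) fun ρ => ?_
      exact (pow_pos (hden ρ) 2).ne'
    have hκc : Continuous κ := continuous_iff_continuousAt.2 fun ρ => (hder ρ).continuousAt
    have hηc : Continuous η := Continuous.div (by fun_prop) (by fun_prop) fun ρ => (hden ρ).ne'
    have hκb' : ∀ ρ, |κ' ρ| ≤ (ρ ^ 2 + σ ^ 2)⁻¹ := by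
      intro ρ
      rw [hκ', abs_div, abs_of_pos (pow_pos (hden ρ) 2), div_le_iff₀ (pow_pos (hden ρ) 2)]
      have : (ρ ^ 2 + σ ^ 2)⁻¹ * (ρ ^ 2 + σ ^ 2) ^ 2 = ρ ^ 2 + σ ^ 2 := by
        have := (hden ρ).ne'
        field_simp
      rw [this, abs_le]
      constructor <;> nlinarith [sq_nonneg ρ, sq_nonneg σ]
    have hinv : ∀ ρ : ℝ, (ρ ^ 2 + σ ^ 2)⁻¹ ≤ (σ ^ 2)⁻¹ := by
      intro ρ; gcongr; nlinarith [sq_nonneg ρ]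
    set M : ℝ := σ⁻¹ + (σ ^ 2)⁻¹ with hM
    have hb : ∀ ρ, |κ ρ| ≤ M := by
      intro ρ
      rw [hκ, abs_div, abs_of_pos (hden ρ), div_le_iff₀ (hden ρ)]
      have : σ⁻¹ * (ρ ^ 2 + σ ^ 2) ≤ M * (ρ ^ 2 + σ ^ 2) := by
        have := hden ρ
        gcongr
        rw [hM]; linarith [inv_pos.2 (pow_pos hσ 2)]
      refine le_trans ?_ this
      rw [← div_eq_inv_mul, le_div_iff₀ hσ, ← sq_abs ρ]
      nlinarith [sq_nonneg (|ρ| - σ), abs_nonneg ρ, sq_nonneg (|ρ| + σ)]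
    have hb' : ∀ ρ, |κ' ρ| ≤ M := fun ρ => (hκb' ρ).trans ((hinv ρ).trans (by
      rw [hM]; linarith [inv_pos.2 hσ]))
    have hηb : ∀ ρ, |η ρ| ≤ 1 := by
      intro ρ
      rw [hη, abs_div, abs_of_pos (hden ρ), abs_of_nonneg (sq_nonneg σ), div_le_one (hden ρ)]
      nlinarith [sq_nonneg ρ]
    have hsplit : J = (∫ ρ in Ioi (0 : ℝ), wav b ρ * ((κ ρ * ρ ^ 2 : ℝ) * ray g₁ ν ρ)) +
        ∫ ρ in Ioi (0 : ℝ), wav b ρ * ((η ρ * ρ ^ 1 : ℝ) * ray g₁ ν ρ) := by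
      rw [hJ, ← integral_add (integrable_wav_mul_ray g₁ ν b hκc hb 2).integrableOn
        (integrable_wav_mul_ray g₁ ν b hηc hηb 1).integrableOn]
      congr 1; ext ρ
      have : 1 * ρ ^ 1 = κ ρ * ρ ^ 2 + η ρ * ρ ^ 1 := by
        simp only [hκ, hη]
        have := (hden ρ).ne'
        field_simp
      rw [this]; push_cast; ring
    have ibp := h₁.integral_by_parts ν b hder hκ'c hb hb'
    have t1 : ‖∫ ρ in Ioi (0 : ℝ), wav b ρ * ((κ ρ * ρ ^ 2 : ℝ) * ray g₁ ν ρ)‖ₑ ≤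
        ENNReal.ofReal σ * ∫⁻ ρ in Ioi (0 : ℝ), ENNReal.ofReal (ρ ^ 2 / (ρ ^ 2 + σ ^ 2)) *
          (‖ray g₁ ν ρ‖ₑ + ‖ray g₂ ν ρ‖ₑ + ‖ray e₁ ν ρ‖ₑ) := by
      have := le_ofReal_inv_mul (by positivity : (0:ℝ) < σ⁻¹)
        (hτ ▸ (enorm_phase_mul (b + s * t) _).trans (by rw [ibp]))
      rw [inv_inv] at this
      refine this.trans ?_
      gcongr
      refine (enorm_integral_le_lintegral_enorm _).trans ?_
      refine setLIntegral_mono' measurableSet_Ioi fun ρ hρ => ?_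
      have hρ' : 0 < ρ := hρ
      have e1 : wav b ρ * ((κ ρ * ρ : ℝ) * (ray g₂ ν ρ + ray e₁ ν ρ) - (κ' ρ * ρ ^ 2 : ℝ) * ray g₁ ν ρ)
          = wav b ρ * ((κ ρ * ρ : ℝ) * ray g₂ ν ρ) + wav b ρ * ((κ ρ * ρ : ℝ) * ray e₁ ν ρ)
            + wav b ρ * ((-(κ' ρ * ρ ^ 2) : ℝ) * ray g₁ ν ρ) := by push_cast; ring
      rw [e1]
      refine (enorm_add_le _ _).trans ((add_le_add_left (enorm_add_le _ _) _).trans ?_)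
      rw [enorm_wav_mul, enorm_wav_mul, enorm_wav_mul]
      have c1 : |κ ρ * ρ| = ρ ^ 2 / (ρ ^ 2 + σ ^ 2) := by
        rw [abs_of_nonneg (by simp only [hκ]; positivity)]
        simp only [hκ]; ring
      have c2 : |-(κ' ρ * ρ ^ 2)| ≤ ρ ^ 2 / (ρ ^ 2 + σ ^ 2) := by
        rw [abs_neg, abs_mul, abs_of_nonneg (sq_nonneg ρ), mul_comm, div_eq_mul_inv]
        gcongr
        exact hκb' ρ
      rw [c1]
      calc _ ≤ ENNReal.ofReal (ρ ^ 2 / (ρ ^ 2 + σ ^ 2)) * ‖ray g₂ ν ρ‖ₑ +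
            ENNReal.ofReal (ρ ^ 2 / (ρ ^ 2 + σ ^ 2)) * ‖ray e₁ ν ρ‖ₑ +
            ENNReal.ofReal (ρ ^ 2 / (ρ ^ 2 + σ ^ 2)) * ‖ray g₁ ν ρ‖ₑ := by gcongr
        _ = _ := by ring
    have t2 : ‖∫ ρ in Ioi (0 : ℝ), wav b ρ * ((η ρ * ρ ^ 1 : ℝ) * ray g₁ ν ρ)‖ₑ ≤
        ENNReal.ofReal σ * ∫⁻ ρ in Ioi (0 : ℝ), ENNReal.ofReal (σ * ρ / (ρ ^ 2 + σ ^ 2)) *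
          (‖ray g₁ ν ρ‖ₑ + ‖ray g₂ ν ρ‖ₑ + ‖ray e₁ ν ρ‖ₑ) := by
      refine (enorm_integral_le_lintegral_enorm _).trans ?_
      rw [← lintegral_const_mul' _ _ ENNReal.ofReal_ne_top]
      refine setLIntegral_mono' measurableSet_Ioi fun ρ hρ => ?_
      have hρ' : 0 < ρ := hρ
      rw [enorm_wav_mul, ← mul_assoc, ← ENNReal.ofReal_mul hσ.le]
      have : |η ρ * ρ ^ 1| = σ * (σ * ρ / (ρ ^ 2 + σ ^ 2)) := by
        rw [abs_of_nonneg (by simp only [hη]; positivity)]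
        simp only [hη]; ring
      rw [this, add_assoc]
      gcongr
      exact le_self_add
    have hmeas : Measurable fun ρ : ℝ => ENNReal.ofReal (ρ ^ 2 / (ρ ^ 2 + σ ^ 2)) *
        (‖ray g₁ ν ρ‖ₑ + ‖ray g₂ ν ρ‖ₑ + ‖ray e₁ ν ρ‖ₑ) := by
      have := (hm g₁).measurable
      have := (hm g₂).measurable
      have := (hm e₁).measurable
      fun_prop
    rw [hsplit]
    refine (enorm_add_le _ _).trans ((add_le_add t1 t2).trans (le_of_eq ?_))
    rw [← mul_add, ← lintegral_add_left hmeas]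
    congr 1
    refine setLIntegral_congr_fun measurableSet_Ioi fun ρ hρ => ?_
    have hρ' : 0 < ρ := hρ
    rw [← add_mul, ← ENNReal.ofReal_add (by positivity) (by positivity), add_div]
  refine s1.trans ?_
  have hsq : ENNReal.ofReal (σ ^ 2) = ENNReal.ofReal σ * ENNReal.ofReal σ := by
    rw [pow_two, ENNReal.ofReal_mul hσ.le]
  rw [mul_add, add_comm, hsq, mul_assoc]
  gcongr

/-! ### From rays to space -/

/-- The inverse Fourier integral `∫ e^{2πi x·ξ} F(ξ) dξ`. -/
def osc (x : Space3) (F : Space3 → ℂ) : ℂ :=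
  ∫ ξ, Complex.exp (2 * Real.pi * Complex.I * (inner ℝ x ξ : ℝ)) * F ξ

lemma norm_exp_inner (x ξ : Space3) :
    ‖Complex.exp (2 * Real.pi * Complex.I * (inner ℝ x ξ : ℝ))‖ = 1 := by
  simpa [wav] using norm_wav (inner ℝ x ξ) 1

lemma integrable_exp_mul_sym (g : Fin 4 → 𝓢(Space3, ℂ)) (x : Space3) :
    Integrable fun ξ => Complex.exp (2 * Real.pi * Complex.I * (inner ℝ x ξ : ℝ)) * sym g ξ := by
  refine (integrable_sym g).bdd_mul (c := 1) ?_ ?_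
  · exact (by fun_prop : Continuous fun ξ : Space3 =>
      Complex.exp (2 * Real.pi * Complex.I * (inner ℝ x ξ : ℝ))).aestronglyMeasurable
  · exact Filter.Eventually.of_forall fun ξ => (norm_exp_inner x ξ).le

lemma enorm_osc_sym_le (g : Fin 4 → 𝓢(Space3, ℂ)) (x : Space3) :
    ‖osc x (sym g)‖ₑ ≤ ∫⁻ ν : S2, ‖rayInt g ν (inner ℝ x (ν : Space3))‖ₑ ∂sph := by
  rw [osc, integral_polar (integrable_exp_mul_sym g x)]
  refine (enorm_integral_le_lintegral_enorm _).trans (le_of_eq ?_)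
  refine lintegral_congr fun ν => ?_
  congr 1
  refine setIntegral_congr_fun measurableSet_Ioi fun ρ hρ => ?_
  rw [sym_smul g ν hρ, inner_smul_right, wav, mul_comm ρ, Complex.real_smul]
  ring

lemma fourier_inversion_osc (f : 𝓢(Space3, ℂ)) (x : Space3) : f x = osc x (𝓕 f : 𝓢(Space3, ℂ)) := by
  have h : (𝓕⁻ (𝓕 f) : 𝓢(Space3, ℂ)) = f := FourierTransform.fourierInv_fourier_eq f
  conv_lhs => rw [← h]
  rw [SchwartzMap.fourierInv_coe, Real.fourierInv_eq', osc]
  refine integral_congr_ae (Filter.Eventually.of_forall fun ξ => ?_)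
  simp only [smul_eq_mul]
  rw [real_inner_comm]
  congr 2
  push_cast; ring

/-- The two half-waves (`s = ± 1`) whose mean is the component `μ` of the spacetime gradient `P`. -/
def halfVec (P : Fin 4 → 𝓢(Space3, ℂ)) (μ : Fin 4) (s : ℝ) : Fin 4 → 𝓢(Space3, ℂ) :=
  Fin.cases (motive := fun _ => Fin 4 → 𝓢(Space3, ℂ))
    (Fin.cases (motive := fun _ => 𝓢(Space3, ℂ)) (P 0) (fun j => s • P j.succ))
    (fun j => Fin.cases (motive := fun _ => 𝓢(Space3, ℂ)) (P j.succ)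
      (fun i => if i = j then s • P 0 else 0)) μ

lemma sym_halfVec_add (P : Fin 4 → 𝓢(Space3, ℂ)) (μ : Fin 4) (ξ : Space3) :
    sym (halfVec P μ 1) ξ + sym (halfVec P μ (-1)) ξ = 2 * 𝓕 (P μ) ξ := by
  have hneg : ∀ f : 𝓢(Space3, ℂ), 𝓕 (-f) ξ = -𝓕 f ξ := fun f => by
    rw [FourierTransform.fourier_neg, neg_apply]
  refine Fin.cases ?_ (fun j => ?_) μ
  · simp only [sym, halfVec, Fin.sum_univ_succ, Fin.cases_zero, Fin.cases_succ, one_smul, neg_smul,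
      hneg, dirCoef_zero, dirCoef_succ, Finset.univ_eq_empty, Finset.sum_empty]
    ring
  · have h0 : 𝓕 (0 : 𝓢(Space3, ℂ)) ξ = 0 := by
      rw [FourierTransform.fourier_zero]; rfl
    rw [sym, sym, Fin.sum_univ_succ, Fin.sum_univ_succ (n := 3)]
    have hs : ∀ i : Fin 3, halfVec P j.succ (-1) i.succ = - halfVec P j.succ 1 i.succ := by
      intro i
      simp only [halfVec, Fin.cases_succ]
      split_ifs <;> simp
    have hz : ∀ s, halfVec P j.succ s 0 = P j.succ := fun s => rfl
    simp only [hs, hneg, hz, dirCoef_zero, mul_neg, Finset.sum_neg_distrib]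
    ring

lemma enorm_le_of_halfVec (P : Fin 4 → 𝓢(Space3, ℂ)) (μ : Fin 4) (x : Space3) {B : ℝ≥0∞}
    (h : ∀ s : ℝ, s = 1 ∨ s = -1 → ‖osc x (sym (halfVec P μ s))‖ₑ ≤ B) : ‖P μ x‖ₑ ≤ B := by
  have h2 : (2 : ℂ) * P μ x = osc x (sym (halfVec P μ 1)) + osc x (sym (halfVec P μ (-1))) := by
    rw [fourier_inversion_osc (P μ) x, osc, osc, osc, ← integral_add (integrable_exp_mul_sym _ x)
      (integrable_exp_mul_sym _ x), ← integral_const_mul]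
    congr 1; ext ξ
    rw [← mul_add, sym_halfVec_add]; ring
  have h3 : 2 * ‖P μ x‖ₑ ≤ 2 * B := by
    calc 2 * ‖P μ x‖ₑ = ‖(2 : ℂ) * P μ x‖ₑ := by
          rw [enorm_mul, ← ofReal_norm (2 : ℂ)]; simp
      _ ≤ B + B := by
          rw [h2]
          exact (enorm_add_le _ _).trans (add_le_add (h 1 (Or.inl rfl)) (h (-1) (Or.inr rfl)))
      _ = 2 * B := (two_mul B).symm
  exact (ENNReal.mul_le_mul_iff_right two_ne_zero (by simp)).1 h3

end

section

/-! ### The half-wave estimate in frequency space -/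

/-- The distance `|x·ξ/|ξ| + c|` of a frequency direction to the cone of stationary phase. -/
def coneDist (x : Space3) (c : ℝ) (ξ : Space3) : ℝ := |inner ℝ x (‖ξ‖⁻¹ • ξ) + c|

lemma measurable_coneDist (x : Space3) (c : ℝ) : Measurable (coneDist x c) := by
  unfold coneDist; fun_prop

lemma norm_smul_S2 (ν : S2) {ρ : ℝ} (hρ : 0 < ρ) : ‖ρ • (ν : Space3)‖ = ρ := by
  rw [norm_smul, norm_S2, mul_one, Real.norm_of_nonneg hρ.le]

lemma coneDist_smul (x : Space3) (c : ℝ) (ν : S2) {ρ : ℝ} (hρ : 0 < ρ) :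
    coneDist x c (ρ • (ν : Space3)) = |inner ℝ x (ν : Space3) + c| := by
  rw [coneDist, norm_smul_S2 ν hρ, smul_smul, inv_mul_cancel₀ hρ.ne', one_smul]

/-- The weight of the half-wave near the cone. -/
def wNear (τ κ : ℝ) : ℝ := if τ ≤ κ then 1 else 0

/-- The weight of the inhomogeneity away from the cone. -/
def wOne (τ κ ρ : ℝ) : ℝ := if τ ≤ κ then 0 else τ⁻¹ * ρ⁻¹

/-- The weight of the twice scaled half-wave away from the cone. -/
def wTwo (τ κ ρ : ℝ) : ℝ :=
  if τ ≤ κ then 0 else (τ⁻¹) ^ 2 * ((ρ ^ 2 + τ⁻¹ * ρ) / (ρ ^ 2 + (τ⁻¹) ^ 2)) * (ρ ^ 2)⁻¹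

lemma measurable_wNear (x : Space3) (c κ : ℝ) : Measurable fun ξ => wNear (coneDist x c ξ) κ := by
  have h := measurable_coneDist x c
  exact Measurable.ite (measurableSet_le h measurable_const) measurable_const measurable_const

lemma measurable_wOne (x : Space3) (c κ : ℝ) :
    Measurable fun ξ => wOne (coneDist x c ξ) κ ‖ξ‖ := by
  have h := measurable_coneDist x c
  exact Measurable.ite (measurableSet_le h measurable_const) measurable_const (by fun_prop)

lemma measurable_wTwo (x : Space3) (c κ : ℝ) :
    Measurable fun ξ => wTwo (coneDist x c ξ) κ ‖ξ‖ := by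
  have h := measurable_coneDist x c
  exact Measurable.ite (measurableSet_le h measurable_const) measurable_const (by fun_prop)

lemma ofReal_sq_mul_wOne {τ κ ρ : ℝ} (hκ : 0 < κ) (hτ : κ < τ) (hρ : 0 < ρ) (A : ℝ≥0∞) :
    ENNReal.ofReal (ρ ^ 2) * (ENNReal.ofReal (wOne τ κ ρ) * A)
      = ENNReal.ofReal τ⁻¹ * (ENNReal.ofReal ρ * A) := by
  rw [wOne, if_neg hτ.not_ge, ← mul_assoc, ← mul_assoc, ← ENNReal.ofReal_mul (by positivity),
    ← ENNReal.ofReal_mul (inv_nonneg.2 (hκ.trans hτ).le)]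
  congr 2
  field_simp

lemma ofReal_sq_mul_wTwo {τ κ ρ : ℝ} (hτ : κ < τ) (hρ : 0 < ρ) (A : ℝ≥0∞) :
    ENNReal.ofReal (ρ ^ 2) * (ENNReal.ofReal (wTwo τ κ ρ) * A)
      = ENNReal.ofReal ((τ⁻¹) ^ 2) *
        (ENNReal.ofReal ((ρ ^ 2 + τ⁻¹ * ρ) / (ρ ^ 2 + (τ⁻¹) ^ 2)) * A) := by
  rw [wTwo, if_neg hτ.not_ge, ← mul_assoc, ← mul_assoc, ← ENNReal.ofReal_mul (by positivity),
    ← ENNReal.ofReal_mul (by positivity)]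
  congr 2
  field_simp

/-- A half-wave is estimated by itself near the cone, and by its scaling derivatives and
inhomogeneities away from the cone. -/
lemma HalfWave.enorm_osc_le {s t : ℝ} {g g₁ g₂ e e₁ : Fin 4 → 𝓢(Space3, ℂ)}
    (h : HalfWave s t g g₁ e) (h₁ : HalfWave s t g₁ g₂ e₁) (x : Space3) {κ : ℝ} (hκ : 0 < κ) :
    ‖osc x (sym g)‖ₑ ≤
      (∫⁻ ξ, ENNReal.ofReal (wNear (coneDist x (s * t) ξ) κ) * ‖sym g ξ‖ₑ) +
      (∫⁻ ξ, ENNReal.ofReal (wOne (coneDist x (s * t) ξ) κ ‖ξ‖) * ‖sym e ξ‖ₑ) +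
      ∫⁻ ξ, ENNReal.ofReal (wTwo (coneDist x (s * t) ξ) κ ‖ξ‖) *
        (‖sym g₁ ξ‖ₑ + ‖sym g₂ ξ‖ₑ + ‖sym e₁ ξ‖ₑ) := by
  have m0 := measurable_wNear x (s * t) κ
  have m1 := measurable_wOne x (s * t) κ
  have m2 := measurable_wTwo x (s * t) κ
  have hs := measurable_sym g
  have hs1 := measurable_sym g₁
  have hs2 := measurable_sym g₂
  have he := measurable_sym e
  have he1 := measurable_sym e₁
  rw [← lintegral_add_left (by fun_prop), ← lintegral_add_left (by fun_prop),
    lintegral_polar (by fun_prop)]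
  refine (enorm_osc_sym_le g x).trans (lintegral_mono fun ν => ?_)
  by_cases hτ : |inner ℝ x (ν : Space3) + s * t| ≤ κ
  · refine (WaveDecay.enorm_rayInt_le g ν _).trans ?_
    refine setLIntegral_mono' measurableSet_Ioi fun ρ hρ => ?_
    gcongr
    rw [coneDist_smul x _ ν hρ, wNear, if_pos hτ, ENNReal.ofReal_one, one_mul, sym_smul g ν hρ,
      add_assoc]
    exact le_self_add
  · rw [not_le] at hτ
    have hpos : 0 < |inner ℝ x (ν : Space3) + s * t| := hκ.trans hτ
    refine (h.enorm_rayInt_le h₁ ν (inv_pos.2 hpos) (inv_inv _).symm).trans ?_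
    have c1 := (continuous_ray e ν).measurable
    rw [← lintegral_const_mul' _ _ ENNReal.ofReal_ne_top,
      ← lintegral_const_mul' _ _ ENNReal.ofReal_ne_top, ← lintegral_add_left (by fun_prop)]
    refine setLIntegral_mono' measurableSet_Ioi fun ρ hρ => ?_
    rw [mul_add (ENNReal.ofReal (ρ ^ 2)), mul_add (ENNReal.ofReal (ρ ^ 2)), coneDist_smul x _ ν hρ, norm_smul_S2 ν hρ,
      ofReal_sq_mul_wOne hκ hτ hρ, ofReal_sq_mul_wTwo hτ hρ]
    simp only [sym_smul _ ν (show 0 < ρ from hρ)]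
    gcongr
    exact le_add_self

lemma lintegral_mul_le_eLpNorm {w : Space3 → ℝ} {G : Space3 → ℂ} (hw : Measurable w)
    (hG : Measurable G) :
    ∫⁻ ξ, ENNReal.ofReal (w ξ) * ‖G ξ‖ₑ ≤
      (∫⁻ ξ, ENNReal.ofReal (w ξ) ^ 2) ^ (1 / 2 : ℝ) * eLpNorm G 2 volume := by
  have h := ENNReal.lintegral_mul_le_Lp_mul_Lq volume Real.HolderConjugate.two_two
    (f := fun ξ => ENNReal.ofReal (w ξ)) (g := fun ξ => ‖G ξ‖ₑ) (by fun_prop) (by fun_prop)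
  refine h.trans (le_of_eq ?_)
  rw [eLpNorm_eq_lintegral_rpow_enorm_toReal (by simp) (by simp)]
  simp

lemma lintegral_sq_polar_le {w : Space3 → ℝ} (hw : Measurable w) {a : S2 → ℝ≥0∞}
    (h : ∀ ν : S2, ∫⁻ ρ in Ioi (0 : ℝ), ENNReal.ofReal ((ρ * w (ρ • (ν : Space3))) ^ 2) ≤ a ν) :
    ∫⁻ ξ, ENNReal.ofReal (w ξ) ^ 2 ≤ ∫⁻ ν, a ν ∂sph := by
  rw [lintegral_polar (by fun_prop)]
  refine lintegral_mono fun ν => le_trans ?_ (h ν)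
  refine setLIntegral_mono' measurableSet_Ioi fun ρ hρ => ?_
  rw [mul_pow, ENNReal.ofReal_mul (by positivity), ← sq_abs (w _), ENNReal.ofReal_pow (abs_nonneg _)]
  gcongr
  exact le_abs_self _

lemma lintegral_Ioi_inv_sq {K : ℝ} (hK : 0 < K) :
    ∫⁻ u in Ioi (0 : ℝ), ENNReal.ofReal ((1 + K * u) ^ 2)⁻¹ = ENNReal.ofReal K⁻¹ := by
  rw [← Measure.restrict_congr_set (Ioi_ae_eq_Ici (a := (0:ℝ)) (μ := volume)).symm,
    lintegral_Ici_inv_sq hK le_rfl]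
  simp

/-- The weights used with square integrable functions, near the cone. -/
lemma lintegral_sq_wNear_le (x : Space3) (c : ℝ) :
    ∫⁻ ξ, ENNReal.ofReal (wNear (coneDist x c ξ) 1 * ((1 + ‖ξ‖) ^ 2)⁻¹) ^ 2 ≤
      ∫⁻ ν : S2, 8 * ENNReal.ofReal ((1 + |inner ℝ x (ν : Space3) + c|) ^ 3)⁻¹ ∂sph := by
  have m0 := measurable_wNear x c 1
  refine lintegral_sq_polar_le (by fun_prop) fun ν => ?_
  have h8 : (8 : ℝ≥0∞) = ENNReal.ofReal 8 := by simp
  rw [h8, ← ENNReal.ofReal_mul (by norm_num)]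
  set τ := |inner ℝ x (ν : Space3) + c| with hτ
  have hτ0 : 0 ≤ τ := abs_nonneg _
  calc _ ≤ ∫⁻ ρ in Ioi (0 : ℝ), ENNReal.ofReal (8 * ((1 + τ) ^ 3)⁻¹) *
        ENNReal.ofReal ((1 + 1 * ρ) ^ 2)⁻¹ := by
        refine setLIntegral_mono' measurableSet_Ioi fun ρ hρ => ?_
        have hρ' : 0 < ρ := hρ
        rw [← ENNReal.ofReal_mul (by positivity), coneDist_smul x _ ν hρ, norm_smul_S2 ν hρ, ← hτ]
        refine ENNReal.ofReal_le_ofReal ?_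
        rw [wNear]
        split_ifs with hle
        · have h1 : 1 ≤ 8 * ((1 + τ) ^ 3)⁻¹ := by
            rw [← div_eq_mul_inv, le_div_iff₀ (by positivity), one_mul]
            calc (1 + τ) ^ 3 ≤ (1 + 1) ^ 3 := by gcongr
              _ = 8 := by norm_num
          have h2 : (ρ * (1 * ((1 + ρ) ^ 2)⁻¹)) ^ 2 ≤ ((1 + 1 * ρ) ^ 2)⁻¹ := by
            have : ρ * (1 * ((1 + ρ) ^ 2)⁻¹) ≤ (1 + ρ)⁻¹ := by
              rw [one_mul, ← div_eq_mul_inv, div_le_iff₀ (by positivity), sq,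
                inv_mul_cancel_left₀ (by positivity)]
              linarith
            calc _ ≤ ((1 + ρ)⁻¹) ^ 2 := by gcongr
              _ = _ := by rw [inv_pow, one_mul]
          calc _ ≤ 1 * ((1 + 1 * ρ) ^ 2)⁻¹ := by rw [one_mul ((1 + 1 * ρ) ^ 2)⁻¹]; exact h2
            _ ≤ _ := by gcongr
        · simp only [zero_mul, mul_zero, ne_eq, OfNat.ofNat_ne_zero, not_false_eq_true, zero_pow]
          positivity
    _ = _ := by
        rw [lintegral_const_mul' _ _ ENNReal.ofReal_ne_top, lintegral_Ioi_inv_sq one_pos]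
        simp

/-- The weights used with square integrable functions, for the inhomogeneity. -/
lemma lintegral_sq_wOne_le (x : Space3) (c : ℝ) :
    ∫⁻ ξ, ENNReal.ofReal (wOne (coneDist x c ξ) 1 ‖ξ‖ * (1 + ‖ξ‖)⁻¹) ^ 2 ≤
      ∫⁻ ν : S2, 4 * ENNReal.ofReal ((1 + 1 * |inner ℝ x (ν : Space3) + c|) ^ 2)⁻¹ ∂sph := by
  have m0 := measurable_wOne x c 1
  refine lintegral_sq_polar_le (by fun_prop) fun ν => ?_
  have h8 : (4 : ℝ≥0∞) = ENNReal.ofReal 4 := by simp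
  rw [h8, ← ENNReal.ofReal_mul (by norm_num)]
  set τ := |inner ℝ x (ν : Space3) + c| with hτ
  have hτ0 : 0 ≤ τ := abs_nonneg _
  calc _ ≤ ∫⁻ ρ in Ioi (0 : ℝ), ENNReal.ofReal (4 * ((1 + 1 * τ) ^ 2)⁻¹) *
        ENNReal.ofReal ((1 + 1 * ρ) ^ 2)⁻¹ := by
        refine setLIntegral_mono' measurableSet_Ioi fun ρ hρ => ?_
        have hρ' : 0 < ρ := hρ
        rw [← ENNReal.ofReal_mul (by positivity), coneDist_smul x _ ν hρ, norm_smul_S2 ν hρ, ← hτ]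
        refine ENNReal.ofReal_le_ofReal ?_
        rw [wOne]
        split_ifs with hle
        · simp only [zero_mul, mul_zero, ne_eq, OfNat.ofNat_ne_zero, not_false_eq_true, zero_pow]
          positivity
        · rw [not_le] at hle
          have h1 : (ρ * (τ⁻¹ * ρ⁻¹ * (1 + ρ)⁻¹)) ^ 2 = (τ ^ 2)⁻¹ * ((1 + 1 * ρ) ^ 2)⁻¹ := by
            field_simp
          rw [h1]
          gcongr
          rw [← div_eq_mul_inv, le_div_iff₀ (by positivity), inv_mul_le_iff₀ (by positivity)]
          nlinarith
    _ = _ := by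
        rw [lintegral_const_mul' _ _ ENNReal.ofReal_ne_top, lintegral_Ioi_inv_sq one_pos]
        simp

lemma wTwo_aux {ρ σ : ℝ} (hρ : 0 < ρ) (hσ : 0 < σ) :
    (ρ * (((ρ ^ 2 + σ * ρ) / (ρ ^ 2 + σ ^ 2)) * (ρ ^ 2)⁻¹)) ^ 2 ≤ 2 / (ρ ^ 2 + σ ^ 2) := by
  have h1 : ρ * (((ρ ^ 2 + σ * ρ) / (ρ ^ 2 + σ ^ 2)) * (ρ ^ 2)⁻¹) = (ρ + σ) / (ρ ^ 2 + σ ^ 2) := by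
    field_simp
  rw [h1, div_pow, div_le_div_iff₀ (by positivity) (by positivity)]
  have : (ρ + σ) ^ 2 ≤ 2 * (ρ ^ 2 + σ ^ 2) := by nlinarith [sq_nonneg (ρ - σ)]
  nlinarith [sq_nonneg ρ, sq_nonneg σ, mul_pos hρ hσ, sq_nonneg (ρ ^ 2 + σ ^ 2)]

/-- The weights used with square integrable functions, for the scaled half-waves. -/
lemma lintegral_sq_wTwo_le (x : Space3) (c : ℝ) :
    ∫⁻ ξ, ENNReal.ofReal (wTwo (coneDist x c ξ) 1 ‖ξ‖) ^ 2 ≤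
      ∫⁻ ν : S2, 32 * ENNReal.ofReal ((1 + |inner ℝ x (ν : Space3) + c|) ^ 3)⁻¹ ∂sph := by
  have m0 := measurable_wTwo x c 1
  refine lintegral_sq_polar_le (by fun_prop) fun ν => ?_
  have h8 : (32 : ℝ≥0∞) = ENNReal.ofReal 32 := by simp
  rw [h8, ← ENNReal.ofReal_mul (by norm_num)]
  set τ := |inner ℝ x (ν : Space3) + c| with hτ
  have hτ0 : 0 ≤ τ := abs_nonneg _
  by_cases hle : τ ≤ 1
  · refine le_trans (le_of_eq ?_) zero_le
    rw [setLIntegral_congr_fun (g := fun _ => 0) measurableSet_Ioi fun ρ hρ => ?_, lintegral_zero]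
    rw [coneDist_smul x _ ν hρ, ← hτ, wTwo, if_pos hle]
    simp
  · rw [not_le] at hle
    calc _ ≤ ∫⁻ ρ in Ioi (0 : ℝ), ENNReal.ofReal (4 * (τ ^ 2)⁻¹) *
        ENNReal.ofReal ((1 + τ * ρ) ^ 2)⁻¹ := by
          refine setLIntegral_mono' measurableSet_Ioi fun ρ hρ => ?_
          have hρ' : 0 < ρ := hρ
          rw [← ENNReal.ofReal_mul (by positivity), coneDist_smul x _ ν hρ, norm_smul_S2 ν hρ, ← hτ]
          refine ENNReal.ofReal_le_ofReal ?_
          rw [wTwo, if_neg hle.not_ge]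
          have h1 := wTwo_aux hρ' (inv_pos.2 (zero_lt_one.trans hle))
          have hτp : 0 < τ := zero_lt_one.trans hle
          calc _ = (τ⁻¹) ^ 4 * (ρ * (((ρ ^ 2 + τ⁻¹ * ρ) / (ρ ^ 2 + (τ⁻¹) ^ 2)) * (ρ ^ 2)⁻¹)) ^ 2 := by
                ring
            _ ≤ (τ⁻¹) ^ 4 * (2 / (ρ ^ 2 + (τ⁻¹) ^ 2)) := by gcongr
            _ = 2 * (τ ^ 2)⁻¹ * ((1 + τ ^ 2 * ρ ^ 2))⁻¹ := by field_simp; ring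
            _ ≤ 2 * (τ ^ 2)⁻¹ * (2 * ((1 + τ * ρ) ^ 2)⁻¹) := by
                gcongr
                rw [← div_eq_mul_inv, le_div_iff₀ (by positivity), inv_mul_le_iff₀ (by positivity)]
                nlinarith [sq_nonneg (1 - τ * ρ)]
            _ = _ := by ring
      _ = ENNReal.ofReal (4 * (τ ^ 2)⁻¹ * τ⁻¹) := by
          rw [lintegral_const_mul' _ _ ENNReal.ofReal_ne_top,
            lintegral_Ioi_inv_sq (zero_lt_one.trans hle), ← ENNReal.ofReal_mul (by positivity)]
      _ ≤ _ := by
          refine ENNReal.ofReal_le_ofReal ?_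
          have hτp : 0 < τ := zero_lt_one.trans hle
          have : (1 + τ) ^ 3 ≤ 8 * τ ^ 3 := by
            calc (1 + τ) ^ 3 ≤ (τ + τ) ^ 3 := by gcongr
              _ = _ := by ring
          rw [← div_eq_mul_inv, ← div_eq_mul_inv, ← div_eq_mul_inv, div_div,
            div_le_div_iff₀ (by positivity) (by positivity)]
          linarith [this, show τ ^ 2 * τ = τ ^ 3 by ring]

end

section

/-- The annulus `K / c ≤ |ξ| ≤ c K`. -/
def annulus (c K : ℝ) : Set Space3 := {ξ | ‖ξ‖ ∈ Icc (K / c) (c * K)}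

lemma measurableSet_annulus (c K : ℝ) : MeasurableSet (annulus c K) :=
  measurableSet_Icc.preimage measurable_norm

/-- The integral of a weight over an annulus of frequencies, when the weight decays quadratically
away from the cone. -/
lemma lintegral_annulus_le {x : Space3} {s t K c : ℝ} (hs : s = 1 ∨ s = -1) (hK : 0 < K)
    (ht : 0 < t) (hc : 1 ≤ c) {w : Space3 → ℝ} (hw : Measurable w)
    (h : ∀ (ν : S2) (ρ : ℝ), K / c ≤ ρ → ρ ≤ c * K → ρ ^ 2 * w (ρ • (ν : Space3)) ≤
      8 * c ^ 2 * K ^ 2 * ((1 + K * |inner ℝ x (ν : Space3) + s * t|) ^ 2)⁻¹) :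
    ∫⁻ ξ in annulus c K, ENNReal.ofReal (w ξ) ≤ ENNReal.ofReal (256 * c ^ 4 * K ^ 2 / t) := by
  have hc0 : 0 < c := zero_lt_one.trans_le hc
  rw [← lintegral_indicator (measurableSet_annulus c K),
    lintegral_polar (Measurable.indicator (by fun_prop) (measurableSet_annulus c K))]
  calc _ ≤ ∫⁻ ν : S2, ENNReal.ofReal (8 * c ^ 3 * K ^ 3) *
        ENNReal.ofReal ((1 + K * |inner ℝ x (ν : Space3) + s * t|) ^ 2)⁻¹ ∂sph := by
        refine lintegral_mono fun ν => ?_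
        set B := ((1 + K * |inner ℝ x (ν : Space3) + s * t|) ^ 2)⁻¹ with hB
        have hB0 : 0 ≤ B := by positivity
        calc _ ≤ ∫⁻ ρ in Ioi (0 : ℝ), (Ioc 0 (c * K)).indicator
              (fun _ => ENNReal.ofReal (8 * c ^ 2 * K ^ 2 * B)) ρ := by
              refine setLIntegral_mono' measurableSet_Ioi fun ρ hρ => ?_
              have hρ' : 0 < ρ := hρ
              by_cases hA : ρ • (ν : Space3) ∈ annulus c K
              · rw [indicator_of_mem hA]
                have hA' : ρ ∈ Icc (K / c) (c * K) := by
                  rw [annulus, mem_ofPred_eq, norm_smul_S2 ν hρ'] at hA; exact hA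
                rw [indicator_of_mem (show ρ ∈ Ioc 0 (c * K) from ⟨hρ', hA'.2⟩),
                  ← ENNReal.ofReal_mul (by positivity)]
                exact ENNReal.ofReal_le_ofReal (h ν ρ hA'.1 hA'.2)
              · rw [indicator_of_notMem hA, mul_zero]; exact zero_le
          _ ≤ ∫⁻ ρ, (Ioc 0 (c * K)).indicator
              (fun _ => ENNReal.ofReal (8 * c ^ 2 * K ^ 2 * B)) ρ := setLIntegral_le_lintegral _ _
          _ = _ := by
              rw [lintegral_indicator measurableSet_Ioc, setLIntegral_const, Real.volume_Ioc,
                ← ENNReal.ofReal_mul (by positivity), ← ENNReal.ofReal_mul (by positivity)]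
              congr 1; ring
    _ ≤ ENNReal.ofReal (8 * c ^ 3 * K ^ 3) * ENNReal.ofReal (8 * Real.pi / (K * t)) := by
        rw [lintegral_const_mul' _ _ ENNReal.ofReal_ne_top]
        gcongr
        exact lintegral_sph_cone_two hs hK ht
    _ ≤ _ := by
        rw [← ENNReal.ofReal_mul (by positivity)]
        refine ENNReal.ofReal_le_ofReal ?_
        have h1 : 8 * c ^ 3 * K ^ 3 * (8 * Real.pi / (K * t)) = 64 * Real.pi * c ^ 3 * K ^ 2 / t := by
          field_simp; ring
        rw [h1]
        have h2 : c ^ 3 ≤ c ^ 4 := pow_le_pow_right₀ hc (by norm_num)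
        have h3 : 64 * Real.pi ≤ 256 := by linarith [Real.pi_le_four]
        gcongr

lemma inv_sq_le_of_lt {τ K : ℝ} (hK : 0 < K) (h : K⁻¹ < τ) :
    (τ⁻¹) ^ 2 ≤ 4 * K ^ 2 * ((1 + K * τ) ^ 2)⁻¹ := by
  have hτ : 0 < τ := (inv_pos.2 hK).trans h
  have h1 : 1 < K * τ := by rwa [inv_lt_iff_one_lt_mul₀ hK, mul_comm] at h
  rw [← div_eq_mul_inv, le_div_iff₀ (by positivity), inv_pow, inv_mul_le_iff₀ (by positivity)]
  have : (1 + K * τ) ^ 2 ≤ (2 * (K * τ)) ^ 2 := by gcongr; linarith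
  nlinarith

lemma lintegral_annulus_wNear_le {x : Space3} {s t K c : ℝ} (hs : s = 1 ∨ s = -1) (hK : 0 < K)
    (ht : 0 < t) (hc : 1 ≤ c) : ∫⁻ ξ in annulus c K, ENNReal.ofReal (wNear (coneDist x (s * t) ξ) K⁻¹) ≤
      ENNReal.ofReal (256 * c ^ 4 * K ^ 2 / t) := by
  refine lintegral_annulus_le (x := x) hs hK ht hc (measurable_wNear x (s * t) K⁻¹) fun ν ρ h1 h2 => ?_
  have hc0 : 0 < c := zero_lt_one.trans_le hc
  have hρ : 0 < ρ := (by positivity : 0 < K / c).trans_le h1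
  rw [coneDist_smul x _ ν hρ]
  set τ := |inner ℝ x (ν : Space3) + s * t| with hτ
  have hτ0 : 0 ≤ τ := abs_nonneg _
  rw [wNear]
  split_ifs with hle
  · have h3 : K * τ ≤ 1 := by rwa [← one_div, le_div_iff₀ hK, mul_comm] at hle
    have h4 : 1 ≤ 4 * ((1 + K * τ) ^ 2)⁻¹ := by
      rw [← div_eq_mul_inv, le_div_iff₀ (by positivity), one_mul]
      calc (1 + K * τ) ^ 2 ≤ (1 + 1) ^ 2 := by gcongr
        _ = 4 := by norm_num
    calc ρ ^ 2 * 1 ≤ (c * K) ^ 2 * (4 * ((1 + K * τ) ^ 2)⁻¹) := by gcongr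
      _ ≤ _ := by
        have : 0 ≤ c ^ 2 * K ^ 2 * ((1 + K * τ) ^ 2)⁻¹ := by positivity
        linarith
  · rw [mul_zero]; positivity

lemma lintegral_annulus_wOne_le {x : Space3} {s t K c : ℝ} (hs : s = 1 ∨ s = -1) (hK : 0 < K)
    (ht : 0 < t) (hc : 1 ≤ c) : ∫⁻ ξ in annulus c K, ENNReal.ofReal (wOne (coneDist x (s * t) ξ) K⁻¹ ‖ξ‖ ^ 2) ≤
      ENNReal.ofReal (256 * c ^ 4 * K ^ 2 / t) := by
  refine lintegral_annulus_le (x := x) hs hK ht hc ((measurable_wOne x (s * t) K⁻¹).pow_const 2)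
    fun ν ρ h1 h2 => ?_
  have hc0 : 0 < c := zero_lt_one.trans_le hc
  have hρ : 0 < ρ := (by positivity : 0 < K / c).trans_le h1
  rw [coneDist_smul x _ ν hρ, norm_smul_S2 ν hρ]
  set τ := |inner ℝ x (ν : Space3) + s * t| with hτ
  have hτ0 : 0 ≤ τ := abs_nonneg _
  rw [wOne]
  split_ifs with hle
  · simp only [ne_eq, OfNat.ofNat_ne_zero, not_false_eq_true, zero_pow, mul_zero]; positivity
  · rw [not_le] at hle
    have h3 : ρ ^ 2 * (τ⁻¹ * ρ⁻¹) ^ 2 = (τ⁻¹) ^ 2 := by field_simp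
    rw [h3]
    refine (inv_sq_le_of_lt hK hle).trans ?_
    gcongr
    nlinarith

lemma lintegral_annulus_wTwo_le {x : Space3} {s t K c : ℝ} (hs : s = 1 ∨ s = -1) (hK : 0 < K)
    (ht : 0 < t) (hc : 1 ≤ c) : ∫⁻ ξ in annulus c K, ENNReal.ofReal (wTwo (coneDist x (s * t) ξ) K⁻¹ ‖ξ‖) ≤
      ENNReal.ofReal (256 * c ^ 4 * K ^ 2 / t) := by
  refine lintegral_annulus_le (x := x) hs hK ht hc (measurable_wTwo x (s * t) K⁻¹) fun ν ρ h1 h2 => ?_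
  have hc0 : 0 < c := zero_lt_one.trans_le hc
  have hρ : 0 < ρ := (by positivity : 0 < K / c).trans_le h1
  rw [coneDist_smul x _ ν hρ, norm_smul_S2 ν hρ]
  set τ := |inner ℝ x (ν : Space3) + s * t| with hτ
  have hτ0 : 0 ≤ τ := abs_nonneg _
  rw [wTwo]
  split_ifs with hle
  · rw [mul_zero]; positivity
  · rw [not_le] at hle
    have hτp : 0 < τ⁻¹ := inv_pos.2 ((inv_pos.2 hK).trans hle)
    have h3 : ρ ^ 2 * ((τ⁻¹) ^ 2 * ((ρ ^ 2 + τ⁻¹ * ρ) / (ρ ^ 2 + (τ⁻¹) ^ 2)) * (ρ ^ 2)⁻¹) =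
        (τ⁻¹) ^ 2 * ((ρ ^ 2 + τ⁻¹ * ρ) / (ρ ^ 2 + (τ⁻¹) ^ 2)) := by field_simp
    have h4 : (ρ ^ 2 + τ⁻¹ * ρ) / (ρ ^ 2 + (τ⁻¹) ^ 2) ≤ 2 := by
      rw [div_le_iff₀ (by positivity)]
      nlinarith [sq_nonneg (ρ - τ⁻¹)]
    rw [h3]
    calc _ ≤ (4 * K ^ 2 * ((1 + K * τ) ^ 2)⁻¹) * 2 := by gcongr; exact inv_sq_le_of_lt hK hle
      _ ≤ _ := by
        have : 0 ≤ K ^ 2 * ((1 + K * τ) ^ 2)⁻¹ := by positivity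
        have hc2 : 1 ≤ c ^ 2 := one_le_pow₀ hc
        linarith [mul_le_mul_of_nonneg_right hc2 this]

lemma lintegral_annulus_sq_wTwo_le {x : Space3} {s t K c : ℝ} (hs : s = 1 ∨ s = -1) (hK : 0 < K)
    (ht : 0 < t) (hc : 1 ≤ c) : ∫⁻ ξ in annulus c K, ENNReal.ofReal (wTwo (coneDist x (s * t) ξ) K⁻¹ ‖ξ‖ ^ 2) ≤
      ENNReal.ofReal (256 * c ^ 4 * K ^ 2 / t) := by
  refine lintegral_annulus_le (x := x) hs hK ht hc ((measurable_wTwo x (s * t) K⁻¹).pow_const 2)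
    fun ν ρ h1 h2 => ?_
  have hc0 : 0 < c := zero_lt_one.trans_le hc
  have hρ : 0 < ρ := (by positivity : 0 < K / c).trans_le h1
  rw [coneDist_smul x _ ν hρ, norm_smul_S2 ν hρ]
  set τ := |inner ℝ x (ν : Space3) + s * t| with hτ
  have hτ0 : 0 ≤ τ := abs_nonneg _
  rw [wTwo]
  split_ifs with hle
  · simp only [ne_eq, OfNat.ofNat_ne_zero, not_false_eq_true, zero_pow, mul_zero]; positivity
  · rw [not_le] at hle
    set σ := τ⁻¹ with hσ
    have hτp : 0 < τ := (inv_pos.2 hK).trans hle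
    have hσp : 0 < σ := inv_pos.2 hτp
    have hσK : σ ≤ K := by rw [hσ]; exact (inv_lt_of_inv_lt₀ hK hle).le
    have h3 := wTwo_aux hρ hσp
    have h5 : 2 / (ρ ^ 2 + σ ^ 2) ≤ 2 * c ^ 2 / K ^ 2 := by
      rw [div_le_div_iff₀ (by positivity) (by positivity)]
      have : K ≤ ρ * c := by rwa [div_le_iff₀ hc0] at h1
      have : K ^ 2 ≤ (ρ * c) ^ 2 := by gcongr
      nlinarith [sq_nonneg (c * σ)]
    calc _ = σ ^ 2 * (ρ * (((ρ ^ 2 + σ * ρ) / (ρ ^ 2 + σ ^ 2)) * (ρ ^ 2)⁻¹)) ^ 2 * σ ^ 2 := by ring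
      _ ≤ K ^ 2 * (2 * c ^ 2 / K ^ 2) * (4 * K ^ 2 * ((1 + K * τ) ^ 2)⁻¹) := by
          gcongr
          · exact h3.trans h5
          · exact inv_sq_le_of_lt hK hle
      _ = _ := by field_simp; ring

end

section

/-! ### Norms of half-waves -/

/-- The `L²` norm of a Schwartz function. -/
def l2 (f : 𝓢(Space3, ℂ)) : ℝ≥0∞ := eLpNorm f 2 volume

/-- The `H¹` norm of a Schwartz function. -/
def h1 (f : 𝓢(Space3, ℂ)) : ℝ≥0∞ := l2 f + ∑ i, l2 (sd i f)

/-- The `H²` norm of a Schwartz function, without mixed derivatives. -/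
def h2 (f : 𝓢(Space3, ℂ)) : ℝ≥0∞ := l2 f + ∑ i, l2 (sd i (sd i f))

lemma l2_ne_top (f : 𝓢(Space3, ℂ)) : l2 f ≠ ⊤ := (f.memLp 2 volume).2.ne

lemma l2_fourier (f : 𝓢(Space3, ℂ)) : eLpNorm (𝓕 f : 𝓢(Space3, ℂ)) 2 volume = l2 f := by
  have h := SchwartzMap.norm_fourier_toL2_eq f
  rw [SchwartzMap.norm_toLp, SchwartzMap.norm_toLp] at h
  exact (ENNReal.toReal_eq_toReal_iff' (l2_ne_top (𝓕 f)) (l2_ne_top f)).1 h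

lemma l2_add_le (f g : 𝓢(Space3, ℂ)) : l2 (f + g) ≤ l2 f + l2 g :=
  eLpNorm_add_le f.continuous.aestronglyMeasurable g.continuous.aestronglyMeasurable one_le_two

lemma l2_smul (c : ℝ) (f : 𝓢(Space3, ℂ)) : l2 (c • f) = ‖c‖ₑ * l2 f :=
  eLpNorm_const_smul c f 2 volume

lemma sd_add (i : Fin 3) (f g : 𝓢(Space3, ℂ)) : sd i (f + g) = sd i f + sd i g :=
  LineDeriv.lineDerivOp_add _ _ _

lemma sd_smul (i : Fin 3) (c : ℝ) (f : 𝓢(Space3, ℂ)) : sd i (c • f) = c • sd i f :=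
  LineDeriv.lineDerivOp_smul _ _ _

/-- A seminorm on Schwartz functions with values in `[0, ∞]`. -/
structure IsSeminorm (N : 𝓢(Space3, ℂ) → ℝ≥0∞) : Prop where
  add_le : ∀ f g, N (f + g) ≤ N f + N g
  smul : ∀ (c : ℝ) f, N (c • f) = ‖c‖ₑ * N f

lemma isSeminorm_l2 : IsSeminorm l2 := ⟨l2_add_le, l2_smul⟩

lemma isSeminorm_h1 : IsSeminorm h1 := by
  refine ⟨fun f g => ?_, fun c f => ?_⟩
  · simp only [h1, sd_add]
    calc _ ≤ (l2 f + l2 g) + ∑ i, (l2 (sd i f) + l2 (sd i g)) := by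
          gcongr <;> exact l2_add_le _ _
      _ = _ := by rw [Finset.sum_add_distrib]; ring
  · simp only [h1, sd_smul, l2_smul, mul_add, Finset.mul_sum]

lemma isSeminorm_h2 : IsSeminorm h2 := by
  refine ⟨fun f g => ?_, fun c f => ?_⟩
  · simp only [h2, sd_add]
    calc _ ≤ (l2 f + l2 g) + ∑ i, (l2 (sd i (sd i f)) + l2 (sd i (sd i g))) := by
          gcongr <;> exact l2_add_le _ _
      _ = _ := by rw [Finset.sum_add_distrib]; ring
  · simp only [h2, sd_smul, l2_smul, mul_add, Finset.mul_sum]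

lemma IsSeminorm.zero {N : 𝓢(Space3, ℂ) → ℝ≥0∞} (hN : IsSeminorm N) : N 0 = 0 := by
  have := hN.smul 0 0
  simpa using this

lemma IsSeminorm.sign {N : 𝓢(Space3, ℂ) → ℝ≥0∞} (hN : IsSeminorm N) {s : ℝ}
    (hs : s = 1 ∨ s = -1) (f : 𝓢(Space3, ℂ)) : N (s • f) = N f := by
  rw [hN.smul]
  rcases hs with rfl | rfl <;> simp

lemma l2_coord_mul_fourier_le (i : Fin 3) (f : 𝓢(Space3, ℂ)) :
    eLpNorm (fun ξ => (ξ i : ℂ) * 𝓕 f ξ) 2 volume ≤ l2 (sd i f) := by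
  rw [← l2_fourier]
  refine eLpNorm_mono fun ξ => ?_
  rw [fourier_sd_apply, mul_assoc (2 * Real.pi * Complex.I : ℂ), norm_mul (2 * Real.pi * Complex.I : ℂ)]
  refine le_mul_of_one_le_left (norm_nonneg _) ?_
  simp only [norm_mul, Complex.norm_ofNat, Complex.norm_real, Complex.norm_I, mul_one,
    Real.norm_eq_abs, abs_of_pos Real.pi_pos]
  linarith [Real.pi_gt_three]

lemma l2_coord_sq_mul_fourier_le (i : Fin 3) (f : 𝓢(Space3, ℂ)) :
    eLpNorm (fun ξ => (ξ i : ℂ) * ((ξ i : ℂ) * 𝓕 f ξ)) 2 volume ≤ l2 (sd i (sd i f)) := by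
  refine le_trans (eLpNorm_mono fun ξ => ?_) (l2_coord_mul_fourier_le i (sd i f))
  rw [norm_mul, norm_mul (ξ i : ℂ) (𝓕 (sd i f) ξ), fourier_sd_apply,
    mul_assoc (2 * Real.pi * Complex.I : ℂ), norm_mul (2 * Real.pi * Complex.I : ℂ)]
  refine mul_le_mul_of_nonneg_left ?_ (norm_nonneg _)
  refine le_mul_of_one_le_left (norm_nonneg _) ?_
  simp only [norm_mul, Complex.norm_ofNat, Complex.norm_real, Complex.norm_I, mul_one,
    Real.norm_eq_abs, abs_of_pos Real.pi_pos]
  linarith [Real.pi_gt_three]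

lemma norm_sq_eq_sum (ξ : Space3) : ‖ξ‖ ^ 2 = ∑ i, ξ i ^ 2 := by
  rw [EuclideanSpace.norm_sq_eq]; simp

lemma norm_le_sum (ξ : Space3) : ‖ξ‖ ≤ ∑ i, |ξ i| := by
  refine le_of_sq_le_sq ?_ (by positivity)
  rw [norm_sq_eq_sum, Fin.sum_univ_three, Fin.sum_univ_three, ← sq_abs (ξ 0), ← sq_abs (ξ 1),
    ← sq_abs (ξ 2)]
  have := abs_nonneg (ξ 0); have := abs_nonneg (ξ 1); have := abs_nonneg (ξ 2)
  nlinarith [mul_nonneg ‹0 ≤ |ξ 0|› ‹0 ≤ |ξ 1|›, mul_nonneg ‹0 ≤ |ξ 0|› ‹0 ≤ |ξ 2|›,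
    mul_nonneg ‹0 ≤ |ξ 1|› ‹0 ≤ |ξ 2|›]

lemma norm_sym_le (g : Fin 4 → 𝓢(Space3, ℂ)) (ξ : Space3) : ‖sym g ξ‖ ≤ ∑ μ, ‖𝓕 (g μ) ξ‖ := by
  refine (norm_sum_le _ _).trans (Finset.sum_le_sum fun μ _ => ?_)
  rw [norm_mul]
  exact mul_le_of_le_one_left (norm_nonneg _) (norm_dirCoef_le μ (norm_normalize_le ξ))

/-- A weighted `L²` norm of a symbol is bounded by weighted norms of its components. -/
lemma eLpNorm_mul_sym_le (g : Fin 4 → 𝓢(Space3, ℂ)) {w : Space3 → ℝ} (hw : Continuous w) :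
    eLpNorm (fun ξ => (w ξ : ℂ) * sym g ξ) 2 volume ≤
      ∑ μ, eLpNorm (fun ξ => (w ξ : ℂ) * 𝓕 (g μ) ξ) 2 volume := by
  calc _ ≤ eLpNorm (∑ μ, fun ξ => ((‖(w ξ : ℂ) * 𝓕 (g μ) ξ‖ : ℝ) : ℂ)) 2 volume := by
        refine eLpNorm_mono fun ξ => ?_
        rw [Finset.sum_apply, norm_mul, ← Complex.ofReal_sum, Complex.norm_real (∑ _, _),
          Real.norm_of_nonneg (Finset.sum_nonneg fun _ _ => norm_nonneg _)]
        simp only [norm_mul, ← Finset.mul_sum]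
        rw [Complex.norm_real]
        gcongr
        exact norm_sym_le g ξ
    _ ≤ _ := by
        refine (eLpNorm_sum_le (fun μ _ => ?_) one_le_two).trans ?_
        · have := (𝓕 (g μ)).continuous
          exact (by fun_prop : Continuous fun ξ => ((‖(w ξ : ℂ) * 𝓕 (g μ) ξ‖ : ℝ) : ℂ)).aestronglyMeasurable
        · refine Finset.sum_le_sum fun μ _ => eLpNorm_mono fun ξ => ?_
          simp

lemma eLpNorm_sym_le (g : Fin 4 → 𝓢(Space3, ℂ)) : eLpNorm (sym g) 2 volume ≤ ∑ μ, l2 (g μ) := by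
  have h := eLpNorm_mul_sym_le g (w := fun _ => 1) continuous_const
  simp only [Complex.ofReal_one, one_mul] at h
  exact h.trans (Finset.sum_le_sum fun μ _ => (l2_fourier (g μ)).le)

lemma eLpNorm_weighted_fourier_le (f : 𝓢(Space3, ℂ)) {w : Space3 → ℝ} {u : Fin 3 → Space3 → ℂ}
    {C : ℝ} (hC : 0 ≤ C) (hu : ∀ i, Continuous (u i))
    (h : ∀ ξ, |w ξ| * ‖𝓕 f ξ‖ ≤ C * (‖𝓕 f ξ‖ + ∑ i, ‖u i ξ‖)) :
    eLpNorm (fun ξ => (w ξ : ℂ) * 𝓕 f ξ) 2 volume ≤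
      ENNReal.ofReal C * (l2 f + ∑ i, eLpNorm (u i) 2 volume) := by
  have hc := (𝓕 f).continuous
  calc _ ≤ eLpNorm (C • ((fun ξ => ((‖𝓕 f ξ‖ : ℝ) : ℂ)) + ∑ i, fun ξ => ((‖u i ξ‖ : ℝ) : ℂ))) 2 volume := by
        refine eLpNorm_mono fun ξ => ?_
        rw [norm_mul, Complex.norm_real, Real.norm_eq_abs]
        refine (h ξ).trans (le_of_eq ?_)
        simp only [Pi.smul_apply, Pi.add_apply, Finset.sum_apply, norm_smul,
          Real.norm_of_nonneg hC]
        rw [← Complex.ofReal_sum, ← Complex.ofReal_add, Complex.norm_real,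
          Real.norm_of_nonneg (by positivity)]
    _ ≤ _ := by
        rw [eLpNorm_const_smul, ← ofReal_norm C, Real.norm_of_nonneg hC]
        gcongr
        refine (eLpNorm_add_le (by fun_prop) ?_ one_le_two).trans ?_
        · refine Finset.aestronglyMeasurable_sum _ fun i _ => ?_
          have := hu i
          fun_prop
        gcongr
        · rw [← l2_fourier]
          exact eLpNorm_mono fun ξ => by simp
        · refine (eLpNorm_sum_le (fun i _ => ?_) one_le_two).trans ?_
          · have := hu i
            fun_prop
          · exact Finset.sum_le_sum fun i _ => eLpNorm_mono fun ξ => by simp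

lemma eLpNorm_one_add_mul_sym_le (g : Fin 4 → 𝓢(Space3, ℂ)) :
    eLpNorm (fun ξ => ((1 + ‖ξ‖ : ℝ) : ℂ) * sym g ξ) 2 volume ≤ ∑ μ, h1 (g μ) := by
  refine (eLpNorm_mul_sym_le g (by fun_prop)).trans (Finset.sum_le_sum fun μ _ => ?_)
  have hc := (𝓕 (g μ)).continuous
  have h := eLpNorm_weighted_fourier_le (g μ) (w := fun ξ => 1 + ‖ξ‖)
    (u := fun i ξ => (ξ i : ℂ) * 𝓕 (g μ) ξ) zero_le_one (fun i => by fun_prop) fun ξ => by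
      simp only [norm_mul, Complex.norm_real, Real.norm_eq_abs, ← Finset.sum_mul]
      rw [abs_of_nonneg (by positivity), one_mul, ← one_add_mul]
      gcongr
      exact norm_le_sum ξ
  rw [ENNReal.ofReal_one, one_mul] at h
  refine h.trans ?_
  unfold h1
  gcongr
  exact l2_coord_mul_fourier_le _ _

lemma eLpNorm_one_add_sq_mul_sym_le (g : Fin 4 → 𝓢(Space3, ℂ)) :
    eLpNorm (fun ξ => (((1 + ‖ξ‖) ^ 2 : ℝ) : ℂ) * sym g ξ) 2 volume ≤ 2 * ∑ μ, h2 (g μ) := by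
  rw [Finset.mul_sum]
  refine (eLpNorm_mul_sym_le g (by fun_prop)).trans (Finset.sum_le_sum fun μ _ => ?_)
  have hc := (𝓕 (g μ)).continuous
  have h := eLpNorm_weighted_fourier_le (g μ) (w := fun ξ => (1 + ‖ξ‖) ^ 2)
    (u := fun i ξ => (ξ i : ℂ) * ((ξ i : ℂ) * 𝓕 (g μ) ξ)) zero_le_two (fun i => by fun_prop)
    fun ξ => by
      simp only [norm_mul, Complex.norm_real, Real.norm_eq_abs, ← mul_assoc, ← Finset.sum_mul,
        abs_mul_abs_self]
      rw [abs_of_nonneg (by positivity), ← one_add_mul, ← mul_assoc]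
      gcongr
      have := norm_sq_eq_sum ξ
      simp only [← sq]
      rw [← this]
      nlinarith [sq_nonneg (1 - ‖ξ‖)]
  refine h.trans ?_
  unfold h2
  rw [show ENNReal.ofReal 2 = 2 by simp]
  gcongr
  exact l2_coord_sq_mul_fourier_le _ _

/-! ### Schwartz solutions up to an error -/

/-- The defect of the relations which express the spacetime gradient `Q` of `Sφ` through the
spacetime gradient `P` of `φ` at time `t`, when `□φ = 0`. -/
def scalErr (t : ℝ) (P Q : Fin 4 → 𝓢(Space3, ℂ)) (μ : Fin 4) : 𝓢(Space3, ℂ) :=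
  Fin.cases (motive := fun _ => 𝓢(Space3, ℂ))
    (P 0 + sD (P 0) + t • (∑ j : Fin 3, sd j (P j.succ)) - Q 0)
    (fun j => P j.succ + sD (P j.succ) + t • sd j (P 0) - Q j.succ) μ

/-- The curl of the spatial part of `P`. -/
def curl (P : Fin 4 → 𝓢(Space3, ℂ)) (i j : Fin 3) : 𝓢(Space3, ℂ) :=
  sd i (P j.succ) - sd j (P i.succ)

/-- The inhomogeneity of the half-wave `halfVec P μ s`. -/
def halfErr (t : ℝ) (P Q : Fin 4 → 𝓢(Space3, ℂ)) (μ : Fin 4) (s : ℝ) : Fin 4 → 𝓢(Space3, ℂ) :=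
  Fin.cases (motive := fun _ => Fin 4 → 𝓢(Space3, ℂ))
    (Fin.cases (motive := fun _ => 𝓢(Space3, ℂ)) (scalErr t P Q 0)
      (fun j => s • scalErr t P Q j.succ))
    (fun j => Fin.cases (motive := fun _ => 𝓢(Space3, ℂ)) (scalErr t P Q j.succ)
      (fun i => s • ((if i = j then scalErr t P Q 0 else 0) + t • curl P i j))) μ

/-- The total size of the defects. -/
def errNorm (N : 𝓢(Space3, ℂ) → ℝ≥0∞) (t : ℝ) (P Q : Fin 4 → 𝓢(Space3, ℂ)) : ℝ≥0∞ :=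
  ∑ μ, N (scalErr t P Q μ) + ∑ i, ∑ j, ‖t‖ₑ * N (curl P i j)

lemma sum_halfVec_le {N : 𝓢(Space3, ℂ) → ℝ≥0∞} (hN : IsSeminorm N) (P : Fin 4 → 𝓢(Space3, ℂ))
    (μ : Fin 4) {s : ℝ} (hs : s = 1 ∨ s = -1) :
    ∑ κ, N (halfVec P μ s κ) ≤ ∑ κ, N (P κ) := by
  refine Fin.cases ?_ (fun j => ?_) μ
  · refine Finset.sum_le_sum fun κ _ => ?_
    refine Fin.cases le_rfl (fun i => ?_) κ
    exact (hN.sign hs _).le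
  · rw [Fin.sum_univ_succ, Fin.sum_univ_succ (n := 3), add_comm]
    have e1 : ∑ i : Fin 3, N (halfVec P j.succ s i.succ) = N (P 0) := by
      have : ∀ i : Fin 3, N (halfVec P j.succ s i.succ) = if i = j then N (P 0) else 0 := by
        intro i
        simp only [halfVec, Fin.cases_succ]
        split_ifs
        · exact hN.sign hs _
        · exact hN.zero
      simp [this]
    rw [e1]
    gcongr
    exact Finset.single_le_sum (f := fun i : Fin 3 => N (P i.succ)) (fun _ _ => zero_le)
      (Finset.mem_univ j)

lemma halfErr_le {N : 𝓢(Space3, ℂ) → ℝ≥0∞} (hN : IsSeminorm N) (t : ℝ)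
    (P Q : Fin 4 → 𝓢(Space3, ℂ)) (μ κ : Fin 4) {s : ℝ} (hs : s = 1 ∨ s = -1) :
    N (halfErr t P Q μ s κ) ≤ errNorm N t P Q := by
  have h1 : ∀ κ, N (scalErr t P Q κ) ≤ errNorm N t P Q := fun κ =>
    (Finset.single_le_sum (f := fun κ => N (scalErr t P Q κ)) (fun _ _ => zero_le)
      (Finset.mem_univ κ)).trans le_self_add
  refine Fin.cases ?_ (fun j => ?_) μ
  · refine Fin.cases (h1 0) (fun i => ?_) κ
    exact (hN.sign hs _).le.trans (h1 i.succ)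
  · refine Fin.cases (h1 j.succ) (fun i => ?_) κ
    refine (hN.sign hs _).le.trans ((hN.add_le _ _).trans ?_)
    refine add_le_add ?_ ?_
    · refine le_trans ?_ (Finset.single_le_sum (f := fun κ => N (scalErr t P Q κ))
        (fun _ _ => zero_le) (Finset.mem_univ 0))
      split_ifs
      · exact le_rfl
      · rw [hN.zero]; exact zero_le
    · rw [hN.smul]
      refine le_trans ?_ (Finset.single_le_sum (f := fun i => ∑ j, ‖t‖ₑ * N (curl P i j))
        (fun _ _ => zero_le) (Finset.mem_univ i))
      exact Finset.single_le_sum (f := fun j => ‖t‖ₑ * N (curl P i j))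
        (fun _ _ => zero_le) (Finset.mem_univ j)

lemma sum_halfErr_le {N : 𝓢(Space3, ℂ) → ℝ≥0∞} (hN : IsSeminorm N) (t : ℝ)
    (P Q : Fin 4 → 𝓢(Space3, ℂ)) (μ : Fin 4) {s : ℝ} (hs : s = 1 ∨ s = -1) :
    ∑ κ, N (halfErr t P Q μ s κ) ≤ 4 * errNorm N t P Q := by
  refine (Finset.sum_le_sum fun κ _ => halfErr_le hN t P Q μ κ hs).trans ?_
  simp

end

section

lemma fourier_add_apply (f g : 𝓢(Space3, ℂ)) (ξ : Space3) : 𝓕 (f + g) ξ = 𝓕 f ξ + 𝓕 g ξ := by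
  rw [FourierTransform.fourier_add, add_apply]

lemma fourier_sub_apply (f g : 𝓢(Space3, ℂ)) (ξ : Space3) : 𝓕 (f - g) ξ = 𝓕 f ξ - 𝓕 g ξ := by
  rw [sub_eq_add_neg, fourier_add_apply, FourierTransform.fourier_neg, neg_apply, sub_eq_add_neg]

lemma fourier_smul_apply (c : ℝ) (f : 𝓢(Space3, ℂ)) (ξ : Space3) : 𝓕 (c • f) ξ = c * 𝓕 f ξ := by
  rw [FourierTransform.fourier_smul, smul_apply, Complex.real_smul]

lemma fourier_zero_apply (ξ : Space3) : 𝓕 (0 : 𝓢(Space3, ℂ)) ξ = 0 := by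
  rw [FourierTransform.fourier_zero]; rfl

lemma fourier_sum_apply (F : Fin 3 → 𝓢(Space3, ℂ)) (ξ : Space3) :
    𝓕 (∑ i, F i) ξ = ∑ i, 𝓕 (F i) ξ := by
  rw [show 𝓕 (∑ i, F i) = ∑ i, 𝓕 (F i) from map_sum (FourierTransform.fourierCLM ℂ 𝓢(Space3, ℂ)) _ _,
    sum_schwartz_apply]

lemma coord_eq (ξ : Space3) (hξ : ξ ≠ 0) (i : Fin 3) : ξ i = ‖ξ‖ * (‖ξ‖⁻¹ • ξ) i := by
  have : ‖ξ‖ ≠ 0 := norm_ne_zero_iff.2 hξ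
  rw [PiLp.smul_apply, smul_eq_mul, mul_inv_cancel_left₀ this]

lemma sum_normalize_sq (ξ : Space3) (hξ : ξ ≠ 0) :
    ((‖ξ‖⁻¹ • ξ) 0 : ℂ) ^ 2 + ((‖ξ‖⁻¹ • ξ) 1 : ℂ) ^ 2 + ((‖ξ‖⁻¹ • ξ) 2 : ℂ) ^ 2 = 1 := by
  have h := norm_sq_eq_sum (‖ξ‖⁻¹ • ξ)
  rw [norm_smul, norm_inv, norm_norm, inv_mul_cancel₀ (norm_ne_zero_iff.2 hξ), one_pow,
    Fin.sum_univ_three] at h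
  exact_mod_cast h.symm

/-- The scaling relations for the spacetime gradient decouple into half-waves. With `ω = ξ/|ξ|` and
`s² = 1`, the derivatives in these relations act on the symbol as the multiplier `s |ξ|`, up to the
curl. -/
lemma halfWave_halfVec (t : ℝ) (P Q : Fin 4 → 𝓢(Space3, ℂ)) (μ : Fin 4) {s : ℝ}
    (hs : s = 1 ∨ s = -1) : HalfWave s t (halfVec P μ s) (halfVec Q μ s) (halfErr t P Q μ s) := by
  intro ξ hξ
  have hs2 : (s : ℂ) * s = 1 := by rcases hs with rfl | rfl <;> simp
  have hn := sum_normalize_sq ξ hξ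
  have hc := coord_eq ξ hξ
  have hD : ∀ (c : ℝ) f, sD (c • f) = c • sD f := by
    intro c f
    ext y
    rw [sD_apply, smul_apply, sD_apply, Finset.smul_sum]
    refine Finset.sum_congr rfl fun i _ => ?_
    rw [← sd_apply, ← sd_apply, sd_smul, smul_apply, mul_smul_comm]
  have hD0 : sD 0 = 0 := by
    have := hD 0 0
    simpa using this
  set v := ‖ξ‖⁻¹ • ξ with hv
  refine Fin.cases ?_ (fun j => ?_) μ
  · simp only [sym, halfVec, halfErr, scalErr, Fin.sum_univ_succ, Fin.cases_zero, Fin.cases_succ,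
      fourier_smul_apply, fourier_add_apply, fourier_sub_apply, fourier_sd_apply, hD, dirCoef_zero,
      dirCoef_succ, Finset.univ_eq_empty, Finset.sum_empty, ← hv, hc, fourier_zero_apply]
    push_cast
    linear_combination (-2 * Real.pi * Complex.I * t * ‖ξ‖ * ((v 0 : ℂ) * 𝓕 (P 1) ξ +
        (v 1 : ℂ) * 𝓕 (P 2) ξ + (v 2 : ℂ) * 𝓕 (P 3) ξ)) * hs2 +
      (2 * Real.pi * Complex.I * s * t * ‖ξ‖ * 𝓕 (P 0) ξ) * hn
  · have key : ∀ a b : Fin 4 → 𝓢(Space3, ℂ), (∀ i : Fin 3, a i.succ = if i = j then b 0 else 0) →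
        sym a ξ = 𝓕 (a 0) ξ + v j * 𝓕 (b 0) ξ := by
      intro a b hab
      rw [sym, Fin.sum_univ_succ, dirCoef_zero, one_mul, Finset.sum_eq_single j]
      · rw [hab, if_pos rfl, dirCoef_succ]
      · intro i _ hij
        rw [hab, if_neg hij, fourier_zero_apply, mul_zero]
      · simp
    rw [key (halfVec P j.succ s) (fun _ => s • P 0) (fun i => rfl),
      key (halfVec Q j.succ s) (fun _ => s • Q 0) (fun i => rfl),
      key (fun μ => halfVec P j.succ s μ + sD (halfVec P j.succ s μ))
        (fun _ => s • P 0 + sD (s • P 0)) (fun i => by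
          simp only [halfVec, Fin.cases_succ]
          split_ifs
          · rfl
          · rw [hD0, add_zero])]
    have hE : sym (halfErr t P Q j.succ s) ξ = 𝓕 (scalErr t P Q j.succ) ξ +
        s * (v j * 𝓕 (scalErr t P Q 0) ξ + t * ∑ i, (v i : ℂ) * 𝓕 (curl P i j) ξ) := by
      rw [sym, Fin.sum_univ_succ, dirCoef_zero, one_mul]
      congr 1
      have : ∀ i : Fin 3, dirCoef i.succ (‖ξ‖⁻¹ • ξ) * 𝓕 (halfErr t P Q j.succ s i.succ) ξ =
          s * ((if i = j then (v i : ℂ) * 𝓕 (scalErr t P Q 0) ξ else 0) +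
            t * ((v i : ℂ) * 𝓕 (curl P i j) ξ)) := by
        intro i
        simp only [halfErr, Fin.cases_succ, fourier_smul_apply, fourier_add_apply, dirCoef_succ]
        split_ifs
        · ring
        · rw [fourier_zero_apply]; ring
      simp only [this]
      rw [← Finset.mul_sum, Finset.sum_add_distrib, ← Finset.mul_sum, Finset.sum_ite_eq']
      simp
    rw [hE]
    simp only [halfVec, scalErr, curl, Fin.sum_univ_three, Fin.cases_zero, Fin.cases_succ,
      fourier_smul_apply, fourier_add_apply, fourier_sub_apply, fourier_sd_apply, hD, hc]
    push_cast
    linear_combination (2 * Real.pi * Complex.I * t * ‖ξ‖ * s * 𝓕 (P j.succ) ξ) * hn -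
      (2 * Real.pi * Complex.I * t * ‖ξ‖ * v j * 𝓕 (P 0) ξ) * hs2

end

section

lemma rpow_half_le {A : ℝ≥0∞} {r : ℝ} (hr : 0 ≤ r) (h : A ≤ ENNReal.ofReal (r ^ 2)) :
    A ^ (1 / 2 : ℝ) ≤ ENNReal.ofReal r := by
  calc A ^ (1 / 2 : ℝ) ≤ ENNReal.ofReal (r ^ 2) ^ (1 / 2 : ℝ) := by gcongr
    _ = ENNReal.ofReal r := by
      rw [ENNReal.ofReal_rpow_of_nonneg (by positivity) (by norm_num), ← Real.sqrt_eq_rpow,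
        Real.sqrt_sq hr]

lemma ofReal_mul_enorm_eq {w r : ℝ} (hw : 0 ≤ w) (hr : 0 < r) (z : ℂ) :
    ENNReal.ofReal w * ‖z‖ₑ = ENNReal.ofReal (w * r⁻¹) * ‖(r : ℂ) * z‖ₑ := by
  rw [enorm_mul, ← ofReal_norm (r : ℂ), Complex.norm_real, Real.norm_of_nonneg hr.le,
    ← mul_assoc, ← ENNReal.ofReal_mul (by positivity), inv_mul_cancel_right₀ hr.ne']

/-- The weight `(1 + |t - |x||)⁻¹` inside the cone, and `1` outside of it. -/
def coneMul (t : ℝ) (x : Space3) : ℝ := if ‖x‖ ≤ t then (1 + (t - ‖x‖))⁻¹ else 1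

lemma coneMul_pos (t : ℝ) (x : Space3) : 0 < coneMul t x := by
  rw [coneMul]
  split_ifs with h
  · have : 0 ≤ t - ‖x‖ := by linarith
    positivity
  · exact one_pos

/-- Pointwise decay of approximate solutions in terms of `L²` norms. -/
lemma enorm_le_of_scalErr {t : ℝ} (ht : 1 ≤ t) (P P₁ P₂ : Fin 4 → 𝓢(Space3, ℂ)) (μ : Fin 4)
    (x : Space3) : ‖P μ x‖ₑ ≤
      ENNReal.ofReal (256 * ((√t)⁻¹ * coneMul t x)) *
        (∑ κ, h2 (P κ) + ∑ κ, l2 (P₁ κ) + ∑ κ, l2 (P₂ κ) + errNorm l2 t P₁ P₂) +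
      ENNReal.ofReal (256 * (√t)⁻¹) * errNorm h1 t P P₁ := by
  refine enorm_le_of_halfVec P μ x fun s hs => ?_
  have ht0 : 0 < t := zero_lt_one.trans_le ht
  have hm := coneMul_pos t x
  have hπ := Real.pi_le_four
  have hsq : (√t)⁻¹ ^ 2 = t⁻¹ := by rw [inv_pow, Real.sq_sqrt ht0.le]
  set a := ENNReal.ofReal (64 * ((√t)⁻¹ * coneMul t x)) with ha
  set b := ENNReal.ofReal (64 * (√t)⁻¹) with hb
  have cone3 : ∀ n : ℝ≥0∞, n ≤ 32 → n ≠ ⊤ → ∫⁻ ν : S2, n *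
      ENNReal.ofReal ((1 + |inner ℝ x (ν : Space3) + s * t|) ^ 3)⁻¹ ∂sph ≤
      ENNReal.ofReal ((64 * ((√t)⁻¹ * coneMul t x)) ^ 2) := by
    intro n hn hn'
    rw [lintegral_const_mul' _ _ hn']
    calc _ ≤ 32 * ENNReal.ofReal (32 * Real.pi / t * coneMul t x ^ 2) := by
          gcongr
          exact lintegral_sph_cone_three hs ht
      _ = ENNReal.ofReal (32 * (32 * Real.pi / t * coneMul t x ^ 2)) := by
          rw [ENNReal.ofReal_mul (p := 32) (by norm_num)]; simp
      _ ≤ _ := by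
          refine ENNReal.ofReal_le_ofReal ?_
          rw [mul_pow, mul_pow, hsq]
          have : 0 ≤ t⁻¹ * coneMul t x ^ 2 := by positivity
          calc _ = 1024 * Real.pi * (t⁻¹ * coneMul t x ^ 2) := by ring
            _ ≤ 4096 * (t⁻¹ * coneMul t x ^ 2) := by gcongr; linarith
            _ = _ := by ring
  have n1 : (∫⁻ ξ, ENNReal.ofReal (wNear (coneDist x (s * t) ξ) 1 * ((1 + ‖ξ‖) ^ 2)⁻¹) ^ 2) ^
      (1 / 2 : ℝ) ≤ a :=
    rpow_half_le (by positivity) ((lintegral_sq_wNear_le x (s * t)).trans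
      (cone3 8 (by norm_num) (by simp)))
  have n3 : (∫⁻ ξ, ENNReal.ofReal (wTwo (coneDist x (s * t) ξ) 1 ‖ξ‖) ^ 2) ^ (1 / 2 : ℝ) ≤ a :=
    rpow_half_le (by positivity) ((lintegral_sq_wTwo_le x (s * t)).trans
      (cone3 32 le_rfl (by simp)))
  have n2 : (∫⁻ ξ, ENNReal.ofReal (wOne (coneDist x (s * t) ξ) 1 ‖ξ‖ * (1 + ‖ξ‖)⁻¹) ^ 2) ^
      (1 / 2 : ℝ) ≤ b := by
    refine rpow_half_le (by positivity) ((lintegral_sq_wOne_le x (s * t)).trans ?_)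
    rw [lintegral_const_mul' _ _ (by simp)]
    calc _ ≤ 4 * ENNReal.ofReal (8 * Real.pi / (1 * t)) := by
          gcongr
          exact lintegral_sph_cone_two hs one_pos ht0
      _ = ENNReal.ofReal (4 * (8 * Real.pi / (1 * t))) := by
          rw [ENNReal.ofReal_mul (by norm_num)]; simp
      _ ≤ _ := by
          refine ENNReal.ofReal_le_ofReal ?_
          rw [mul_pow, hsq]
          calc _ = 32 * Real.pi * t⁻¹ := by field_simp; ring
            _ ≤ 64 ^ 2 * t⁻¹ := by gcongr; linarith
  have m0 := measurable_wNear x (s * t) 1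
  have m1 := measurable_wOne x (s * t) 1
  have m2 := measurable_wTwo x (s * t) 1
  have hsym := fun g => measurable_sym g
  have p1 : ∫⁻ ξ, ENNReal.ofReal (wNear (coneDist x (s * t) ξ) 1) * ‖sym (halfVec P μ s) ξ‖ₑ ≤
      a * (2 * ∑ κ, h2 (P κ)) := by
    have hS := hsym (halfVec P μ s)
    have h := lintegral_mul_le_eLpNorm
      (w := fun ξ => wNear (coneDist x (s * t) ξ) 1 * ((1 + ‖ξ‖) ^ 2)⁻¹)
      (G := fun ξ => (((1 + ‖ξ‖) ^ 2 : ℝ) : ℂ) * sym (halfVec P μ s) ξ) (by fun_prop) (by fun_prop)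
    calc _ = _ := lintegral_congr fun ξ => ?_
      _ ≤ _ := h
      _ ≤ _ := by
        gcongr
        exact (eLpNorm_one_add_sq_mul_sym_le _).trans
          (mul_le_mul_right (sum_halfVec_le isSeminorm_h2 P μ hs) 2)
    exact ofReal_mul_enorm_eq (by rw [wNear]; split_ifs <;> positivity) (by positivity) _
  have p2 : ∫⁻ ξ, ENNReal.ofReal (wOne (coneDist x (s * t) ξ) 1 ‖ξ‖) *
      ‖sym (halfErr t P P₁ μ s) ξ‖ₑ ≤ b * (4 * errNorm h1 t P P₁) := by
    have hS := hsym (halfErr t P P₁ μ s)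
    have h := lintegral_mul_le_eLpNorm
      (w := fun ξ => wOne (coneDist x (s * t) ξ) 1 ‖ξ‖ * (1 + ‖ξ‖)⁻¹)
      (G := fun ξ => ((1 + ‖ξ‖ : ℝ) : ℂ) * sym (halfErr t P P₁ μ s) ξ) (by fun_prop) (by fun_prop)
    calc _ = _ := lintegral_congr fun ξ => ?_
      _ ≤ _ := h
      _ ≤ _ := by
        gcongr
        exact (eLpNorm_one_add_mul_sym_le _).trans (sum_halfErr_le isSeminorm_h1 t P P₁ μ hs)
    have : 0 ≤ wOne (coneDist x (s * t) ξ) 1 ‖ξ‖ := by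
      have : 0 ≤ coneDist x (s * t) ξ := abs_nonneg _
      rw [wOne]; split_ifs <;> positivity
    exact ofReal_mul_enorm_eq this (by positivity) _
  have p3 : ∀ g : Fin 4 → 𝓢(Space3, ℂ), ∫⁻ ξ, ENNReal.ofReal (wTwo (coneDist x (s * t) ξ) 1 ‖ξ‖) *
      ‖sym g ξ‖ₑ ≤ a * ∑ κ, l2 (g κ) := fun g =>
    (lintegral_mul_le_eLpNorm m2 (hsym g)).trans (by gcongr; exact eLpNorm_sym_le g)
  have main := (halfWave_halfVec t P P₁ μ hs).enorm_osc_le (halfWave_halfVec t P₁ P₂ μ hs) x one_pos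
  have hS1 := hsym (halfVec P₁ μ s)
  have hS2 := hsym (halfVec P₂ μ s)
  simp only [mul_add] at main
  rw [lintegral_add_left (by fun_prop), lintegral_add_left (by fun_prop)] at main
  refine main.trans ?_
  have q1 := (p3 (halfVec P₁ μ s)).trans
    (mul_le_mul_right (sum_halfVec_le isSeminorm_l2 P₁ μ hs) a)
  have q2 := (p3 (halfVec P₂ μ s)).trans
    (mul_le_mul_right (sum_halfVec_le isSeminorm_l2 P₂ μ hs) a)
  have q3 := (p3 (halfErr t P₁ P₂ μ s)).trans
    (mul_le_mul_right (sum_halfErr_le isSeminorm_l2 t P₁ P₂ μ hs) a)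
  have c1 : ENNReal.ofReal (256 * ((√t)⁻¹ * coneMul t x)) = 4 * a := by
    rw [ha, show (4 : ℝ≥0∞) = ENNReal.ofReal 4 by simp, ← ENNReal.ofReal_mul (by norm_num)]
    congr 1; ring
  have c2 : ENNReal.ofReal (256 * (√t)⁻¹) = 4 * b := by
    rw [hb, show (4 : ℝ≥0∞) = ENNReal.ofReal 4 by simp, ← ENNReal.ofReal_mul (by norm_num)]
    congr 1; ring
  rw [c1, c2]
  calc _ ≤ a * (2 * ∑ κ, h2 (P κ)) + b * (4 * errNorm h1 t P P₁) +
        (a * ∑ κ, l2 (P₁ κ) + a * ∑ κ, l2 (P₂ κ) + a * (4 * errNorm l2 t P₁ P₂)) := by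
        gcongr
    _ ≤ a * (4 * ∑ κ, h2 (P κ)) + b * (4 * errNorm h1 t P P₁) +
        (a * (4 * ∑ κ, l2 (P₁ κ)) + a * (4 * ∑ κ, l2 (P₂ κ)) + a * (4 * errNorm l2 t P₁ P₂)) := by
        have h4 : ∀ A : ℝ≥0∞, A ≤ 4 * A := fun A => le_mul_of_one_le_left zero_le (by norm_num)
        gcongr
        · norm_num
        · exact h4 _
        · exact h4 _
    _ = _ := by ring

lemma enorm_le_lintegral_fourier (f : 𝓢(Space3, ℂ)) (x : Space3) : ‖f x‖ₑ ≤ ∫⁻ ξ, ‖𝓕 f ξ‖ₑ := by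
  rw [fourier_inversion_osc f x, osc]
  refine (enorm_integral_le_lintegral_enorm _).trans (le_of_eq (lintegral_congr fun ξ => ?_))
  rw [enorm_mul, ← ofReal_norm, norm_exp_inner, ENNReal.ofReal_one, one_mul]

/-- The elementary bound of a Schwartz function in terms of its `H²` norm. -/
lemma enorm_le_h2 (f : 𝓢(Space3, ℂ)) (x : Space3) : ‖f x‖ₑ ≤ 24 * h2 f := by
  have m0 := measurable_wNear 0 0 1
  have h1 := lintegral_mul_le_eLpNorm
    (w := fun ξ => wNear (coneDist 0 0 ξ) 1 * ((1 + ‖ξ‖) ^ 2)⁻¹)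
    (G := fun ξ => (((1 + ‖ξ‖) ^ 2 : ℝ) : ℂ) * 𝓕 f ξ) (by fun_prop) (by
      have := (𝓕 f).continuous
      fun_prop)
  have h12 : (∫⁻ ξ, ENNReal.ofReal (wNear (coneDist 0 0 ξ) 1 * ((1 + ‖ξ‖) ^ 2)⁻¹) ^ 2) ^
      (1 / 2 : ℝ) ≤ ENNReal.ofReal 12 := by
    refine rpow_half_le (by norm_num) ((lintegral_sq_wNear_le 0 0).trans ?_)
    simp only [inner_zero_left, add_zero, abs_zero, one_pow, inv_one, ENNReal.ofReal_one, mul_one,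
      lintegral_const, sph_univ]
    rw [show (8 : ℝ≥0∞) = ENNReal.ofReal 8 by simp, ← ENNReal.ofReal_mul (by norm_num)]
    refine ENNReal.ofReal_le_ofReal ?_
    linarith [Real.pi_le_four]
  set g : Fin 4 → 𝓢(Space3, ℂ) := Fin.cases f (fun _ => 0) with hg
  have hsym : ∀ ξ, sym g ξ = 𝓕 f ξ := fun ξ => by
    rw [sym, Fin.sum_univ_succ]
    simp only [hg, Fin.cases_zero, Fin.cases_succ, fourier_zero_apply]
    simp
  have h3 := eLpNorm_one_add_sq_mul_sym_le g
  simp only [hsym] at h3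
  have h4 : ∑ κ, h2 (g κ) = h2 f := by
    rw [Fin.sum_univ_succ]
    simp only [hg, Fin.cases_zero, Fin.cases_succ, isSeminorm_h2.zero]
    simp
  rw [h4] at h3
  refine (enorm_le_lintegral_fourier f x).trans ?_
  calc _ = _ := lintegral_congr fun ξ => ?_
    _ ≤ _ := h1
    _ ≤ ENNReal.ofReal 12 * (2 * h2 f) := by gcongr
    _ = 24 * h2 f := by
      rw [← mul_assoc]; congr 1
      rw [show (2 : ℝ≥0∞) = ENNReal.ofReal 2 by simp, ← ENNReal.ofReal_mul (by norm_num)]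
      norm_num
  have hw : wNear (coneDist 0 0 ξ) 1 = 1 := by simp [wNear, coneDist]
  have := ofReal_mul_enorm_eq (w := 1) zero_le_one
    (r := (1 + ‖ξ‖) ^ 2) (by positivity) (𝓕 f ξ)
  rw [ENNReal.ofReal_one, one_mul] at this
  rw [hw, this]

/-! ### Frequency localized half-waves -/

/-- The Fourier transform of `f` vanishes outside of `A`. -/
def FourierVanish (A : Set Space3) (f : 𝓢(Space3, ℂ)) : Prop := ∀ ξ ∉ A, 𝓕 f ξ = 0

namespace FourierVanish

variable {A : Set Space3} {f g : 𝓢(Space3, ℂ)}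

lemma zero : FourierVanish A 0 := fun ξ _ => fourier_zero_apply ξ

lemma add (hf : FourierVanish A f) (hg : FourierVanish A g) : FourierVanish A (f + g) :=
  fun ξ hξ => by rw [fourier_add_apply, hf ξ hξ, hg ξ hξ, add_zero]

lemma sub (hf : FourierVanish A f) (hg : FourierVanish A g) : FourierVanish A (f - g) :=
  fun ξ hξ => by rw [fourier_sub_apply, hf ξ hξ, hg ξ hξ, sub_zero]

lemma smul (hf : FourierVanish A f) (c : ℝ) : FourierVanish A (c • f) :=
  fun ξ hξ => by rw [fourier_smul_apply, hf ξ hξ, mul_zero]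

lemma sum {F : Fin 3 → 𝓢(Space3, ℂ)} (h : ∀ i, FourierVanish A (F i)) :
    FourierVanish A (∑ i, F i) := fun ξ hξ => by
  rw [fourier_sum_apply]
  exact Finset.sum_eq_zero fun i _ => h i ξ hξ

lemma sd (hf : FourierVanish A f) (i : Fin 3) : FourierVanish A (sd i f) :=
  fun ξ hξ => by rw [fourier_sd_apply, hf ξ hξ, mul_zero]

lemma sD (hA : IsClosed A) (hf : FourierVanish A f) : FourierVanish A (sD f) := by
  intro ξ hξ
  have h0 : (𝓕 f : 𝓢(Space3, ℂ)) =ᶠ[nhds ξ] fun _ => (0 : ℂ) := by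
    filter_upwards [hA.isOpen_compl.mem_nhds hξ] with η hη using hf η hη
  have h1 := fourier_sD f ξ
  rw [h0.fderiv_eq, hf ξ hξ] at h1
  simpa using h1

lemma scalErr {t : ℝ} {P Q : Fin 4 → 𝓢(Space3, ℂ)} (hA : IsClosed A)
    (hP : ∀ κ, FourierVanish A (P κ)) (hQ : ∀ κ, FourierVanish A (Q κ)) (κ : Fin 4) :
    FourierVanish A (scalErr t P Q κ) := by
  refine Fin.cases ?_ (fun j => ?_) κ
  · exact (((hP 0).add ((hP 0).sD hA)).add ((sum fun j => (hP j.succ).sd j).smul t)).sub (hQ 0)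
  · exact (((hP j.succ).add ((hP j.succ).sD hA)).add (((hP 0).sd j).smul t)).sub (hQ j.succ)

lemma halfVec {P : Fin 4 → 𝓢(Space3, ℂ)} (hP : ∀ κ, FourierVanish A (P κ)) (μ : Fin 4) (s : ℝ)
    (κ : Fin 4) : FourierVanish A (halfVec P μ s κ) := by
  refine Fin.cases ?_ (fun j => ?_) μ
  · exact Fin.cases (hP 0) (fun i => (hP i.succ).smul s) κ
  · refine Fin.cases (hP j.succ) (fun i => ?_) κ
    rw [WaveDecay.halfVec, Fin.cases_succ, Fin.cases_succ]
    split_ifs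
    · exact (hP 0).smul s
    · exact zero

lemma halfErr {t : ℝ} {P Q : Fin 4 → 𝓢(Space3, ℂ)} (hA : IsClosed A)
    (hP : ∀ κ, FourierVanish A (P κ)) (hQ : ∀ κ, FourierVanish A (Q κ)) (μ : Fin 4) (s : ℝ)
    (κ : Fin 4) : FourierVanish A (halfErr t P Q μ s κ) := by
  have hE := scalErr (t := t) hA hP hQ
  refine Fin.cases ?_ (fun j => ?_) μ
  · exact Fin.cases (hE 0) (fun i => (hE i.succ).smul s) κ
  · refine Fin.cases (hE j.succ) (fun i => ?_) κ
    refine FourierVanish.smul (add ?_ ((((hP j.succ).sd i).sub ((hP i.succ).sd j)).smul t)) s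
    split_ifs
    · exact hE 0
    · exact zero

lemma sym {g : Fin 4 → 𝓢(Space3, ℂ)} (hg : ∀ κ, FourierVanish A (g κ)) {ξ : Space3} (hξ : ξ ∉ A) :
    sym g ξ = 0 :=
  Finset.sum_eq_zero fun κ _ => by rw [hg κ ξ hξ, mul_zero]

lemma lintegral_mul_sym {g : Fin 4 → 𝓢(Space3, ℂ)} (hA : MeasurableSet A)
    (hg : ∀ κ, FourierVanish A (g κ)) (w : Space3 → ℝ≥0∞) :
    ∫⁻ ξ, w ξ * ‖WaveDecay.sym g ξ‖ₑ = ∫⁻ ξ in A, w ξ * ‖WaveDecay.sym g ξ‖ₑ := by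
  rw [← lintegral_indicator hA]
  refine lintegral_congr fun ξ => ?_
  by_cases hξ : ξ ∈ A
  · rw [indicator_of_mem hξ]
  · rw [indicator_of_notMem hξ, sym hg hξ, enorm_zero, mul_zero]

end FourierVanish

lemma isClosed_annulus (c K : ℝ) : IsClosed (annulus c K) :=
  isClosed_Icc.preimage continuous_norm

lemma enorm_sym_halfVec_le {P : Fin 4 → 𝓢(Space3, ℂ)} {M : ℝ≥0∞} (hM : ∀ κ ξ, ‖𝓕 (P κ) ξ‖ₑ ≤ M)
    (μ : Fin 4) {s : ℝ} (hs : s = 1 ∨ s = -1) (ξ : Space3) : ‖sym (halfVec P μ s) ξ‖ₑ ≤ 4 * M := by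
  have hN : ∀ f : 𝓢(Space3, ℂ), ‖𝓕 f ξ‖ₑ ≤ M → ‖𝓕 (s • f) ξ‖ₑ ≤ M := fun f hf => by
    rw [fourier_smul_apply, enorm_mul]
    rcases hs with rfl | rfl <;> simpa using hf
  have h : ∀ κ, ‖𝓕 (halfVec P μ s κ) ξ‖ₑ ≤ M := by
    intro κ
    refine Fin.cases ?_ (fun j => ?_) μ
    · exact Fin.cases (hM 0 ξ) (fun i => hN _ (hM i.succ ξ)) κ
    · refine Fin.cases (hM j.succ ξ) (fun i => ?_) κ
      rw [halfVec, Fin.cases_succ, Fin.cases_succ]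
      split_ifs
      · exact hN _ (hM 0 ξ)
      · rw [fourier_zero_apply, enorm_zero]; exact zero_le
  refine (enorm_sym_le _ ξ).trans ((Finset.sum_le_sum fun κ _ => h κ).trans ?_)
  simp

lemma setLIntegral_mul_sym_le_sup {A : Set Space3} {w : Space3 → ℝ} {g : Fin 4 → 𝓢(Space3, ℂ)}
    {Q B : ℝ≥0∞} (hw : Measurable w) (hQ : ∫⁻ ξ in A, ENNReal.ofReal (w ξ) ≤ Q)
    (hB : ∀ ξ, ‖sym g ξ‖ₑ ≤ B) :
    ∫⁻ ξ in A, ENNReal.ofReal (w ξ) * ‖sym g ξ‖ₑ ≤ Q * B := by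
  calc _ ≤ ∫⁻ ξ in A, ENNReal.ofReal (w ξ) * B := lintegral_mono fun ξ => by gcongr; exact hB ξ
    _ = (∫⁻ ξ in A, ENNReal.ofReal (w ξ)) * B := lintegral_mul_const _ (by fun_prop)
    _ ≤ _ := by gcongr

lemma setLIntegral_mul_sym_le_l2 {A : Set Space3} (hA : MeasurableSet A) {w : Space3 → ℝ}
    {g : Fin 4 → 𝓢(Space3, ℂ)} {r : ℝ} (hr : 0 ≤ r) (hw : Measurable w)
    (hQ : ∫⁻ ξ in A, ENNReal.ofReal (w ξ ^ 2) ≤ ENNReal.ofReal (r ^ 2)) :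
    ∫⁻ ξ in A, ENNReal.ofReal (w ξ) * ‖sym g ξ‖ₑ ≤ ENNReal.ofReal r * ∑ κ, l2 (g κ) := by
  have h := lintegral_mul_le_eLpNorm (w := A.indicator w) (G := sym g) (hw.indicator hA)
    (measurable_sym g)
  calc _ = ∫⁻ ξ, ENNReal.ofReal (A.indicator w ξ) * ‖sym g ξ‖ₑ := by
        rw [← lintegral_indicator hA]
        refine lintegral_congr fun ξ => ?_
        by_cases hξ : ξ ∈ A
        · simp [hξ]
        · simp [hξ]
    _ ≤ _ := h
    _ ≤ _ := by
        gcongr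
        · refine rpow_half_le hr (le_trans ?_ hQ)
          rw [← lintegral_indicator hA]
          refine lintegral_mono fun ξ => ?_
          by_cases hξ : ξ ∈ A
          · simp only [hξ, indicator_of_mem]
            rw [← sq_abs (w ξ), ENNReal.ofReal_pow (abs_nonneg _)]
            gcongr
            exact le_abs_self _
          · simp [hξ]
        · exact eLpNorm_sym_le g

/-- Pointwise decay of approximate solutions with frequencies in an annulus, in terms of the
supremum of the Fourier transform. -/
lemma enorm_le_of_annulus {t K c : ℝ} (ht : 0 < t) (hK : 0 < K) (hc : 1 ≤ c)
    (P P₁ P₂ : Fin 4 → 𝓢(Space3, ℂ)) (μ : Fin 4) (x : Space3) {M : ℝ≥0∞}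
    (hP : ∀ κ, FourierVanish (annulus c K) (P κ)) (hP₁ : ∀ κ, FourierVanish (annulus c K) (P₁ κ))
    (hP₂ : ∀ κ, FourierVanish (annulus c K) (P₂ κ)) (hM : ∀ κ ξ, ‖𝓕 (P κ) ξ‖ₑ ≤ M)
    (hM₁ : ∀ κ ξ, ‖𝓕 (P₁ κ) ξ‖ₑ ≤ M) (hM₂ : ∀ κ ξ, ‖𝓕 (P₂ κ) ξ‖ₑ ≤ M) : ‖P μ x‖ₑ ≤
      ENNReal.ofReal (4096 * c ^ 4 * (K ^ 2 / t)) * M +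
      ENNReal.ofReal (4096 * c ^ 4 * (K * (√t)⁻¹)) *
        (errNorm l2 t P P₁ + errNorm l2 t P₁ P₂) := by
  refine enorm_le_of_halfVec P μ x fun s hs => ?_
  have hc0 : 0 < c := zero_lt_one.trans_le hc
  have hA := measurableSet_annulus c K
  have hAc := isClosed_annulus c K
  have hsq : (√t)⁻¹ ^ 2 = t⁻¹ := by rw [inv_pow, Real.sq_sqrt ht.le]
  set r : ℝ := 16 * c ^ 2 * (K * (√t)⁻¹) with hr
  have hr0 : 0 ≤ r := by positivity
  have hr2 : 256 * c ^ 4 * K ^ 2 / t = r ^ 2 := by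
    rw [hr, mul_pow, mul_pow, mul_pow, hsq]; ring
  have b0 := lintegral_annulus_wNear_le (x := x) hs hK ht hc
  have b1 := lintegral_annulus_wOne_le (x := x) hs hK ht hc
  have b2 := lintegral_annulus_wTwo_le (x := x) hs hK ht hc
  have b3 := lintegral_annulus_sq_wTwo_le (x := x) hs hK ht hc
  rw [hr2] at b1 b3
  set q := ENNReal.ofReal (256 * c ^ 4 * K ^ 2 / t) with hq
  have m0 := measurable_wNear x (s * t) K⁻¹
  have m1 := measurable_wOne x (s * t) K⁻¹
  have m2 := measurable_wTwo x (s * t) K⁻¹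
  have main := (halfWave_halfVec t P P₁ μ hs).enorm_osc_le (halfWave_halfVec t P₁ P₂ μ hs) x
    (inv_pos.2 hK)
  have hS1 := measurable_sym (halfVec P₁ μ s)
  have hS2 := measurable_sym (halfVec P₂ μ s)
  simp only [mul_add] at main
  rw [lintegral_add_left (by fun_prop), lintegral_add_left (by fun_prop),
    FourierVanish.lintegral_mul_sym hA (FourierVanish.halfVec hP μ s),
    FourierVanish.lintegral_mul_sym hA (FourierVanish.halfVec hP₁ μ s),
    FourierVanish.lintegral_mul_sym hA (FourierVanish.halfVec hP₂ μ s),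
    FourierVanish.lintegral_mul_sym hA (FourierVanish.halfErr hAc hP hP₁ μ s),
    FourierVanish.lintegral_mul_sym hA (FourierVanish.halfErr hAc hP₁ hP₂ μ s)] at main
  refine main.trans ?_
  have e1 := sum_halfErr_le isSeminorm_l2 t P P₁ μ hs
  have e2 := sum_halfErr_le isSeminorm_l2 t P₁ P₂ μ hs
  calc _ ≤ q * (4 * M) + ENNReal.ofReal r * (4 * errNorm l2 t P P₁) +
        (q * (4 * M) + q * (4 * M) + ENNReal.ofReal r * (4 * errNorm l2 t P₁ P₂)) := by
        gcongr
        · exact setLIntegral_mul_sym_le_sup m0 b0 (enorm_sym_halfVec_le hM μ hs)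
        · exact (setLIntegral_mul_sym_le_l2 hA hr0 m1 b1).trans (mul_le_mul_right e1 _)
        · exact setLIntegral_mul_sym_le_sup m2 b2 (enorm_sym_halfVec_le hM₁ μ hs)
        · exact setLIntegral_mul_sym_le_sup m2 b2 (enorm_sym_halfVec_le hM₂ μ hs)
        · exact (setLIntegral_mul_sym_le_l2 hA hr0 m2 b3).trans (mul_le_mul_right e2 _)
    _ = (12 * q) * M + (4 * ENNReal.ofReal r) * (errNorm l2 t P P₁ + errNorm l2 t P₁ P₂) := by ring
    _ ≤ _ := by
        have h12 : (12 : ℝ≥0∞) = ENNReal.ofReal 12 := by simp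
        have h4 : (4 : ℝ≥0∞) = ENNReal.ofReal 4 := by simp
        rw [hq, h12, h4, ← ENNReal.ofReal_mul (by norm_num), ← ENNReal.ofReal_mul (by norm_num)]
        have k1 : 12 * (256 * c ^ 4 * K ^ 2 / t) ≤ 4096 * c ^ 4 * (K ^ 2 / t) := by
          have : 0 ≤ c ^ 4 * (K ^ 2 / t) := by positivity
          calc _ = 3072 * (c ^ 4 * (K ^ 2 / t)) := by ring
            _ ≤ 4096 * (c ^ 4 * (K ^ 2 / t)) := by gcongr; norm_num
            _ = _ := by ring
        have k2 : 4 * r ≤ 4096 * c ^ 4 * (K * (√t)⁻¹) := by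
          have h24 : c ^ 2 ≤ c ^ 4 := pow_le_pow_right₀ hc (by norm_num)
          calc 4 * r = 64 * c ^ 2 * (K * (√t)⁻¹) := by rw [hr]; ring
            _ ≤ 4096 * c ^ 4 * (K * (√t)⁻¹) := by gcongr; norm_num
        exact add_le_add (mul_le_mul_left (ENNReal.ofReal_le_ofReal k1) _)
          (mul_le_mul_left (ENNReal.ofReal_le_ofReal k2) _)

end

section

/-! ### Cutoffs -/

/-- The partial derivative `∂_i` of functions on `ℝ³`. -/
def pd (i : Fin 3) (h : Space3 → ℂ) : Space3 → ℂ := fun y => fderiv ℝ h y (bas i)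

/-- A class `Θ` of Schwartz functions and a class `H` of smooth functions, closed under
derivatives, such that the elements of `Θ`, at any scale, cut off the elements of `H` to Schwartz
functions. -/
structure CutClass (Θ : 𝓢(Space3, ℂ) → Prop) (H : (Space3 → ℂ) → Prop) : Prop where
  sd_mem : ∀ θ i, Θ θ → Θ (sd i θ)
  sD_mem : ∀ θ, Θ θ → Θ (sD θ)
  differentiable : ∀ h, H h → Differentiable ℝ h
  pd_mem : ∀ h i, H h → H (pd i h)
  exists_cut : ∀ θ h, Θ θ → H h → ∀ ε : ℝ, 0 < ε → ∃ f : 𝓢(Space3, ℂ), ∀ y, f y = θ (ε • y) * h y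

open Classical in
/-- The function `θ(ε y) h(y)`, as a Schwartz function (and zero if it is not Schwartz). -/
def cut (θ : 𝓢(Space3, ℂ)) (ε : ℝ) (h : Space3 → ℂ) : 𝓢(Space3, ℂ) :=
  if H : ∃ f : 𝓢(Space3, ℂ), ∀ y, f y = θ (ε • y) * h y then H.choose else 0

lemma cut_eq {θ : 𝓢(Space3, ℂ)} {ε : ℝ} {h : Space3 → ℂ}
    (H : ∃ f : 𝓢(Space3, ℂ), ∀ y, f y = θ (ε • y) * h y) (y : Space3) :
    cut θ ε h y = θ (ε • y) * h y := by
  rw [cut, dif_pos H]; exact H.choose_spec y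

lemma norm_cut_le (θ : 𝓢(Space3, ℂ)) (ε : ℝ) (h : Space3 → ℂ) (y : Space3) :
    ‖cut θ ε h y‖ ≤ ‖θ (ε • y)‖ * ‖h y‖ := by
  by_cases H : ∃ f : 𝓢(Space3, ℂ), ∀ y, f y = θ (ε • y) * h y
  · rw [cut_eq H, norm_mul]
  · rw [cut, dif_neg H]; simp; positivity

/-- A bound of the absolute value of a Schwartz function. -/
def supB (θ : 𝓢(Space3, ℂ)) : ℝ := SchwartzMap.seminorm ℝ 0 0 θ

lemma norm_le_supB (θ : 𝓢(Space3, ℂ)) (y : Space3) : ‖θ y‖ ≤ supB θ :=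
  SchwartzMap.norm_le_seminorm ℝ θ y

lemma l2_cut_le (θ : 𝓢(Space3, ℂ)) (ε : ℝ) (h : Space3 → ℂ) :
    l2 (cut θ ε h) ≤ ENNReal.ofReal (supB θ) * eLpNorm h 2 volume := by
  refine eLpNorm_le_mul_eLpNorm_of_ae_le_mul (Filter.Eventually.of_forall fun y => ?_) 2
  exact (norm_cut_le θ ε h y).trans (by gcongr; exact norm_le_supB θ _)

open Filter in
lemma tendsto_l2_smul_cut (θ : 𝓢(Space3, ℂ)) {h : Space3 → ℂ} (hh : eLpNorm h 2 volume ≠ ⊤) :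
    Tendsto (fun ε : ℝ => l2 (ε • cut θ ε h)) (nhdsWithin 0 (Ioi 0)) (nhds 0) := by
  have h1 : Tendsto (fun ε : ℝ => ENNReal.ofReal |ε| *
      (ENNReal.ofReal (supB θ) * eLpNorm h 2 volume)) (nhdsWithin 0 (Ioi 0)) (nhds 0) := by
    have h2 : Tendsto (fun ε : ℝ => ENNReal.ofReal |ε|) (nhdsWithin 0 (Ioi 0)) (nhds 0) := by
      have : Continuous fun ε : ℝ => ENNReal.ofReal |ε| := ENNReal.continuous_ofReal.comp continuous_abs
      have h3 := this.tendsto 0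
      rw [abs_zero, ENNReal.ofReal_zero] at h3
      exact h3.mono_left nhdsWithin_le_nhds
    have h4 := ENNReal.Tendsto.mul_const h2 (b := ENNReal.ofReal (supB θ) * eLpNorm h 2 volume)
      (Or.inr (ENNReal.mul_ne_top ENNReal.ofReal_ne_top hh))
    rwa [zero_mul] at h4
  refine tendsto_of_tendsto_of_tendsto_of_le_of_le tendsto_const_nhds h1 (fun _ => zero_le) ?_
  intro ε
  beta_reduce
  rw [l2_smul, ← ofReal_norm ε, Real.norm_eq_abs]
  gcongr
  exact l2_cut_le θ ε h

open Filter in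
lemma tendsto_l2_cut {θ : 𝓢(Space3, ℂ)} (h0 : θ 0 = 0) {h : Space3 → ℂ} (hc : Continuous h)
    (hh : eLpNorm h 2 volume ≠ ⊤) :
    Tendsto (fun ε : ℝ => l2 (cut θ ε h)) (nhdsWithin 0 (Ioi 0)) (nhds 0) := by
  have e2 : ∀ g : Space3 → ℂ, eLpNorm g 2 volume = (∫⁻ y, ‖g y‖ₑ ^ 2) ^ (1 / 2 : ℝ) := by
    intro g
    rw [eLpNorm_eq_lintegral_rpow_enorm_toReal (by simp) (by simp)]
    simp
  have hfin : ∫⁻ y, ‖h y‖ₑ ^ 2 ≠ ⊤ := by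
    intro htop
    rw [e2, htop] at hh
    simp at hh
  have hθ := θ.continuous
  have key : Tendsto (fun ε : ℝ => ∫⁻ y, (‖θ (ε • y)‖ₑ * ‖h y‖ₑ) ^ 2) (nhdsWithin 0 (Ioi 0))
      (nhds (∫⁻ y : Space3, 0)) := by
    refine tendsto_lintegral_filter_of_dominated_convergence
      (fun y => ENNReal.ofReal (supB θ) ^ 2 * ‖h y‖ₑ ^ 2) ?_ ?_ ?_ ?_
    · exact Eventually.of_forall fun ε => by fun_prop
    · refine Eventually.of_forall fun ε => Eventually.of_forall fun y => ?_
      rw [mul_pow]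
      gcongr
      rw [← ofReal_norm]
      exact ENNReal.ofReal_le_ofReal (norm_le_supB θ _)
    · rw [lintegral_const_mul' _ _ (by simp)]
      exact ENNReal.mul_ne_top (by simp) hfin
    · refine Eventually.of_forall fun y => ?_
      have hcy : Continuous fun ε : ℝ => ‖θ (ε • y)‖ₑ := by fun_prop
      have h3 := hcy.tendsto 0
      rw [zero_smul, h0, enorm_zero] at h3
      have h4 := ENNReal.Tendsto.mul_const (h3.mono_left (nhdsWithin_le_nhds (s := Ioi (0:ℝ))))
        (b := ‖h y‖ₑ) (Or.inr enorm_ne_top)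
      have h5 := ENNReal.Tendsto.pow (n := 2) h4
      simpa using h5
  rw [lintegral_zero] at key
  have k2 := (ENNReal.continuous_rpow_const (y := (1 / 2 : ℝ))).continuousAt.tendsto.comp key
  rw [ENNReal.zero_rpow_of_pos (by norm_num)] at k2
  refine tendsto_of_tendsto_of_tendsto_of_le_of_le tendsto_const_nhds k2 (fun _ => zero_le) ?_
  intro ε
  beta_reduce
  rw [l2, e2]
  simp only [Function.comp]
  gcongr with y
  rw [← enorm_mul]
  have := norm_cut_le θ ε h y
  rw [← norm_mul] at this
  rw [← ofReal_norm, ← ofReal_norm]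
  exact ENNReal.ofReal_le_ofReal this

section CutClass

variable {Θ : 𝓢(Space3, ℂ) → Prop} {H : (Space3 → ℂ) → Prop} {θ : 𝓢(Space3, ℂ)}
  {h : Space3 → ℂ} {ε : ℝ}

lemma CutClass.cut_apply (hC : CutClass Θ H) (hθ : Θ θ) (hh : H h) (hε : 0 < ε) (y : Space3) :
    cut θ ε h y = θ (ε • y) * h y := cut_eq (hC.exists_cut θ h hθ hh ε hε) y

lemma hasFDerivAt_comp_smul (θ : 𝓢(Space3, ℂ)) (ε : ℝ) (y : Space3) :
    HasFDerivAt (fun y : Space3 => θ (ε • y))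
      ((fderiv ℝ θ (ε • y)).comp (ε • ContinuousLinearMap.id ℝ Space3)) y :=
  (θ.hasFDerivAt (ε • y)).comp y ((hasFDerivAt_id y).const_smul ε)

lemma CutClass.sd_cut (hC : CutClass Θ H) (hθ : Θ θ) (hh : H h) (hε : 0 < ε) (i : Fin 3) :
    sd i (cut θ ε h) = ε • cut (sd i θ) ε h + cut θ ε (pd i h) := by
  ext y
  rw [sd_apply, funext (hC.cut_apply hθ hh hε), add_apply, smul_apply,
    hC.cut_apply (hC.sd_mem θ i hθ) hh hε, hC.cut_apply hθ (hC.pd_mem h i hh) hε, sd_apply,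
    ((hasFDerivAt_comp_smul θ ε y).fun_mul (hC.differentiable h hh y).hasFDerivAt).fderiv]
  simp [pd]
  ring

/-- A bound for a Schwartz function and its derivatives. -/
def supTwo (θ : 𝓢(Space3, ℂ)) : ℝ≥0∞ := ENNReal.ofReal (supB θ) +
  ∑ i, ENNReal.ofReal (supB (sd i θ)) + ∑ i, ENNReal.ofReal (supB (sd i (sd i θ)))

lemma supTwo_ne_top (θ : 𝓢(Space3, ℂ)) : supTwo θ ≠ ⊤ := by
  simp [supTwo, Fin.sum_univ_three]

lemma l2_cut_le_supTwo (θ : 𝓢(Space3, ℂ)) (ε : ℝ) (h : Space3 → ℂ) :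
    l2 (cut θ ε h) ≤ supTwo θ * eLpNorm h 2 volume :=
  (l2_cut_le θ ε h).trans (by gcongr; exact le_self_add.trans le_self_add)

lemma l2_smul_le {ε : ℝ} (hε : 0 < ε) (hε1 : ε ≤ 1) (f : 𝓢(Space3, ℂ)) : l2 (ε • f) ≤ l2 f := by
  rw [l2_smul]
  refine mul_le_of_le_one_left zero_le ?_
  rw [← ofReal_norm, Real.norm_of_nonneg hε.le]
  exact ENNReal.ofReal_le_one.2 hε1

lemma l2_cut_sd_le (θ : 𝓢(Space3, ℂ)) (i : Fin 3) (ε : ℝ) (h : Space3 → ℂ) :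
    l2 (cut (sd i θ) ε h) ≤ supTwo θ * eLpNorm h 2 volume := by
  refine (l2_cut_le _ ε h).trans ?_
  gcongr
  refine le_trans ?_ le_self_add
  refine le_trans ?_ le_add_self
  exact Finset.single_le_sum (f := fun i => ENNReal.ofReal (supB (sd i θ))) (fun _ _ => zero_le)
    (Finset.mem_univ i)

lemma l2_cut_sd_sd_le (θ : 𝓢(Space3, ℂ)) (i : Fin 3) (ε : ℝ) (h : Space3 → ℂ) :
    l2 (cut (sd i (sd i θ)) ε h) ≤ supTwo θ * eLpNorm h 2 volume := by
  refine (l2_cut_le _ ε h).trans ?_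
  gcongr
  refine le_trans ?_ le_add_self
  exact Finset.single_le_sum (f := fun i => ENNReal.ofReal (supB (sd i (sd i θ))))
    (fun _ _ => zero_le) (Finset.mem_univ i)

lemma CutClass.h1_cut_le (hC : CutClass Θ H) (hθ : Θ θ) (hh : H h) (hε : 0 < ε) (hε1 : ε ≤ 1) :
    h1 (cut θ ε h) ≤ 4 * supTwo θ *
      (eLpNorm h 2 volume + ∑ i, eLpNorm (pd i h) 2 volume) := by
  have hb : ∀ i, l2 (sd i (cut θ ε h)) ≤
      supTwo θ * (eLpNorm h 2 volume + eLpNorm (pd i h) 2 volume) := by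
    intro i
    rw [hC.sd_cut hθ hh hε, mul_add]
    refine (l2_add_le _ _).trans (add_le_add ((l2_smul_le hε hε1 _).trans ?_) ?_)
    · exact l2_cut_sd_le θ i ε h
    · exact l2_cut_le_supTwo θ ε _
  calc h1 (cut θ ε h) ≤ supTwo θ * eLpNorm h 2 volume +
        ∑ i, supTwo θ * (eLpNorm h 2 volume + eLpNorm (pd i h) 2 volume) := by
        unfold h1
        gcongr with i
        · exact l2_cut_le_supTwo θ ε h
        · exact hb i
    _ = supTwo θ * (4 * eLpNorm h 2 volume + ∑ i, eLpNorm (pd i h) 2 volume) := by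
        rw [← Finset.mul_sum, Finset.sum_add_distrib]
        simp only [Finset.sum_const, Finset.card_univ, Fintype.card_fin, nsmul_eq_mul]
        push_cast
        ring
    _ ≤ supTwo θ * (4 * eLpNorm h 2 volume + 4 * ∑ i, eLpNorm (pd i h) 2 volume) := by
        gcongr
        exact le_mul_of_one_le_left zero_le (by norm_num)
    _ = _ := by ring

lemma CutClass.h2_cut_le (hC : CutClass Θ H) (hθ : Θ θ) (hh : H h) (hε : 0 < ε) (hε1 : ε ≤ 1) :
    h2 (cut θ ε h) ≤ 4 * supTwo θ * (eLpNorm h 2 volume + ∑ i, eLpNorm (pd i h) 2 volume +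
      ∑ i, eLpNorm (pd i (pd i h)) 2 volume) := by
  have hb : ∀ i, l2 (sd i (sd i (cut θ ε h))) ≤ supTwo θ * (eLpNorm h 2 volume +
      2 * eLpNorm (pd i h) 2 volume + eLpNorm (pd i (pd i h)) 2 volume) := by
    intro i
    rw [hC.sd_cut hθ hh hε, sd_add, sd_smul, hC.sd_cut (hC.sd_mem θ i hθ) hh hε,
      hC.sd_cut hθ (hC.pd_mem h i hh) hε]
    calc _ ≤ (l2 (cut (sd i (sd i θ)) ε h) + l2 (cut (sd i θ) ε (pd i h))) +
          (l2 (cut (sd i θ) ε (pd i h)) + l2 (cut θ ε (pd i (pd i h)))) := by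
          refine (l2_add_le _ _).trans (add_le_add ((l2_smul_le hε hε1 _).trans
            ((l2_add_le _ _).trans ?_)) ((l2_add_le _ _).trans ?_))
          · gcongr; exact l2_smul_le hε hε1 _
          · gcongr; exact l2_smul_le hε hε1 _
      _ ≤ (supTwo θ * eLpNorm h 2 volume + supTwo θ * eLpNorm (pd i h) 2 volume) +
          (supTwo θ * eLpNorm (pd i h) 2 volume + supTwo θ * eLpNorm (pd i (pd i h)) 2 volume) := by
          gcongr
          · exact l2_cut_sd_sd_le θ i ε h
          · exact l2_cut_sd_le θ i ε _
          · exact l2_cut_sd_le θ i ε _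
          · exact l2_cut_le_supTwo θ ε _
      _ = _ := by ring
  calc h2 (cut θ ε h) ≤ supTwo θ * eLpNorm h 2 volume +
        ∑ i, supTwo θ * (eLpNorm h 2 volume +
      2 * eLpNorm (pd i h) 2 volume + eLpNorm (pd i (pd i h)) 2 volume) := by
        unfold h2
        gcongr with i
        · exact l2_cut_le_supTwo θ ε h
        · exact hb i
    _ = supTwo θ * (4 * eLpNorm h 2 volume + 2 * ∑ i, eLpNorm (pd i h) 2 volume +
          1 * ∑ i, eLpNorm (pd i (pd i h)) 2 volume) := by
        rw [← Finset.mul_sum, Finset.sum_add_distrib, Finset.sum_add_distrib, ← Finset.mul_sum]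
        simp only [Finset.sum_const, Finset.card_univ, Fintype.card_fin, nsmul_eq_mul]
        push_cast
        ring
    _ ≤ supTwo θ * (4 * eLpNorm h 2 volume + 4 * ∑ i, eLpNorm (pd i h) 2 volume +
          4 * ∑ i, eLpNorm (pd i (pd i h)) 2 volume) := by
        gcongr <;> norm_num
    _ = _ := by ring

open Filter in
lemma tendsto_zero_of_le {F G : ℝ → ℝ≥0∞} (hG : Tendsto G (nhdsWithin 0 (Ioi 0)) (nhds 0))
    (h : ∀ ε, 0 < ε → F ε ≤ G ε) : Tendsto F (nhdsWithin 0 (Ioi 0)) (nhds 0) :=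
  tendsto_of_tendsto_of_tendsto_of_le_of_le' tendsto_const_nhds hG
    (Eventually.of_forall fun _ => zero_le)
    (by filter_upwards [self_mem_nhdsWithin] with ε hε using h ε hε)

open Filter in
lemma CutClass.tendsto_h1_cut (hC : CutClass Θ H) (hθ : Θ θ) (h0 : θ 0 = 0) (hh : H h)
    (hn : eLpNorm h 2 volume ≠ ⊤) (hn' : ∀ i, eLpNorm (pd i h) 2 volume ≠ ⊤) :
    Tendsto (fun ε : ℝ => h1 (cut θ ε h)) (nhdsWithin 0 (Ioi 0)) (nhds 0) := by
  have hG : Tendsto (fun ε : ℝ => l2 (cut θ ε h) + ∑ i, (l2 (ε • cut (sd i θ) ε h) +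
      l2 (cut θ ε (pd i h)))) (nhdsWithin 0 (Ioi 0)) (nhds (0 + ∑ _i : Fin 3, (0 + 0))) := by
    refine (tendsto_l2_cut h0 (hC.differentiable h hh).continuous hn).add
      (tendsto_finsetSum _ fun i _ => (tendsto_l2_smul_cut _ hn).add
        (tendsto_l2_cut h0 (hC.differentiable _ (hC.pd_mem h i hh)).continuous (hn' i)))
  simp only [add_zero, Finset.sum_const_zero] at hG
  refine tendsto_zero_of_le hG fun ε hε => ?_
  unfold h1
  gcongr with i
  rw [hC.sd_cut hθ hh hε]
  exact l2_add_le _ _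

open Filter in
lemma CutClass.tendsto_h1_smul_cut (hC : CutClass Θ H) (hθ : Θ θ) (hh : H h)
    (hn : eLpNorm h 2 volume ≠ ⊤) (hn' : ∀ i, eLpNorm (pd i h) 2 volume ≠ ⊤) :
    Tendsto (fun ε : ℝ => h1 (ε • cut θ ε h)) (nhdsWithin 0 (Ioi 0)) (nhds 0) := by
  have hε : Tendsto (fun ε : ℝ => ENNReal.ofReal |ε|) (nhdsWithin 0 (Ioi 0)) (nhds 0) := by
    have : Continuous fun ε : ℝ => ENNReal.ofReal |ε| :=
      ENNReal.continuous_ofReal.comp continuous_abs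
    have h3 := this.tendsto 0
    rw [abs_zero, ENNReal.ofReal_zero] at h3
    exact h3.mono_left nhdsWithin_le_nhds
  have hfin : 4 * supTwo θ * (eLpNorm h 2 volume + ∑ i, eLpNorm (pd i h) 2 volume) ≠ ⊤ := by
    refine ENNReal.mul_ne_top (ENNReal.mul_ne_top (by simp) (supTwo_ne_top θ)) ?_
    simp [Fin.sum_univ_three, hn, hn']
  have hG := ENNReal.Tendsto.mul_const hε (Or.inr hfin)
  rw [zero_mul] at hG
  refine tendsto_of_tendsto_of_tendsto_of_le_of_le' tendsto_const_nhds hG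
    (Eventually.of_forall fun _ => zero_le) ?_
  filter_upwards [Ioo_mem_nhdsGT (zero_lt_one (α := ℝ))] with ε hε1
  rw [isSeminorm_h1.smul, ← ofReal_norm, Real.norm_eq_abs]
  gcongr
  exact hC.h1_cut_le hθ hh hε1.1 hε1.2.le

/-! ### Cut off solutions -/

/-- The relations between the spacetime gradient `h` of a solution `φ` of `□φ = f` and the
spacetime gradient `k` of `Sφ`, at time `t`. -/
structure ScalRel (t : ℝ) (h k : Fin 4 → Space3 → ℂ) (f : Space3 → ℂ) : Prop where
  zero : ∀ y, k 0 y = h 0 y + t * (∑ j : Fin 3, pd j (h j.succ) y - f y) +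
    ∑ i, (y i : ℂ) * pd i (h 0) y
  succ : ∀ (j : Fin 3) y, k j.succ y = h j.succ y + t * pd j (h 0) y +
    ∑ i, (y i : ℂ) * pd i (h j.succ) y
  curl : ∀ i j : Fin 3, pd i (h j.succ) = pd j (h i.succ)

/-- The part of the defects caused by the cutoff `χ`. -/
def cutErr (N : 𝓢(Space3, ℂ) → ℝ≥0∞) (t : ℝ) (χ : 𝓢(Space3, ℂ)) (h : Fin 4 → Space3 → ℂ)
    (ε : ℝ) : ℝ≥0∞ :=
  ∑ μ, N (cut (sD χ) ε (h μ)) + 22 * (‖t‖ₑ * ∑ i, ∑ μ, N (ε • cut (sd i χ) ε (h μ)))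

variable {t : ℝ} {h k : Fin 4 → Space3 → ℂ} {f : Space3 → ℂ} {χ : 𝓢(Space3, ℂ)}

lemma CutClass.sd_cut_apply (hC : CutClass Θ H) (hχ : Θ χ) {h : Space3 → ℂ} (hh : H h)
    (hε : 0 < ε) (i : Fin 3) (y : Space3) : fderiv ℝ (cut χ ε h) y (bas i) =
      ε * (sd i χ (ε • y) * h y) + χ (ε • y) * pd i h y := by
  rw [← sd_apply, hC.sd_cut hχ hh hε, add_apply, smul_apply, hC.cut_apply (hC.sd_mem _ i hχ) hh hε,
    hC.cut_apply hχ (hC.pd_mem h i hh) hε, Complex.real_smul]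

lemma CutClass.scalErr_cut_zero (hC : CutClass Θ H) (hχ : Θ χ) (hh : ∀ μ, H (h μ))
    (hk : ∀ μ, H (k μ)) (hf : H f) (hε : 0 < ε) (hr : ScalRel t h k f) :
    scalErr t (fun μ => cut χ ε (h μ)) (fun μ => cut χ ε (k μ)) 0 =
      t • cut χ ε f + cut (sD χ) ε (h 0) + ∑ j, t • ε • cut (sd j χ) ε (h j.succ) := by
  ext y
  simp only [scalErr, Fin.cases_zero, add_apply, sub_apply, smul_apply,
    sD_apply, sd_apply, hC.cut_apply hχ (hh _) hε, hC.cut_apply hχ (hk _) hε,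
    hC.cut_apply hχ hf hε, hC.cut_apply (hC.sD_mem _ hχ) (hh _) hε,
    hC.cut_apply (hC.sd_mem _ _ hχ) (hh _) hε, hC.sd_cut_apply hχ (hh _) hε, Complex.real_smul,
    hr.zero y, Fin.sum_univ_three, PiLp.smul_apply, smul_eq_mul, Complex.ofReal_mul]
  ring

lemma CutClass.scalErr_cut_succ (hC : CutClass Θ H) (hχ : Θ χ) (hh : ∀ μ, H (h μ))
    (hk : ∀ μ, H (k μ)) (hε : 0 < ε) (hr : ScalRel t h k f) (j : Fin 3) :
    scalErr t (fun μ => cut χ ε (h μ)) (fun μ => cut χ ε (k μ)) j.succ =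
      cut (sD χ) ε (h j.succ) + t • ε • cut (sd j χ) ε (h 0) := by
  ext y
  simp only [scalErr, Fin.cases_succ, add_apply, sub_apply, smul_apply,
    sD_apply, sd_apply, hC.cut_apply hχ (hh _) hε, hC.cut_apply hχ (hk _) hε,
    hC.cut_apply (hC.sD_mem _ hχ) (hh _) hε,
    hC.cut_apply (hC.sd_mem _ _ hχ) (hh _) hε, hC.sd_cut_apply hχ (hh _) hε, Complex.real_smul,
    hr.succ j y, Fin.sum_univ_three, PiLp.smul_apply, smul_eq_mul, Complex.ofReal_mul]
  ring

lemma CutClass.curl_cut (hC : CutClass Θ H) (hχ : Θ χ) (hh : ∀ μ, H (h μ))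
    (hε : 0 < ε) (hr : ScalRel t h k f) (i j : Fin 3) :
    curl (fun μ => cut χ ε (h μ)) i j =
      ε • cut (sd i χ) ε (h j.succ) + (-1 : ℝ) • ε • cut (sd j χ) ε (h i.succ) := by
  ext y
  have := congrFun (hr.curl i j) y
  simp only [curl, add_apply, sub_apply, smul_apply, sd_apply,
    hC.cut_apply (hC.sd_mem _ _ hχ) (hh _) hε, hC.sd_cut_apply hχ (hh _) hε, Complex.real_smul,
    this]
  push_cast
  ring

/-- The defects of a cut off solution are its inhomogeneity and the errors of the cutoff. -/
lemma CutClass.errNorm_le (hC : CutClass Θ H) {N : 𝓢(Space3, ℂ) → ℝ≥0∞} (hN : IsSeminorm N)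
    (hχ : Θ χ) (hh : ∀ μ, H (h μ)) (hk : ∀ μ, H (k μ)) (hf : H f) (hε : 0 < ε)
    (hr : ScalRel t h k f) :
    errNorm N t (fun μ => cut χ ε (h μ)) (fun μ => cut χ ε (k μ)) ≤
      ‖t‖ₑ * N (cut χ ε f) + cutErr N t χ h ε := by
  set X : ℝ≥0∞ := ∑ i, ∑ μ, N (ε • cut (sd i χ) ε (h μ)) with hX
  have hle : ∀ i μ, N (ε • cut (sd i χ) ε (h μ)) ≤ X := fun i μ =>
    (Finset.single_le_sum (f := fun μ => N (ε • cut (sd i χ) ε (h μ))) (fun _ _ => zero_le)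
      (Finset.mem_univ μ)).trans
    (Finset.single_le_sum (f := fun i => ∑ μ, N (ε • cut (sd i χ) ε (h μ))) (fun _ _ => zero_le)
      (Finset.mem_univ i))
  have hle0 : ∑ j : Fin 3, N (ε • cut (sd j χ) ε (h j.succ)) ≤ X :=
    Finset.sum_le_sum fun j _ => Finset.single_le_sum
      (f := fun μ => N (ε • cut (sd j χ) ε (h μ))) (fun _ _ => zero_le) (Finset.mem_univ j.succ)
  have hsum : ∀ F : Fin 3 → 𝓢(Space3, ℂ), N (∑ i, F i) ≤ ∑ i, N (F i) := by
    intro F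
    rw [Fin.sum_univ_three, Fin.sum_univ_three]
    refine (hN.add_le _ _).trans ?_
    gcongr
    exact hN.add_le _ _
  have c0 : N (scalErr t (fun μ => cut χ ε (h μ)) (fun μ => cut χ ε (k μ)) 0) ≤
      ‖t‖ₑ * N (cut χ ε f) + N (cut (sD χ) ε (h 0)) + ‖t‖ₑ * X := by
    rw [hC.scalErr_cut_zero hχ hh hk hf hε hr]
    refine (hN.add_le _ _).trans (add_le_add ((hN.add_le _ _).trans ?_) ((hsum _).trans ?_))
    · rw [hN.smul]
    · simp only [hN.smul t, ← Finset.mul_sum]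
      gcongr
  have cs : ∀ j : Fin 3, N (scalErr t (fun μ => cut χ ε (h μ)) (fun μ => cut χ ε (k μ)) j.succ) ≤
      N (cut (sD χ) ε (h j.succ)) + ‖t‖ₑ * X := by
    intro j
    rw [hC.scalErr_cut_succ hχ hh hk hε hr]
    refine (hN.add_le _ _).trans ?_
    gcongr
    rw [hN.smul t]
    gcongr
    exact hle j 0
  have cc : ∀ i j : Fin 3, N (WaveDecay.curl (fun μ => cut χ ε (h μ)) i j) ≤ 2 * X := by
    intro i j
    rw [hC.curl_cut hχ hh hε hr, two_mul]
    refine (hN.add_le _ _).trans (add_le_add (hle i _) ?_)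
    rw [hN.sign (Or.inr rfl)]
    exact hle j _
  rw [errNorm, cutErr, ← hX, Fin.sum_univ_succ, Fin.sum_univ_succ (n := 3)]
  calc _ ≤ (‖t‖ₑ * N (cut χ ε f) + N (cut (sD χ) ε (h 0)) + ‖t‖ₑ * X +
        ∑ j : Fin 3, (N (cut (sD χ) ε (h j.succ)) + ‖t‖ₑ * X)) +
        ∑ _i : Fin 3, ∑ _j : Fin 3, ‖t‖ₑ * (2 * X) := by
        gcongr with j _ i _ j
        · exact cs j
        · exact cc i j
    _ = _ := by
        rw [Finset.sum_add_distrib]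
        simp only [Finset.sum_const, Finset.card_univ, Fintype.card_fin, nsmul_eq_mul]
        push_cast
        ring

open Filter in
lemma tendsto_cutErr {N : 𝓢(Space3, ℂ) → ℝ≥0∞}
    (h1 : ∀ μ, Tendsto (fun ε => N (cut (sD χ) ε (h μ))) (nhdsWithin 0 (Ioi 0)) (nhds 0))
    (h2 : ∀ i μ, Tendsto (fun ε => N (ε • cut (sd i χ) ε (h μ))) (nhdsWithin 0 (Ioi 0)) (nhds 0)) :
    Tendsto (cutErr N t χ h) (nhdsWithin 0 (Ioi 0)) (nhds 0) := by
  have a1 := tendsto_finsetSum Finset.univ fun μ _ => h1 μ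
  have a2 := tendsto_finsetSum Finset.univ fun i _ =>
    tendsto_finsetSum Finset.univ fun μ _ => h2 i μ
  simp only [Finset.sum_const_zero] at a1 a2
  have a3 := ENNReal.Tendsto.const_mul (a := 22)
    (ENNReal.Tendsto.const_mul (a := ‖t‖ₑ) a2 (Or.inr enorm_ne_top)) (Or.inr (by simp))
  have a4 := a1.add a3
  rw [mul_zero, mul_zero, add_zero] at a4
  exact a4

lemma sD_zero (χ : 𝓢(Space3, ℂ)) : sD χ 0 = 0 := by
  rw [sD_apply]; simp

end CutClass

end

section

/-! ### Calculus on the slab -/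

variable {a b : ℝ} {ψ ψ' φ f : ℝ × Space3 → ℂ}

/-- Smoothness on the slab. -/
def SlabSmooth (a b : ℝ) (ψ : ℝ × Space3 → ℂ) : Prop := ContDiffOn ℝ ∞ ψ (slab a b)

/-- The derivative of `ψ` in the spacetime direction `v`. -/
def dirD (v : ℝ × Space3) (ψ : ℝ × Space3 → ℂ) : ℝ × Space3 → ℂ := fun p => fderiv ℝ ψ p v

lemma dt_eq_dirD : dt ψ = dirD (1, 0) ψ := rfl

lemma dx_eq_dirD (i : Fin 3) : dx i ψ = dirD (0, bas i) ψ := rfl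

lemma grad_eq_dirD (μ : Fin 4) : ∃ v, ∀ ψ, grad μ ψ = dirD v ψ := by
  refine Fin.cases ⟨(1, 0), fun ψ => rfl⟩ (fun i => ⟨(0, bas i), fun ψ => rfl⟩) μ

lemma isOpen_slab (a b : ℝ) : IsOpen (slab a b) := isOpen_Ioo.prod isOpen_univ

lemma mem_slab {t : ℝ} (ht : t ∈ Ioo a b) (x : Space3) : (t, x) ∈ slab a b := ⟨ht, mem_univ x⟩

lemma SlabSmooth.contDiffAt (h : SlabSmooth a b ψ) {p : ℝ × Space3} (hp : p ∈ slab a b) :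
    ContDiffAt ℝ ∞ ψ p := ContDiffOn.contDiffAt h ((isOpen_slab a b).mem_nhds hp)

lemma SlabSmooth.differentiableAt (h : SlabSmooth a b ψ) {p : ℝ × Space3} (hp : p ∈ slab a b) :
    DifferentiableAt ℝ ψ p := (h.contDiffAt hp).differentiableAt (by simp)

lemma SlabSmooth.fderiv (h : SlabSmooth a b ψ) : ContDiffOn ℝ ∞ (fderiv ℝ ψ) (slab a b) :=
  ContDiffOn.fderiv_of_isOpen h (isOpen_slab a b) (by simp)

lemma SlabSmooth.dirD (h : SlabSmooth a b ψ) (v : ℝ × Space3) : SlabSmooth a b (dirD v ψ) :=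
  h.fderiv.clm_apply contDiffOn_const

lemma SlabSmooth.congr (h : SlabSmooth a b ψ) (he : EqOn ψ' ψ (slab a b)) : SlabSmooth a b ψ' :=
  ContDiffOn.congr h he

lemma dirD_congr (v : ℝ × Space3) (he : EqOn ψ' ψ (slab a b)) :
    EqOn (dirD v ψ') (dirD v ψ) (slab a b) := fun p hp => by
  have : ψ' =ᶠ[nhds p] ψ := he.eventuallyEq_of_mem ((isOpen_slab a b).mem_nhds hp)
  rw [dirD, this.fderiv_eq, dirD]

lemma sum_smul_bas (x : Space3) : ∑ i, x i • bas i = x := by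
  ext j; simp [bas, Pi.single_apply]

/-- The scaling field is the derivative in the direction of the point itself. -/
lemma scaling_eq_fderiv (ψ : ℝ × Space3 → ℂ) (p : ℝ × Space3) : scaling ψ p = fderiv ℝ ψ p p := by
  have hp : p = p.1 • ((1 : ℝ), (0 : Space3)) + ∑ i, p.2 i • ((0 : ℝ), bas i) := by
    refine Prod.ext ?_ ?_
    · simp [Prod.fst_sum]
    · simp [Prod.snd_sum, sum_smul_bas]
  conv_rhs => rw [show fderiv ℝ ψ p p = fderiv ℝ ψ p (p.1 • ((1 : ℝ), (0 : Space3)) +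
    ∑ i, p.2 i • ((0 : ℝ), bas i)) by rw [← hp]]
  rw [map_add, map_sum, map_smul]
  simp only [map_smul, Complex.real_smul]
  rfl

lemma SlabSmooth.scaling (h : SlabSmooth a b ψ) : SlabSmooth a b (scaling ψ) := by
  rw [show WaveDecay.scaling ψ = fun p => _root_.fderiv ℝ ψ p p from
    funext (scaling_eq_fderiv ψ)]
  exact h.fderiv.clm_apply contDiffOn_id

lemma SlabSmooth.gam (h : SlabSmooth a b ψ) (Z : Option (Fin 3)) : SlabSmooth a b (gam Z ψ) := by
  cases Z with
  | none => exact h.scaling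
  | some i => exact h.dirD _

lemma SlabSmooth.gamWord (h : SlabSmooth a b ψ) (w : List (Option (Fin 3))) :
    SlabSmooth a b (gamWord w ψ) := by
  induction w with
  | nil => exact h
  | cons Z w ih => exact ih.gam Z

lemma SlabSmooth.grad (h : SlabSmooth a b ψ) (μ : Fin 4) : SlabSmooth a b (grad μ ψ) := by
  obtain ⟨v, hv⟩ := grad_eq_dirD μ
  rw [hv]; exact h.dirD v

lemma SlabSmooth.hasFDerivAt_fderiv_apply (h : SlabSmooth a b ψ) {p : ℝ × Space3}
    (hp : p ∈ slab a b) (v w : ℝ × Space3) :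
    WaveDecay.dirD v (WaveDecay.dirD w ψ) p = _root_.fderiv ℝ (_root_.fderiv ℝ ψ) p v w := by
  have h1 : DifferentiableAt ℝ (_root_.fderiv ℝ ψ) p :=
    (h.fderiv.contDiffAt ((isOpen_slab a b).mem_nhds hp)).differentiableAt (by simp)
  have h2 := h1.hasFDerivAt.clm_apply (hasFDerivAt_const w p)
  unfold WaveDecay.dirD
  rw [h2.fderiv]
  simp

lemma SlabSmooth.snd_fderiv_symm (h : SlabSmooth a b ψ) {p : ℝ × Space3} (hp : p ∈ slab a b)
    (v w : ℝ × Space3) :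
    _root_.fderiv ℝ (_root_.fderiv ℝ ψ) p v w = _root_.fderiv ℝ (_root_.fderiv ℝ ψ) p w v :=
  ((h.contDiffAt hp).isSymmSndFDerivAt (by
    rw [minSmoothness_of_isRCLikeNormedField]
    exact WithTop.coe_le_coe.2 (le_top : (2 : ℕ∞) ≤ ⊤))).eq v w

lemma SlabSmooth.dirD_comm (h : SlabSmooth a b ψ) (v w : ℝ × Space3) :
    EqOn (WaveDecay.dirD v (WaveDecay.dirD w ψ)) (WaveDecay.dirD w (WaveDecay.dirD v ψ))
      (slab a b) := fun p hp => by
  rw [h.hasFDerivAt_fderiv_apply hp, h.hasFDerivAt_fderiv_apply hp, h.snd_fderiv_symm hp]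

/-- The commutator `[∂_v, S] = ∂_v`. -/
lemma SlabSmooth.dirD_scaling (h : SlabSmooth a b ψ) (v : ℝ × Space3) :
    EqOn (WaveDecay.dirD v (WaveDecay.scaling ψ))
      (fun p => WaveDecay.scaling (WaveDecay.dirD v ψ) p + WaveDecay.dirD v ψ p) (slab a b) := by
  intro p hp
  have h1 : DifferentiableAt ℝ (_root_.fderiv ℝ ψ) p :=
    (h.fderiv.contDiffAt ((isOpen_slab a b).mem_nhds hp)).differentiableAt (by simp)
  have h2 := h1.hasFDerivAt.clm_apply (hasFDerivAt_id p)
  beta_reduce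
  rw [scaling_eq_fderiv]
  have h3 := h.hasFDerivAt_fderiv_apply hp p v
  have h4 : _root_.fderiv ℝ (WaveDecay.dirD v ψ) p p = WaveDecay.dirD p (WaveDecay.dirD v ψ) p := rfl
  rw [h4, h3, h.snd_fderiv_symm hp]
  rw [WaveDecay.dirD, show WaveDecay.scaling ψ = fun p => _root_.fderiv ℝ ψ p p from
    funext (scaling_eq_fderiv ψ)]
  simp only [id] at h2
  rw [h2.fderiv]
  simp [WaveDecay.dirD, add_comm]

lemma SlabSmooth.dirD_add (h : SlabSmooth a b ψ) (h' : SlabSmooth a b ψ') (v : ℝ × Space3) :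
    EqOn (WaveDecay.dirD v fun p => ψ p + ψ' p)
      (fun p => WaveDecay.dirD v ψ p + WaveDecay.dirD v ψ' p) (slab a b) := fun p hp => by
  simp only [WaveDecay.dirD]
  rw [fderiv_fun_add (h.differentiableAt hp) (h'.differentiableAt hp)]
  simp

lemma SlabSmooth.dirD_dirD_scaling (h : SlabSmooth a b ψ) (v : ℝ × Space3) :
    EqOn (WaveDecay.dirD v (WaveDecay.dirD v (WaveDecay.scaling ψ)))
      (fun p => WaveDecay.scaling (WaveDecay.dirD v (WaveDecay.dirD v ψ)) p +
        2 * WaveDecay.dirD v (WaveDecay.dirD v ψ) p) (slab a b) := by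
  intro p hp
  rw [dirD_congr v (h.dirD_scaling v) hp, ((h.dirD v).scaling.dirD_add (h.dirD v) v) hp]
  beta_reduce
  rw [(h.dirD v).dirD_scaling v hp]
  ring

lemma SlabSmooth.box (h : SlabSmooth a b ψ) : SlabSmooth a b (box ψ) := by
  have h1 := (h.dirD (1, 0)).dirD (1, 0)
  have h2 := fun i : Fin 3 => (h.dirD (0, bas i)).dirD (0, bas i)
  exact ContDiffOn.add (ContDiffOn.neg h1) (ContDiffOn.sum fun i _ => h2 i)

/-- The commutator `[□, S] = 2□`. -/
lemma SlabSmooth.box_scaling (h : SlabSmooth a b ψ) :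
    EqOn (WaveDecay.box (WaveDecay.scaling ψ))
      (fun p => WaveDecay.scaling (WaveDecay.box ψ) p + 2 * WaveDecay.box ψ p) (slab a b) := by
  intro p hp
  have h1 := ((h.dirD (1, 0)).dirD (1, 0)).differentiableAt hp
  have h2 := fun i : Fin 3 => ((h.dirD (0, bas i)).dirD (0, bas i)).differentiableAt hp
  have hb : HasFDerivAt (WaveDecay.box ψ) (-_root_.fderiv ℝ (dt (dt ψ)) p +
      ∑ i, _root_.fderiv ℝ (dx i (dx i ψ)) p) p :=
    h1.hasFDerivAt.fun_neg.fun_add (HasFDerivAt.fun_sum fun i _ => (h2 i).hasFDerivAt)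
  have e1 := h.dirD_dirD_scaling (1, 0) hp
  have e2 := fun i : Fin 3 => h.dirD_dirD_scaling (0, bas i) hp
  beta_reduce at e1 e2 ⊢
  rw [scaling_eq_fderiv (WaveDecay.box ψ), hb.fderiv]
  simp only [WaveDecay.box, dt_eq_dirD, dx_eq_dirD, e1, e2, scaling_eq_fderiv,
    Fin.sum_univ_three]
  simp
  ring

/-! ### Time slices -/

lemma SlabSmooth.slice (h : SlabSmooth a b ψ) {t : ℝ} (ht : t ∈ Ioo a b) :
    ContDiff ℝ ∞ (fun x => ψ (t, x)) := by
  rw [contDiff_iff_contDiffAt]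
  intro x
  exact (h.contDiffAt (mem_slab ht x)).comp x (by fun_prop)

lemma SlabSmooth.pd_slice (h : SlabSmooth a b ψ) {t : ℝ} (ht : t ∈ Ioo a b) (i : Fin 3) :
    pd i (fun x => ψ (t, x)) = fun x => dx i ψ (t, x) := by
  ext x
  have h1 : HasFDerivAt (fun x : Space3 => (t, x)) (ContinuousLinearMap.inr ℝ ℝ Space3) x :=
    hasFDerivAt_prodMk_right t x
  have h2 := (h.differentiableAt (mem_slab ht x)).hasFDerivAt.comp x h1
  rw [pd, show (fun x => ψ (t, x)) = ψ ∘ (fun x : Space3 => (t, x)) from rfl, h2.fderiv]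
  rfl

lemma IsSmoothSolution.smooth (h : IsSmoothSolution a b φ f) : SlabSmooth a b φ := h.1

lemma IsSmoothSolution.smooth_rhs (h : IsSmoothSolution a b φ f) : SlabSmooth a b f :=
  h.smooth.box.congr fun p hp => (h.2 p hp).symm

/-- If `□φ = f` then `□Sφ = Sf + 2f`. -/
lemma IsSmoothSolution.scaling (h : IsSmoothSolution a b φ f) :
    IsSmoothSolution a b (scaling φ) (fun p => scaling f p + 2 * f p) := by
  refine ⟨h.smooth.scaling, fun p hp => ?_⟩
  rw [h.smooth.box_scaling hp]
  beta_reduce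
  rw [h.2 p hp, scaling_eq_fderiv, scaling_eq_fderiv]
  have : box φ =ᶠ[nhds p] f := by
    filter_upwards [(isOpen_slab a b).mem_nhds hp] with q hq using h.2 q hq
  rw [this.fderiv_eq]

/-- The spacetime gradients of a solution and of its scaling derivative are related. -/
lemma IsSmoothSolution.scalRel (h : IsSmoothSolution a b φ f) {t : ℝ} (ht : t ∈ Ioo a b) :
    ScalRel t (fun μ y => grad μ φ (t, y)) (fun μ y => grad μ (WaveDecay.scaling φ) (t, y))
      (fun y => f (t, y)) := by
  have hs := h.smooth
  have hpd : ∀ μ i, pd i (fun y => grad μ φ (t, y)) = fun y => dx i (grad μ φ) (t, y) :=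
    fun μ i => (hs.grad μ).pd_slice ht i
  refine ⟨fun y => ?_, fun j y => ?_, fun i j => ?_⟩
  · have e := hs.dirD_scaling (1, 0) (mem_slab ht y)
    have hb := h.2 (t, y) (mem_slab ht y)
    beta_reduce at e
    simp only [hpd]
    simp only [grad, Fin.cases_zero, Fin.cases_succ]
    rw [dt_eq_dirD, e, WaveDecay.scaling, ← hb, box, ← dt_eq_dirD]
    ring
  · have e := hs.dirD_scaling (0, bas j) (mem_slab ht y)
    have hc := hs.dirD_comm (0, bas j) (1, 0) (mem_slab ht y)
    beta_reduce at e
    simp only [hpd]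
    simp only [grad, Fin.cases_zero, Fin.cases_succ]
    rw [dx_eq_dirD, e, WaveDecay.scaling, ← dx_eq_dirD]
    rw [dt_eq_dirD (ψ := dx j φ), dx_eq_dirD j (ψ := φ), ← hc]
    simp only [← dx_eq_dirD, ← dt_eq_dirD]
    ring
  · rw [hpd, hpd]
    ext y
    exact hs.dirD_comm (0, bas i) (0, bas j) (mem_slab ht y)

/-! ### The norms of the vector fields -/

lemma le_gamNorm (N : (Space3 → ℂ) → ℝ≥0∞) {n : ℕ} (ψ : ℝ × Space3 → ℂ) (t : ℝ)
    (w : List (Option (Fin 3))) (hw : w.length ≤ n) :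
    N (fun x => gamWord w ψ (t, x)) ≤ gamNorm N n ψ t := by
  refine le_trans (le_trans (le_of_eq ?_) (Finset.single_le_sum
    (f := fun u : Fin w.length → Option (Fin 3) => N fun x => gamWord (List.ofFn u) ψ (t, x))
    (fun _ _ => zero_le) (Finset.mem_univ w.get)))
    (Finset.single_le_sum (f := fun j => ∑ u : Fin j → Option (Fin 3),
      N fun x => gamWord (List.ofFn u) ψ (t, x)) (fun _ _ => zero_le)
      (Finset.mem_range.2 (Nat.lt_succ_of_le hw)))
  rw [List.ofFn_get]

lemma le_gradGamNorm (N : (Space3 → ℂ) → ℝ≥0∞) {n : ℕ} (ψ : ℝ × Space3 → ℂ) (t : ℝ)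
    (w : List (Option (Fin 3))) (hw : w.length ≤ n) (μ : Fin 4) :
    N (fun x => grad μ (gamWord w ψ) (t, x)) ≤ gradGamNorm N n ψ t := by
  refine le_trans (le_trans (le_trans (le_of_eq ?_) (Finset.single_le_sum
    (f := fun μ => N fun x => grad μ (gamWord (List.ofFn w.get) ψ) (t, x))
    (fun _ _ => zero_le) (Finset.mem_univ μ))) (Finset.single_le_sum
    (f := fun u : Fin w.length → Option (Fin 3) => ∑ μ,
      N fun x => grad μ (gamWord (List.ofFn u) ψ) (t, x))
    (fun _ _ => zero_le) (Finset.mem_univ w.get)))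
    (Finset.single_le_sum (f := fun j => ∑ u : Fin j → Option (Fin 3), ∑ μ,
      N fun x => grad μ (gamWord (List.ofFn u) ψ) (t, x)) (fun _ _ => zero_le)
      (Finset.mem_range.2 (Nat.lt_succ_of_le hw)))
  rw [List.ofFn_get]

lemma SlabSmooth.pd_grad (h : SlabSmooth a b ψ) {t : ℝ} (ht : t ∈ Ioo a b) (i : Fin 3)
    (μ : Fin 4) : pd i (fun x => WaveDecay.grad μ ψ (t, x)) =
      fun x => WaveDecay.grad μ (WaveDecay.gamWord [some i] ψ) (t, x) := by
  obtain ⟨v, hv⟩ := grad_eq_dirD μ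
  rw [(h.grad μ).pd_slice ht]
  ext x
  rw [hv, hv, dx_eq_dirD]
  exact h.dirD_comm _ _ (mem_slab ht x)

lemma SlabSmooth.pd_pd_grad (h : SlabSmooth a b ψ) {t : ℝ} (ht : t ∈ Ioo a b) (i : Fin 3)
    (μ : Fin 4) : pd i (pd i (fun x => WaveDecay.grad μ ψ (t, x))) =
      fun x => WaveDecay.grad μ (WaveDecay.gamWord [some i, some i] ψ) (t, x) := by
  rw [h.pd_grad ht, (h.gamWord [some i]).pd_grad ht]
  rfl

end

section

/-! ### The interior and exterior decay estimate -/

variable {a b : ℝ} {ψ ψ' φ f : ℝ × Space3 → ℂ}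

lemma one_le_bracket (s : ℝ) : 1 ≤ bracket s := by
  rw [bracket, Real.one_le_sqrt]; nlinarith [sq_nonneg s]

lemma bracket_pos (s : ℝ) : 0 < bracket s := zero_lt_one.trans_le (one_le_bracket s)

lemma bracket_le_one_add {s : ℝ} (hs : 0 ≤ s) : bracket s ≤ 1 + s := by
  rw [bracket, Real.sqrt_le_left (by positivity)]; nlinarith

lemma le_bracket (s : ℝ) : s ≤ bracket s := Real.le_sqrt_of_sq_le (by linarith)

lemma bracket_le_two {s : ℝ} (hs : 0 ≤ s) (hs1 : s ≤ 1) : bracket s ≤ 2 :=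
  (bracket_le_one_add hs).trans (by linarith)

lemma bracket_le_two_mul {s : ℝ} (hs : 1 ≤ s) : bracket s ≤ 2 * s :=
  (bracket_le_one_add (by linarith)).trans (by linarith)

lemma coneWeight_pos (δ t : ℝ) (x : Space3) : 0 < coneWeight δ t x := by
  rw [coneWeight]
  split_ifs
  · exact Real.rpow_pos_of_pos (bracket_pos _) _
  · exact one_pos

lemma coneMul_le_one (t : ℝ) (x : Space3) : coneMul t x ≤ 1 := by
  rw [coneMul]
  split_ifs with h
  · exact inv_le_one_of_one_le₀ (by linarith)
  · exact le_rfl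

lemma coneMul_le_coneWeight {δ : ℝ} (hδ : 0 < δ) (t : ℝ) (x : Space3) :
    coneMul t x ≤ coneWeight δ t x := by
  rw [coneMul, coneWeight]
  split_ifs with h
  · have h0 : 0 ≤ t - ‖x‖ := by linarith
    calc (1 + (t - ‖x‖))⁻¹ ≤ (bracket (t - ‖x‖))⁻¹ :=
          inv_anti₀ (bracket_pos _) (bracket_le_one_add h0)
      _ = bracket (t - ‖x‖) ^ (-1 : ℝ) := (Real.rpow_neg_one _).symm
      _ ≤ _ := Real.rpow_le_rpow_of_exponent_le (one_le_bracket _) (by linarith)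
  · exact le_rfl

lemma half_le_coneWeight {δ : ℝ} (hδ : 0 < δ) {t : ℝ} (ht : t ≤ 1) (x : Space3) :
    1 / 2 ≤ coneWeight δ t x := by
  refine le_trans ?_ (coneMul_le_coneWeight hδ t x)
  rw [coneMul]
  split_ifs with h
  · rw [one_div]
    refine inv_anti₀ (by linarith) ?_
    linarith [norm_nonneg x]
  · norm_num

lemma rpow_half_bracket_le {t : ℝ} (ht : 1 ≤ t) :
    (√t)⁻¹ ≤ 2 * bracket t ^ (-(1 / 2) : ℝ) := by
  have ht0 : 0 < t := by linarith
  rw [Real.rpow_neg (bracket_pos t).le, ← Real.sqrt_eq_rpow, ← div_eq_mul_inv,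
    le_div_iff₀ (Real.sqrt_pos.2 (bracket_pos t)), inv_mul_le_iff₀ (Real.sqrt_pos.2 ht0)]
  calc √(bracket t) ≤ √(2 ^ 2 * t) := Real.sqrt_le_sqrt (by linarith [bracket_le_two_mul ht])
    _ = √t * 2 := by rw [Real.sqrt_mul (by norm_num), Real.sqrt_sq (by norm_num), mul_comm]

lemma sqrt_le_rpow_bracket {t : ℝ} : √t ≤ bracket t ^ (1 / 2 : ℝ) := by
  rw [← Real.sqrt_eq_rpow]
  exact Real.sqrt_le_sqrt (le_bracket t)

lemma half_le_rpow_bracket {t : ℝ} (ht : 0 ≤ t) (ht1 : t ≤ 1) :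
    1 / 2 ≤ bracket t ^ (-(1 / 2) : ℝ) := by
  rw [Real.rpow_neg (bracket_pos t).le, ← Real.sqrt_eq_rpow, one_div]
  refine inv_anti₀ (Real.sqrt_pos.2 (bracket_pos t)) ?_
  rw [Real.sqrt_le_left (by norm_num)]
  linarith [bracket_le_two ht ht1]

/-- Compactly supported cutoffs apply to all smooth functions. -/
lemma cutClass_compact :
    CutClass (fun θ => HasCompactSupport (θ : Space3 → ℂ)) (fun h => ContDiff ℝ ∞ h) where
  sd_mem θ i hθ := by
    have := hθ.fderiv_apply (𝕜 := ℝ) (bas i)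
    exact this
  sD_mem θ hθ := by
    have h : (sD θ : Space3 → ℂ) = fun y => fderiv ℝ θ y y := by
      ext y
      rw [sD_apply]
      conv_rhs => rw [show fderiv ℝ θ y y = fderiv ℝ θ y (∑ i, y i • bas i) by rw [sum_smul_bas]]
      rw [map_sum]
      simp
    rw [h]
    refine (hθ.fderiv (𝕜 := ℝ)).mono' ?_
    refine (Function.support_subset_iff'.2 fun y hy => ?_).trans (subset_tsupport _)
    rw [Function.notMem_support] at hy
    rw [hy]; rfl
  differentiable h hh := hh.differentiable (by simp)
  pd_mem h i hh := (hh.fderiv_right (by simp)).clm_apply contDiff_const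
  exists_cut θ h hθ hh ε hε := by
    have h1 : HasCompactSupport fun y : Space3 => θ (ε • y) :=
      hθ.comp_homeomorph (Homeomorph.smulOfNeZero ε hε.ne')
    have h2 : ContDiff ℝ ∞ fun y : Space3 => θ (ε • y) :=
      (θ.smooth ⊤).comp (contDiff_const_smul ε)
    refine ⟨(h1.mul_right (f' := h)).toSchwartzMap (h2.mul hh), fun y => rfl⟩

lemma exists_compact_cutoff :
    ∃ χ : 𝓢(Space3, ℂ), HasCompactSupport (χ : Space3 → ℂ) ∧ χ 0 = 1 := by
  obtain ⟨g⟩ : Nonempty (ContDiffBump (0 : Space3)) := inferInstance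
  have h1 : HasCompactSupport fun y => ((g y : ℝ) : ℂ) :=
    g.hasCompactSupport.comp_left Complex.ofReal_zero
  refine ⟨h1.toSchwartzMap (Complex.ofRealCLM.contDiff.comp g.contDiff), h1, ?_⟩
  change ((g 0 : ℝ) : ℂ) = 1
  rw [g.one_of_mem_closedBall (by simp [g.rIn_pos.le])]
  simp

open Filter in
/-- The cutoff is removed in the limit. -/
lemma le_of_cut_le {χ : 𝓢(Space3, ℂ)} (h1 : χ 0 = 1) {h : Space3 → ℂ} {x : Space3} {B : ℝ≥0∞}
    {G : ℝ → ℝ≥0∞} {ε₀ : ℝ} (h0 : 0 < ε₀) (hG : Tendsto G (nhdsWithin 0 (Ioi 0)) (nhds 0))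
    (hle : ∀ ε, 0 < ε → ε ≤ ε₀ → ‖χ (ε • x) * h x‖ₑ ≤ B + G ε) : ‖h x‖ₑ ≤ B := by
  have hc : Continuous fun ε : ℝ => ‖χ (ε • x) * h x‖ₑ := by
    have := χ.continuous
    fun_prop
  have h2 := (hc.tendsto 0).mono_left (nhdsWithin_le_nhds (s := Ioi (0 : ℝ)))
  rw [zero_smul, h1, one_mul] at h2
  have h3 := hG.const_add B
  rw [add_zero] at h3
  refine le_of_tendsto_of_tendsto h2 h3 ?_
  filter_upwards [Ioo_mem_nhdsGT h0] with ε hε using hle ε hε.1 hε.2.le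

lemma eLpNorm_grad_le (n : ℕ) (φ : ℝ × Space3 → ℂ) (t : ℝ)
    (w : List (Option (Fin 3))) (hw : w.length ≤ n) (μ : Fin 4) :
    eLpNorm (fun x => grad μ (gamWord w φ) (t, x)) 2 volume ≤ gradGamNorm normL2 n φ t :=
  le_gradGamNorm normL2 φ t w hw μ

lemma eLpNorm_gam_le (n : ℕ) (f : ℝ × Space3 → ℂ) (t : ℝ)
    (w : List (Option (Fin 3))) (hw : w.length ≤ n) :
    eLpNorm (fun x => gamWord w f (t, x)) 2 volume ≤ gamNorm normL2 n f t :=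
  le_gamNorm normL2 f t w hw

lemma SlabSmooth.eLpNorm_scaled_rhs_le (hf : SlabSmooth a b f) {n : ℕ} (hn : 1 ≤ n) {t : ℝ}
    (ht : t ∈ Ioo a b) : eLpNorm (fun x => WaveDecay.scaling f (t, x) + 2 * f (t, x)) 2 volume ≤
      3 * gamNorm normL2 n f t := by
  have h0 := eLpNorm_gam_le n f t [] (by simp)
  have h1 := eLpNorm_gam_le n f t [none] (by simpa using hn)
  have c0 := (hf.slice ht).continuous
  have c1 := (hf.scaling.slice ht).continuous
  have e2 : eLpNorm (fun x => 2 * f (t, x)) 2 volume = 2 * eLpNorm (fun x => f (t, x)) 2 volume := by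
    have := eLpNorm_const_smul (2 : ℂ) (fun x => f (t, x)) 2 (volume : Measure Space3)
    rw [← ofReal_norm, Complex.norm_ofNat, ENNReal.ofReal_ofNat] at this
    exact this
  have c2 : Continuous fun x => 2 * f (t, x) := continuous_const.mul c0
  have h2 := eLpNorm_add_le c1.aestronglyMeasurable (c2.aestronglyMeasurable (μ := volume))
    (one_le_two (α := ℝ≥0∞))
  rw [e2] at h2
  refine h2.trans ?_
  calc _ ≤ gamNorm normL2 n f t + 2 * gamNorm normL2 n f t := by
        gcongr
        · exact h1
        · exact h0
    _ = _ := by ring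

lemma ofReal_mul_ofReal_mul {u v : ℝ} (hu : 0 ≤ u) (A : ℝ≥0∞) :
    ENNReal.ofReal u * (ENNReal.ofReal v * A) = ENNReal.ofReal (u * v) * A := by
  rw [← mul_assoc, ENNReal.ofReal_mul hu]

section

variable {t : ℝ} {χ : 𝓢(Space3, ℂ)}

lemma SlabSmooth.h2_cut_grad_le (h : SlabSmooth a b φ) (ht : t ∈ Ioo a b) {n : ℕ} (hn : 2 ≤ n)
    (hχ : HasCompactSupport (χ : Space3 → ℂ)) {ε : ℝ} (hε : 0 < ε) (hε1 : ε ≤ 1) (μ : Fin 4) :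
    h2 (cut χ ε (fun y => WaveDecay.grad μ φ (t, y))) ≤
      28 * supTwo χ * gradGamNorm normL2 n φ t := by
  refine (cutClass_compact.h2_cut_le hχ ((h.grad μ).slice ht) hε hε1).trans ?_
  have b0 := eLpNorm_grad_le n φ t [] (by simp) μ
  have b1 : ∀ i, eLpNorm (pd i (fun y => WaveDecay.grad μ φ (t, y))) 2 volume ≤
      gradGamNorm normL2 n φ t := fun i => by
    rw [h.pd_grad ht]
    exact eLpNorm_grad_le n φ t [some i] (by simp; omega) μ
  have b2 : ∀ i, eLpNorm (pd i (pd i (fun y => WaveDecay.grad μ φ (t, y)))) 2 volume ≤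
      gradGamNorm normL2 n φ t := fun i => by
    rw [h.pd_pd_grad ht]
    exact eLpNorm_grad_le n φ t [some i, some i] (by simpa using hn) μ
  calc _ ≤ 4 * supTwo χ * (gradGamNorm normL2 n φ t + ∑ _i : Fin 3, gradGamNorm normL2 n φ t +
        ∑ _i : Fin 3, gradGamNorm normL2 n φ t) := by
        gcongr with i _ i
        · exact b0
        · exact b1 i
        · exact b2 i
    _ = _ := by
        simp only [Finset.sum_const, Finset.card_univ, Fintype.card_fin, nsmul_eq_mul]
        push_cast
        ring

/-- For times less than one the Sobolev inequality suffices. -/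
lemma SlabSmooth.enorm_grad_le_of_le_one (h : SlabSmooth a b φ) (ht : t ∈ Ioo a b)
    (hχ : HasCompactSupport (χ : Space3 → ℂ)) (hχ0 : χ 0 = 1) (μ : Fin 4) (x : Space3) :
    ‖WaveDecay.grad μ φ (t, x)‖ₑ ≤ 672 * supTwo χ * gradGamNorm normL2 3 φ t := by
  refine le_of_cut_le (h := fun y => WaveDecay.grad μ φ (t, y)) hχ0 (G := fun _ => 0)
    zero_lt_one tendsto_const_nhds fun ε hε hε1 => ?_
  rw [← cutClass_compact.cut_apply hχ ((h.grad μ).slice ht) hε, add_zero]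
  refine (enorm_le_h2 _ x).trans ?_
  calc _ ≤ 24 * (28 * supTwo χ * gradGamNorm normL2 3 φ t) := by
        gcongr
        exact h.h2_cut_grad_le ht (by norm_num) hχ hε hε1 μ
    _ = _ := by ring

/-- For times greater than one, decay from the scaling field. -/
lemma IsSmoothSolution.enorm_grad_le_of_one_le (h : IsSmoothSolution a b φ f) (ht : t ∈ Ioo a b)
    (ht1 : 1 ≤ t) (hχ : HasCompactSupport (χ : Space3 → ℂ)) (hχ0 : χ 0 = 1)
    (hA : gradGamNorm normL2 3 φ t ≠ ⊤) (μ : Fin 4) (x : Space3) :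
    ‖grad μ φ (t, x)‖ₑ ≤ ENNReal.ofReal (256 * ((√t)⁻¹ * coneMul t x)) *
        (120 * supTwo χ * gradGamNorm normL2 3 φ t + ‖t‖ₑ * (3 * supTwo χ * gamNorm normL2 2 f t)) +
      ENNReal.ofReal (256 * (√t)⁻¹) * (‖t‖ₑ * (16 * supTwo χ * gamNorm normL2 2 f t)) := by
  set A := gradGamNorm normL2 3 φ t with hAdef
  set F := gamNorm normL2 2 f t with hFdef
  have hs := h.smooth
  have hs1 := hs.scaling
  have hs2 := hs1.scaling
  have hf := h.smooth_rhs
  have hf1 := h.scaling.smooth_rhs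
  set p := fun (μ : Fin 4) y => grad μ φ (t, y) with hp
  set p₁ := fun (μ : Fin 4) y => grad μ (WaveDecay.scaling φ) (t, y) with hp₁
  set p₂ := fun (μ : Fin 4) y => grad μ (WaveDecay.scaling (WaveDecay.scaling φ)) (t, y) with hp₂
  have Hp : ∀ μ, ContDiff ℝ ∞ (p μ) := fun μ => (hs.grad μ).slice ht
  have Hp₁ : ∀ μ, ContDiff ℝ ∞ (p₁ μ) := fun μ => (hs1.grad μ).slice ht
  have Hp₂ : ∀ μ, ContDiff ℝ ∞ (p₂ μ) := fun μ => (hs2.grad μ).slice ht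
  have r := h.scalRel ht
  have r₁ := h.scaling.scalRel ht
  have np : ∀ μ, eLpNorm (p μ) 2 volume ≠ ⊤ := fun μ =>
    ne_top_of_le_ne_top hA (eLpNorm_grad_le 3 φ t [] (by simp) μ)
  have np₁ : ∀ μ, eLpNorm (p₁ μ) 2 volume ≤ A := fun μ =>
    eLpNorm_grad_le 3 φ t [none] (by simp) μ
  have np₂ : ∀ μ, eLpNorm (p₂ μ) 2 volume ≤ A := fun μ =>
    eLpNorm_grad_le 3 φ t [none, none] (by simp) μ
  have dp : ∀ i μ, eLpNorm (pd i (p μ)) 2 volume ≠ ⊤ := fun i μ => by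
    refine ne_top_of_le_ne_top hA ?_
    rw [hp, hs.pd_grad ht]
    exact eLpNorm_grad_le 3 φ t [some i] (by simp) μ
  have t1 := tendsto_cutErr (t := t) (N := h1) (χ := χ) (h := p)
    (fun μ => cutClass_compact.tendsto_h1_cut (cutClass_compact.sD_mem χ hχ) (sD_zero χ) (Hp μ)
      (np μ) (fun i => dp i μ))
    (fun i μ => cutClass_compact.tendsto_h1_smul_cut (cutClass_compact.sd_mem χ i hχ) (Hp μ)
      (np μ) (fun i => dp i μ))
  have t2 := tendsto_cutErr (t := t) (N := l2) (χ := χ) (h := p₁)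
    (fun μ => tendsto_l2_cut (sD_zero χ) (Hp₁ μ).continuous (ne_top_of_le_ne_top hA (np₁ μ)))
    (fun i μ => tendsto_l2_smul_cut _ (ne_top_of_le_ne_top hA (np₁ μ)))
  have hG := (ENNReal.Tendsto.const_mul (a := ENNReal.ofReal (256 * ((√t)⁻¹ * coneMul t x))) t2
    (Or.inr ENNReal.ofReal_ne_top)).add
    (ENNReal.Tendsto.const_mul (a := ENNReal.ofReal (256 * (√t)⁻¹)) t1
    (Or.inr ENNReal.ofReal_ne_top))
  rw [mul_zero, mul_zero, add_zero] at hG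
  refine le_of_cut_le (h := p μ) hχ0 zero_lt_one hG fun ε hε hε1 => ?_
  rw [← cutClass_compact.cut_apply hχ (Hp μ) hε]
  have main := enorm_le_of_scalErr ht1 (fun μ => cut χ ε (p μ)) (fun μ => cut χ ε (p₁ μ))
    (fun μ => cut χ ε (p₂ μ)) μ x
  refine main.trans ?_
  have b0 : ∑ κ, h2 (cut χ ε (p κ)) ≤ 4 * (28 * supTwo χ * A) := by
    refine (Finset.sum_le_sum fun κ _ => hs.h2_cut_grad_le (n := 3) ht (by norm_num) hχ hε hε1 κ).trans ?_
    simp [hAdef]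
  have b1 : ∑ κ, l2 (cut χ ε (p₁ κ)) ≤ 4 * (supTwo χ * A) := by
    refine (Finset.sum_le_sum fun κ _ => (l2_cut_le_supTwo χ ε (p₁ κ)).trans
      (mul_le_mul_right (np₁ κ) _)).trans ?_
    simp
  have b2 : ∑ κ, l2 (cut χ ε (p₂ κ)) ≤ 4 * (supTwo χ * A) := by
    refine (Finset.sum_le_sum fun κ _ => (l2_cut_le_supTwo χ ε (p₂ κ)).trans
      (mul_le_mul_right (np₂ κ) _)).trans ?_
    simp
  have b3 := cutClass_compact.errNorm_le isSeminorm_l2 hχ Hp₁ Hp₂ (hf1.slice ht) hε r₁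
  have b3' : l2 (cut χ ε fun y => WaveDecay.scaling f (t, y) + 2 * f (t, y)) ≤
      3 * supTwo χ * F := by
    refine (l2_cut_le_supTwo χ ε _).trans ?_
    calc _ ≤ supTwo χ * (3 * F) := by
          gcongr
          exact hf.eLpNorm_scaled_rhs_le (by norm_num) ht
      _ = _ := by ring
  have b4 := cutClass_compact.errNorm_le isSeminorm_h1 hχ Hp Hp₁ (hf.slice ht) hε r
  have b4' : h1 (cut χ ε fun y => f (t, y)) ≤ 16 * supTwo χ * F := by
    refine (cutClass_compact.h1_cut_le hχ (hf.slice ht) hε hε1).trans ?_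
    have c0 := eLpNorm_gam_le 2 f t [] (by simp)
    have c1 : ∀ i, eLpNorm (pd i fun y => f (t, y)) 2 volume ≤ F := fun i => by
      rw [hf.pd_slice ht]
      exact eLpNorm_gam_le 2 f t [some i] (by simp)
    calc _ ≤ 4 * supTwo χ * (F + ∑ _i : Fin 3, F) := by
          gcongr with i
          · exact c0
          · exact c1 i
      _ = _ := by
          simp only [Finset.sum_const, Finset.card_univ, Fintype.card_fin, nsmul_eq_mul]
          push_cast
          ring
  calc _ ≤ ENNReal.ofReal (256 * ((√t)⁻¹ * coneMul t x)) *
        (4 * (28 * supTwo χ * A) + 4 * (supTwo χ * A) + 4 * (supTwo χ * A) +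
          (‖t‖ₑ * (3 * supTwo χ * F) + cutErr l2 t χ p₁ ε)) +
        ENNReal.ofReal (256 * (√t)⁻¹) *
          (‖t‖ₑ * (16 * supTwo χ * F) + cutErr h1 t χ p ε) := by
        gcongr
        · exact b3.trans (by gcongr)
        · exact b4.trans (by gcongr)
    _ = _ := by ring

end

/-- The decay estimate in the interior and in the exterior of the cone. -/
theorem exists_interior_exterior_decay : ∃ C : ℝ, 0 < C ∧ ∀ δ : ℝ, 0 < δ → δ < 1 →
      ∀ (a b : ℝ) (φ f : ℝ × Space3 → ℂ), IsSmoothSolution a b φ f →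
      ∀ t ∈ Ioo a b, 0 ≤ t → ∀ x : Space3,
        absGrad φ t x ≤ ENNReal.ofReal (C * δ⁻¹) *
          (ENNReal.ofReal (bracket t ^ (-(1 / 2) : ℝ) * coneWeight δ t x) *
              gradGamNorm normL2 3 φ t +
            ENNReal.ofReal (bracket t ^ (1 / 2 : ℝ)) * gamNorm normL2 2 f t) := by
  obtain ⟨χ, hχ, hχ0⟩ := exists_compact_cutoff
  set B : ℝ := (supTwo χ).toReal with hB
  have hBe : supTwo χ = ENNReal.ofReal B := (ENNReal.ofReal_toReal (supTwo_ne_top χ)).symm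
  have hB0 : 0 ≤ B := ENNReal.toReal_nonneg
  refine ⟨4 * 100000 * (B + 1), by positivity, ?_⟩
  intro δ hδ hδ1 a b φ f h t ht ht0 x
  set A := gradGamNorm normL2 3 φ t with hA
  set F := gamNorm normL2 2 f t with hF
  have hδi : 1 ≤ δ⁻¹ := (one_le_inv₀ hδ).2 hδ1.le
  set W := bracket t ^ (-(1 / 2) : ℝ) * coneWeight δ t x with hW
  have hWpos : 0 < W := mul_pos (Real.rpow_pos_of_pos (bracket_pos t) _) (coneWeight_pos δ t x)
  have hVpos : 0 < bracket t ^ (1 / 2 : ℝ) := Real.rpow_pos_of_pos (bracket_pos t) _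
  have hcomp : ∀ μ, ‖grad μ φ (t, x)‖ₑ ≤ ENNReal.ofReal (100000 * (B + 1) * δ⁻¹) *
      (ENNReal.ofReal W * A + ENNReal.ofReal (bracket t ^ (1 / 2 : ℝ)) * F) := by
    intro μ
    by_cases hAtop : A = ⊤
    · rw [hAtop, ENNReal.mul_top (by simpa using hWpos), top_add,
        ENNReal.mul_top (by simp; positivity)]
      exact le_top
    rcases le_total t 1 with ht1 | ht1
    · refine (h.smooth.enorm_grad_le_of_le_one ht hχ hχ0 μ x).trans ?_
      rw [mul_add, ← mul_assoc, ← ENNReal.ofReal_mul (by positivity), hBe,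
        show (672 : ℝ≥0∞) = ENNReal.ofReal 672 by simp, ← ENNReal.ofReal_mul (by norm_num)]
      refine le_trans ?_ le_self_add
      refine mul_le_mul_left (ENNReal.ofReal_le_ofReal ?_) _
      have hW4 : 1 / 4 ≤ W := by
        calc (1 / 4 : ℝ) = 1 / 2 * (1 / 2) := by norm_num
          _ ≤ W := mul_le_mul (half_le_rpow_bracket ht0 ht1) (half_le_coneWeight hδ ht1 x)
            (by norm_num) (Real.rpow_nonneg (bracket_pos t).le _)
      calc 672 * B ≤ 100000 * (B + 1) * 1 * (1 / 4) := by linarith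
        _ ≤ 100000 * (B + 1) * δ⁻¹ * W := by gcongr
    · refine (h.enorm_grad_le_of_one_le ht ht1 hχ hχ0 hAtop μ x).trans ?_
      have htp : 0 < t := by linarith
      have hst : (√t)⁻¹ * t = √t := by
        rw [inv_mul_eq_div, div_eq_iff (Real.sqrt_pos.2 htp).ne', Real.mul_self_sqrt htp.le]
      have hm := coneMul_pos t x
      have e1 : ‖t‖ₑ = ENNReal.ofReal t := by rw [← ofReal_norm, Real.norm_of_nonneg htp.le]
      have n120 : (120 : ℝ≥0∞) = ENNReal.ofReal 120 := by simp
      have n3 : (3 : ℝ≥0∞) = ENNReal.ofReal 3 := by simp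
      have n16 : (16 : ℝ≥0∞) = ENNReal.ofReal 16 := by simp
      rw [e1, hBe, n120, n3, n16]
      have k1 : ENNReal.ofReal (256 * ((√t)⁻¹ * coneMul t x)) *
          (ENNReal.ofReal 120 * ENNReal.ofReal B * A) ≤
          ENNReal.ofReal (100000 * (B + 1) * δ⁻¹) * (ENNReal.ofReal W * A) := by
        rw [mul_assoc (ENNReal.ofReal 120), ofReal_mul_ofReal_mul (by positivity),
          ofReal_mul_ofReal_mul (by positivity), ofReal_mul_ofReal_mul (by positivity)]
        refine mul_le_mul_left (ENNReal.ofReal_le_ofReal ?_) _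
        have : (√t)⁻¹ * coneMul t x ≤ 2 * W := by
          rw [hW, ← mul_assoc]
          exact mul_le_mul (rpow_half_bracket_le ht1) (coneMul_le_coneWeight hδ t x) hm.le
            (by have := Real.rpow_nonneg (bracket_pos t).le (-(1 / 2)); positivity)
        calc 256 * ((√t)⁻¹ * coneMul t x) * 120 * B ≤ 256 * (2 * W) * 120 * B := by gcongr
          _ = 61440 * B * 1 * W := by ring
          _ ≤ 100000 * (B + 1) * δ⁻¹ * W := by gcongr <;> linarith
      have k2 : ENNReal.ofReal (256 * ((√t)⁻¹ * coneMul t x)) *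
          (ENNReal.ofReal t * (ENNReal.ofReal 3 * ENNReal.ofReal B * F)) +
          ENNReal.ofReal (256 * (√t)⁻¹) *
          (ENNReal.ofReal t * (ENNReal.ofReal 16 * ENNReal.ofReal B * F)) ≤
          ENNReal.ofReal (100000 * (B + 1) * δ⁻¹) *
            (ENNReal.ofReal (bracket t ^ (1 / 2 : ℝ)) * F) := by
        calc _ ≤ ENNReal.ofReal (256 * (√t)⁻¹) *
            (ENNReal.ofReal t * (ENNReal.ofReal 3 * ENNReal.ofReal B * F)) +
            ENNReal.ofReal (256 * (√t)⁻¹) *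
            (ENNReal.ofReal t * (ENNReal.ofReal 16 * ENNReal.ofReal B * F)) := by
              gcongr
              exact mul_le_of_le_one_right (by positivity) (coneMul_le_one t x)
          _ = (ENNReal.ofReal (256 * (√t)⁻¹) * ENNReal.ofReal t *
              ((ENNReal.ofReal 3 + ENNReal.ofReal 16) * ENNReal.ofReal B)) * F := by ring
          _ ≤ _ := by
              rw [← ENNReal.ofReal_add (by norm_num) (by norm_num),
                ← ENNReal.ofReal_mul (by norm_num), ← ENNReal.ofReal_mul (by positivity),
                ← ENNReal.ofReal_mul (by positivity), ofReal_mul_ofReal_mul (by positivity)]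
              refine mul_le_mul_left (ENNReal.ofReal_le_ofReal ?_) _
              calc 256 * (√t)⁻¹ * t * ((3 + 16) * B) = 4864 * B * 1 * ((√t)⁻¹ * t) := by ring
                _ = 4864 * B * 1 * √t := by rw [hst]
                _ ≤ 100000 * (B + 1) * δ⁻¹ * bracket t ^ (1 / 2 : ℝ) := by
                    gcongr
                    · linarith
                    · linarith
                    · exact sqrt_le_rpow_bracket
      rw [mul_add, mul_add, add_assoc]
      exact add_le_add k1 k2
  rw [absGrad]
  refine (Finset.sum_le_sum fun μ _ => hcomp μ).trans (le_of_eq ?_)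
  rw [Finset.sum_const, Finset.card_univ, Fintype.card_fin, nsmul_eq_mul, ← mul_assoc]
  congr 1
  rw [mul_assoc 4, mul_assoc 4, ENNReal.ofReal_mul (p := 4) (by norm_num)]
  simp

end

section

/-! ### Temperate functions on the slab -/

variable {a b : ℝ} {F G : Type*} [NormedAddCommGroup F] [NormedSpace ℝ F] [NormedAddCommGroup G]
  [NormedSpace ℝ G]

/-- A smooth function on the slab, all of whose derivatives grow at most polynomially on the
slabs `(c, d) × ℝ³` with `a < c` and `d < b`. Over such slabs, polynomial growth in the spacetime
point is the same as polynomial growth in `x`. -/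
structure SlabTemp (a b : ℝ) (ψ : ℝ × Space3 → F) : Prop where
  contDiffOn : ContDiffOn ℝ ∞ ψ (slab a b)
  bound : ∀ (n : ℕ) (c d : ℝ), a < c → d < b → ∃ (N : ℕ) (C : ℝ), ∀ p ∈ slab c d,
    ‖iteratedFDeriv ℝ n ψ p‖ ≤ C * (1 + ‖p‖) ^ N

lemma slab_subset {c d : ℝ} (hc : a < c) (hd : d < b) : slab c d ⊆ slab a b :=
  prod_mono (Ioo_subset_Ioo hc.le hd.le) subset_rfl

lemma SlabTemp.of_temperateOnSlab {ψ : ℝ × Space3 → ℂ} (h : SlabSmooth a b ψ)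
    (ht : TemperateOnSlab a b ψ) : SlabTemp a b ψ := by
  refine ⟨h, fun n c d hc hd => ?_⟩
  obtain ⟨N, C, hC⟩ := ht n c d hc hd
  refine ⟨N, |C|, fun p hp => (hC p.1 ⟨hp.1.1.le, hp.1.2.le⟩ p.2).trans ?_⟩
  gcongr
  · exact le_abs_self C
  · exact norm_snd_le p

lemma SlabTemp.fderiv {ψ : ℝ × Space3 → F} (h : SlabTemp a b ψ) : SlabTemp a b (fderiv ℝ ψ) := by
  refine ⟨ContDiffOn.fderiv_of_isOpen h.contDiffOn (isOpen_slab a b) (by simp), fun n c d hc hd => ?_⟩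
  obtain ⟨N, C, hC⟩ := h.bound (n + 1) c d hc hd
  refine ⟨N, C, fun p hp => ?_⟩
  rw [norm_iteratedFDeriv_fderiv]
  exact hC p hp

lemma SlabTemp.of_hasTemperateGrowth {ψ : ℝ × Space3 → F} (h : ψ.HasTemperateGrowth) :
    SlabTemp a b ψ := by
  refine ⟨h.1.contDiffOn, fun n c d _ _ => ?_⟩
  obtain ⟨N, C, hC⟩ := h.2 n
  exact ⟨N, C, fun p _ => hC p⟩

lemma SlabTemp.clm_apply {ψ : ℝ × Space3 → F →L[ℝ] G} {v : ℝ × Space3 → F} (h : SlabTemp a b ψ)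
    (hv : SlabTemp a b v) : SlabTemp a b (fun p => ψ p (v p)) := by
  refine ⟨h.contDiffOn.clm_apply hv.contDiffOn, fun n c d hc hd => ?_⟩
  choose N C hC using fun n => h.bound n c d hc hd
  choose N' C' hC' using fun n => hv.bound n c d hc hd
  refine ⟨∑ i ∈ Finset.range (n + 1), (N i + N' (n - i)),
    ∑ i ∈ Finset.range (n + 1), n.choose i * |C i| * |C' (n - i)|, fun p hp => ?_⟩
  have hsub := slab_subset hc hd
  have ho := isOpen_slab c d
  have key := norm_iteratedFDerivWithin_clm_apply (n := n) (h.contDiffOn.mono hsub)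
    (hv.contDiffOn.mono hsub) ho.uniqueDiffOn hp (WithTop.coe_le_coe.2 le_top)
  simp only [iteratedFDerivWithin_of_isOpen _ ho hp] at key
  refine key.trans ?_
  rw [Finset.sum_mul]
  refine Finset.sum_le_sum fun i hi => ?_
  have hle : N i + N' (n - i) ≤ ∑ i ∈ Finset.range (n + 1), (N i + N' (n - i)) :=
    Finset.single_le_sum (f := fun i => N i + N' (n - i)) (fun _ _ => Nat.zero_le _) hi
  have h1 : 1 ≤ 1 + ‖p‖ := by linarith [norm_nonneg p]
  calc _ ≤ n.choose i * (|C i| * (1 + ‖p‖) ^ N i) * (|C' (n - i)| * (1 + ‖p‖) ^ N' (n - i)) := by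
        gcongr
        · exact (hC i p hp).trans (by gcongr; exact le_abs_self _)
        · exact (hC' _ p hp).trans (by gcongr; exact le_abs_self _)
    _ = n.choose i * |C i| * |C' (n - i)| * (1 + ‖p‖) ^ (N i + N' (n - i)) := by
        rw [pow_add]; ring
    _ ≤ _ := by gcongr

section

variable {ψ : ℝ × Space3 → ℂ}

lemma SlabTemp.smooth (h : SlabTemp a b ψ) : SlabSmooth a b ψ := h.contDiffOn

lemma SlabTemp.dirD (h : SlabTemp a b ψ) (v : ℝ × Space3) : SlabTemp a b (dirD v ψ) :=
  h.fderiv.clm_apply (.of_hasTemperateGrowth (.const v))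

lemma SlabTemp.scaling (h : SlabTemp a b ψ) : SlabTemp a b (scaling ψ) := by
  rw [show WaveDecay.scaling ψ = fun p => _root_.fderiv ℝ ψ p p from funext (scaling_eq_fderiv ψ)]
  exact h.fderiv.clm_apply (.of_hasTemperateGrowth .id')

lemma exists_slab_mem {t : ℝ} (ht : t ∈ Ioo a b) : ∃ c d, a < c ∧ d < b ∧ t ∈ Ioo c d := by
  obtain ⟨c, hc⟩ := exists_between ht.1
  obtain ⟨d, hd⟩ := exists_between ht.2
  exact ⟨c, d, hc.1, hd.2, hc.2, hd.1⟩

lemma hasTemperateGrowth_prodMk (t : ℝ) :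
    (fun x : Space3 => (t, x)).HasTemperateGrowth := by
  have h1 := (ContinuousLinearMap.inr ℝ ℝ Space3).hasTemperateGrowth
  have h2 := (Function.HasTemperateGrowth.const (E := Space3) (t, (0 : Space3))).add h1
  convert h2 using 1
  ext x <;> simp

lemma SlabTemp.slice (h : SlabTemp a b ψ) {t : ℝ} (ht : t ∈ Ioo a b) :
    (fun x => ψ (t, x)).HasTemperateGrowth := by
  obtain ⟨c, d, hc, hd, htcd⟩ := exists_slab_mem ht
  have hg := hasTemperateGrowth_prodMk t
  refine Function.HasTemperateGrowth.comp' (t := slab c d) (g := ψ) ?_ (isOpen_slab c d).uniqueDiffOn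
    (h.contDiffOn.mono (slab_subset hc hd)) ?_ hg
  · rintro _ ⟨x, rfl⟩
    exact mem_slab htcd x
  · intro n
    choose N C hC using fun n => h.bound n c d hc hd
    refine ⟨∑ i ∈ Finset.range (n + 1), N i, ∑ i ∈ Finset.range (n + 1), |C i|,
      Finset.sum_nonneg fun _ _ => abs_nonneg _, fun i hi p hp => ?_⟩
    have hi' : i ∈ Finset.range (n + 1) := Finset.mem_range.2 (by omega)
    rw [iteratedFDerivWithin_of_isOpen _ (isOpen_slab c d) hp]
    have h1 : 1 ≤ 1 + ‖p‖ := by linarith [norm_nonneg p]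
    calc _ ≤ |C i| * (1 + ‖p‖) ^ N i := (hC i p hp).trans (by gcongr; exact le_abs_self _)
      _ ≤ _ := by
          gcongr
          · exact Finset.single_le_sum (f := fun i => |C i|) (fun _ _ => abs_nonneg _) hi'
          · exact Finset.single_le_sum (f := N) (fun _ _ => Nat.zero_le _) hi'

/-- The right hand side of the wave equation is temperate along with the solution. -/
lemma SlabTemp.slice_rhs {f : ℝ × Space3 → ℂ} (h : SlabTemp a b ψ) (hf : IsSmoothSolution a b ψ f)
    {t : ℝ} (ht : t ∈ Ioo a b) : (fun x => f (t, x)).HasTemperateGrowth := by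
  have h0 := (((h.dirD (1, 0)).dirD (1, 0)).slice ht).neg
  have h1 : ∀ i : Fin 3, (fun x => dx i (dx i ψ) (t, x)).HasTemperateGrowth := fun i =>
    ((h.dirD (0, bas i)).dirD (0, bas i)).slice ht
  have h2 := h0.add (Function.HasTemperateGrowth.sum (s := Finset.univ) fun i _ => h1 i)
  convert h2 using 1
  ext x
  rw [← hf.2 (t, x) (mem_slab ht x), box]
  simp [dt_eq_dirD]

/-! ### Schwartz cutoffs of temperate functions -/

lemma smulLeft_apply {g : Space3 → ℂ} (hg : g.HasTemperateGrowth) (η : 𝓢(Space3, ℂ)) (y : Space3) :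
    SchwartzMap.smulLeftCLM ℂ g η y = g y * η y := SchwartzMap.smulLeftCLM_apply_apply hg η y

lemma hasTemperateGrowth_pd {g : Space3 → ℂ} (hg : g.HasTemperateGrowth) (i : Fin 3) :
    (pd i g).HasTemperateGrowth := by
  refine ⟨(hg.1.fderiv_right (by simp)).clm_apply contDiff_const, fun n => ?_⟩
  obtain ⟨k, C, hC⟩ := hg.2 (n + 1)
  refine ⟨k, ‖bas i‖ * C, fun x => ?_⟩
  have h1 : ContDiffAt ℝ n (fderiv ℝ g) x :=
    ((hg.1.fderiv_right (m := ∞) (by simp)).of_le (WithTop.coe_le_coe.2 le_top)).contDiffAt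
  refine (norm_iteratedFDeriv_clm_apply_const h1 le_rfl).trans ?_
  rw [norm_iteratedFDeriv_fderiv, mul_assoc]
  gcongr
  exact hC x

/-- Schwartz functions cut off all temperate functions. -/
lemma cutClass_temperate :
    CutClass (fun _ => True) (fun h : Space3 → ℂ => h.HasTemperateGrowth) where
  sd_mem _ _ _ := trivial
  sD_mem _ _ := trivial
  differentiable h hh := hh.1.differentiable (by simp)
  pd_mem h i hh := hasTemperateGrowth_pd hh i
  exists_cut θ h _ hh ε hε := by
    refine ⟨SchwartzMap.smulLeftCLM ℂ h (SchwartzMap.compCLMOfContinuousLinearEquiv ℝ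
        (ContinuousLinearEquiv.smulLeft (R₁ := ℝ) (M₁ := Space3) (Units.mk0 ε hε.ne')) θ),
      fun y => ?_⟩
    rw [smulLeft_apply hh, mul_comm]
    rfl

end

end

section

/-! ### Frequency localized functions -/

variable {a b : ℝ} {ψ : ℝ × Space3 → ℂ} {A : Set Space3} {g : Space3 → ℂ}

lemma integrable_mul_schwartz (hg : g.HasTemperateGrowth) (η : 𝓢(Space3, ℂ)) :
    Integrable fun y => g y * η y :=
  (SchwartzMap.smulLeftCLM ℂ g η).integrable.congr
    (Filter.Eventually.of_forall (smulLeft_apply hg η))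

/-- The Fourier transform of `g` vanishes off the closed set `A`, in the sense of distributions:
it annihilates the test functions with compact support disjoint from `A`. -/
def FourierOff (A : Set Space3) (g : Space3 → ℂ) : Prop :=
  ∀ η : 𝓢(Space3, ℂ), HasCompactSupport (η : Space3 → ℂ) → Disjoint (tsupport η) A →
    ∫ y, g y * 𝓕 η y = 0

open Manifold in
/-- A distribution annihilates the compactly supported test functions which vanish near its
support. -/
lemma eq_zero_of_disjoint_dsupport {T : 𝓢'(Space3, ℂ)} {η : 𝓢(Space3, ℂ)}
    (hη : HasCompactSupport (η : Space3 → ℂ))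
    (hd : Disjoint (tsupport η) (Distribution.dsupport T)) : T η = 0 := by
  have hU : ∀ x : tsupport η, ∃ U : Set Space3, Distribution.IsVanishingOn T U ∧ IsOpen U ∧
      (x : Space3) ∈ U := fun x =>
    (Distribution.notMem_dsupport_iff (x : Space3)).1 (disjoint_left.1 hd x.2)
  choose U hUv hUo hUx using hU
  obtain ⟨s, hs⟩ := hη.isCompact.elim_finite_subcover U hUo
    fun x hx => mem_iUnion.2 ⟨⟨x, hx⟩, hUx ⟨x, hx⟩⟩
  obtain ⟨ρ, hρ⟩ := SmoothPartitionOfUnity.exists_isSubordinate (𝓘(ℝ, Space3))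
    (isClosed_tsupport η) (fun i : s => U i) (fun i => hUo i) (by
      refine hs.trans (iUnion₂_subset fun i hi => ?_)
      exact subset_iUnion (fun i : s => U i) ⟨i, hi⟩)
  have hc : ∀ i : s, HasCompactSupport fun y => ((ρ i y : ℝ) : ℂ) * η y := fun i =>
    HasCompactSupport.mul_left (f := fun y => ((ρ i y : ℝ) : ℂ)) hη
  have hsm : ∀ i : s, ContDiff ℝ ∞ fun y => ((ρ i y : ℝ) : ℂ) * η y := fun i =>
    (Complex.ofRealCLM.contDiff.comp (ρ i).contMDiff.contDiff).mul (η.smooth ⊤)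
  have hsum : η = ∑ i : s, (hc i).toSchwartzMap (hsm i) := by
    ext y
    rw [sum_schwartz_apply]
    change η y = ∑ i : s, ((ρ i y : ℝ) : ℂ) * η y
    rw [← Finset.sum_mul, ← Complex.ofReal_sum]
    by_cases hy : y ∈ tsupport η
    · have h1 := ρ.sum_eq_one hy
      rw [finsum_eq_sum_of_fintype] at h1
      rw [h1]; simp
    · rw [image_eq_zero_of_notMem_tsupport hy, mul_zero]
  rw [hsum, map_sum]
  refine Finset.sum_eq_zero fun i _ => hUv i _ ?_
  refine subset_trans (closure_mono fun y hy => ?_) (hρ i)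
  rw [Function.mem_support] at hy ⊢
  intro h0
  apply hy
  change ((ρ i y : ℝ) : ℂ) * η y = 0
  rw [h0]; simp

lemma FrequencyLocalized.fourierOff {Λ : ℝ} {k : ℤ} (h : FrequencyLocalized Λ k g) :
    FourierOff {ξ : Space3 | Λ⁻¹ * (2 : ℝ) ^ k ≤ ‖(2 * Real.pi) • ξ‖ ∧
        ‖(2 * Real.pi) • ξ‖ ≤ Λ * (2 : ℝ) ^ k} g := by
  obtain ⟨T, hT, hsupp⟩ := h
  intro η hη hd
  rw [← (hT (𝓕 η)).2, ← TemperedDistribution.fourier_apply]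
  exact eq_zero_of_disjoint_dsupport hη (hd.mono_right hsupp)

namespace FourierOff

lemma tsupport_sd_subset (i : Fin 3) (η : 𝓢(Space3, ℂ)) : tsupport (sd i η) ⊆ tsupport η :=
  tsupport_fderiv_apply_subset ℝ (bas i)

lemma tsupport_sx_subset (i : Fin 3) (η : 𝓢(Space3, ℂ)) : tsupport (sx i η) ⊆ tsupport η := by
  rw [show (sx i η : Space3 → ℂ) = fun y => (y i : ℂ) * η y from funext (sx_apply i η)]
  exact tsupport_mul_subset_right

lemma two_pi_I_ne_zero : (2 * Real.pi * Complex.I : ℂ) ≠ 0 := Complex.two_pi_I_ne_zero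

lemma coord_mul (h : FourierOff A g) (i : Fin 3) : FourierOff A fun y => (y i : ℂ) * g y := by
  intro η hη hd
  have h1 := h (sd i η) (hη.mono' ((subset_tsupport _).trans (tsupport_sd_subset i η)))
    (hd.mono_left (tsupport_sd_subset i η))
  have h2 : ∀ y : Space3, g y * 𝓕 (sd i η) y =
      (2 * Real.pi * Complex.I) * ((y i : ℂ) * g y * 𝓕 η y) := fun y => by
    rw [fourier_sd_apply]; ring
  simp only [h2] at h1
  rw [integral_const_mul] at h1
  exact (mul_eq_zero.1 h1).resolve_left two_pi_I_ne_zero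

lemma integral_sd (f : 𝓢(Space3, ℂ)) (i : Fin 3) : ∫ y, sd i f y = 0 := by
  have h := fourier_sd_apply i f 0
  rw [SchwartzMap.fourier_coe, Real.fourier_eq] at h
  simpa using h

lemma pd (hg : g.HasTemperateGrowth) (h : FourierOff A g) (i : Fin 3) :
    FourierOff A (pd i g) := by
  intro η hη hd
  have h1 := h (sx i η) (hη.mono' ((subset_tsupport _).trans (tsupport_sx_subset i η)))
    (hd.mono_left (tsupport_sx_subset i η))
  have h2 := integral_sd (SchwartzMap.smulLeftCLM ℂ g (𝓕 η)) i
  have h3 : ∀ y, sd i (SchwartzMap.smulLeftCLM ℂ g (𝓕 η)) y =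
      WaveDecay.pd i g y * 𝓕 η y + -(2 * Real.pi * Complex.I) * (g y * 𝓕 (sx i η) y) := by
    intro y
    rw [sd_apply, funext (smulLeft_apply hg (𝓕 η)),
      ((hg.1.differentiable (by simp) y).hasFDerivAt.fun_mul ((𝓕 η).hasFDerivAt y)).fderiv]
    have h4 : (sd i (𝓕 η) : 𝓢(Space3, ℂ)) y = -(2 * Real.pi * Complex.I) * 𝓕 (sx i η) y := by
      rw [sd_fourier]; rfl
    rw [sd_apply] at h4
    simp only [add_apply, smul_apply, smul_eq_mul, h4, WaveDecay.pd]
    ring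
  simp only [h3] at h2
  rw [integral_add (integrable_mul_schwartz (hasTemperateGrowth_pd hg i) _)
    ((integrable_mul_schwartz hg _).const_mul _), integral_const_mul, h1, mul_zero, add_zero] at h2
  exact h2

end FourierOff

lemma integrable_one_add_norm_pow_mul (η : 𝓢(Space3, ℂ)) (N : ℕ) :
    Integrable fun y => (1 + ‖y‖) ^ N * ‖η y‖ := by
  have hg : (fun y : Space3 => (((2 * (1 + ‖y‖ ^ 2)) ^ N : ℝ) : ℂ)).HasTemperateGrowth := by
    have h1 : (fun y : Space3 => (2 * (1 + ‖y‖ ^ 2)) ^ N).HasTemperateGrowth := by fun_prop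
    exact Complex.ofRealCLM.hasTemperateGrowth.comp h1
  refine (integrable_mul_schwartz hg η).mono (by have := η.continuous; fun_prop)
    (Filter.Eventually.of_forall fun y => ?_)
  rw [norm_mul, norm_mul, Complex.norm_real, norm_norm]
  gcongr ?_ * _
  rw [Real.norm_of_nonneg (by positivity), Real.norm_of_nonneg (by positivity)]
  gcongr
  nlinarith [sq_nonneg (‖y‖ - 1)]

/-- A temperate function on the slab whose time slices have their frequencies in `A`. -/
structure SlabLoc (a b : ℝ) (A : Set Space3) (ψ : ℝ × Space3 → ℂ) : Prop where
  temp : SlabTemp a b ψ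
  off : ∀ s ∈ Ioo a b, FourierOff A fun y => ψ (s, y)

namespace SlabLoc

lemma dx (h : SlabLoc a b A ψ) (i : Fin 3) : SlabLoc a b A (dx i ψ) :=
  ⟨h.temp.dirD (0, bas i), fun s hs => by
    rw [← h.temp.smooth.pd_slice hs]
    exact FourierOff.pd (h.temp.slice hs) (h.off s hs) i⟩

/-- The time derivative may be taken in the integrals of the slices against test functions. -/
lemma dt (h : SlabLoc a b A ψ) : SlabLoc a b A (dt ψ) := by
  refine ⟨h.temp.dirD (1, 0), fun t ht η hη hd => ?_⟩
  obtain ⟨c, d, hc, hd', htcd⟩ := exists_slab_mem ht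
  have hcd : ∀ s ∈ Ioo c d, s ∈ Ioo a b := fun s hs => ⟨hc.trans hs.1, hs.2.trans hd'⟩
  obtain ⟨N, C, hC⟩ := (h.temp.dirD (1, 0)).bound 0 c d hc hd'
  set R := |c| + |d| with hR
  have hderiv := hasDerivAt_integral_of_dominated_loc_of_deriv_le (𝕜 := ℝ) (μ := volume)
    (F := fun s y => ψ (s, y) * 𝓕 η y) (F' := fun s y => WaveDecay.dt ψ (s, y) * 𝓕 η y) (x₀ := t)
    (bound := fun y => |C| * (1 + R) ^ N * ((1 + ‖y‖) ^ N * ‖𝓕 η y‖)) (s := Ioo c d)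
    (isOpen_Ioo.mem_nhds htcd) ?_ ?_ ?_ ?_ ?_ ?_
  · have h0 : (fun s => ∫ y, ψ (s, y) * 𝓕 η y) =ᶠ[nhds t] fun _ => 0 := by
      filter_upwards [isOpen_Ioo.mem_nhds ht] with s hs using h.off s hs η hη hd
    exact (hderiv.2.congr_of_eventuallyEq h0.symm).unique (hasDerivAt_const t (0 : ℂ))
  · filter_upwards [isOpen_Ioo.mem_nhds ht] with s hs
    exact (integrable_mul_schwartz (h.temp.slice hs) _).aestronglyMeasurable
  · exact integrable_mul_schwartz (h.temp.slice ht) _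
  · exact (integrable_mul_schwartz ((h.temp.dirD (1, 0)).slice ht) _).aestronglyMeasurable
  · refine Filter.Eventually.of_forall fun y s hs => ?_
    have h1 := hC (s, y) (mem_slab hs y)
    rw [norm_iteratedFDeriv_zero] at h1
    rw [norm_mul, ← mul_assoc]
    refine mul_le_mul_of_nonneg_right (h1.trans ?_) (norm_nonneg _)
    rw [mul_assoc, ← mul_pow]
    have hsR : |s| ≤ R := by
      rw [hR, abs_le]
      have := neg_abs_le c; have := le_abs_self d; have := abs_nonneg c; have := abs_nonneg d
      constructor <;> linarith [hs.1, hs.2]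
    have hn : ‖(s, y)‖ ≤ R + ‖y‖ := by
      rw [Prod.norm_mk, Real.norm_eq_abs]
      have := norm_nonneg y
      have := abs_nonneg s
      exact max_le (by linarith) (by linarith)
    have hR0 : 0 ≤ R := by positivity
    gcongr
    · exact le_abs_self C
    · nlinarith [mul_nonneg hR0 (norm_nonneg y)]
  · exact (integrable_one_add_norm_pow_mul (𝓕 η) N).const_mul _
  · refine Filter.Eventually.of_forall fun y s hs => ?_
    refine HasDerivAt.mul_const ?_ _
    have h1 : HasFDerivAt ψ (fderiv ℝ ψ (s, y)) (s, y) :=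
      (h.temp.smooth.differentiableAt (mem_slab (hcd s hs) y)).hasFDerivAt
    have h2 : HasDerivAt (fun s : ℝ => (s, y)) ((1 : ℝ), (0 : Space3)) s :=
      (hasDerivAt_id s).prodMk (hasDerivAt_const s y)
    exact h1.comp_hasDerivAt s h2

lemma grad (h : SlabLoc a b A ψ) (μ : Fin 4) : SlabLoc a b A (grad μ ψ) :=
  Fin.cases h.dt (fun i => h.dx i) μ

lemma scaling (h : SlabLoc a b A ψ) : SlabLoc a b A (scaling ψ) := by
  refine ⟨h.temp.scaling, fun t ht η hη hd => ?_⟩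
  have hcoord : ∀ i : Fin 3, (fun y : Space3 => ((y i : ℝ) : ℂ)).HasTemperateGrowth := fun i => by
    simp only [← inner_bas]
    exact Complex.ofRealCLM.hasTemperateGrowth.comp (hasTemperateGrowth_inner_bas i)
  have i0 := (integrable_mul_schwartz (h.dt.temp.slice ht) (𝓕 η)).const_mul (t : ℂ)
  have i1 : ∀ i : Fin 3, Integrable fun y : Space3 =>
      (y i : ℂ) * WaveDecay.dx i ψ (t, y) * 𝓕 η y := fun i =>
    integrable_mul_schwartz ((hcoord i).mul ((h.dx i).temp.slice ht)) (𝓕 η)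
  have e : ∀ y, WaveDecay.scaling ψ (t, y) * 𝓕 η y = t * (WaveDecay.dt ψ (t, y) * 𝓕 η y) +
      ∑ i, (y i : ℂ) * WaveDecay.dx i ψ (t, y) * 𝓕 η y := fun y => by
    rw [WaveDecay.scaling, add_mul, Finset.sum_mul, mul_assoc]
  simp only [e]
  rw [integral_add i0 (integrable_finsetSum _ fun i _ => i1 i), integral_const_mul,
    h.dt.off t ht η hη hd, integral_finsetSum _ fun i _ => i1 i,
    Finset.sum_eq_zero fun i _ => ((h.dx i).off t ht).coord_mul i η hη hd]
  simp

end SlabLoc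

/-! ### The Fourier transform of a cut off function -/

/-- The Schwartz function with Fourier transform `e^{-2πi y·ξ} θ(ε y)`, a rescaled translate of
the inverse Fourier transform of `θ`. -/
def kern (θ : 𝓢(Space3, ℂ)) {ε : ℝ} (hε : 0 < ε) (ξ : Space3) : 𝓢(Space3, ℂ) :=
  (ε⁻¹ ^ 3) • SchwartzMap.compSubConstCLM ℝ ξ (SchwartzMap.compCLMOfContinuousLinearEquiv ℝ
    (ContinuousLinearEquiv.smulLeft (R₁ := ℝ) (M₁ := Space3) (Units.mk0 ε⁻¹ (inv_ne_zero hε.ne')))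
    (𝓕⁻ θ : 𝓢(Space3, ℂ)))

lemma kern_apply (θ : 𝓢(Space3, ℂ)) {ε : ℝ} (hε : 0 < ε) (ξ ζ : Space3) :
    kern θ hε ξ ζ = (ε⁻¹ ^ 3) • (𝓕⁻ θ : 𝓢(Space3, ℂ)) (ε⁻¹ • (ζ - ξ)) := rfl

lemma integral_rescale {E : Type*} [NormedAddCommGroup E] [NormedSpace ℝ E] (G : Space3 → E)
    {ε : ℝ} (hε : 0 < ε) (ξ : Space3) :
    ∫ ζ, (ε⁻¹ ^ 3) • G (ε⁻¹ • (ζ - ξ)) = ∫ w, G w := by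
  rw [integral_smul, integral_sub_right_eq_self (fun ζ => G (ε⁻¹ • ζ)),
    Measure.integral_comp_inv_smul]
  simp only [finrank_euclideanSpace, Fintype.card_fin]
  rw [abs_of_pos (by positivity), smul_smul, ← mul_pow, inv_mul_cancel₀ hε.ne', one_pow, one_smul]

lemma fourier_kern (θ : 𝓢(Space3, ℂ)) {ε : ℝ} (hε : 0 < ε) (ξ y : Space3) :
    𝓕 (kern θ hε ξ) y = Real.fourierChar (-(inner ℝ ξ y)) • θ (ε • y) := by
  have h1 : ∀ ζ, Real.fourierChar (-(inner ℝ ζ y)) • kern θ hε ξ ζ = (ε⁻¹ ^ 3) •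
      (fun w => Real.fourierChar (-(inner ℝ ξ y)) •
        (Real.fourierChar (-(inner ℝ w (ε • y))) • (𝓕⁻ θ : 𝓢(Space3, ℂ)) w)) (ε⁻¹ • (ζ - ξ)) := by
    intro ζ
    rw [kern_apply, smul_comm]
    congr 1
    beta_reduce
    rw [smul_smul, ← AddChar.map_add_eq_mul]
    congr 2
    rw [inner_smul_left, inner_smul_right, inner_sub_left]
    simp
    field_simp
    ring
  rw [SchwartzMap.fourier_coe, Real.fourier_eq]
  rw [(integral_congr_ae (Filter.Eventually.of_forall h1)).trans (integral_rescale
    (fun w => Real.fourierChar (-(inner ℝ ξ y)) •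
        (Real.fourierChar (-(inner ℝ w (ε • y))) • (𝓕⁻ θ : 𝓢(Space3, ℂ)) w)) hε ξ)]
  simp only [Circle.smul_def (Real.fourierChar (-(inner ℝ ξ y)))]
  rw [integral_smul, ← Real.fourier_eq, ← SchwartzMap.fourier_coe,
    FourierTransform.fourier_fourierInv_eq]

lemma integral_norm_kern (θ : 𝓢(Space3, ℂ)) {ε : ℝ} (hε : 0 < ε) (ξ : Space3) :
    ∫ ζ, ‖kern θ hε ξ ζ‖ = ∫ w, ‖(𝓕⁻ θ : 𝓢(Space3, ℂ)) w‖ := by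
  rw [← integral_rescale (fun w => ‖(𝓕⁻ θ : 𝓢(Space3, ℂ)) w‖) hε ξ]
  refine integral_congr_ae (Filter.Eventually.of_forall fun ζ => ?_)
  beta_reduce
  rw [kern_apply, norm_smul, Real.norm_of_nonneg (by positivity), smul_eq_mul]

lemma fourier_cut (θ : 𝓢(Space3, ℂ)) {ε : ℝ} (hε : 0 < ε) (hg : g.HasTemperateGrowth)
    (ξ : Space3) : 𝓕 (cut θ ε g) ξ = ∫ y, g y * 𝓕 (kern θ hε ξ) y := by
  rw [SchwartzMap.fourier_coe, Real.fourier_eq]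
  refine integral_congr_ae (Filter.Eventually.of_forall fun y => ?_)
  beta_reduce
  rw [cutClass_temperate.cut_apply trivial hg hε, fourier_kern, real_inner_comm, Circle.smul_def,
    Circle.smul_def, smul_eq_mul, smul_eq_mul]
  ring

/-- The cutoff enlarges the set of frequencies by at most the size of the support of `𝓕⁻ θ`. -/
lemma FourierOff.fourierVanish_cut {θ : 𝓢(Space3, ℂ)} {r ε : ℝ}
    (hθ : ∀ w, r < ‖w‖ → (𝓕⁻ θ : 𝓢(Space3, ℂ)) w = 0) (hε : 0 < ε)
    (hg : g.HasTemperateGrowth) (h : FourierOff A g) {A' : Set Space3}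
    (hA : ∀ ξ ∉ A', ∀ ζ ∈ A, ε * r < ‖ζ - ξ‖) : FourierVanish A' (cut θ ε g) := by
  intro ξ hξ
  rw [fourier_cut θ hε hg]
  have hts : tsupport (kern θ hε ξ) ⊆ Metric.closedBall ξ (ε * r) := by
    refine closure_minimal (fun ζ hζ => ?_) Metric.isClosed_closedBall
    rw [Metric.mem_closedBall, dist_eq_norm]
    by_contra! hlt
    apply hζ
    rw [kern_apply, hθ, smul_zero]
    rw [norm_smul, Real.norm_of_nonneg (by positivity), ← div_eq_inv_mul, lt_div_iff₀ hε, mul_comm]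
    exact hlt
  refine h _ (HasCompactSupport.of_support_subset_isCompact (isCompact_closedBall ξ (ε * r))
    ((subset_tsupport _).trans hts)) (disjoint_left.2 fun ζ hζ hζA => ?_)
  have h1 := hts hζ
  rw [Metric.mem_closedBall, dist_eq_norm] at h1
  exact (hA ξ hξ ζ hζA).not_ge h1

lemma enorm_integral_mul_fourier_le (g : Space3 → ℂ) (η : 𝓢(Space3, ℂ)) {B : ℝ} (hB : 0 < B)
    (hη : ∫ ζ, ‖η ζ‖ ≤ B) :
    ‖∫ y, g y * 𝓕 η y‖ₑ ≤ fourierSupNorm g * ENNReal.ofReal B := by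
  have hB' : ENNReal.ofReal B ≠ 0 := by simpa using hB
  rw [← ENNReal.div_le_iff_le_mul (Or.inl hB') (Or.inl ENNReal.ofReal_ne_top)]
  unfold fourierSupNorm
  refine le_iInf₂ fun T hT => le_iInf fun h => le_iInf₂ fun hh hTh => ?_
  refine ENNReal.div_le_of_le_mul ?_
  rw [← (hT (𝓕 η)).2, ← TemperedDistribution.fourier_apply, (hTh η).2]
  refine (enorm_integral_le_lintegral_enorm _).trans ?_
  calc _ ≤ ∫⁻ ζ, eLpNorm h ⊤ volume * ‖η ζ‖ₑ := by
        refine lintegral_mono_ae ?_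
        filter_upwards [enorm_ae_le_eLpNormEssSup h volume] with ζ hζ
        rw [enorm_mul, eLpNorm_exponent_top]
        gcongr
    _ = eLpNorm h ⊤ volume * ∫⁻ ζ, ‖η ζ‖ₑ :=
        lintegral_const_mul _ (by have := η.continuous; fun_prop)
    _ ≤ _ := by
        gcongr
        rw [← ofReal_integral_norm_eq_lintegral_enorm η.integrable]
        exact ENNReal.ofReal_le_ofReal hη

/-- The `L¹` norm of the inverse Fourier transform of `θ`, made positive. -/
def supF (θ : 𝓢(Space3, ℂ)) : ℝ := 1 + ∫ w, ‖(𝓕⁻ θ : 𝓢(Space3, ℂ)) w‖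

lemma supF_pos (θ : 𝓢(Space3, ℂ)) : 0 < supF θ := by
  have : 0 ≤ ∫ w, ‖(𝓕⁻ θ : 𝓢(Space3, ℂ)) w‖ := integral_nonneg fun _ => norm_nonneg _
  unfold supF
  linarith

lemma enorm_fourier_cut_le (θ : 𝓢(Space3, ℂ)) {ε : ℝ} (hε : 0 < ε) (hg : g.HasTemperateGrowth)
    (ξ : Space3) : ‖𝓕 (cut θ ε g) ξ‖ₑ ≤ ENNReal.ofReal (supF θ) * fourierSupNorm g := by
  rw [fourier_cut θ hε hg, mul_comm]
  refine enorm_integral_mul_fourier_le g _ (supF_pos θ) ?_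
  rw [integral_norm_kern]
  unfold supF
  linarith

end

section

/-! ### Decay of frequency localized solutions -/

variable {a b : ℝ} {φ f : ℝ × Space3 → ℂ} {c K : ℝ}

lemma volume_annulus_le (hc : 0 < c) (hK : 0 < K) :
    volume (annulus c K) ≤ ENNReal.ofReal (5 * c ^ 3 * K ^ 3) := by
  have hsub : annulus c K ⊆ Metric.closedBall 0 (c * K) := fun ξ hξ => by
    rw [mem_closedBall_zero_iff]; exact hξ.2
  refine (measure_mono hsub).trans ?_
  rw [EuclideanSpace.volume_closedBall_fin_three, ← ENNReal.ofReal_pow (by positivity),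
    ← ENNReal.ofReal_mul (by positivity)]
  refine ENNReal.ofReal_le_ofReal ?_
  have : Real.pi * 4 / 3 ≤ 5 := by linarith [Real.pi_lt_d2]
  calc (c * K) ^ 3 * (Real.pi * 4 / 3) ≤ (c * K) ^ 3 * 5 := by gcongr
    _ = _ := by ring

lemma FourierVanish.enorm_le {A : Set Space3} {g : 𝓢(Space3, ℂ)} {B : ℝ≥0∞} (hA : MeasurableSet A)
    (hg : FourierVanish A g) (hB : ∀ ξ ∈ A, ‖𝓕 g ξ‖ₑ ≤ B) (x : Space3) :
    ‖g x‖ₑ ≤ volume A * B := by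
  refine (enorm_le_lintegral_fourier g x).trans ?_
  calc _ ≤ ∫⁻ ξ, A.indicator (fun _ => B) ξ := lintegral_mono fun ξ => by
        by_cases hξ : ξ ∈ A
        · rw [indicator_of_mem hξ]; exact hB ξ hξ
        · rw [indicator_of_notMem hξ, hg ξ hξ, enorm_zero]
    _ = _ := by rw [lintegral_indicator hA, setLIntegral_const, mul_comm]

lemma FourierVanish.l2_le {A : Set Space3} {g : 𝓢(Space3, ℂ)} {B : ℝ≥0∞} (hA : MeasurableSet A)
    (hg : FourierVanish A g) (hB : ∀ ξ, ‖𝓕 g ξ‖ₑ ≤ B) :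
    l2 g ≤ volume A ^ (1 / 2 : ℝ) * B := by
  rw [← l2_fourier]
  have h1 : ∫⁻ ξ, ‖𝓕 g ξ‖ₑ ^ (2 : ℝ) ≤ volume A * B ^ (2 : ℝ) := by
    calc _ ≤ ∫⁻ ξ, A.indicator (fun _ => B ^ (2 : ℝ)) ξ := lintegral_mono fun ξ => by
          by_cases hξ : ξ ∈ A
          · rw [indicator_of_mem hξ]; exact ENNReal.rpow_le_rpow (hB ξ) zero_le_two
          · rw [indicator_of_notMem hξ, hg ξ hξ, enorm_zero, ENNReal.zero_rpow_of_pos two_pos]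
      _ = _ := by rw [lintegral_indicator hA, setLIntegral_const, mul_comm]
  rw [eLpNorm_eq_lintegral_rpow_enorm_toReal (by simp) (by simp), ENNReal.toReal_ofNat]
  calc _ ≤ (volume A * B ^ (2 : ℝ)) ^ (1 / 2 : ℝ) := ENNReal.rpow_le_rpow h1 (by norm_num)
    _ = _ := by
      rw [ENNReal.mul_rpow_of_nonneg _ _ (by norm_num), ← ENNReal.rpow_mul]
      norm_num

open Filter in
/-- A uniform `L²` bound is inherited by the limit in which the cutoff is removed. -/
lemma eLpNorm_le_of_l2_cut_le {χ : 𝓢(Space3, ℂ)} (h1 : χ 0 = 1) {g : Space3 → ℂ}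
    (hg : g.HasTemperateGrowth) {Q : ℝ≥0∞} {ε₀ : ℝ} (h0 : 0 < ε₀)
    (hle : ∀ ε, 0 < ε → ε ≤ ε₀ → l2 (cut χ ε g) ≤ Q) : eLpNorm g 2 volume ≤ Q := by
  set e : ℕ → ℝ := fun n => ε₀ / (n + 1) with he
  have hpos : ∀ n, 0 < e n := fun n => by positivity
  have hle0 : ∀ n, e n ≤ ε₀ := fun n => div_le_self h0.le (by
    have : (0 : ℝ) ≤ n := n.cast_nonneg
    linarith)
  have hlim : Tendsto e atTop (nhds 0) := by
    have := (tendsto_one_div_add_atTop_nhds_zero_nat (𝕜 := ℝ)).const_mul ε₀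
    rw [mul_zero] at this
    exact this.congr fun n => mul_one_div _ _
  have key := Lp.eLpNorm_lim_le_liminf_eLpNorm (p := 2) (μ := volume)
    (f := fun n => (cut χ (e n) g : Space3 → ℂ))
    (fun n => (cut χ (e n) g).continuous.aestronglyMeasurable) g
    (Eventually.of_forall fun y => by
      simp only [cutClass_temperate.cut_apply trivial hg (hpos _)]
      have hc : Continuous fun s : ℝ => χ (s • y) * g y := by
        have := χ.continuous
        fun_prop
      have h2 := (hc.tendsto 0).comp hlim
      rw [zero_smul, h1, one_mul] at h2
      exact h2)
  refine key.trans ?_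
  refine liminf_le_of_le (by isBoundedDefault) fun B hB => ?_
  obtain ⟨n, hn⟩ := hB.exists
  exact hn.trans (hle _ (hpos n) (hle0 n))

/-- The Fourier transform of a bump function of integral one. -/
lemma exists_bandlimited_cutoff : ∃ χ : 𝓢(Space3, ℂ), χ 0 = 1 ∧
    ∀ w, 1 < ‖w‖ → (𝓕⁻ χ : 𝓢(Space3, ℂ)) w = 0 := by
  let g : ContDiffBump (0 : Space3) := ⟨1 / 2, 1, by norm_num, by norm_num⟩
  have h1 : HasCompactSupport fun y => ((g.normed volume y : ℝ) : ℂ) :=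
    g.hasCompactSupport_normed.comp_left Complex.ofReal_zero
  set β := h1.toSchwartzMap (Complex.ofRealCLM.contDiff.comp g.contDiff_normed) with hβ
  have hβa : ∀ y, β y = ((g.normed volume y : ℝ) : ℂ) := fun y => rfl
  refine ⟨𝓕 β, ?_, fun w hw => ?_⟩
  · rw [SchwartzMap.fourier_coe, Real.fourier_eq]
    simp only [inner_zero_right, neg_zero, AddChar.map_zero_eq_one, one_smul, hβa]
    rw [integral_complex_ofReal, g.integral_normed, Complex.ofReal_one]
  · rw [FourierTransform.fourierInv_fourier_eq, hβa]
    have : w ∉ Function.support (g.normed volume) := by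
      rw [g.support_normed_eq, mem_ball_zero_iff]
      exact hw.le.not_gt
    rw [Function.notMem_support.1 this, Complex.ofReal_zero]

/-- The neighbourhood of the frequencies of `φ` of a small size is contained in a fixed annulus. -/
lemma lt_norm_sub_of_notMem_annulus {Λ : ℝ} (hΛ : 1 ≤ Λ) (hK : 0 < K) {ε : ℝ}
    (hε : ε ≤ K / (8 * Real.pi * Λ)) {ξ ζ : Space3} (hξ : ξ ∉ annulus (4 * Real.pi * Λ) K)
    (h1 : Λ⁻¹ * K ≤ ‖(2 * Real.pi) • ζ‖) (h2 : ‖(2 * Real.pi) • ζ‖ ≤ Λ * K) :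
    ε * 1 < ‖ζ - ξ‖ := by
  have hπ := Real.pi_gt_three
  have hΛ0 : 0 < Λ := by linarith
  rw [norm_smul, Real.norm_of_nonneg (by positivity)] at h1 h2
  have e1 : K / (4 * Real.pi * Λ) = 2 * (K / (8 * Real.pi * Λ)) := by field_simp; norm_num
  have e2 : Λ⁻¹ * K = 2 * Real.pi * (4 * (K / (8 * Real.pi * Λ))) := by field_simp; norm_num
  set u := K / (8 * Real.pi * Λ) with hu
  have hu0 : 0 < u := by positivity
  have h3 : 4 * u ≤ ‖ζ‖ := by
    rw [e2] at h1
    exact le_of_mul_le_mul_left h1 (by positivity)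
  have hKu : u ≤ Λ * K := by
    rw [hu, div_le_iff₀ (by positivity)]
    have hΛΛ : 1 ≤ Λ * Λ := one_le_mul_of_one_le_of_one_le hΛ hΛ
    have : 1 ≤ Λ * (8 * Real.pi * Λ) := by
      calc 1 ≤ (8 * Real.pi) * (Λ * Λ) := one_le_mul_of_one_le_of_one_le (by linarith) hΛΛ
        _ = _ := by ring
    nlinarith
  rw [annulus, mem_ofPred_eq, mem_Icc, not_and_or, not_le, not_le, e1] at hξ
  rcases hξ with hξ | hξ
  · have := norm_sub_norm_le ζ ξ
    linarith
  · have h4 := norm_sub_norm_le ξ ζ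
    rw [norm_sub_rev] at h4
    have h5 : ‖ζ‖ ≤ Λ * K := by nlinarith [norm_nonneg ζ]
    have h6 : 3 * (Λ * K) ≤ 4 * Real.pi * Λ * K := by nlinarith [mul_pos hΛ0 hK]
    have : 0 < Λ * K := by positivity
    linarith

/-- On an annulus, a Fourier transform is controlled by that of the gradient. -/
lemma enorm_fourier_le_of_mem_annulus (hc : 0 < c) (hK : 0 < K) (g : 𝓢(Space3, ℂ)) {ξ : Space3}
    (hξ : ξ ∈ annulus c K) :
    ‖𝓕 g ξ‖ₑ ≤ ENNReal.ofReal (c / K) * ∑ j, ‖𝓕 (sd j g) ξ‖ₑ := by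
  have h1 : ‖𝓕 g ξ‖ ≤ c / K * ∑ j, ‖𝓕 (sd j g) ξ‖ := by
    have h2 : ∀ j : Fin 3, |ξ j| * ‖𝓕 g ξ‖ ≤ ‖𝓕 (sd j g) ξ‖ := fun j => by
      rw [fourier_sd_apply, mul_assoc (2 * Real.pi * Complex.I : ℂ),
        norm_mul _ ((ξ j : ℂ) * 𝓕 g ξ), norm_mul (ξ j : ℂ), Complex.norm_real, Real.norm_eq_abs]
      refine le_mul_of_one_le_left (by positivity) ?_
      simp only [norm_mul, Complex.norm_ofNat, Complex.norm_real, Complex.norm_I, mul_one,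
        Real.norm_eq_abs, abs_of_pos Real.pi_pos]
      linarith [Real.pi_gt_three]
    have h3 : K / c * ‖𝓕 g ξ‖ ≤ ∑ j, ‖𝓕 (sd j g) ξ‖ := by
      calc _ ≤ ‖ξ‖ * ‖𝓕 g ξ‖ := by gcongr; exact hξ.1
        _ ≤ (∑ j, |ξ j|) * ‖𝓕 g ξ‖ := by gcongr; exact norm_le_sum ξ
        _ ≤ _ := by rw [Finset.sum_mul]; exact Finset.sum_le_sum fun j _ => h2 j
    calc _ = c / K * (K / c * ‖𝓕 g ξ‖) := by field_simp
      _ ≤ _ := by gcongr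
  rw [← ofReal_norm]
  refine (ENNReal.ofReal_le_ofReal h1).trans (le_of_eq ?_)
  rw [ENNReal.ofReal_mul (by positivity), ENNReal.ofReal_sum_of_nonneg fun _ _ => norm_nonneg _]
  simp only [ofReal_norm]

end

section

section

variable {a b : ℝ} {φ f : ℝ × Space3 → ℂ} {c K : ℝ} {t ε₀ : ℝ} {χ : 𝓢(Space3, ℂ)} {A : Set Space3}

/-- A cutoff `χ` is admissible for the frequency set `A` at the scales at most `ε₀` if it does not
move the frequencies out of the annulus. -/
structure AnnulusCutoff (χ : 𝓢(Space3, ℂ)) (A : Set Space3) (c K ε₀ : ℝ) : Prop where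
  one_le : 1 ≤ c
  pos : 0 < K
  scale_pos : 0 < ε₀
  apply_zero : χ 0 = 1
  vanish : ∀ g : Space3 → ℂ, g.HasTemperateGrowth → FourierOff A g → ∀ ε, 0 < ε → ε ≤ ε₀ →
    FourierVanish (annulus c K) (cut χ ε g)

namespace AnnulusCutoff

lemma eLpNorm_ne_top (H : AnnulusCutoff χ A c K ε₀) {g : Space3 → ℂ} (hg : g.HasTemperateGrowth)
    (hA : FourierOff A g) (hn : fourierSupNorm g ≠ ⊤) : eLpNorm g 2 volume ≠ ⊤ := by
  have hc : 0 < c := zero_lt_one.trans_le H.one_le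
  have hv : volume (annulus c K) ≠ ⊤ := ne_top_of_le_ne_top ENNReal.ofReal_ne_top
    (volume_annulus_le hc H.pos)
  refine ne_top_of_le_ne_top ?_ (eLpNorm_le_of_l2_cut_le H.apply_zero hg H.scale_pos
    fun ε hε hε0 => (H.vanish g hg hA ε hε hε0).l2_le (measurableSet_annulus c K)
      (enorm_fourier_cut_le χ hε hg))
  exact ENNReal.mul_ne_top (ENNReal.rpow_ne_top_of_nonneg (by norm_num) hv)
    (ENNReal.mul_ne_top ENNReal.ofReal_ne_top hn)

/-- The elementary bound at low frequencies. -/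
lemma enorm_le_of_le_one (H : AnnulusCutoff χ A c K ε₀) (hK1 : K ≤ 1) {g : Space3 → ℂ}
    (hg : g.HasTemperateGrowth) (hA : FourierOff A g) (x : Space3) :
    ‖g x‖ₑ ≤ ENNReal.ofReal (15 * c ^ 4 * K ^ 2 * supF χ) * fourierSupNorm g := by
  have hc : 0 < c := zero_lt_one.trans_le H.one_le
  refine le_of_cut_le H.apply_zero (G := fun _ => 0) H.scale_pos tendsto_const_nhds
    fun ε hε hε0 => ?_
  rw [← cutClass_temperate.cut_apply trivial hg hε, add_zero]
  refine ((H.vanish g hg hA ε hε hε0).enorm_le (measurableSet_annulus c K)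
    (fun ξ _ => enorm_fourier_cut_le χ hε hg ξ) x).trans ?_
  rw [← mul_assoc]
  gcongr
  refine (mul_le_mul_left (volume_annulus_le hc H.pos) _).trans ?_
  have hK0 := H.pos
  rw [← ENNReal.ofReal_mul (by positivity)]
  refine ENNReal.ofReal_le_ofReal (mul_le_mul_of_nonneg_right ?_ (supF_pos χ).le)
  calc 5 * c ^ 3 * K ^ 3 = 5 * (c ^ 3 * (K ^ 2 * K)) := by ring
    _ ≤ 15 * (c ^ 4 * (K ^ 2 * 1)) := by
        gcongr
        · norm_num
        · exact H.one_le
        · norm_num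
    _ = _ := by ring

/-- The elementary bound at high frequencies, which uses one derivative. -/
lemma enorm_le_of_one_le (H : AnnulusCutoff χ A c K ε₀) (hK1 : 1 ≤ K) {g : Space3 → ℂ}
    (hg : g.HasTemperateGrowth) (hA : FourierOff A g) {M : ℝ≥0∞} (hM : M ≠ ⊤)
    (h0 : fourierSupNorm g ≤ M) (h1 : ∀ j, fourierSupNorm (pd j g) ≤ M) (x : Space3) :
    ‖g x‖ₑ ≤ ENNReal.ofReal (15 * c ^ 4 * K ^ 2 * supF χ) * M := by
  have hc : 0 < c := zero_lt_one.trans_le H.one_le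
  have hK0 := H.pos
  have hB := supF_pos χ
  set E : ℝ → ℝ≥0∞ := fun ε => ENNReal.ofReal (5 * c ^ 3 * K ^ 3) * (ENNReal.ofReal (c / K) *
    (ENNReal.ofReal |ε| * (∑ j, ENNReal.ofReal (supF (sd j χ)) * M))) with hE
  have hlim : Filter.Tendsto E (nhdsWithin 0 (Ioi 0)) (nhds 0) := by
    have hε : Filter.Tendsto (fun ε : ℝ => ENNReal.ofReal |ε|) (nhdsWithin 0 (Ioi 0))
        (nhds 0) := by
      have : Continuous fun ε : ℝ => ENNReal.ofReal |ε| :=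
        ENNReal.continuous_ofReal.comp continuous_abs
      have h3 := this.tendsto 0
      rw [abs_zero, ENNReal.ofReal_zero] at h3
      exact h3.mono_left nhdsWithin_le_nhds
    have hS : ∑ j, ENNReal.ofReal (supF (sd j χ)) * M ≠ ⊤ :=
      ENNReal.sum_ne_top.2 fun j _ => ENNReal.mul_ne_top ENNReal.ofReal_ne_top hM
    have l1 := ENNReal.Tendsto.mul_const hε (Or.inr hS)
    have l2 := ENNReal.Tendsto.const_mul (a := ENNReal.ofReal (c / K)) l1
      (Or.inr ENNReal.ofReal_ne_top)
    have l3 := ENNReal.Tendsto.const_mul (a := ENNReal.ofReal (5 * c ^ 3 * K ^ 3)) l2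
      (Or.inr ENNReal.ofReal_ne_top)
    simpa using l3
  refine le_of_cut_le H.apply_zero H.scale_pos hlim fun ε hε hε0 => ?_
  rw [← cutClass_temperate.cut_apply trivial hg hε]
  have hsd : ∀ j ξ, ‖𝓕 (sd j (cut χ ε g)) ξ‖ₑ ≤ ENNReal.ofReal |ε| *
      (ENNReal.ofReal (supF (sd j χ)) * M) + ENNReal.ofReal (supF χ) * M := by
    intro j ξ
    rw [cutClass_temperate.sd_cut trivial hg hε, fourier_add_apply, fourier_smul_apply]
    refine (enorm_add_le _ _).trans ?_
    rw [enorm_mul]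
    gcongr
    · rw [← ofReal_norm, Complex.norm_real, Real.norm_eq_abs]
    · exact (enorm_fourier_cut_le (sd j χ) hε hg ξ).trans (by gcongr)
    · exact (enorm_fourier_cut_le χ hε (hasTemperateGrowth_pd hg j) ξ).trans (by gcongr; exact h1 j)
  refine ((H.vanish g hg hA ε hε hε0).enorm_le (measurableSet_annulus c K)
    (B := ENNReal.ofReal (c / K) * ∑ j : Fin 3, (ENNReal.ofReal |ε| *
      (ENNReal.ofReal (supF (sd j χ)) * M) + ENNReal.ofReal (supF χ) * M))
    (fun ξ hξ => (enorm_fourier_le_of_mem_annulus hc H.pos _ hξ).trans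
      (by gcongr with j; exact hsd j ξ)) x).trans ?_
  refine (mul_le_mul_left (volume_annulus_le hc H.pos) _).trans ?_
  rw [Finset.sum_add_distrib, ← Finset.mul_sum, mul_add, mul_add, add_comm]
  refine add_le_add ?_ le_rfl
  simp only [Finset.sum_const, Finset.card_univ, Fintype.card_fin, nsmul_eq_mul]
  rw [← mul_assoc, ← mul_assoc, ← mul_assoc]
  gcongr
  rw [show ((3 : ℕ) : ℝ≥0∞) = ENNReal.ofReal 3 by simp, ← ENNReal.ofReal_mul (by positivity),
    ← ENNReal.ofReal_mul (by positivity), ← ENNReal.ofReal_mul (by positivity)]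
  refine ENNReal.ofReal_le_ofReal (le_of_eq ?_)
  field_simp
  norm_num

end AnnulusCutoff

lemma SlabLoc.enorm_grad_le_of_le_one (H : AnnulusCutoff χ A c K ε₀) (h : SlabLoc a b A φ)
    (ht : t ∈ Ioo a b) (hM : gradGamNorm fourierSupNorm 2 φ t ≠ ⊤) (μ : Fin 4) (x : Space3) :
    ‖WaveDecay.grad μ φ (t, x)‖ₑ ≤ ENNReal.ofReal (15 * c ^ 4 * K ^ 2 * supF χ) *
      gradGamNorm fourierSupNorm 2 φ t := by
  have hg := (h.grad μ).temp.slice ht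
  have hA := (h.grad μ).off t ht
  have b0 := le_gradGamNorm fourierSupNorm (n := 2) φ t [] (by simp) μ
  have b1 : ∀ j, fourierSupNorm (pd j fun y => WaveDecay.grad μ φ (t, y)) ≤
      gradGamNorm fourierSupNorm 2 φ t := fun j => by
    rw [h.temp.smooth.pd_grad ht]
    exact le_gradGamNorm fourierSupNorm φ t [some j] (by simp) μ
  rcases le_total K 1 with hK | hK
  · exact (H.enorm_le_of_le_one hK hg hA x).trans (mul_le_mul_right b0 _)
  · exact H.enorm_le_of_one_le hK hg hA hM b0 b1 x

/-- Decay of a frequency localized solution for positive times. -/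
lemma SlabLoc.enorm_grad_le_of_pos (H : AnnulusCutoff χ A c K ε₀) (h : SlabLoc a b A φ)
    (hs : IsSmoothSolution a b φ f) (ht : t ∈ Ioo a b) (ht0 : 0 < t)
    (hM : gradGamNorm fourierSupNorm 2 φ t ≠ ⊤) (μ : Fin 4) (x : Space3) :
    ‖WaveDecay.grad μ φ (t, x)‖ₑ ≤ ENNReal.ofReal (4096 * c ^ 4 * (K ^ 2 / t)) *
        (ENNReal.ofReal (supF χ) * gradGamNorm fourierSupNorm 2 φ t) +
      ENNReal.ofReal (4096 * c ^ 4 * (K * (√t)⁻¹)) *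
        (‖t‖ₑ * (4 * supTwo χ * gamNorm normL2 1 f t)) := by
  set M := gradGamNorm fourierSupNorm 2 φ t with hMdef
  set F := gamNorm normL2 1 f t with hFdef
  have h1 := h.scaling
  have h2 := h1.scaling
  have hf := hs.smooth_rhs
  set p := fun (μ : Fin 4) y => WaveDecay.grad μ φ (t, y) with hp
  set p₁ := fun (μ : Fin 4) y => WaveDecay.grad μ (WaveDecay.scaling φ) (t, y) with hp₁
  set p₂ := fun (μ : Fin 4) y => WaveDecay.grad μ (WaveDecay.scaling (WaveDecay.scaling φ)) (t, y)
    with hp₂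
  have Hp : ∀ μ, (p μ).HasTemperateGrowth := fun μ => (h.grad μ).temp.slice ht
  have Hp₁ : ∀ μ, (p₁ μ).HasTemperateGrowth := fun μ => (h1.grad μ).temp.slice ht
  have Hp₂ : ∀ μ, (p₂ μ).HasTemperateGrowth := fun μ => (h2.grad μ).temp.slice ht
  have Ap : ∀ μ, FourierOff A (p μ) := fun μ => (h.grad μ).off t ht
  have Ap₁ : ∀ μ, FourierOff A (p₁ μ) := fun μ => (h1.grad μ).off t ht
  have Ap₂ : ∀ μ, FourierOff A (p₂ μ) := fun μ => (h2.grad μ).off t ht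
  have Hf : (fun y => f (t, y)).HasTemperateGrowth := h.temp.slice_rhs hs ht
  have Hf₁ : (fun y => WaveDecay.scaling f (t, y) + 2 * f (t, y)).HasTemperateGrowth :=
    h1.temp.slice_rhs hs.scaling ht
  have Mp : ∀ μ, fourierSupNorm (p μ) ≤ M := fun μ =>
    le_gradGamNorm fourierSupNorm φ t [] (by simp) μ
  have Mp₁ : ∀ μ, fourierSupNorm (p₁ μ) ≤ M := fun μ =>
    le_gradGamNorm fourierSupNorm φ t [none] (by simp) μ
  have Mp₂ : ∀ μ, fourierSupNorm (p₂ μ) ≤ M := fun μ =>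
    le_gradGamNorm fourierSupNorm φ t [none, none] (by simp) μ
  have np : ∀ μ, eLpNorm (p μ) 2 volume ≠ ⊤ := fun μ =>
    H.eLpNorm_ne_top (Hp μ) (Ap μ) (ne_top_of_le_ne_top hM (Mp μ))
  have np₁ : ∀ μ, eLpNorm (p₁ μ) 2 volume ≠ ⊤ := fun μ =>
    H.eLpNorm_ne_top (Hp₁ μ) (Ap₁ μ) (ne_top_of_le_ne_top hM (Mp₁ μ))
  have hlim : ∀ q : Fin 4 → Space3 → ℂ, (∀ μ, (q μ).HasTemperateGrowth) →
      (∀ μ, eLpNorm (q μ) 2 volume ≠ ⊤) →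
      Filter.Tendsto (cutErr l2 t χ q) (nhdsWithin 0 (Ioi 0)) (nhds 0) := fun q hq hn =>
    tendsto_cutErr (fun μ => tendsto_l2_cut (sD_zero χ) (hq μ).1.continuous (hn μ))
      fun i μ => tendsto_l2_smul_cut _ (hn μ)
  have hG := ENNReal.Tendsto.const_mul (a := ENNReal.ofReal (4096 * c ^ 4 * (K * (√t)⁻¹)))
    ((hlim p Hp np).add (hlim p₁ Hp₁ np₁)) (Or.inr ENNReal.ofReal_ne_top)
  rw [add_zero, mul_zero] at hG
  refine le_of_cut_le (h := p μ) H.apply_zero H.scale_pos hG fun ε hε hε0 => ?_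
  rw [← cutClass_temperate.cut_apply trivial (Hp μ) hε]
  have main := enorm_le_of_annulus ht0 H.pos H.one_le (fun μ => cut χ ε (p μ))
    (fun μ => cut χ ε (p₁ μ)) (fun μ => cut χ ε (p₂ μ)) μ x (M := ENNReal.ofReal (supF χ) * M)
    (fun κ => H.vanish _ (Hp κ) (Ap κ) ε hε hε0) (fun κ => H.vanish _ (Hp₁ κ) (Ap₁ κ) ε hε hε0)
    (fun κ => H.vanish _ (Hp₂ κ) (Ap₂ κ) ε hε hε0)
    (fun κ ξ => (enorm_fourier_cut_le χ hε (Hp κ) ξ).trans (mul_le_mul_right (Mp κ) _))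
    (fun κ ξ => (enorm_fourier_cut_le χ hε (Hp₁ κ) ξ).trans (mul_le_mul_right (Mp₁ κ) _))
    (fun κ ξ => (enorm_fourier_cut_le χ hε (Hp₂ κ) ξ).trans (mul_le_mul_right (Mp₂ κ) _))
  refine main.trans ?_
  have b1 := cutClass_temperate.errNorm_le isSeminorm_l2 (χ := χ) trivial Hp Hp₁ Hf hε
    (hs.scalRel ht)
  have b2 := cutClass_temperate.errNorm_le isSeminorm_l2 (χ := χ) trivial Hp₁ Hp₂ Hf₁ hε
    (hs.scaling.scalRel ht)
  have d1 : l2 (cut χ ε fun y => f (t, y)) ≤ supTwo χ * F :=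
    (l2_cut_le_supTwo χ ε _).trans (by gcongr; exact eLpNorm_gam_le 1 f t [] (by simp))
  have d2 : l2 (cut χ ε fun y => WaveDecay.scaling f (t, y) + 2 * f (t, y)) ≤
      supTwo χ * (3 * F) :=
    (l2_cut_le_supTwo χ ε _).trans (by gcongr; exact hf.eLpNorm_scaled_rhs_le le_rfl ht)
  rw [add_assoc, ← mul_add]
  refine add_le_add le_rfl (mul_le_mul_right ?_ _)
  calc _ ≤ (‖t‖ₑ * (supTwo χ * F) + cutErr l2 t χ p ε) +
        (‖t‖ₑ * (supTwo χ * (3 * F)) + cutErr l2 t χ p₁ ε) :=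
        add_le_add (b1.trans (by gcongr)) (b2.trans (by gcongr))
    _ = _ := by ring

end

/-- The decay estimate for frequency localized solutions. -/
theorem exists_localized_decay (Λ : ℝ) (hΛ : 1 ≤ Λ) : ∃ C : ℝ, 0 < C ∧
    ∀ (k : ℤ) (a b : ℝ) (φ f : ℝ × Space3 → ℂ),
      IsSmoothSolution a b φ f → TemperateOnSlab a b φ →
      (∀ s ∈ Ioo a b, FrequencyLocalized Λ k (fun y => φ (s, y))) →
      ∀ t ∈ Ioo a b, 0 ≤ t → ∀ x : Space3,
        absGrad φ t x ≤ ENNReal.ofReal C *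
          (ENNReal.ofReal ((bracket t)⁻¹ * (2 : ℝ) ^ (2 * k)) *
              gradGamNorm fourierSupNorm 2 φ t +
            ENNReal.ofReal (bracket t ^ (1 / 2 : ℝ) * (2 : ℝ) ^ k) * gamNorm normL2 1 f t) := by
  obtain ⟨χ, hχ0, hχs⟩ := exists_bandlimited_cutoff
  have hπ := Real.pi_gt_three
  have hΛ0 : 0 < Λ := by linarith
  set c := 4 * Real.pi * Λ with hc
  have hc1 : 1 ≤ c := by
    rw [hc]; exact one_le_mul_of_one_le_of_one_le (by linarith) hΛ
  set B : ℝ := (supTwo χ).toReal with hB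
  have hBe : supTwo χ = ENNReal.ofReal B := (ENNReal.ofReal_toReal (supTwo_ne_top χ)).symm
  have hB0 : 0 ≤ B := ENNReal.toReal_nonneg
  have hD := supF_pos χ
  set D := supF χ with hDdef
  set C₀ : ℝ := 16384 * c ^ 4 * (B + D) with hC₀
  have hC₀pos : 0 < C₀ := by positivity
  refine ⟨4 * C₀, by positivity, fun k a b φ f h htemp hloc t ht ht0 x => ?_⟩
  set K : ℝ := (2 : ℝ) ^ k with hK
  have hKpos : 0 < K := zpow_pos two_pos k
  have hK2 : (2 : ℝ) ^ (2 * k) = K ^ 2 := by rw [hK, ← zpow_natCast, ← zpow_mul, mul_comm]; rfl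
  set A : Set Space3 := {ξ : Space3 | Λ⁻¹ * K ≤ ‖(2 * Real.pi) • ξ‖ ∧
    ‖(2 * Real.pi) • ξ‖ ≤ Λ * K} with hA
  have H : AnnulusCutoff χ A c K (K / (8 * Real.pi * Λ)) :=
    { one_le := hc1
      pos := hKpos
      scale_pos := by positivity
      apply_zero := hχ0
      vanish := fun g hg hgA ε hε hε0 => hgA.fourierVanish_cut hχs hε hg fun ξ hξ ζ hζ =>
        lt_norm_sub_of_notMem_annulus hΛ hKpos hε0 hξ hζ.1 hζ.2 }
  have hL : SlabLoc a b A φ :=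
    ⟨.of_temperateOnSlab h.smooth htemp, fun s hs => (hloc s hs).fourierOff⟩
  rw [hK2]
  set M := gradGamNorm fourierSupNorm 2 φ t with hM
  set F := gamNorm normL2 1 f t with hF
  have hbp := bracket_pos t
  have hcomp : ∀ μ, ‖grad μ φ (t, x)‖ₑ ≤ ENNReal.ofReal C₀ *
      (ENNReal.ofReal ((bracket t)⁻¹ * K ^ 2) * M +
        ENNReal.ofReal (bracket t ^ (1 / 2 : ℝ) * K) * F) := by
    intro μ
    by_cases hMtop : M = ⊤
    · rw [hMtop, ENNReal.mul_top (by simp; positivity), top_add,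
        ENNReal.mul_top (by simpa using hC₀pos)]
      exact le_top
    have hbi : ∀ s : ℝ, 0 ≤ s → t ≤ s → 1 ≤ s → s⁻¹ ≤ 2 * (bracket t)⁻¹ := fun s hs hts h1s => by
      rw [inv_eq_one_div, div_le_iff₀ (by linarith), mul_right_comm, ← div_eq_mul_inv,
        le_div_iff₀ hbp]
      linarith [bracket_le_one_add ht0]
    rcases le_total t 1 with ht1 | ht1
    · refine (hL.enorm_grad_le_of_le_one H ht hMtop μ x).trans ?_
      rw [mul_add, ofReal_mul_ofReal_mul hC₀pos.le]
      refine le_trans (mul_le_mul_left (ENNReal.ofReal_le_ofReal ?_) _) le_self_add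
      have hb := hbi 1 zero_le_one ht1 le_rfl
      rw [inv_one] at hb
      calc 15 * c ^ 4 * K ^ 2 * D ≤ 8192 * c ^ 4 * K ^ 2 * (B + D) * 1 := by
            rw [mul_one]; gcongr <;> linarith
        _ ≤ 8192 * c ^ 4 * K ^ 2 * (B + D) * (2 * (bracket t)⁻¹) := by gcongr
        _ = _ := by rw [hC₀]; ring
    · have htp : 0 < t := by linarith
      refine (hL.enorm_grad_le_of_pos H h ht htp hMtop μ x).trans ?_
      have e1 : ‖t‖ₑ = ENNReal.ofReal t := by rw [← ofReal_norm, Real.norm_of_nonneg htp.le]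
      have hst : (√t)⁻¹ * t = √t := by
        rw [inv_mul_eq_div, div_eq_iff (Real.sqrt_pos.2 htp).ne', Real.mul_self_sqrt htp.le]
      rw [e1, hBe, show (4 : ℝ≥0∞) = ENNReal.ofReal 4 by simp, mul_assoc (ENNReal.ofReal 4),
        ofReal_mul_ofReal_mul (by positivity), ofReal_mul_ofReal_mul (by positivity),
        ofReal_mul_ofReal_mul (by positivity), ofReal_mul_ofReal_mul (by positivity), mul_add,
        ofReal_mul_ofReal_mul hC₀pos.le, ofReal_mul_ofReal_mul hC₀pos.le]
      refine add_le_add (mul_le_mul_left (ENNReal.ofReal_le_ofReal ?_) _)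
        (mul_le_mul_left (ENNReal.ofReal_le_ofReal ?_) _)
      · have hb := hbi t ht0 le_rfl ht1
        calc 4096 * c ^ 4 * (K ^ 2 / t) * D ≤ 8192 * c ^ 4 * K ^ 2 * (B + D) * t⁻¹ := by
              rw [div_eq_mul_inv]
              calc _ = 4096 * c ^ 4 * K ^ 2 * D * t⁻¹ := by ring
                _ ≤ _ := by gcongr <;> linarith
          _ ≤ 8192 * c ^ 4 * K ^ 2 * (B + D) * (2 * (bracket t)⁻¹) := by gcongr
          _ = _ := by rw [hC₀]; ring
      · calc 4096 * c ^ 4 * (K * (√t)⁻¹) * t * 4 * B =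
              16384 * c ^ 4 * B * (((√t)⁻¹ * t) * K) := by ring
          _ ≤ 16384 * c ^ 4 * (B + D) * (bracket t ^ (1 / 2 : ℝ) * K) := by
              rw [hst]
              gcongr
              · linarith
              · exact sqrt_le_rpow_bracket
  rw [absGrad]
  refine (Finset.sum_le_sum fun μ _ => hcomp μ).trans (le_of_eq ?_)
  rw [Finset.sum_const, Finset.card_univ, Fintype.card_fin, nsmul_eq_mul, ← mul_assoc]
  congr 1
  rw [ENNReal.ofReal_mul (p := 4) (by norm_num)]
  simp

end

section

/-! ### Integrals over spheres -/

/-- Differentiation of an integral over the sphere with respect to a parameter. -/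
lemma hasDerivAt_integral_sph {F F' : ℝ → S2 → ℂ} {c d s : ℝ} (hs : s ∈ Ioo c d)
    (hF : ∀ u ∈ Ioo c d, Continuous (F u))
    (hF' : ContinuousOn (fun p : ℝ × S2 => F' p.1 p.2) (Ioo c d ×ˢ univ))
    (h : ∀ u ∈ Ioo c d, ∀ ν, HasDerivAt (fun u => F u ν) (F' u ν) u) :
    HasDerivAt (fun u => ∫ ν, F u ν ∂sph) (∫ ν, F' s ν ∂sph) s := by
  have hfin : IsFiniteMeasure sph := inferInstance
  obtain ⟨c', hc'⟩ := exists_between hs.1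
  obtain ⟨d', hd'⟩ := exists_between hs.2
  have hsub : Icc c' d' ⊆ Ioo c d := Icc_subset_Ioo hc'.1 hd'.2
  obtain ⟨B, hB⟩ := (isCompact_Icc (a := c') (b := d')).prod (isCompact_univ (X := S2))
    |>.exists_bound_of_continuousOn (hF'.mono (prod_mono hsub subset_rfl))
  have hint : ∀ g : S2 → ℂ, Continuous g → Integrable g sph := fun g hg =>
    hg.integrable_of_hasCompactSupport (HasCompactSupport.of_compactSpace g)
  have hF's : Continuous (F' s) := by
    have := hF'.comp_continuous (f := fun ν : S2 => (s, ν)) (by fun_prop) fun ν => ⟨hs, mem_univ ν⟩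
    exact this
  refine (hasDerivAt_integral_of_dominated_loc_of_deriv_le (𝕜 := ℝ) (s := Ioo c' d')
    (bound := fun _ => B) (isOpen_Ioo.mem_nhds ⟨hc'.2, hd'.1⟩) ?_ (hint _ (hF s hs))
    hF's.aestronglyMeasurable ?_ (integrable_const B) ?_).2
  · filter_upwards [isOpen_Ioo.mem_nhds hs] with u hu using (hF u hu).aestronglyMeasurable
  · exact Filter.Eventually.of_forall fun ν u hu => hB (u, ν) ⟨Ioo_subset_Icc_self hu, mem_univ ν⟩
  · exact Filter.Eventually.of_forall fun ν u hu => h u (hsub (Ioo_subset_Icc_self hu)) ν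

/-- The rotation by the angle `θ` in the plane spanned by `e_i` and `e_j`, as a linear map. -/
def rotLin (i j : Fin 3) (θ : ℝ) : Space3 →ₗ[ℝ] Space3 where
  toFun y := y + (((Real.cos θ - 1) * y i - Real.sin θ * y j) • bas i +
    (Real.sin θ * y i + (Real.cos θ - 1) * y j) • bas j)
  map_add' y z := by
    ext k
    simp
    split_ifs <;> ring
  map_smul' c y := by
    ext k
    simp
    split_ifs <;> ring

/-- The rotation by the angle `θ` in the plane spanned by `e_i` and `e_j`. -/
def rot {i j : Fin 3} (hij : i ≠ j) (θ : ℝ) : Space3 ≃ₗᵢ[ℝ] Space3 :=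
  LinearIsometry.toLinearIsometryEquiv
    { toLinearMap := rotLin i j θ
      norm_map' := fun y => by
        refine (sq_eq_sq₀ (norm_nonneg _) (norm_nonneg _)).1 ?_
        have e1 : inner ℝ (bas i) (bas j) = (0 : ℝ) := by
          rw [inner_bas]; simp [bas, hij]
        have e2 : ∀ k, inner ℝ y (bas k) = y k := inner_bas y
        have e3 : ∀ k : Fin 3, ‖(bas k : Space3)‖ ^ 2 = 1 := fun k => by simp [bas]
        change ‖y + (_ + _)‖ ^ 2 = _
        rw [norm_add_sq_real, norm_add_sq_real, inner_add_right, inner_smul_right, inner_smul_right,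
          inner_smul_left, inner_smul_right, e1, e2, e2, norm_smul, norm_smul, mul_pow, mul_pow,
          e3, e3, Real.norm_eq_abs, Real.norm_eq_abs, sq_abs, sq_abs]
        have := Real.sin_sq_add_cos_sq θ
        linear_combination (y i ^ 2 + y j ^ 2) * this } rfl

lemma rot_apply {i j : Fin 3} (hij : i ≠ j) (θ : ℝ) (y : Space3) :
    rot hij θ y = y + (((Real.cos θ - 1) * y i - Real.sin θ * y j) • bas i +
      (Real.sin θ * y i + (Real.cos θ - 1) * y j) • bas j) := rfl

lemma integral_sph_rotate (L : Space3 ≃ₗᵢ[ℝ] Space3) {g : Space3 → ℂ} (hg : Continuous g) :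
    ∫ ν : S2, g (L ν.1) ∂sph = ∫ ν : S2, g ν.1 ∂sph := by
  have hc : Continuous fun ν : S2 => g ν.1 := by fun_prop
  have h := integral_map (μ := sph) (measurePreserving_sphMap L).measurable.aemeasurable
    (f := fun ν : S2 => g ν.1) hc.aestronglyMeasurable
  rw [(measurePreserving_sphMap L).map_eq] at h
  exact h.symm

lemma fderiv_eq_sum_pd (w : Space3 → ℂ) (y z : Space3) :
    fderiv ℝ w y z = ∑ i, (z i : ℂ) * pd i w y := by
  conv_lhs => rw [← sum_smul_bas z]
  rw [map_sum]
  simp only [map_smul, Complex.real_smul, pd]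

lemma contDiff_pd {w : Space3 → ℂ} (hw : ContDiff ℝ ∞ w) (i : Fin 3) : ContDiff ℝ ∞ (pd i w) :=
  (hw.fderiv_right (by simp)).clm_apply contDiff_const

/-- Angular derivatives integrate to zero over spheres, by rotation invariance. -/
lemma integral_sph_angular {w : Space3 → ℂ} (hw : ContDiff ℝ ∞ w) {i j : Fin 3} (hij : i ≠ j)
    (r : ℝ) : ∫ ν : S2, (((r * ν.1 i : ℝ) : ℂ) * pd j w (r • ν.1) -
      ((r * ν.1 j : ℝ) : ℂ) * pd i w (r • ν.1)) ∂sph = 0 := by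
  have hdiff := hw.differentiable (by simp)
  have hpd := fun k => (contDiff_pd hw k).continuous
  have hwc := hw.continuous
  have hrot : ∀ θ, Continuous fun ν : S2 => r • rot hij θ ν.1 := fun θ => by
    simp only [rot_apply]; fun_prop
  have hrot2 : Continuous fun p : ℝ × S2 => r • rot hij p.1 p.2.1 := by
    simp only [rot_apply]; fun_prop
  set D : ℝ → S2 → Space3 := fun θ ν => r •
    (((-Real.sin θ) * ν.1 i - Real.cos θ * ν.1 j) • bas i +
      (Real.cos θ * ν.1 i + (-Real.sin θ) * ν.1 j) • bas j) with hD
  have hDc : Continuous fun p : ℝ × S2 => D p.1 p.2 := by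
    simp only [hD]; fun_prop
  have key := hasDerivAt_integral_sph (F := fun θ ν => w (r • rot hij θ ν.1))
    (F' := fun θ ν => ∑ k, ((D θ ν k : ℝ) : ℂ) * pd k w (r • rot hij θ ν.1)) (c := -1) (d := 1)
    (s := 0) (by norm_num) (fun θ _ => hwc.comp (hrot θ)) ?_ ?_
  · have hconst : ∀ θ, ∫ ν : S2, w (r • rot hij θ ν.1) ∂sph = ∫ ν : S2, w (r • ν.1) ∂sph :=
      fun θ => integral_sph_rotate (rot hij θ) (g := fun y => w (r • y)) (by fun_prop)
    simp only [hconst] at key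
    have h0 := key.unique (hasDerivAt_const 0 _)
    rw [← h0]
    refine integral_congr_ae (Filter.Eventually.of_forall fun ν => ?_)
    beta_reduce
    have hr0 : rot hij 0 ν.1 = ν.1 := by rw [rot_apply]; simp
    rw [hr0, ← fderiv_eq_sum_pd]
    simp only [hD, Real.sin_zero, Real.cos_zero, pd, map_smul, map_add, Complex.real_smul]
    push_cast
    ring
  · refine Continuous.continuousOn ?_
    refine continuous_finsetSum _ fun k _ => ?_
    have h1 : Continuous fun p : ℝ × S2 => ((D p.1 p.2 k : ℝ) : ℂ) := by fun_prop
    exact h1.mul ((hpd k).comp hrot2)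
  · intro θ _ ν
    have h1 : HasDerivAt (fun θ => r • rot hij θ ν.1) (D θ ν) θ := by
      simp only [rot_apply, hD]
      refine HasDerivAt.const_smul r ?_
      have hc := (Real.hasDerivAt_cos θ).sub_const 1
      have hs := Real.hasDerivAt_sin θ
      exact ((((hc.mul_const (ν.1 i)).sub (hs.mul_const (ν.1 j))).smul_const (bas i)).add
        (((hs.mul_const (ν.1 i)).add (hc.mul_const (ν.1 j))).smul_const (bas j))).const_add ν.1
    have h2 := (hdiff (r • rot hij θ ν.1)).hasFDerivAt.comp_hasDerivAt θ h1
    rw [fderiv_eq_sum_pd] at h2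
    exact h2

end

section

/-! ### Kirchhoff's formula -/

/-- The Laplacian of the sphere through `y` centred at the origin, multiplied by `|y|²`. -/
def sphLap (v : Space3 → ℂ) (y : Space3) : ℂ :=
  (∑ k, (y k : ℂ) ^ 2) * ∑ i, pd i (pd i v) y - ∑ i, ∑ j, (y i : ℂ) * (y j : ℂ) * pd j (pd i v) y -
    2 * ∑ i, (y i : ℂ) * pd i v y

/-- The angular derivative `y_i ∂_j - y_j ∂_i`. -/
def ang (i j : Fin 3) (v : Space3 → ℂ) (y : Space3) : ℂ :=
  (y i : ℂ) * pd j v y - (y j : ℂ) * pd i v y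

lemma contDiff_ang {v : Space3 → ℂ} (hv : ContDiff ℝ ∞ v) (i j : Fin 3) :
    ContDiff ℝ ∞ (ang i j v) := by
  have h1 : ∀ k : Fin 3, ContDiff ℝ ∞ fun y : Space3 => ((y k : ℝ) : ℂ) := fun k =>
    Complex.ofRealCLM.contDiff.comp (by fun_prop)
  exact ((h1 i).mul (contDiff_pd hv j)).sub ((h1 j).mul (contDiff_pd hv i))

lemma pd_ang {v : Space3 → ℂ} (hv : ContDiff ℝ ∞ v) (i j k : Fin 3) (y : Space3) :
    pd k (ang i j v) y = (if i = k then 1 else 0) * pd j v y + (y i : ℂ) * pd k (pd j v) y -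
      ((if j = k then 1 else 0) * pd i v y + (y j : ℂ) * pd k (pd i v) y) := by
  have h1 : ∀ l : Fin 3, HasFDerivAt (fun y : Space3 => ((y l : ℝ) : ℂ))
      (Complex.ofRealCLM.comp (EuclideanSpace.proj (𝕜 := ℝ) l)) y := fun l =>
    (Complex.ofRealCLM.comp (EuclideanSpace.proj (𝕜 := ℝ) l)).hasFDerivAt
  have h2 : ∀ l, HasFDerivAt (pd l v) (fderiv ℝ (pd l v) y) y := fun l =>
    ((contDiff_pd hv l).differentiable (by simp) y).hasFDerivAt
  have h3 := ((h1 i).fun_mul (h2 j)).fun_sub ((h1 j).fun_mul (h2 i))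
  rw [show pd k (ang i j v) y = fderiv ℝ (ang i j v) y (bas k) from rfl]
  unfold ang
  rw [h3.fderiv]
  simp [pd]
  split_ifs <;> simp <;> ring

/-- The spherical Laplacian is the sum of the squares of the angular derivatives, each of which
integrates to zero. -/
lemma integral_sphLap {v : Space3 → ℂ} (hv : ContDiff ℝ ∞ v) (r : ℝ) :
    ∫ ν : S2, sphLap v (r • ν.1) ∂sph = 0 := by
  have e : ∀ y, sphLap v y = ang 0 1 (ang 0 1 v) y + ang 0 2 (ang 0 2 v) y +
      ang 1 2 (ang 1 2 v) y := fun y => by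
    simp only [ang.eq_1 _ _ (ang _ _ v), pd_ang hv, sphLap, Fin.sum_univ_three]
    simp
    ring
  have hint : ∀ i j, Integrable (fun ν : S2 => ang i j (ang i j v) (r • ν.1)) sph := fun i j => by
    have hc := (contDiff_ang (contDiff_ang hv i j) i j).continuous
    exact (by fun_prop : Continuous fun ν : S2 =>
      ang i j (ang i j v) (r • ν.1)).integrable_of_hasCompactSupport
        (HasCompactSupport.of_compactSpace _)
  have hz : ∀ i j : Fin 3, i ≠ j → ∫ ν : S2, ang i j (ang i j v) (r • ν.1) ∂sph = 0 :=
    fun i j hij => by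
      rw [← integral_sph_angular (contDiff_ang hv i j) hij r]
      rfl
  simp only [e]
  have hint2 : Integrable (fun ν : S2 => ang 0 1 (ang 0 1 v) (r • ν.1) +
      ang 0 2 (ang 0 2 v) (r • ν.1)) sph := (hint 0 1).add (hint 0 2)
  rw [integral_add hint2 (hint 1 2), integral_add (hint 0 1) (hint 0 2),
    hz 0 1 (by simp), hz 0 2 (by simp), hz 1 2 (by simp)]
  simp

variable {a b T : ℝ} {q ψ : ℝ × Space3 → ℂ}

lemma SlabSmooth.continuousOn_cone (h : SlabSmooth a b q) (x : Space3) (T : ℝ) :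
    ContinuousOn (fun p : ℝ × S2 => q (p.1, x + (T - p.1) • p.2.1)) (Ioo a b ×ˢ univ) :=
  h.continuousOn.comp (by fun_prop) fun p hp => ⟨hp.1, mem_univ _⟩

lemma SlabSmooth.continuous_cone (h : SlabSmooth a b q) (x : Space3) (T : ℝ) {s : ℝ}
    (hs : s ∈ Ioo a b) : Continuous fun ν : S2 => q (s, x + (T - s) • ν.1) := by
  exact (h.slice hs).continuous.comp (by fun_prop)

lemma SlabSmooth.hasDerivAt_cone (h : SlabSmooth a b q) (x : Space3) (T : ℝ) {s : ℝ}
    (hs : s ∈ Ioo a b) (ν : S2) : HasDerivAt (fun s => q (s, x + (T - s) • ν.1))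
      (dt q (s, x + (T - s) • ν.1) - ∑ j, (ν.1 j : ℂ) * dx j q (s, x + (T - s) • ν.1)) s := by
  have h1 : HasDerivAt (fun s : ℝ => (s, x + (T - s) • ν.1)) ((1 : ℝ), -ν.1) s := by
    refine (hasDerivAt_id s).prodMk ?_
    have := (((hasDerivAt_id s).const_sub T).smul_const ν.1).const_add x
    simpa using this
  have h2 := (h.differentiableAt (mem_slab hs (x + (T - s) • ν.1))).hasFDerivAt.comp_hasDerivAt s h1
  refine h2.congr_deriv ?_
  have e : ((1 : ℝ), -ν.1) = ((1 : ℝ), (0 : Space3)) - ∑ j, ν.1 j • ((0 : ℝ), (bas j : Space3)) := by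
    refine Prod.ext ?_ ?_
    · simp [Prod.fst_sum]
    · simp [Prod.snd_sum, sum_smul_bas]
  rw [e, map_sub, map_sum]
  simp only [map_smul, Complex.real_smul]
  rfl

/-- The integrand of Kirchhoff's formula on the backward light cone with vertex `(T, x)`. -/
def kirch (ψ : ℝ × Space3 → ℂ) (T : ℝ) (x : Space3) (s : ℝ) (ν : S2) : ℂ :=
  ((T - s : ℝ) : ℂ) * (dt ψ (s, x + (T - s) • ν.1) +
    ∑ i, (ν.1 i : ℂ) * dx i ψ (s, x + (T - s) • ν.1)) + ψ (s, x + (T - s) • ν.1)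

/-- The derivative of the integrand of Kirchhoff's formula along the light cone. -/
def kirchDeriv (ψ : ℝ × Space3 → ℂ) (T : ℝ) (x : Space3) (s : ℝ) (ν : S2) : ℂ :=
  ((T - s : ℝ) : ℂ) * (dt (dt ψ) (s, x + (T - s) • ν.1) -
    ∑ i, ∑ j, (ν.1 i : ℂ) * (ν.1 j : ℂ) * dx j (dx i ψ) (s, x + (T - s) • ν.1)) -
    2 * ∑ i, (ν.1 i : ℂ) * dx i ψ (s, x + (T - s) • ν.1)

lemma SlabSmooth.hasDerivAt_kirch (h : SlabSmooth a b ψ) (x : Space3) (T : ℝ) {s : ℝ}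
    (hs : s ∈ Ioo a b) (ν : S2) :
    HasDerivAt (fun s => kirch ψ T x s ν) (kirchDeriv ψ T x s ν) s := by
  have hT : HasDerivAt (fun s : ℝ => ((T - s : ℝ) : ℂ)) (-1) s := by
    have := ((hasDerivAt_id s).const_sub T).ofReal_comp
    simpa using this
  have h0 := h.hasDerivAt_cone x T hs ν
  have h1 : HasDerivAt (fun s => dt ψ (s, x + (T - s) • ν.1)) (dt (dt ψ) (s, x + (T - s) • ν.1) -
      ∑ j, (ν.1 j : ℂ) * dx j (dt ψ) (s, x + (T - s) • ν.1)) s :=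
    (h.dirD (1, 0)).hasDerivAt_cone x T hs ν
  have h2 : ∀ i : Fin 3, HasDerivAt (fun s => (ν.1 i : ℂ) * dx i ψ (s, x + (T - s) • ν.1))
      ((ν.1 i : ℂ) * (dt (dx i ψ) (s, x + (T - s) • ν.1) -
        ∑ j, (ν.1 j : ℂ) * dx j (dx i ψ) (s, x + (T - s) • ν.1))) s := fun i =>
    ((h.dirD (0, bas i)).hasDerivAt_cone x T hs ν).const_mul (ν.1 i : ℂ)
  have h3 := (hT.mul (h1.add (HasDerivAt.fun_sum fun i (_ : i ∈ Finset.univ) => h2 i))).add h0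
  have hc : ∀ i : Fin 3, dt (dx i ψ) (s, x + (T - s) • ν.1) = dx i (dt ψ) (s, x + (T - s) • ν.1) :=
    fun i => h.dirD_comm (1, 0) (0, bas i) (mem_slab hs (x + (T - s) • ν.1))
  refine h3.congr_deriv ?_
  simp only [kirchDeriv, Fin.sum_univ_three, hc, Pi.add_apply]
  ring

/-- The integral of `kirch` over the spheres of the light cone is conserved: by the wave equation,
`(T - s) * kirchDeriv` is the spherical Laplacian of the time slice. -/
lemma IsSmoothSolution.integral_kirchDeriv (h : IsSmoothSolution a b ψ fun _ => 0) (x : Space3)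
    {s : ℝ} (hs : s ∈ Ioo a b) (hsT : s ≠ T) : ∫ ν, kirchDeriv ψ T x s ν ∂sph = 0 := by
  have hr : ((T - s : ℝ) : ℂ) ≠ 0 := by
    rw [Complex.ofReal_ne_zero, sub_ne_zero]; exact hsT.symm
  set v : Space3 → ℂ := fun y => ψ (s, x + y) with hv
  have htr : ∀ q : ℝ × Space3 → ℂ, SlabSmooth a b q → ∀ i,
      pd i (fun y => q (s, x + y)) = fun y => dx i q (s, x + y) := fun q hq i => by
    ext y
    rw [pd, fderiv_comp_add_left (f := fun y => q (s, y))]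
    exact congrFun (hq.pd_slice hs i) (x + y)
  have hpd := htr ψ h.smooth
  have hpd2 := fun i : Fin 3 => htr (dx i ψ) (h.smooth.dirD (0, bas i))
  have hvs : ContDiff ℝ ∞ v := (h.smooth.slice hs).comp (contDiff_const.add contDiff_id)
  have key := integral_sphLap hvs (T - s)
  have e : ∀ ν : S2, sphLap v ((T - s) • ν.1) = ((T - s : ℝ) : ℂ) * kirchDeriv ψ T x s ν := by
    intro ν
    have hbox := h.2 (s, x + (T - s) • ν.1) (mem_slab hs _)
    have hn : (ν.1 0 : ℂ) ^ 2 + (ν.1 1 : ℂ) ^ 2 + (ν.1 2 : ℂ) ^ 2 = 1 := by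
      have h1 := norm_sq_eq_sum ν.1
      rw [norm_S2, one_pow, Fin.sum_univ_three] at h1
      exact_mod_cast h1.symm
    rw [box] at hbox
    have hbox' := (neg_add_eq_zero.1 hbox)
    simp only [sphLap, hv, hpd, hpd2, kirchDeriv, hbox', Fin.sum_univ_three, PiLp.smul_apply,
      smul_eq_mul, Complex.ofReal_mul]
    linear_combination (((T - s : ℝ) : ℂ) ^ 2 * (dx 0 (dx 0 ψ) (s, x + (T - s) • ν.1) +
      dx 1 (dx 1 ψ) (s, x + (T - s) • ν.1) + dx 2 (dx 2 ψ) (s, x + (T - s) • ν.1))) * hn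
  simp only [e] at key
  rw [integral_const_mul] at key
  exact (mul_eq_zero.1 key).resolve_left hr

/-- Kirchhoff's formula, as the equality of the values at `s = T` and `s = 0` of the conserved
integral. -/
lemma IsSmoothSolution.kirchhoff (h : IsSmoothSolution a b ψ fun _ => 0) (h0 : 0 ∈ Ioo a b)
    (hT : T ∈ Ioo a b) (hT0 : 0 ≤ T) (x : Space3) :
    ((4 * Real.pi : ℝ) : ℂ) * ψ (T, x) = ∫ ν : S2, kirch ψ T x 0 ν ∂sph := by
  have hsub : Icc 0 T ⊆ Ioo a b := fun s hs => ⟨h0.1.trans_le hs.1, hs.2.trans_lt hT.2⟩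
  have hder : ∀ s ∈ Ioo a b, HasDerivAt (fun s => ∫ ν, kirch ψ T x s ν ∂sph)
      (∫ ν, kirchDeriv ψ T x s ν ∂sph) s := by
    intro s hs
    have hcoord : ∀ i : Fin 3, Continuous fun p : ℝ × S2 => ((p.2.1 i : ℝ) : ℂ) := fun i => by
      fun_prop
    have hTs : Continuous fun p : ℝ × S2 => ((T - p.1 : ℝ) : ℂ) := by fun_prop
    have h1 : ∀ q, SlabSmooth a b q → _ := fun q hq => SlabSmooth.continuousOn_cone hq x T
    have hd := h.smooth.dirD
    refine hasDerivAt_integral_sph hs (fun u hu => ?_) ?_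
      fun u hu ν => h.smooth.hasDerivAt_kirch x T hu ν
    · have c0 := h.smooth.continuous_cone x T hu
      have c1 := (hd (1, 0)).continuous_cone x T hu
      have c2 := fun i : Fin 3 => (hd (0, bas i)).continuous_cone x T hu
      simp only [← dt_eq_dirD, ← dx_eq_dirD] at c1 c2
      exact (continuous_const.mul (c1.add (continuous_finsetSum _ fun i _ =>
        (by fun_prop : Continuous fun ν : S2 => ((ν.1 i : ℝ) : ℂ)).mul (c2 i)))).add c0
    · have c1 := h1 _ ((hd (1, 0)).dirD (1, 0))
      have c2 := fun i : Fin 3 => h1 _ (hd (0, bas i))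
      have c3 := fun i j : Fin 3 => h1 _ ((hd (0, bas i)).dirD (0, bas j))
      simp only [← dt_eq_dirD, ← dx_eq_dirD] at c1 c2 c3
      unfold kirchDeriv
      refine ContinuousOn.sub (hTs.continuousOn.mul (c1.sub (continuousOn_finsetSum _ fun i _ =>
        continuousOn_finsetSum _ fun j _ =>
          ((hcoord i).continuousOn.mul (hcoord j).continuousOn).mul (c3 i j))))
        (continuousOn_const.mul (continuousOn_finsetSum _ fun i _ =>
          (hcoord i).continuousOn.mul (c2 i)))
  have hconst := constant_of_has_deriv_right_zero
    (f := fun s => ∫ ν, kirch ψ T x s ν ∂sph) (a := 0) (b := T)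
    (fun s hs => (hder s (hsub hs)).continuousAt.continuousWithinAt)
    (fun s hs => by
      have h1 := hder s (hsub (Ico_subset_Icc_self hs))
      rw [h.integral_kirchDeriv x (hsub (Ico_subset_Icc_self hs)) hs.2.ne] at h1
      exact h1.hasDerivWithinAt) T ⟨hT0, le_rfl⟩
  rw [← hconst]
  have hπ := Real.pi_pos
  simp only [kirch, sub_self, zero_smul, add_zero, Complex.ofReal_zero, zero_mul, zero_add,
    integral_const, Measure.real, sph_univ, Complex.real_smul]
  rw [ENNReal.toReal_ofReal (by positivity)]

end

section

/-! ### Radial estimates -/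

variable {v : Space3 → ℂ} {x : Space3} {T : ℝ}

/-- The `L¹` norm of `v` over the sphere of radius `r` about `x`, with respect to the measure of
the unit sphere. -/
def sphNorm (v : Space3 → ℂ) (x : Space3) (r : ℝ) : ℝ≥0∞ := ∫⁻ ν : S2, ‖v (x + r • ν.1)‖ₑ ∂sph

lemma measurable_sphNorm (hv : Continuous v) (x : Space3) : Measurable (sphNorm v x) := by
  have h : Continuous fun p : ℝ × S2 => ‖v (x + p.1 • p.2.1)‖ₑ := by fun_prop
  exact h.measurable.lintegral_prod_right'

lemma lintegral_sphNorm (hv : Continuous v) (x : Space3) :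
    ∫⁻ r in Ioi (0 : ℝ), ENNReal.ofReal (r ^ 2) * sphNorm v x r = ∫⁻ y, ‖v y‖ₑ := by
  rw [← lintegral_add_left_eq_self (fun y => ‖v y‖ₑ) x,
    lintegral_polar (F := fun y => ‖v (x + y)‖ₑ)
      (by fun_prop : Continuous fun y => ‖v (x + y)‖ₑ).measurable, lintegral_lintegral_swap]
  · refine lintegral_congr fun r => ?_
    rw [sphNorm, lintegral_const_mul _
      (by fun_prop : Continuous fun ν : S2 => ‖v (x + r • ν.1)‖ₑ).measurable]
  · have h1 : Measurable fun p : S2 × ℝ => ENNReal.ofReal (p.2 ^ 2) := by fun_prop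
    have h2 : Continuous fun p : S2 × ℝ => ‖v (x + p.2 • p.1.1)‖ₑ := by fun_prop
    exact (h1.mul h2.measurable).aemeasurable

/-- The fundamental theorem of calculus on the rays from `x`. -/
lemma sphNorm_le_add (hv : ContDiff ℝ ∞ v) {R : ℝ} (hTR : T ≤ R) :
    sphNorm v x T ≤ sphNorm v x R + ∫⁻ r in Ioi T, ∑ i, sphNorm (pd i v) x r := by
  have hc := hv.continuous
  have hpc := fun i => (contDiff_pd hv i).continuous
  have hcont : Continuous fun p : S2 × ℝ => ∑ i, ‖pd i v (x + p.2 • p.1.1)‖ₑ := by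
    refine continuous_finsetSum _ fun i _ => ?_
    have := hpc i
    fun_prop
  have hpt : ∀ ν : S2, ‖v (x + T • ν.1)‖ₑ ≤ ‖v (x + R • ν.1)‖ₑ +
      ∫⁻ r in Ioi T, ∑ i, ‖pd i v (x + r • ν.1)‖ₑ := by
    intro ν
    have hder : ∀ r : ℝ, HasDerivAt (fun r : ℝ => v (x + r • ν.1))
        (∑ i, (ν.1 i : ℂ) * pd i v (x + r • ν.1)) r := fun r => by
      rw [← fderiv_eq_sum_pd]
      have h1 : HasDerivAt (fun r : ℝ => x + r • ν.1) ν.1 r := by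
        simpa using ((hasDerivAt_id r).smul_const ν.1).const_add x
      exact (hv.differentiable (by simp) _).hasFDerivAt.comp_hasDerivAt r h1
    have hdc : Continuous fun r : ℝ => ∑ i, (ν.1 i : ℂ) * pd i v (x + r • ν.1) := by
      refine continuous_finsetSum _ fun i _ => ?_
      have := hpc i
      fun_prop
    have hftc := intervalIntegral.integral_eq_sub_of_hasDerivAt (a := T) (b := R)
      (fun r _ => hder r) (hdc.intervalIntegrable T R)
    have e : v (x + T • ν.1) = v (x + R • ν.1) -
        ∫ r in T..R, ∑ i, (ν.1 i : ℂ) * pd i v (x + r • ν.1) := by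
      rw [hftc]; ring
    rw [e]
    refine enorm_sub_le.trans ?_
    gcongr
    rw [intervalIntegral.integral_of_le hTR]
    refine (enorm_integral_le_lintegral_enorm _).trans ((lintegral_mono fun r => ?_).trans
      (lintegral_mono_set Ioc_subset_Ioi_self))
    refine (enorm_sum_le _ _).trans (Finset.sum_le_sum fun i _ => ?_)
    rw [enorm_mul]
    refine mul_le_of_le_one_left zero_le ?_
    rw [← ofReal_norm, Complex.norm_real]
    refine ENNReal.ofReal_le_one.2 ?_
    have := PiLp.norm_apply_le ν.1 i
    rwa [norm_S2] at this
  calc sphNorm v x T ≤ ∫⁻ ν : S2, (‖v (x + R • ν.1)‖ₑ +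
        ∫⁻ r in Ioi T, ∑ i, ‖pd i v (x + r • ν.1)‖ₑ) ∂sph := lintegral_mono hpt
    _ = _ := by
        rw [lintegral_add_left
          (by fun_prop : Continuous fun ν : S2 => ‖v (x + R • ν.1)‖ₑ).measurable,
          lintegral_lintegral_swap hcont.aemeasurable]
        congr 1
        refine lintegral_congr fun r => ?_
        rw [lintegral_finsetSum]
        · rfl
        · intro i _
          have := hpc i
          exact (by fun_prop : Continuous fun ν : S2 => ‖pd i v (x + r • ν.1)‖ₑ).measurable

/-- An integrable function becomes small on some large spheres, so that it is controlled by the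
integral of its gradient outside of a ball. -/
lemma sphNorm_le (hv : ContDiff ℝ ∞ v) (hfin : ∫⁻ y, ‖v y‖ₑ ≠ ⊤) :
    sphNorm v x T ≤ ∫⁻ r in Ioi T, ∑ i, sphNorm (pd i v) x r := by
  by_contra! hlt
  set J := ∫⁻ r in Ioi T, ∑ i, sphNorm (pd i v) x r with hJ
  have hδ : sphNorm v x T - J ≠ 0 := (tsub_pos_of_lt hlt).ne'
  apply hfin
  rw [← lintegral_sphNorm hv.continuous x, eq_top_iff]
  calc ⊤ = ∫⁻ _r in Ioi (max T 1), (sphNorm v x T - J) := by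
        rw [setLIntegral_const, Real.volume_Ioi, ENNReal.mul_top hδ]
    _ ≤ ∫⁻ r in Ioi (max T 1), ENNReal.ofReal (r ^ 2) * sphNorm v x r := by
        refine setLIntegral_mono' measurableSet_Ioi fun r hr => ?_
        rw [mem_Ioi, max_lt_iff] at hr
        refine (tsub_le_iff_right.2 (sphNorm_le_add hv hr.1.le)).trans ?_
        refine le_mul_of_one_le_left zero_le ?_
        rw [ENNReal.one_le_ofReal]
        nlinarith [hr.2]
    _ ≤ _ := lintegral_mono_set (Ioi_subset_Ioi (le_max_of_le_right zero_le_one))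

/-- Tonelli's theorem on the region `T < r < ρ`, where `r ^ k ≤ ρ ^ k`. -/
lemma lintegral_pow_mul_tail_le {G : ℝ → ℝ≥0∞} (hG : Measurable G) (hT : 0 ≤ T) (k : ℕ) :
    ∫⁻ r in Ioi T, ENNReal.ofReal (r ^ k) * ∫⁻ ρ in Ioi r, G ρ ≤
      ∫⁻ ρ in Ioi T, ENNReal.ofReal (ρ ^ (k + 1)) * G ρ := by
  have hm : Measurable fun p : ℝ × ℝ => if p.1 < p.2 then ENNReal.ofReal (p.1 ^ k) * G p.2 else 0 :=
    Measurable.ite (measurableSet_lt measurable_fst measurable_snd) (by fun_prop) measurable_const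
  calc _ = ∫⁻ r in Ioi T, ∫⁻ ρ in Ioi T,
        if r < ρ then ENNReal.ofReal (r ^ k) * G ρ else 0 := by
        refine setLIntegral_congr_fun measurableSet_Ioi fun r hr => ?_
        rw [← lintegral_const_mul _ hG, ← lintegral_indicator measurableSet_Ioi,
          ← lintegral_indicator measurableSet_Ioi]
        refine lintegral_congr fun ρ => ?_
        by_cases h : r < ρ
        · rw [indicator_of_mem (mem_Ioi.2 h), indicator_of_mem (mem_Ioi.2 (lt_trans hr h)), if_pos h]
        · rw [indicator_of_notMem (by simpa using h)]
          simp [indicator, h]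
    _ = ∫⁻ ρ in Ioi T, ∫⁻ r in Ioi T,
        if r < ρ then ENNReal.ofReal (r ^ k) * G ρ else 0 :=
        lintegral_lintegral_swap hm.aemeasurable
    _ ≤ _ := by
        refine setLIntegral_mono' measurableSet_Ioi fun ρ hρ => ?_
        have hρ0 : 0 ≤ ρ := hT.trans (le_of_lt hρ)
        calc _ ≤ ∫⁻ _r in Ioc 0 ρ, ENNReal.ofReal (ρ ^ k) * G ρ := by
              rw [← lintegral_indicator measurableSet_Ioi, ← lintegral_indicator measurableSet_Ioc]
              refine lintegral_mono fun r => ?_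
              by_cases hr : r ∈ Ioi T
              · rw [indicator_of_mem hr]
                have hr0 : 0 < r := hT.trans_lt hr
                split_ifs with h
                · rw [indicator_of_mem (show r ∈ Ioc 0 ρ from ⟨hr0, h.le⟩)]
                  gcongr
                · exact zero_le
              · rw [indicator_of_notMem hr]; exact zero_le
          _ = _ := by
              rw [setLIntegral_const, Real.volume_Ioc, sub_zero, mul_right_comm,
                ← ENNReal.ofReal_mul (by positivity), ← pow_succ]

/-- The integral of `|v|` over the exterior of a ball with the weight `r^{k-2}`. -/
def tail (k : ℕ) (v : Space3 → ℂ) (x : Space3) (T : ℝ) : ℝ≥0∞ :=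
  ∫⁻ r in Ioi T, ENNReal.ofReal (r ^ k) * sphNorm v x r

lemma tail_two_le (hv : Continuous v) (hT : 0 ≤ T) : tail 2 v x T ≤ ∫⁻ y, ‖v y‖ₑ := by
  rw [← lintegral_sphNorm hv x]
  exact lintegral_mono_set (Ioi_subset_Ioi hT)

/-- A derivative gains a power of the radius. -/
lemma tail_le (hv : ContDiff ℝ ∞ v) (hfin : ∫⁻ y, ‖v y‖ₑ ≠ ⊤) (hT : 0 ≤ T) (k : ℕ) :
    tail k v x T ≤ ∑ i, tail (k + 1) (pd i v) x T := by
  have hm := fun i => measurable_sphNorm (contDiff_pd hv i).continuous x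
  calc _ ≤ ∫⁻ r in Ioi T, ENNReal.ofReal (r ^ k) *
        ∫⁻ ρ in Ioi r, ∑ i, sphNorm (pd i v) x ρ :=
        lintegral_mono fun r => mul_le_mul_right (sphNorm_le hv hfin) _
    _ ≤ _ := lintegral_pow_mul_tail_le (by fun_prop) hT k
    _ = _ := by
        simp only [Finset.mul_sum]
        rw [lintegral_finsetSum _ fun i _ => by fun_prop]
        rfl

lemma pow_mul_sphNorm_le (hv : ContDiff ℝ ∞ v) (hfin : ∫⁻ y, ‖v y‖ₑ ≠ ⊤) (hT : 0 ≤ T) (k : ℕ) :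
    ENNReal.ofReal (T ^ k) * sphNorm v x T ≤ ∑ i, tail k (pd i v) x T := by
  have hm := fun i => measurable_sphNorm (contDiff_pd hv i).continuous x
  calc _ ≤ ENNReal.ofReal (T ^ k) * ∫⁻ r in Ioi T, ∑ i, sphNorm (pd i v) x r := by
        gcongr
        exact sphNorm_le hv hfin
    _ = ∫⁻ r in Ioi T, ENNReal.ofReal (T ^ k) * ∑ i, sphNorm (pd i v) x r :=
        (lintegral_const_mul _ (by fun_prop)).symm
    _ ≤ ∫⁻ r in Ioi T, ∑ i, ENNReal.ofReal (r ^ k) * sphNorm (pd i v) x r := by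
        refine setLIntegral_mono' measurableSet_Ioi fun r hr => ?_
        rw [Finset.mul_sum]
        gcongr with i
        exact le_of_lt hr
    _ = _ := by
        rw [lintegral_finsetSum _ fun i _ => by fun_prop]
        rfl

/-- Iterated partial derivatives. -/
def pdw : List (Fin 3) → (Space3 → ℂ) → Space3 → ℂ
  | [], h => h
  | i :: w, h => pd i (pdw w h)

lemma contDiff_pdw {h : Space3 → ℂ} (hh : ContDiff ℝ ∞ h) (w : List (Fin 3)) :
    ContDiff ℝ ∞ (pdw w h) := by
  induction w with
  | nil => exact hh
  | cons i w ih => exact contDiff_pd ih i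

/-- Smooth functions whose derivatives of order at most four have `L¹` norms bounded by `W`. -/
structure BoundedW41 (W : ℝ≥0∞) (h : Space3 → ℂ) : Prop where
  smooth : ContDiff ℝ ∞ h
  ne_top : W ≠ ⊤
  le : ∀ w : List (Fin 3), w.length ≤ 4 → ∫⁻ y, ‖pdw w h y‖ₑ ≤ W

namespace BoundedW41

variable {W : ℝ≥0∞} {h : Space3 → ℂ}

lemma fin_ne_top (H : BoundedW41 W h) {w : List (Fin 3)} (hw : w.length ≤ 4) :
    ∫⁻ y, ‖pdw w h y‖ₑ ≠ ⊤ := ne_top_of_le_ne_top H.ne_top (H.le w hw)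

lemma sum_le {F : Fin 3 → ℝ≥0∞} {B : ℝ≥0∞} (hF : ∀ i, F i ≤ B) : ∑ i, F i ≤ 3 * B := by
  refine (Finset.sum_le_sum fun i _ => hF i).trans ?_
  simp

lemma tail_two (H : BoundedW41 W h) (hT : 0 ≤ T) {w : List (Fin 3)} (hw : w.length ≤ 4) :
    tail 2 (pdw w h) x T ≤ W :=
  (tail_two_le (contDiff_pdw H.smooth w).continuous hT).trans (H.le w hw)

lemma tail_one (H : BoundedW41 W h) (hT : 0 ≤ T) {w : List (Fin 3)} (hw : w.length ≤ 3) :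
    tail 1 (pdw w h) x T ≤ 3 * W :=
  (tail_le (contDiff_pdw H.smooth w) (H.fin_ne_top (by omega)) hT 1).trans
    (sum_le fun i => H.tail_two (w := i :: w) hT (by simp; omega))

lemma tail_zero (H : BoundedW41 W h) (hT : 0 ≤ T) {w : List (Fin 3)} (hw : w.length ≤ 2) :
    tail 0 (pdw w h) x T ≤ 3 * (3 * W) :=
  (tail_le (contDiff_pdw H.smooth w) (H.fin_ne_top (by omega)) hT 0).trans
    (sum_le fun i => H.tail_one (w := i :: w) hT (by simp; omega))

lemma sphNorm_zero (H : BoundedW41 W h) (hT : 0 ≤ T) {w : List (Fin 3)} (hw : w.length ≤ 1) :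
    sphNorm (pdw w h) x T ≤ 3 * (3 * (3 * W)) := by
  have := (pow_mul_sphNorm_le (x := x) (contDiff_pdw H.smooth w) (H.fin_ne_top (by omega)) hT 0).trans
    (sum_le fun i => H.tail_zero (w := i :: w) hT (by simp; omega))
  simpa using this

lemma sphNorm_one (H : BoundedW41 W h) (hT : 0 ≤ T) {w : List (Fin 3)} (hw : w.length ≤ 2) :
    ENNReal.ofReal T * sphNorm (pdw w h) x T ≤ 3 * (3 * W) := by
  have := (pow_mul_sphNorm_le (x := x) (contDiff_pdw H.smooth w) (H.fin_ne_top (by omega)) hT 1).trans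
    (sum_le fun i => H.tail_one (w := i :: w) hT (by simp; omega))
  rwa [pow_one] at this

lemma sphNorm_two (H : BoundedW41 W h) (hT : 0 ≤ T) {w : List (Fin 3)} (hw : w.length ≤ 3) :
    ENNReal.ofReal (T ^ 2) * sphNorm (pdw w h) x T ≤ 3 * W :=
  (pow_mul_sphNorm_le (x := x) (contDiff_pdw H.smooth w) (H.fin_ne_top (by omega)) hT 2).trans
    (sum_le fun i => H.tail_two (w := i :: w) hT (by simp; omega))

lemma one_le_bracket_inv (hT : 0 ≤ T) (hT1 : T ≤ 1) : 1 ≤ 2 * (bracket T)⁻¹ := by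
  rw [← div_eq_mul_inv, one_le_div (bracket_pos T)]
  exact bracket_le_two hT hT1

lemma inv_le_bracket_inv (hT : 1 ≤ T) : T⁻¹ ≤ 2 * (bracket T)⁻¹ := by
  rw [← div_eq_mul_inv, le_div_iff₀ (bracket_pos T), inv_mul_le_iff₀ (by linarith)]
  linarith [bracket_le_two_mul hT]

lemma mul_sphNorm_le (H : BoundedW41 W h) (hT : 0 ≤ T) {w : List (Fin 3)} (hw : w.length ≤ 2) :
    ENNReal.ofReal T * sphNorm (pdw w h) x T ≤ ENNReal.ofReal (18 * (bracket T)⁻¹) * W := by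
  -- for small `T`, two derivatives suffice as there is nothing to gain
  rcases le_total T 1 with h1 | h1
  · refine (H.sphNorm_one hT hw).trans ?_
    rw [← mul_assoc]
    gcongr
    rw [show (3 * 3 : ℝ≥0∞) = ENNReal.ofReal 9 by norm_num]
    exact ENNReal.ofReal_le_ofReal (by linarith [one_le_bracket_inv hT h1])
  · have hT0 : 0 < T := by linarith
    have e : ENNReal.ofReal T = ENNReal.ofReal T⁻¹ * ENNReal.ofReal (T ^ 2) := by
      rw [← ENNReal.ofReal_mul (by positivity)]
      congr 1
      field_simp
    rw [e, mul_assoc]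
    refine (mul_le_mul_right (H.sphNorm_two hT (by omega)) _).trans ?_
    rw [← mul_assoc]
    gcongr
    rw [show (3 : ℝ≥0∞) = ENNReal.ofReal 3 by simp, ← ENNReal.ofReal_mul (by positivity)]
    refine ENNReal.ofReal_le_ofReal ?_
    have := inv_pos.2 (bracket_pos T)
    linarith [inv_le_bracket_inv h1]

lemma sphNorm_le (H : BoundedW41 W h) (hT : 0 ≤ T) {w : List (Fin 3)} (hw : w.length ≤ 1) :
    sphNorm (pdw w h) x T ≤ ENNReal.ofReal (54 * (bracket T)⁻¹) * W := by
  rcases le_total T 1 with h1 | h1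
  · refine (H.sphNorm_zero hT hw).trans ?_
    rw [← mul_assoc, ← mul_assoc]
    gcongr
    rw [show (3 * 3 * 3 : ℝ≥0∞) = ENNReal.ofReal 27 by norm_num]
    exact ENNReal.ofReal_le_ofReal (by linarith [one_le_bracket_inv hT h1])
  · calc sphNorm (pdw w h) x T ≤ ENNReal.ofReal T * sphNorm (pdw w h) x T :=
          le_mul_of_one_le_left zero_le (ENNReal.one_le_ofReal.2 h1)
      _ ≤ ENNReal.ofReal (18 * (bracket T)⁻¹) * W := H.mul_sphNorm_le hT (by omega)
      _ ≤ _ := by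
          gcongr
          · exact (inv_pos.2 (bracket_pos T)).le
          · norm_num

end BoundedW41

end

section

/-! ### Decay of homogeneous solutions -/

variable {a b T : ℝ} {φ ψ : ℝ × Space3 → ℂ} {x : Space3}

/-- Translation invariance of the homogeneous wave equation. -/
lemma IsSmoothSolution.dirD (h : IsSmoothSolution a b φ fun _ => 0) (v : ℝ × Space3) :
    IsSmoothSolution a b (dirD v φ) fun _ => 0 := by
  refine ⟨h.smooth.dirD v, fun p hp => ?_⟩
  have hs := h.smooth
  have hcomm : ∀ w, WaveDecay.dirD w (WaveDecay.dirD w (WaveDecay.dirD v φ)) p =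
      WaveDecay.dirD v (WaveDecay.dirD w (WaveDecay.dirD w φ)) p := fun w => by
    rw [dirD_congr w (hs.dirD_comm w v) hp, (hs.dirD w).dirD_comm w v hp]
  have h1 := ((hs.dirD (1, 0)).dirD (1, 0)).differentiableAt hp
  have h2 := fun i : Fin 3 => ((hs.dirD (0, bas i)).dirD (0, bas i)).differentiableAt hp
  have hb : HasFDerivAt (WaveDecay.box φ) (-_root_.fderiv ℝ (dt (dt φ)) p +
      ∑ i, _root_.fderiv ℝ (dx i (dx i φ)) p) p :=
    h1.hasFDerivAt.fun_neg.fun_add (HasFDerivAt.fun_sum fun i _ => (h2 i).hasFDerivAt)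
  have h0 : box φ =ᶠ[nhds p] fun _ => 0 := by
    filter_upwards [(isOpen_slab a b).mem_nhds hp] with q hq using h.2 q hq
  have e := congrArg (fun L : ℝ × Space3 →L[ℝ] ℂ => L v) (hb.fderiv.symm.trans h0.fderiv_eq)
  simp only [box, dt_eq_dirD, dx_eq_dirD, hcomm]
  simp only [add_apply, neg_apply,
    sum_apply, fderiv_fun_const, Pi.zero_apply,
    zero_apply] at e
  exact e

/-- Kirchhoff's formula in absolute value, with the factor `4π` estimated by one. -/
lemma IsSmoothSolution.enorm_le_sphNorm (h : IsSmoothSolution a b ψ fun _ => 0)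
    (h0 : 0 ∈ Ioo a b) (hT : T ∈ Ioo a b) (hT0 : 0 ≤ T) (x : Space3) :
    ‖ψ (T, x)‖ₑ ≤ ENNReal.ofReal T * (sphNorm (fun y => dt ψ (0, y)) x T +
      ∑ i, sphNorm (pd i fun y => ψ (0, y)) x T) + sphNorm (fun y => ψ (0, y)) x T := by
  have hA : Continuous fun y => dt ψ (0, y) := ((h.smooth.dirD (1, 0)).slice h0).continuous
  have hB := h.smooth.slice h0
  have hBc := hB.continuous
  have hpB := fun i => (contDiff_pd hB i).continuous
  have mA : Measurable fun ν : S2 => ‖dt ψ (0, x + T • ν.1)‖ₑ :=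
    (hA.comp (by fun_prop : Continuous fun ν : S2 => x + T • ν.1)).enorm.measurable
  have mpB : ∀ i, Measurable fun ν : S2 => ‖pd i (fun y => ψ (0, y)) (x + T • ν.1)‖ₑ := fun i =>
    ((hpB i).comp (by fun_prop : Continuous fun ν : S2 => x + T • ν.1)).enorm.measurable
  calc ‖ψ (T, x)‖ₑ ≤ ‖((4 * Real.pi : ℝ) : ℂ) * ψ (T, x)‖ₑ := by
        rw [enorm_mul]
        refine le_mul_of_one_le_left zero_le ?_
        rw [← ofReal_norm, Complex.norm_real, ENNReal.one_le_ofReal, Real.norm_eq_abs]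
        exact le_trans (by linarith [Real.pi_gt_three]) (le_abs_self _)
    _ ≤ ∫⁻ ν : S2, ‖kirch ψ T x 0 ν‖ₑ ∂sph := by
        rw [h.kirchhoff h0 hT hT0 x]
        exact enorm_integral_le_lintegral_enorm _
    _ ≤ ∫⁻ ν : S2, (ENNReal.ofReal T * (‖dt ψ (0, x + T • ν.1)‖ₑ +
          ∑ i, ‖pd i (fun y => ψ (0, y)) (x + T • ν.1)‖ₑ) + ‖ψ (0, x + T • ν.1)‖ₑ) ∂sph := by
        refine lintegral_mono fun ν => ?_
        simp only [kirch, sub_zero, h.smooth.pd_slice h0]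
        refine (enorm_add_le _ _).trans ?_
        gcongr
        rw [enorm_mul, ← ofReal_norm ((T : ℝ) : ℂ), Complex.norm_real, Real.norm_of_nonneg hT0]
        gcongr
        refine (enorm_add_le _ _).trans ?_
        gcongr
        refine (enorm_sum_le _ _).trans (Finset.sum_le_sum fun i _ => ?_)
        rw [enorm_mul]
        refine mul_le_of_le_one_left zero_le ?_
        rw [← ofReal_norm, Complex.norm_real]
        refine ENNReal.ofReal_le_one.2 ?_
        have := PiLp.norm_apply_le ν.1 i
        rwa [norm_S2] at this
    _ = _ := by
        rw [lintegral_add_left (by fun_prop), lintegral_const_mul _ (by fun_prop),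
          lintegral_add_left (by fun_prop), lintegral_finsetSum _ fun i _ => mpB i]
        rfl

lemma gamWord_map_some {h : Space3 → ℂ} (hh : ContDiff ℝ ∞ h) (w : List (Fin 3)) (t : ℝ)
    (y : Space3) : gamWord (w.map some) (fun p => h p.2) (t, y) = pdw w h y := by
  suffices gamWord (w.map some) (fun p => h p.2) = fun p => pdw w h p.2 by rw [this]
  clear t y
  induction w with
  | nil => rfl
  | cons i w ih =>
    funext p
    have h1 : HasFDerivAt (fun p : ℝ × Space3 => p.2) (ContinuousLinearMap.snd ℝ ℝ Space3) p :=
      hasFDerivAt_snd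
    have h2 := ((contDiff_pdw hh w).differentiable (by simp) p.2).hasFDerivAt.comp p h1
    rw [List.map_cons, gamWord, ih, gam, dx,
      show (fun p : ℝ × Space3 => pdw w h p.2) = pdw w h ∘ Prod.snd from rfl, h2.fderiv]
    rfl

lemma BoundedW41.of_gamNorm {h : Space3 → ℂ} {W : ℝ≥0∞} (hh : ContDiff ℝ ∞ h) (hW : W ≠ ⊤)
    (hle : gamNorm normL1 4 (fun p => h p.2) 0 ≤ W) : BoundedW41 W h := by
  refine ⟨hh, hW, fun w hw => ?_⟩
  refine (le_trans (le_of_eq ?_) (le_gamNorm normL1 (fun p => h p.2) 0 (w.map some)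
    (by simpa using hw))).trans hle
  simp only [gamWord_map_some hh, normL1, eLpNorm_one_eq_lintegral_enorm]

lemma sphNorm_sum_le {F : Fin 3 → Space3 → ℂ} (hF : ∀ i, Continuous (F i)) (x : Space3) (r : ℝ) :
    sphNorm (fun y => ∑ i, F i y) x r ≤ ∑ i, sphNorm (F i) x r := by
  have hm : ∀ i, Measurable fun ν : S2 => ‖F i (x + r • ν.1)‖ₑ := fun i => by
    have := hF i
    exact (by fun_prop : Continuous fun ν : S2 => ‖F i (x + r • ν.1)‖ₑ).measurable
  unfold sphNorm
  rw [← lintegral_finsetSum _ fun i _ => hm i]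
  exact lintegral_mono fun ν => enorm_sum_le _ _

lemma IsSmoothSolution.enorm_le_of_sphNorm_le (h : IsSmoothSolution a b ψ fun _ => 0)
    (h0 : 0 ∈ Ioo a b) (hT : T ∈ Ioo a b) (hT0 : 0 ≤ T) {A B : Space3 → ℂ} {M : ℝ≥0∞}
    (hA : ∀ y, dt ψ (0, y) = A y) (hB : ∀ y, ψ (0, y) = B y)
    (h1 : ENNReal.ofReal T * sphNorm A x T ≤ M)
    (h2 : ENNReal.ofReal T * ∑ i, sphNorm (pd i B) x T ≤ M) (h3 : sphNorm B x T ≤ M) :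
    ‖ψ (T, x)‖ₑ ≤ 3 * M := by
  have := h.enorm_le_sphNorm h0 hT hT0 x
  rw [funext hA, funext hB, mul_add] at this
  refine this.trans ((add_le_add (add_le_add h1 h2) h3).trans (le_of_eq ?_))
  ring

/-- The decay of the solution of the homogeneous wave equation with data in `W^{4,1}`,
from Kirchhoff's formula for the components of its gradient. -/
theorem exists_homogeneous_decay : ∃ C : ℝ, 0 < C ∧
    ∀ (a b : ℝ) (φ : ℝ × Space3 → ℂ) (φ₀ φ₁ : Space3 → ℂ),
      IsSmoothSolution a b φ (fun _ => 0) → 0 ∈ Ioo a b →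
      (∀ y, φ (0, y) = φ₀ y) → (∀ y, dt φ (0, y) = φ₁ y) →
      ∀ t ∈ Ioo a b, 0 ≤ t → ∀ x : Space3,
        absGrad φ t x ≤ ENNReal.ofReal (C * (bracket t)⁻¹) *
          (gamNorm normL1 4 (fun p => φ₀ p.2) 0 + gamNorm normL1 4 (fun p => φ₁ p.2) 0) := by
  -- four components of the gradient, three terms in Kirchhoff's formula, and `3 * 18` for each
  refine ⟨648, by norm_num, fun a b φ φ₀ φ₁ h h0 e0 e1 t ht ht0 x => ?_⟩
  have hbr := bracket_pos t
  set W := gamNorm normL1 4 (fun p => φ₀ p.2) 0 + gamNorm normL1 4 (fun p => φ₁ p.2) 0 with hW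
  rcases eq_or_ne W ⊤ with hWt | hWt
  · rw [hWt, ENNReal.mul_top (by rw [Ne, ENNReal.ofReal_eq_zero, not_le]; positivity)]
    exact le_top
  have hs := h.smooth
  have s0 : ContDiff ℝ ∞ φ₀ := by rw [← funext e0]; exact hs.slice h0
  have s1 : ContDiff ℝ ∞ φ₁ := by rw [← funext e1]; exact (hs.dirD (1, 0)).slice h0
  have H0 : BoundedW41 W φ₀ := .of_gamNorm s0 hWt (hW ▸ le_self_add)
  have H1 : BoundedW41 W φ₁ := .of_gamNorm s1 hWt (hW ▸ le_add_self)
  have p0 : ∀ i y, dx i φ (0, y) = pdw [i] φ₀ y := fun i y => by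
    rw [pdw, pdw, ← funext e0, hs.pd_slice h0]
  have p1 : ∀ i y, dt (dx i φ) (0, y) = pdw [i] φ₁ y := fun i y => by
    rw [pdw, pdw, ← funext e1]
    exact (hs.dirD_comm (1, 0) (0, bas i) (mem_slab h0 y)).trans
      (congrFun ((hs.dirD (1, 0)).pd_slice h0 i) y).symm
  have p00 : ∀ i y, dx i (dx i φ) (0, y) = pdw [i, i] φ₀ y := fun i y => by
    rw [pdw, ← funext (p0 i)]
    exact (congrFun ((hs.dirD (0, bas i)).pd_slice h0 i) y).symm
  -- the second time derivative of the data is given by the wave equation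
  have ptt : ∀ y, dt (dt φ) (0, y) = ∑ i, pdw [i, i] φ₀ y := fun y => by
    have := h.2 (0, y) (mem_slab h0 y)
    rw [box, neg_add_eq_zero] at this
    simp only [this, p00]
  set β := ENNReal.ofReal (18 * (bracket t)⁻¹) * W with hβ
  have e54 : ENNReal.ofReal (54 * (bracket t)⁻¹) * W = 3 * β := by
    rw [hβ, ← mul_assoc, show (3 : ℝ≥0∞) = ENNReal.ofReal 3 by simp,
      ← ENNReal.ofReal_mul (by norm_num)]
    congr 2
    ring
  have key : ∀ {g : Space3 → ℂ}, BoundedW41 W g → ∀ {w : List (Fin 3)}, w.length ≤ 1 →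
      ENNReal.ofReal t * ∑ i, sphNorm (pd i (pdw w g)) x t ≤ 3 * β := fun H w hw => by
    rw [Finset.mul_sum]
    exact BoundedW41.sum_le fun i => H.mul_sphNorm_le (w := i :: w) ht0 (by simpa using hw)
  have hcomp : ∀ μ, ‖grad μ φ (t, x)‖ₑ ≤ 3 * (3 * β) := by
    intro μ
    refine Fin.cases ?_ (fun i => ?_) μ
    · refine (h.dirD (1, 0)).enorm_le_of_sphNorm_le h0 ht ht0 ptt e1 ?_ (key H1 (w := []) (by simp))
        ((H1.sphNorm_le (w := []) ht0 (by simp)).trans e54.le)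
      refine (mul_le_mul_right (sphNorm_sum_le (fun i => (contDiff_pdw s0 [i, i]).continuous) x t)
        _).trans ?_
      rw [Finset.mul_sum]
      exact BoundedW41.sum_le fun i => H0.mul_sphNorm_le ht0 (by simp)
    · refine (h.dirD (0, bas i)).enorm_le_of_sphNorm_le h0 ht ht0 (p1 i) (p0 i) ?_
        (key H0 (w := [i]) (by simp)) ((H0.sphNorm_le (w := [i]) ht0 (by simp)).trans e54.le)
      exact (H1.mul_sphNorm_le (w := [i]) ht0 (by simp)).trans
        (le_mul_of_one_le_left zero_le (by norm_num))
  rw [absGrad]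
  refine (Finset.sum_le_sum fun μ _ => hcomp μ).trans (le_of_eq ?_)
  rw [Finset.sum_const, Finset.card_univ, Fintype.card_fin, nsmul_eq_mul, hβ, ← mul_assoc,
    ← mul_assoc, ← mul_assoc]
  congr 1
  rw [show ((4 : ℕ) : ℝ≥0∞) * 3 * 3 = ENNReal.ofReal 36 by norm_num,
    ← ENNReal.ofReal_mul (by norm_num)]
  congr 1
  ring

end

end WaveDecay

end

open WaveDecay in
theorem theorem1p2 :
    -- the interior/exterior decay estimate
    (∃ C : ℝ, 0 < C ∧ ∀ δ : ℝ, 0 < δ → δ < 1 →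
      ∀ (a b : ℝ) (φ f : ℝ × Space3 → ℂ), IsSmoothSolution a b φ f →
      ∀ t ∈ Ioo a b, 0 ≤ t → ∀ x : Space3,
        absGrad φ t x ≤ ENNReal.ofReal (C * δ⁻¹) *
          (ENNReal.ofReal (bracket t ^ (-(1 / 2) : ℝ) * coneWeight δ t x) *
              gradGamNorm normL2 3 φ t +
            ENNReal.ofReal (bracket t ^ (1 / 2 : ℝ)) * gamNorm normL2 2 f t)) ∧
    -- the estimate for frequency localized solutions
    (∀ Λ : ℝ, 1 ≤ Λ → ∃ C : ℝ, 0 < C ∧ ∀ (k : ℤ) (a b : ℝ) (φ f : ℝ × Space3 → ℂ),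
      IsSmoothSolution a b φ f → TemperateOnSlab a b φ →
      (∀ s ∈ Ioo a b, FrequencyLocalized Λ k (fun y => φ (s, y))) →
      ∀ t ∈ Ioo a b, 0 ≤ t → ∀ x : Space3,
        absGrad φ t x ≤ ENNReal.ofReal C *
          (ENNReal.ofReal ((bracket t)⁻¹ * (2 : ℝ) ^ (2 * k)) *
              gradGamNorm fourierSupNorm 2 φ t +
            ENNReal.ofReal (bracket t ^ (1 / 2 : ℝ) * (2 : ℝ) ^ k) * gamNorm normL2 1 f t)) ∧
    -- the sharp decay of homogeneous solutions in terms of the data at time zero, on which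
    -- the vector fields act as on functions that do not depend on time
    (∃ C : ℝ, 0 < C ∧ ∀ (a b : ℝ) (φ : ℝ × Space3 → ℂ) (φ₀ φ₁ : Space3 → ℂ),
      IsSmoothSolution a b φ (fun _ => 0) → 0 ∈ Ioo a b →
      (∀ y, φ (0, y) = φ₀ y) → (∀ y, dt φ (0, y) = φ₁ y) →
      ∀ t ∈ Ioo a b, 0 ≤ t → ∀ x : Space3,
        absGrad φ t x ≤ ENNReal.ofReal (C * (bracket t)⁻¹) *
          (gamNorm normL1 4 (fun p => φ₀ p.2) 0 + gamNorm normL1 4 (fun p => φ₁ p.2) 0)) ∧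
    -- the measure of the dyadic sets
    (∃ C : ℝ, 0 < C ∧ ∀ (μ : ℝ), μ = 1 ∨ μ = -1 → ∀ (k l : ℤ) (t : ℝ), t ≠ 0 → ∀ x : Space3,
      volume (phaseSet μ k l t x) ≤ ENNReal.ofReal (C * (2 : ℝ) ^ (3 * k + l))) := by
  refine ⟨exists_interior_exterior_decay, exists_localized_decay, exists_homogeneous_decay,
    8 * Real.pi, by positivity, fun μ hμ k l t ht x => volume_phaseSet_le hμ k l ht x⟩
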